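/- For a function $u\in L_2[0,\pi]$ consider the Sturm--Liouville operator $Ly=-y''+u'y$ in the complex space $L_2[0,\pi]$ with Dirichlet conditions $y(0)=y(\pi)=0$, where $u'$ is the distributional derivative; that is, with the quasi-derivative $y^{[1]}=y'-uy$, $Ly=-(y^{[1]})'-uy^{[1]}-u^2y$ for absolutely continuous $y,y^{[1]}$. Let $\omega(x,\lambda)$ be the solution of $-\omega''+u'\omega=\lambda\omega$ with $\omega(0,\lambda)=0$, $\omega^{[1]}(0,\lambda)=1$. The eigenvalues of $L$ are the zeros of the entire function $\omega(\pi,\lambda)$; let $\lambda_1,\lambda_2,\dots$ be these zeros, repeated according to multiplicity and ordered by increasing modulus and, for equal moduli, by increasing argument in $(-\pi,\pi]$. Let $\{y_n\}_{n\ge1}$ be the correspondingly numbered system of eigenfunctions and associated functions, i.e. the functions $\partial_\lambda^j\omega(x,\mu)$, where $\mu$ is a zero of $\omega(\pi,\cdot)$ of multiplicity $p$ and $0\le j<p$ (for each $\mu$ in increasing order of $j$), normalized by $\|y_n\|_{L_2}=1$. Let $\{w_n\}_{n\ge1}\subset L_2[0,\pi]$ be biorthogonal to it, $(y_k,w_n)=\delta_{kn}$,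 where $(f,g)=\int_0^\pi f\overline{g}\,dx$. For $f\in L_2[0,\pi]$ put $c_n=(f,w_n)$ and $c_{n,0}=\sqrt{2/\pi}\,(f,\sin nx)$. Theorem. For every $R>0$ there are a constant $C_R$ and a function $\upsilon_R(m)$ with $\upsilon_R(m)\to0$ as $m\to+\infty$, both depending only on $R$, such that for every real-valued $u\in L_2[0,\pi]$ with $\|u\|_{L_2}\le R$, every $f\in L_2[0,\pi]$ and every $m$, $$ \left\|\sum_{n=1}^{m}c_n y_n(x)-\sum_{n=1}^{m}\sqrt{\frac{2}{\pi}}\,c_{n,0}\sin nx\right\|_{C[0,\pi]}\le C_R\left(\sum_{n\ge\sqrt m}|c_{n,0}|^2\right)^{1/2}+\|f\|_{L_2}\,\upsilon_R(m). $$ -/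

import Mathlib

open MeasureTheory Set Filter Topology
open scoped ComplexConjugate

noncomputable section

namespace SturmLiouville

/-- Membership in the complex space `L₂[0, π]`. -/
def MemL2 (f : ℝ → ℂ) : Prop :=
  MemLp f 2 (volume.restrict (Icc (0 : ℝ) Real.pi))

/-- The scalar product `(f, g) = ∫₀^π f(x) conj(g(x)) dx`. -/
def scalarProduct (f g : ℝ → ℂ) : ℂ :=
  ∫ x in (0 : ℝ)..Real.pi, f x * conj (g x)

/-- The norm of `L₂[0, π]`. -/
def l2Norm (f : ℝ → ℂ) : ℝ :=
  Real.sqrt (∫ x in (0 : ℝ)..Real.pi, ‖f x‖ ^ 2)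

/-- `y` solves `-y'' + u' y = g` on `[0, π]`, where `y₁ = y' - u y` is its quasi-derivative.
For `u` and `g` in `L₂[0, π]` this says that `y` and `y₁` are absolutely continuous on `[0, π]`
with, almost everywhere, `y' = y₁ + u y` and `-y₁' - u y₁ - u² y = g`; both equations are
written in integrated form. All integrands are then integrable. -/
structure IsSolution (u g y y₁ : ℝ → ℂ) : Prop where
  continuousOn : ContinuousOn y (Icc 0 Real.pi)
  continuousOn_quasi : ContinuousOn y₁ (Icc 0 Real.pi)
  eq : ∀ x ∈ Icc (0 : ℝ) Real.pi,
    y x = y 0 + ∫ t in (0 : ℝ)..x, (y₁ t + u t * y t)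
  eq_quasi : ∀ x ∈ Icc (0 : ℝ) Real.pi,
    y₁ x = y₁ 0 - ∫ t in (0 : ℝ)..x, (u t * y₁ t + u t ^ 2 * y t + g t)

/-- `ω z x` is the solution of `-ω'' + u' ω = z ω` with `ω(0) = 0`, `ω^{[1]}(0) = 1`,
for every spectral parameter `z`. -/
def IsCauchySolution (u : ℝ → ℂ) (ω : ℂ → ℝ → ℂ) : Prop :=
  ∀ z : ℂ, ∃ ω₁ : ℝ → ℂ,
    IsSolution u (fun x => z * ω z x) (ω z) ω₁ ∧ ω z 0 = 0 ∧ ω₁ 0 = 1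

/-- `lam 1, lam 2, …` are the eigenvalues and `y 1, y 2, …` is the normalized system of
eigenfunctions and associated functions of the Dirichlet operator `-d²/dx² + u'` on `[0, π]`
(the values at the index `0` play no role). The eigenvalues are the zeros `μ` of `z ↦ ω z π`;
the chain at a zero of multiplicity `p` consists of the derivatives `∂ʲω/∂zʲ (μ, ·)` with
`j < p`. The pairs `(μ, j)` are enumerated, each once, by increasing modulus of `μ`, then
increasing argument of `μ` in `(-π, π]`, then increasing `j`. -/
def IsRootSystem (u : ℝ → ℂ) (lam : ℕ → ℂ) (y : ℕ → ℝ → ℂ) : Prop :=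
  ∃ (ω : ℂ → ℝ → ℂ) (j : ℕ → ℕ),
    IsCauchySolution u ω ∧
    (fun n => (lam n, j n)) '' Ici 1 =
      {p : ℂ × ℕ | (p.2 : ℕ∞) < analyticOrderAt (fun z => ω z Real.pi) p.1} ∧
    StrictMonoOn
      (fun n => toLex (‖lam n‖, toLex (Complex.arg (lam n), j n))) (Ici 1) ∧
    ∀ n, 1 ≤ n →
      (∃ c : ℂ, ∀ x ∈ Icc (0 : ℝ) Real.pi,
        y n x = c * iteratedDeriv (j n) (fun z => ω z x) (lam n)) ∧
      l2Norm (y n) = 1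

/-- `w 1, w 2, …` is a system in `L₂[0, π]` biorthogonal to `y 1, y 2, …`. -/
def IsBiorthogonal (y w : ℕ → ℝ → ℂ) : Prop :=
  (∀ n, 1 ≤ n → MemL2 (w n)) ∧
    ∀ k n, 1 ≤ k → 1 ≤ n → scalarProduct (y k) (w n) = if k = n then 1 else 0

/-- The sine coefficient `√(2/π) (f, sin nx)`. -/
def sineCoeff (f : ℝ → ℂ) (n : ℕ) : ℂ :=
  (Real.sqrt (2 / Real.pi) : ℂ) * scalarProduct f (fun x => (Real.sin (n * x) : ℂ))

end SturmLiouville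

end

/-! Since `u` is real, the Dirichlet operator is self-adjoint. Its eigenvalues are real and simple,
no associated functions occur, and up to unimodular factors the root functions form an orthonormal
basis that is its own biorthogonal system (`IsRootSystem.exists_eigenSystem`,
`IsBiorthogonal.scalarProduct_mul`). The claim thus compares the partial sums `S_m` of the
eigenfunction expansion with the partial sums `S_m⁰` of the sine series.

Two estimates suffice. (a) `‖S_m F - S_m⁰ F‖_C ≤ C ‖F‖` for every `F` in `L₂`
(`exists_norm_combo_sub_le`). (b) If `P` is the part of the sine series of `F` with frequencies
below `√m`, then `S_m⁰ P = P` and `‖P - S_m P‖_C = O(m^(-1/4)) ‖F‖`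
(`EigenSystem.norm_sine_combo_sub_le`). Apply (a) to `F - P`, whose norm is the tail in the
statement, and (b) to `P`.

For (a), put `λ = ρ²` and integrate the difference of the two resolvents over a vertical line `Re ρ
= σ` with `σ` between `m` and `m + 1`. A Prüfer angle argument finds such a line on which both
characteristic functions are bounded below (`exists_gap`, `exists_nonresonance`), and Green's
function then decays like `exp(-|Im ρ| |t - s|)`. A weak second resolvent identity (`Sol.cross`)
involves only `u` and `u²`, and the `L₂` bound of the Laplace transform makes the contour integral
absolutely convergent against an `L₂` and an `L₁` function. Duality gives a bound from `L₂` to `C`.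
The Prüfer angle also shows that `σ + O(1)` eigenvalues lie below `σ²`, so `S_m` differs from the
spectral projection in boundedly many terms, each controlled by a uniform bound for normalized
eigenfunctions.

For (b), the tail of the expansion of a smooth function is estimated through the quadratic form,
moving the operator onto the smooth function (`EigenSystem.norm_combo_le_of_free`).

Every constant depends on `u` only through `∫ u² ≤ R²`: solutions are controlled by the energy
`|y₁|² + s²|y|²` and Grönwall's inequality, which never use `u'`. -/

namespace SturmLiouville

/-! ### Absolutely continuous functions on `[0, π]` -/

/-- `F` is absolutely continuous on `[0, π]` with derivative `f` almost everywhere. -/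
structure HasACDeriv {E : Type*} [NormedAddCommGroup E] [NormedSpace ℝ E] (F f : ℝ → E) :
    Prop where
  ac : AbsolutelyContinuousOnInterval F 0 Real.pi
  deriv : ∀ᵐ x, x ∈ Ioo 0 Real.pi → HasDerivAt F (f x) x

/-- Domination of increments is the one comparison needed for primitives, for continuous linear
images and for compositions with smooth maps. -/
theorem absolutelyContinuousOnInterval_of_dist_le {X Y : Type*} [PseudoMetricSpace X]
    [PseudoMetricSpace Y] {F : ℝ → X} {G : ℝ → Y} {a b K : ℝ}
    (hG : AbsolutelyContinuousOnInterval G a b)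
    (h : ∀ x ∈ uIcc a b, ∀ y ∈ uIcc a b, dist (F x) (F y) ≤ K * dist (G x) (G y)) :
    AbsolutelyContinuousOnInterval F a b := by
  unfold AbsolutelyContinuousOnInterval at hG ⊢
  refine squeeze_zero' ?_ ?_ (by simpa using hG.const_mul K)
  · exact Eventually.of_forall fun _ => Finset.sum_nonneg fun i hi => dist_nonneg
  rw [eventually_inf_principal]
  filter_upwards with I hI
  rw [Finset.mul_sum]
  exact Finset.sum_le_sum fun i hi => h _ (hI.1 i hi).1 _ (hI.1 i hi).2

theorem uIcc_zero_pi : uIcc 0 Real.pi = Icc 0 Real.pi := uIcc_of_le Real.pi_pos.le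

theorem zero_mem_Icc_pi : (0 : ℝ) ∈ Icc 0 Real.pi := ⟨le_rfl, Real.pi_pos.le⟩

theorem pi_mem_Icc_pi : Real.pi ∈ Icc 0 Real.pi := ⟨Real.pi_pos.le, le_rfl⟩

theorem intervalIntegrable_sub {E : Type*} [NormedAddCommGroup E] {f : ℝ → E}
    (hf : IntervalIntegrable f volume 0 Real.pi) {x y : ℝ} (hx : x ∈ Icc 0 Real.pi)
    (hy : y ∈ Icc 0 Real.pi) : IntervalIntegrable f volume x y :=
  hf.mono_set (by rw [uIcc_zero_pi]; exact uIcc_subset_Icc hx hy)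

namespace HasACDeriv

variable {E : Type*} [NormedAddCommGroup E] [NormedSpace ℝ E]

theorem continuousOn {F f : ℝ → E} (h : HasACDeriv F f) : ContinuousOn F (Icc 0 Real.pi) := by
  simpa [uIcc_zero_pi] using h.ac.continuousOn

theorem of_integral [CompleteSpace E] {F f : ℝ → E} (hf : IntervalIntegrable f volume 0 Real.pi)
    (h : ∀ x ∈ Icc 0 Real.pi, F x = F 0 + ∫ t in (0 : ℝ)..x, f t) : HasACDeriv F f := by
  have hsub : ∀ x ∈ Icc (0 : ℝ) Real.pi, ∀ y ∈ Icc (0 : ℝ) Real.pi,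
      F x - F y = ∫ t in y..x, f t := by
    intro x hx y hy
    rw [h x hx, h y hy, add_sub_add_left_eq_sub, intervalIntegral.integral_interval_sub_left
      (intervalIntegrable_sub hf zero_mem_Icc_pi hx)
      (intervalIntegrable_sub hf zero_mem_Icc_pi hy)]
  constructor
  · refine absolutelyContinuousOnInterval_of_dist_le (K := 1)
      (hf.norm.absolutelyContinuousOnInterval_intervalIntegral (c := 0) (by simp)) ?_
    rw [uIcc_zero_pi]
    intro x hx y hy
    rw [dist_eq_norm, hsub x hx y hy, Real.dist_eq, intervalIntegral.integral_interval_sub_left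
      (intervalIntegrable_sub hf.norm zero_mem_Icc_pi hx)
      (intervalIntegrable_sub hf.norm zero_mem_Icc_pi hy), one_mul]
    exact intervalIntegral.norm_integral_le_abs_integral_norm
  · filter_upwards [hf.ae_hasDerivAt_integral] with x hx hx'
    have h1 := hx (by rw [uIcc_zero_pi]; exact Ioo_subset_Icc_self hx') 0 (by simp)
    have h2 : F =ᶠ[𝓝 x] fun y => F 0 + ∫ t in (0 : ℝ)..y, f t := by
      filter_upwards [Icc_mem_nhds hx'.1 hx'.2] with y hy using h y hy
    exact (h1.const_add _).congr_of_eventuallyEq h2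

theorem congr_deriv {F f g : ℝ → E} (h : HasACDeriv F f)
    (hfg : ∀ᵐ x, x ∈ Ioo 0 Real.pi → f x = g x) : HasACDeriv F g := by
  refine ⟨h.ac, ?_⟩
  filter_upwards [h.deriv, hfg] with x h1 h2 hx
  rw [← h2 hx]
  exact h1 hx

theorem congr_deriv' {F f g : ℝ → E} (h : HasACDeriv F f)
    (hfg : ∀ x, f x = g x) : HasACDeriv F g :=
  h.congr_deriv (Eventually.of_forall fun x _ => hfg x)

theorem const (c : E) : HasACDeriv (fun _ => c) fun _ => 0 :=
  ⟨contDiffOn_const.absolutelyContinuousOnInterval,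
    Eventually.of_forall fun x _ => hasDerivAt_const x c⟩

theorem of_contDiff {F f : ℝ → E} (hF : ContDiff ℝ 1 F) (h : ∀ x, HasDerivAt F (f x) x) :
    HasACDeriv F f :=
  ⟨hF.contDiffOn.absolutelyContinuousOnInterval, Eventually.of_forall fun x _ => h x⟩

theorem add {F f G g : ℝ → E} (hF : HasACDeriv F f) (hG : HasACDeriv G g) :
    HasACDeriv (fun x => F x + G x) fun x => f x + g x := by
  refine ⟨hF.ac.add hG.ac, ?_⟩
  filter_upwards [hF.deriv, hG.deriv] with x h1 h2 hx using (h1 hx).add (h2 hx)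

theorem neg {F f : ℝ → E} (hF : HasACDeriv F f) : HasACDeriv (fun x => -F x) fun x => -f x := by
  refine ⟨hF.ac.neg, ?_⟩
  filter_upwards [hF.deriv] with x h1 hx using (h1 hx).neg

theorem sub {F f G g : ℝ → E} (hF : HasACDeriv F f) (hG : HasACDeriv G g) :
    HasACDeriv (fun x => F x - G x) fun x => f x - g x := by
  refine ⟨hF.ac.sub hG.ac, ?_⟩
  filter_upwards [hF.deriv, hG.deriv] with x h1 h2 hx using (h1 hx).sub (h2 hx)

theorem mul {A : Type*} [NormedCommRing A] [NormedAlgebra ℝ A] [NormMulClass A] {F f G g : ℝ → A}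
    (hF : HasACDeriv F f) (hG : HasACDeriv G g) :
    HasACDeriv (fun x => F x * G x) fun x => f x * G x + F x * g x := by
  refine ⟨hF.ac.smul hG.ac, ?_⟩
  filter_upwards [hF.deriv, hG.deriv] with x h1 h2 hx using (h1 hx).mul (h2 hx)

theorem const_mul {A : Type*} [NormedCommRing A] [NormedAlgebra ℝ A] [NormMulClass A]
    {F f : ℝ → A} (c : A) (hF : HasACDeriv F f) : HasACDeriv (fun x => c * F x) fun x => c * f x :=
  ((const c).mul hF).congr_deriv' fun x => by simp

theorem clm {E' : Type*} [NormedAddCommGroup E'] [NormedSpace ℝ E'] {F f : ℝ → E}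
    (L : E →L[ℝ] E') (hF : HasACDeriv F f) : HasACDeriv (fun x => L (F x)) fun x => L (f x) := by
  refine ⟨absolutelyContinuousOnInterval_of_dist_le (K := ‖L‖) hF.ac fun x _ y _ => ?_, ?_⟩
  · rw [dist_eq_norm, dist_eq_norm, ← map_sub]
    exact L.le_opNorm _
  · filter_upwards [hF.deriv] with x h1 hx using L.hasFDerivAt.comp_hasDerivAt x (h1 hx)

theorem re {F f : ℝ → ℂ} (hF : HasACDeriv F f) :
    HasACDeriv (fun x => (F x).re) fun x => (f x).re := hF.clm Complex.reCLM

theorem im {F f : ℝ → ℂ} (hF : HasACDeriv F f) :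
    HasACDeriv (fun x => (F x).im) fun x => (f x).im := hF.clm Complex.imCLM

theorem cconj {F f : ℝ → ℂ} (hF : HasACDeriv F f) :
    HasACDeriv (fun x => conj (F x)) fun x => conj (f x) :=
  hF.clm Complex.conjCLE.toContinuousLinearMap

/-- An absolutely continuous function is bounded, so only a closed ball of the target matters, and
there a `C¹` map is Lipschitz. Prescribing the real differential as multiplication by `φ'` serves
powers and the real and complex exponentials at once. -/
theorem comp_contDiff {A : Type*} [NormedCommRing A] [NormedAlgebra ℝ A] [ProperSpace A]
    {F f : ℝ → A} {φ φ' : A → A} (hF : HasACDeriv F f) (hφ : ContDiff ℝ 1 φ)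
    (hφ' : ∀ a v, fderiv ℝ φ a v = φ' a * v) :
    HasACDeriv (fun x => φ (F x)) fun x => φ' (F x) * f x := by
  obtain ⟨C, hC⟩ := hF.ac.exists_bound
  obtain ⟨K, hK⟩ := hφ.contDiffOn.exists_lipschitzOnWith (s := Metric.closedBall 0 C) (by decide)
    (convex_closedBall _ _) (isCompact_closedBall _ _)
  refine ⟨absolutelyContinuousOnInterval_of_dist_le (K := K) hF.ac fun x hx y hy => ?_, ?_⟩
  · exact hK.dist_le_mul _ (by simpa using hC x hx) _ (by simpa using hC y hy)
  · filter_upwards [hF.deriv] with x h1 hx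
    have := ((hφ.differentiable (by norm_num)) (F x)).hasFDerivAt.comp_hasDerivAt x (h1 hx)
    rwa [hφ'] at this

theorem exp {F f : ℝ → ℝ} (hF : HasACDeriv F f) :
    HasACDeriv (fun x => Real.exp (F x)) fun x => Real.exp (F x) * f x :=
  hF.comp_contDiff Real.contDiff_exp fun a v => by simp [mul_comm]

theorem cexp {F f : ℝ → ℂ} (hF : HasACDeriv F f) :
    HasACDeriv (fun x => Complex.exp (F x)) fun x => Complex.exp (F x) * f x :=
  hF.comp_contDiff Complex.contDiff_exp fun a v => by
    have := ((Complex.hasDerivAt_exp a).hasFDerivAt.restrictScalars ℝ).fderiv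
    rw [this]; simp [mul_comm]

theorem ae_uIcc {p : ℝ → Prop} (h : ∀ᵐ x, x ∈ Ioo 0 Real.pi → p x) :
    ∀ᵐ x, x ∈ uIcc 0 Real.pi → p x := by
  have h0 : ∀ᵐ x : ℝ, x ≠ 0 := by simp [ae_iff]
  have h1 : ∀ᵐ x : ℝ, x ≠ Real.pi := by simp [ae_iff]
  filter_upwards [h, h0, h1] with x h h0 h1 hx
  rw [uIcc_zero_pi] at hx
  exact h ⟨lt_of_le_of_ne hx.1 h0.symm, lt_of_le_of_ne hx.2 h1⟩

theorem intervalIntegrable_real {F f : ℝ → ℝ} (h : HasACDeriv F f) :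
    IntervalIntegrable f volume 0 Real.pi := by
  refine h.ac.intervalIntegrable_deriv.congr_ae ?_
  rw [Filter.EventuallyEq, ae_restrict_iff' measurableSet_uIoc]
  filter_upwards [ae_uIcc h.deriv] with x hx hx'
  exact (hx (uIoc_subset_uIcc hx')).deriv

theorem intervalIntegrable {F f : ℝ → ℂ} (h : HasACDeriv F f) :
    IntervalIntegrable f volume 0 Real.pi := by
  have h1 := h.re.intervalIntegrable_real
  have h2 := h.im.intervalIntegrable_real
  rw [intervalIntegrable_iff_integrableOn_Ioc_of_le Real.pi_pos.le] at *
  refine ((h1.ofReal (𝕜 := ℂ)).add ((h2.ofReal (𝕜 := ℂ)).mul_const Complex.I)).congr ?_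
  exact Eventually.of_forall fun x => Complex.re_add_im (f x)

/-- `F` minus the primitive of `f` is absolutely continuous with derivative zero almost everywhere,
hence constant. -/
theorem sub_eq_of_integrable [CompleteSpace E] {F f : ℝ → E} (h : HasACDeriv F f)
    (hf : IntervalIntegrable f volume 0 Real.pi) {x y : ℝ} (hx : x ∈ Icc 0 Real.pi)
    (hy : y ∈ Icc 0 Real.pi) : ∫ t in x..y, f t = F y - F x := by
  have h1 : HasACDeriv (fun x => ∫ t in (0 : ℝ)..x, f t) f := of_integral hf (by simp)
  have h2 := h.sub h1
  obtain ⟨C, hC⟩ := h2.ac.const_of_ae_hasDerivAt_zero (by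
    refine ae_uIcc ?_
    filter_upwards [h2.deriv] with x hx hx'
    simpa using hx hx')
  rw [uIcc_zero_pi] at hC
  have e1 := hC x hx
  have e2 := hC y hy
  rw [← intervalIntegral.integral_interval_sub_left
    (intervalIntegrable_sub hf zero_mem_Icc_pi hy) (intervalIntegrable_sub hf zero_mem_Icc_pi hx)]
  have : F y - ∫ t in (0 : ℝ)..y, f t = F x - ∫ t in (0 : ℝ)..x, f t := e2.trans e1.symm
  rw [sub_eq_sub_iff_add_eq_add] at this ⊢
  rw [add_comm, ← this, add_comm]

theorem integral_eq {F f : ℝ → ℂ} (h : HasACDeriv F f) {x y : ℝ} (hx : x ∈ Icc 0 Real.pi)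
    (hy : y ∈ Icc 0 Real.pi) : ∫ t in x..y, f t = F y - F x :=
  h.sub_eq_of_integrable h.intervalIntegrable hx hy

theorem integral_eq_real {F f : ℝ → ℝ} (h : HasACDeriv F f) {x y : ℝ} (hx : x ∈ Icc 0 Real.pi)
    (hy : y ∈ Icc 0 Real.pi) : ∫ t in x..y, f t = F y - F x :=
  h.sub_eq_of_integrable h.intervalIntegrable_real hx hy

/-- Integration of a differential inequality. -/
theorem sub_le_integral {F f g : ℝ → ℝ} (h : HasACDeriv F f)
    (hg : IntervalIntegrable g volume 0 Real.pi)
    (hfg : ∀ᵐ x, x ∈ Ioo 0 Real.pi → f x ≤ g x) {x y : ℝ} (hx : x ∈ Icc 0 Real.pi)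
    (hy : y ∈ Icc 0 Real.pi) (hxy : x ≤ y) : F y - F x ≤ ∫ t in x..y, g t := by
  rw [← h.integral_eq_real hx hy]
  refine intervalIntegral.integral_mono_ae_restrict hxy
    (intervalIntegrable_sub h.intervalIntegrable_real hx hy) (intervalIntegrable_sub hg hx hy) ?_
  rw [Filter.EventuallyLE, ae_restrict_iff' measurableSet_Icc]
  filter_upwards [ae_uIcc hfg] with t ht ht'
  exact ht (by rw [uIcc_zero_pi]; exact Icc_subset_Icc hx.1 hy.2 ht')

theorem antitoneOn {F f : ℝ → ℝ} (h : HasACDeriv F f)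
    (hf : ∀ᵐ x, x ∈ Ioo 0 Real.pi → f x ≤ 0) : AntitoneOn F (Icc 0 Real.pi) := by
  intro x hx y hy hxy
  have := h.sub_le_integral (g := fun _ => 0) (by simp) hf hx hy hxy
  simp at this
  linarith

theorem monotoneOn {F f : ℝ → ℝ} (h : HasACDeriv F f)
    (hf : ∀ᵐ x, x ∈ Ioo 0 Real.pi → 0 ≤ f x) : MonotoneOn F (Icc 0 Real.pi) := by
  intro x hx y hy hxy
  have := h.neg.antitoneOn (by filter_upwards [hf] with x hx hx'; linarith [hx hx']) hx hy hxy
  simpa using this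

/-- Grönwall's inequality from above. -/
theorem gronwall_le {F f B b : ℝ → ℝ} (hF : HasACDeriv F f) (hB : HasACDeriv B b)
    (h : ∀ᵐ x, x ∈ Ioo 0 Real.pi → f x ≤ b x * F x) {x y : ℝ} (hx : x ∈ Icc 0 Real.pi)
    (hy : y ∈ Icc 0 Real.pi) (hxy : x ≤ y) : F y ≤ F x * Real.exp (B y - B x) := by
  have := (hF.mul hB.neg.exp).antitoneOn (by
    filter_upwards [h] with x h hx
    have := mul_le_mul_of_nonneg_right (h hx) (Real.exp_pos (-B x)).le
    linarith) hx hy hxy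
  have e := mul_le_mul_of_nonneg_right this (Real.exp_pos (B y)).le
  simp only [mul_assoc, ← Real.exp_add] at e
  simpa [neg_add_eq_sub] using e

/-- Grönwall's inequality from below. -/
theorem le_gronwall {F f B b : ℝ → ℝ} (hF : HasACDeriv F f) (hB : HasACDeriv B b)
    (h : ∀ᵐ x, x ∈ Ioo 0 Real.pi → b x * F x ≤ f x) {x y : ℝ} (hx : x ∈ Icc 0 Real.pi)
    (hy : y ∈ Icc 0 Real.pi) (hxy : x ≤ y) : F x * Real.exp (B y - B x) ≤ F y := by
  have := hF.neg.gronwall_le hB (by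
    filter_upwards [h] with x h hx
    linarith [h hx]) hx hy hxy
  linarith

end HasACDeriv


theorem HasACDeriv.norm_sq {F f : ℝ → ℂ} (h : HasACDeriv F f) :
    HasACDeriv (fun x => ‖F x‖ ^ 2) fun x => 2 * (conj (F x) * f x).re := by
  have := (h.re.mul h.re).add (h.im.mul h.im)
  refine ⟨?_, ?_⟩
  · convert this.ac using 2 with x
    rw [Complex.sq_norm, Complex.normSq_apply]
  · filter_upwards [this.deriv] with x h1 hx
    convert h1 hx using 1
    · ext x; rw [Complex.sq_norm, Complex.normSq_apply]
    · simp; ring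

/-- Grönwall's inequality with a forcing term. -/
theorem HasACDeriv.gronwall_forced {F f B b h : ℝ → ℝ} (hF : HasACDeriv F f) (hB : HasACDeriv B b)
    (hb : ∀ x, 0 ≤ b x) (hh : ∀ x, 0 ≤ h x) (hi : IntervalIntegrable h volume 0 Real.pi)
    (hle : ∀ᵐ x, x ∈ Ioo 0 Real.pi → f x ≤ b x * F x + h x) {x : ℝ} (hx : x ∈ Icc 0 Real.pi) :
    F x ≤ Real.exp (B x - B 0) * (F 0 + ∫ t in (0 : ℝ)..x, h t) := by
  have hmono := hB.monotoneOn (Eventually.of_forall fun x _ => hb x)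
  have hG := (hB.sub (HasACDeriv.const (B 0))).neg.exp
  have := (hF.mul hG).sub_le_integral hi (by
    filter_upwards [hle] with x h1 hx
    have h2 := mul_le_mul_of_nonneg_right (h1 hx) (Real.exp_pos (-(B x - B 0))).le
    have h3 : Real.exp (-(B x - B 0)) ≤ 1 := by
      rw [Real.exp_le_one_iff]
      have := hmono zero_mem_Icc_pi (Ioo_subset_Icc_self hx) hx.1.le
      linarith
    have h4 := mul_le_mul_of_nonneg_left h3 (hh x)
    linarith) zero_mem_Icc_pi hx hx.1
  simp only [sub_self, neg_zero, Real.exp_zero, mul_one] at this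
  have e := mul_le_mul_of_nonneg_left (sub_le_iff_le_add.1 this) (Real.exp_pos (B x - B 0)).le
  have e2 : Real.exp (B x - B 0) * (F x * Real.exp (-(B x - B 0))) = F x := by
    rw [mul_left_comm, ← Real.exp_add]; simp
  rw [e2] at e
  linarith

/-! ### Potentials -/

/-- Lebesgue measure on `[0, π]`. -/
noncomputable abbrev muPi : Measure ℝ := volume.restrict (Icc (0 : ℝ) Real.pi)

theorem restrict_Ioc_pi : volume.restrict (Ioc (0 : ℝ) Real.pi) = muPi :=
  restrict_Ioc_eq_restrict_Icc

theorem intervalIntegral_eq_muPi {E : Type*} [NormedAddCommGroup E] [NormedSpace ℝ E]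
    (f : ℝ → E) : ∫ x in (0 : ℝ)..Real.pi, f x = ∫ x, f x ∂muPi := by
  rw [intervalIntegral.integral_of_le Real.pi_pos.le, restrict_Ioc_pi]

theorem intervalIntegrable_iff_muPi {E : Type*} [NormedAddCommGroup E]
    {f : ℝ → E} : IntervalIntegrable f volume 0 Real.pi ↔ Integrable f muPi := by
  rw [intervalIntegrable_iff_integrableOn_Ioc_of_le Real.pi_pos.le, IntegrableOn, restrict_Ioc_pi]

/-- `u` is a real potential in the ball of radius `R` of `L₂[0, π]`. -/
structure IsPotential (R : ℝ) (u : ℝ → ℝ) : Prop where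
  memLp : MemLp u 2 muPi
  integral_sq_le : ∫ x in (0 : ℝ)..Real.pi, u x ^ 2 ≤ R ^ 2

namespace IsPotential

variable {R : ℝ} {u : ℝ → ℝ}

theorem intervalIntegrable_sq (hu : IsPotential R u) :
    IntervalIntegrable (fun x => u x ^ 2) volume 0 Real.pi :=
  intervalIntegrable_iff_muPi.2 hu.memLp.integrable_sq

theorem intervalIntegrable (hu : IsPotential R u) : IntervalIntegrable u volume 0 Real.pi :=
  intervalIntegrable_iff_muPi.2 (hu.memLp.integrable (by norm_num))

theorem zero : IsPotential 0 fun _ => 0 := ⟨MemLp.zero, by simp⟩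

theorem mono {R' : ℝ} (hu : IsPotential R u) (hR : 0 ≤ R) (h : R ≤ R') : IsPotential R' u :=
  ⟨hu.memLp, hu.integral_sq_le.trans (by gcongr)⟩

theorem integral_sq_sub_le (hu : IsPotential R u) {x y : ℝ} (hx : x ∈ Icc 0 Real.pi)
    (hy : y ∈ Icc 0 Real.pi) (hxy : x ≤ y) : ∫ t in x..y, u t ^ 2 ≤ R ^ 2 := by
  refine le_trans ?_ hu.integral_sq_le
  exact intervalIntegral.integral_mono_interval hx.1 hxy hy.2
    (Eventually.of_forall fun x => sq_nonneg _) hu.intervalIntegrable_sq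

/-- Here `2|u| ≤ 1 + u²` and `u²/s ≤ u²`. The bound is free of `s`, which makes the later constants
uniform in the spectral parameter. -/
theorem integral_weight_le (hu : IsPotential R u) {s x y : ℝ} (hs : 1 ≤ s) (hx : x ∈ Icc 0 Real.pi)
    (hy : y ∈ Icc 0 Real.pi) (hxy : x ≤ y) :
    ∫ t in x..y, (2 * |u t| + u t ^ 2 / s) ≤ Real.pi + 2 * R ^ 2 := by
  have i2 := intervalIntegrable_sub hu.intervalIntegrable_sq hx hy
  have i1 := intervalIntegrable_sub hu.intervalIntegrable hx hy
  calc ∫ t in x..y, (2 * |u t| + u t ^ 2 / s) ≤ ∫ t in x..y, (1 + 2 * u t ^ 2) := by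
        refine intervalIntegral.integral_mono_on hxy ((i1.abs.const_mul 2).add (i2.div_const s))
          (intervalIntegrable_const.add (i2.const_mul 2)) fun t _ => ?_
        have : u t ^ 2 / s ≤ u t ^ 2 := div_le_self (sq_nonneg _) hs
        have h2 := sq_nonneg (|u t| - 1)
        rw [sub_sq, sq_abs] at h2
        linarith
    _ = (y - x) + 2 * ∫ t in x..y, u t ^ 2 := by
        rw [intervalIntegral.integral_add intervalIntegrable_const (i2.const_mul 2)]
        simp
    _ ≤ _ := by
        have := hu.integral_sq_sub_le hx hy hxy
        linarith [hx.1, hy.2]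

end IsPotential

/-! ### Solutions -/

/-- The differential form of `IsSolution`. -/
structure Sol (u : ℝ → ℝ) (g y y₁ : ℝ → ℂ) : Prop where
  deriv : HasACDeriv y fun x => y₁ x + u x * y x
  deriv_quasi : HasACDeriv y₁ fun x => -(u x * y₁ x + u x ^ 2 * y x + g x)

theorem integrable_mul_of_continuousOn {a : ℝ → ℝ} {f : ℝ → ℂ}
    (ha : IntervalIntegrable a volume 0 Real.pi) (hf : ContinuousOn f (Icc 0 Real.pi)) :
    IntervalIntegrable (fun x => (a x : ℂ) * f x) volume 0 Real.pi := by
  have : IntervalIntegrable (fun x => (a x : ℂ)) volume 0 Real.pi := by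
    rw [intervalIntegrable_iff_muPi] at *
    exact ha.ofReal
  exact this.mul_continuousOn (by rwa [uIcc_zero_pi])

theorem IsSolution.sol {R : ℝ} {u : ℝ → ℝ} {g y y₁ : ℝ → ℂ} (hu : IsPotential R u)
    (hg : IntervalIntegrable g volume 0 Real.pi) (h : IsSolution (fun x => (u x : ℂ)) g y y₁) :
    Sol u g y y₁ := by
  constructor
  · refine HasACDeriv.of_integral ?_ h.eq
    exact (h.continuousOn_quasi.intervalIntegrable_of_Icc Real.pi_pos.le).add
      (integrable_mul_of_continuousOn hu.intervalIntegrable h.continuousOn)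
  · refine HasACDeriv.of_integral ?_ ?_
    · have := integrable_mul_of_continuousOn hu.intervalIntegrable_sq h.continuousOn
      push_cast at this
      exact (((integrable_mul_of_continuousOn hu.intervalIntegrable h.continuousOn_quasi).add
        this).add hg).neg
    · intro x hx
      rw [h.eq_quasi x hx, intervalIntegral.integral_neg, sub_eq_add_neg]

namespace Sol

variable {u : ℝ → ℝ} {g g' y y₁ w w₁ : ℝ → ℂ} {z : ℂ}

theorem congr_rhs (h : Sol u g y y₁) (hg : ∀ x ∈ Ioo 0 Real.pi, g x = g' x) : Sol u g' y y₁ :=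
  ⟨h.deriv, h.deriv_quasi.congr_deriv (Eventually.of_forall fun x hx => by rw [hg x hx])⟩

theorem sub (h : Sol u g y y₁) (h' : Sol u g' w w₁) :
    Sol u (fun x => g x - g' x) (fun x => y x - w x) fun x => y₁ x - w₁ x :=
  ⟨(h.deriv.sub h'.deriv).congr_deriv' fun x => by ring,
    (h.deriv_quasi.sub h'.deriv_quasi).congr_deriv' fun x => by ring⟩

theorem add (h : Sol u g y y₁) (h' : Sol u g' w w₁) :
    Sol u (fun x => g x + g' x) (fun x => y x + w x) fun x => y₁ x + w₁ x :=
  ⟨(h.deriv.add h'.deriv).congr_deriv' fun x => by ring,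
    (h.deriv_quasi.add h'.deriv_quasi).congr_deriv' fun x => by ring⟩

theorem const_mul (c : ℂ) (h : Sol u g y y₁) :
    Sol u (fun x => c * g x) (fun x => c * y x) fun x => c * y₁ x :=
  ⟨(h.deriv.const_mul c).congr_deriv' fun x => by ring,
    (h.deriv_quasi.const_mul c).congr_deriv' fun x => by ring⟩

theorem zero (u : ℝ → ℝ) : Sol u (fun _ => 0) (fun _ => 0) fun _ => 0 :=
  ⟨(HasACDeriv.const 0).congr_deriv' fun x => by simp,
    (HasACDeriv.const 0).congr_deriv' fun x => by simp⟩

theorem sum {ι : Type*} (s : Finset ι) {g y y₁ : ι → ℝ → ℂ}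
    (h : ∀ i ∈ s, Sol u (g i) (y i) (y₁ i)) :
    Sol u (fun x => ∑ i ∈ s, g i x) (fun x => ∑ i ∈ s, y i x) fun x => ∑ i ∈ s, y₁ i x := by
  classical
  induction s using Finset.induction_on with
  | empty => simpa using zero u
  | insert a s ha ih =>
    simp only [Finset.sum_insert ha]
    exact (h a (by simp)).add (ih fun i hi => h i (by simp [hi]))

theorem star (h : Sol u g y y₁) :
    Sol u (fun x => conj (g x)) (fun x => conj (y x)) fun x => conj (y₁ x) :=
  ⟨h.deriv.cconj.congr_deriv' fun x => by simp,
    h.deriv_quasi.cconj.congr_deriv' fun x => by simp⟩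

/-- Lagrange's identity. -/
theorem lagrange (h : Sol u g y y₁) (h' : Sol u g' w w₁) :
    HasACDeriv (fun x => y x * w₁ x - y₁ x * w x) fun x => g x * w x - y x * g' x :=
  ((h.deriv.mul h'.deriv_quasi).sub (h.deriv_quasi.mul h'.deriv)).congr_deriv' fun x => by ring

/-- With one factor conjugated this is the quadratic form of the operator, `|y₁|² - u²|y|²`, with no
derivative of `u` in it. -/
theorem mul_quasi (h : Sol u g y y₁) (h' : Sol u g' w w₁) :
    HasACDeriv (fun x => y x * w₁ x) fun x => y₁ x * w₁ x - u x ^ 2 * (y x * w x) - y x * g' x :=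
  (h.deriv.mul h'.deriv_quasi).congr_deriv' fun x => by ring

/-- The energy is that of a free oscillation of frequency `s`, so in its derivative every term not
due to `g` carries `u`, `u²` or `z - s²`. The homogeneous part is an integrable weight times the
energy, and Grönwall's inequality applies. -/
theorem energy_deriv (h : Sol u (fun x => z * y x + g x) y y₁) (s : ℝ) :
    HasACDeriv (fun x => ‖y₁ x‖ ^ 2 + s ^ 2 * ‖y x‖ ^ 2) fun x =>
      2 * u x * (s ^ 2 * ‖y x‖ ^ 2 - ‖y₁ x‖ ^ 2) - 2 * u x ^ 2 * (conj (y₁ x) * y x).re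
        - 2 * (conj (y₁ x) * y x * (z - s ^ 2)).re - 2 * (conj (y₁ x) * g x).re := by
  refine (h.deriv_quasi.norm_sq.add (h.deriv.norm_sq.const_mul (s ^ 2))).congr_deriv' fun x => ?_
  simp only [Complex.sq_norm, Complex.normSq_apply]
  simp only [pow_two]
  simp
  ring

theorem re_conj_mul_le (a b : ℂ) {s : ℝ} (hs : 0 < s) :
    2 * (‖a‖ * ‖b‖) ≤ (‖a‖ ^ 2 + s ^ 2 * ‖b‖ ^ 2) / s := by
  rw [le_div_iff₀ hs]
  nlinarith [sq_nonneg (‖a‖ - s * ‖b‖)]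

theorem energy_bound (a b g z : ℂ) (u : ℝ) {s : ℝ} (hs : 0 < s) :
    |2 * u * (s ^ 2 * ‖b‖ ^ 2 - ‖a‖ ^ 2) - 2 * u ^ 2 * (conj a * b).re
        - 2 * (conj a * b * (z - s ^ 2)).re - 2 * (conj a * g).re| ≤
      (‖z - s ^ 2‖ / s + (2 * |u| + u ^ 2 / s)) * (‖a‖ ^ 2 + s ^ 2 * ‖b‖ ^ 2)
        + 2 * (‖a‖ * ‖g‖) := by
  have h0 := re_conj_mul_le a b hs
  have h1 : |2 * u * (s ^ 2 * ‖b‖ ^ 2 - ‖a‖ ^ 2)| ≤ 2 * |u| * (‖a‖ ^ 2 + s ^ 2 * ‖b‖ ^ 2) := by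
    rw [abs_mul, abs_mul, abs_two]
    gcongr
    rw [abs_le]
    constructor <;> nlinarith [sq_nonneg ‖a‖, mul_nonneg (sq_nonneg s) (sq_nonneg ‖b‖)]
  have h2 : |2 * u ^ 2 * (conj a * b).re| ≤ u ^ 2 / s * (‖a‖ ^ 2 + s ^ 2 * ‖b‖ ^ 2) := by
    have := Complex.abs_re_le_norm (conj a * b)
    rw [norm_mul, RCLike.norm_conj] at this
    rw [abs_mul, abs_of_nonneg (by positivity : 0 ≤ 2 * u ^ 2)]
    calc 2 * u ^ 2 * |(conj a * b).re| ≤ u ^ 2 * (2 * (‖a‖ * ‖b‖)) := by nlinarith [sq_nonneg u]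
      _ ≤ u ^ 2 * ((‖a‖ ^ 2 + s ^ 2 * ‖b‖ ^ 2) / s) := by gcongr
      _ = _ := by ring
  have h3 : |2 * (conj a * b * (z - s ^ 2)).re| ≤
      ‖z - s ^ 2‖ / s * (‖a‖ ^ 2 + s ^ 2 * ‖b‖ ^ 2) := by
    have := Complex.abs_re_le_norm (conj a * b * (z - s ^ 2))
    rw [norm_mul, norm_mul, RCLike.norm_conj] at this
    rw [abs_mul, abs_two]
    calc 2 * |(conj a * b * (z - s ^ 2)).re| ≤ ‖z - s ^ 2‖ * (2 * (‖a‖ * ‖b‖)) := by linarith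
      _ ≤ ‖z - s ^ 2‖ * ((‖a‖ ^ 2 + s ^ 2 * ‖b‖ ^ 2) / s) := by gcongr
      _ = _ := by ring
  have h4 : |2 * (conj a * g).re| ≤ 2 * (‖a‖ * ‖g‖) := by
    have := Complex.abs_re_le_norm (conj a * g)
    rw [norm_mul, RCLike.norm_conj] at this
    rw [abs_mul, abs_two]
    linarith
  rw [abs_le] at *
  constructor <;> linarith [h1.1, h1.2, h2.1, h2.2, h3.1, h3.2, h4.1, h4.2]

end Sol

/-- The weight `∫₀ˣ (c + 2|u| + u²/s)` controlling the growth of the energy. -/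
noncomputable def growth (u : ℝ → ℝ) (c s x : ℝ) : ℝ :=
  ∫ t in (0 : ℝ)..x, (c + (2 * |u t| + u t ^ 2 / s))

section growth

variable {R : ℝ} {u : ℝ → ℝ}

theorem growth_integrable (hu : IsPotential R u) (c s : ℝ) :
    IntervalIntegrable (fun t => c + (2 * |u t| + u t ^ 2 / s)) volume 0 Real.pi :=
  intervalIntegrable_const.add
    ((hu.intervalIntegrable.abs.const_mul 2).add (hu.intervalIntegrable_sq.div_const s))

theorem growth_hasACDeriv (hu : IsPotential R u) (c s : ℝ) :
    HasACDeriv (growth u c s) fun t => c + (2 * |u t| + u t ^ 2 / s) :=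
  HasACDeriv.of_integral (growth_integrable hu c s) fun x _ => by simp [growth]

theorem growth_sub_le (hu : IsPotential R u) (c : ℝ) {s x y : ℝ} (hs : 1 ≤ s)
    (hx : x ∈ Icc 0 Real.pi) (hy : y ∈ Icc 0 Real.pi) (hxy : x ≤ y) :
    growth u c s y - growth u c s x ≤ c * (y - x) + (Real.pi + 2 * R ^ 2) := by
  rw [← (growth_hasACDeriv hu c s).integral_eq_real hx hy]
  have i2 := (intervalIntegrable_sub hu.intervalIntegrable_sq hx hy).div_const s
  have i1 := (intervalIntegrable_sub hu.intervalIntegrable hx hy).abs.const_mul 2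
  rw [intervalIntegral.integral_add intervalIntegrable_const (i1.add i2)]
  have := hu.integral_weight_le hs hx hy hxy
  simp only [intervalIntegral.integral_const, smul_eq_mul] at *
  linarith

end growth

/-- The constant in the energy estimates. -/
noncomputable def energyConst (R : ℝ) : ℝ := Real.exp (Real.pi + 2 * R ^ 2)

theorem one_le_energyConst (R : ℝ) : 1 ≤ energyConst R :=
  Real.one_le_exp (by positivity)

namespace Sol

variable {R : ℝ} {u : ℝ → ℝ} {g g' y y₁ w w₁ : ℝ → ℂ} {z : ℂ}

/-- Grönwall's inequality is run in both directions from `a`. Backwards it yields the lower bounds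
for the energy on which `IsOmega.le_energy` rests. -/
theorem energy_le (hu : IsPotential R u) (h : Sol u (fun x => z * y x) y y₁) {s a b : ℝ}
    (hs : 1 ≤ s) (ha : a ∈ Icc 0 Real.pi) (hb : b ∈ Icc 0 Real.pi) :
    ‖y₁ b‖ ^ 2 + s ^ 2 * ‖y b‖ ^ 2 ≤
      energyConst R * Real.exp (‖z - s ^ 2‖ / s * |b - a|) * (‖y₁ a‖ ^ 2 + s ^ 2 * ‖y a‖ ^ 2) := by
  have hE := energy_deriv (g := fun _ => 0) (by simpa using h) s
  have hbd := fun x => energy_bound (y₁ x) (y x) 0 z (u x) (zero_lt_one.trans_le hs)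
  simp only [norm_zero, mul_zero, add_zero, Complex.zero_re, sub_zero] at hbd hE
  have hG := growth_hasACDeriv hu (‖z - s ^ 2‖ / s) s
  rcases le_total a b with hab | hab
  · have := hE.gronwall_le hG (Eventually.of_forall fun x _ => (abs_le.1 (hbd x)).2) ha hb hab
    refine this.trans ?_
    rw [mul_comm, abs_of_nonneg (sub_nonneg.2 hab), energyConst, ← Real.exp_add]
    gcongr
    linarith [growth_sub_le hu (‖z - s ^ 2‖ / s) hs ha hb hab]
  · have := hE.le_gronwall hG.neg (Eventually.of_forall fun x _ => by
      linarith [(abs_le.1 (hbd x)).1]) hb ha hab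
    have e : ∀ p q c : ℝ, p * Real.exp c ≤ q → p ≤ Real.exp (-c) * q := fun p q c h => by
      have := mul_le_mul_of_nonneg_left h (Real.exp_pos (-c)).le
      rwa [mul_left_comm, ← Real.exp_add, neg_add_cancel, Real.exp_zero, mul_one] at this
    refine (e _ _ _ this).trans ?_
    rw [abs_of_nonpos (sub_nonpos.2 hab), energyConst, ← Real.exp_add]
    gcongr
    linarith [growth_sub_le hu (‖z - s ^ 2‖ / s) hs hb ha hab]

/-- Energy estimate for the inhomogeneous equation with zero initial data. -/
theorem energy_forced (hu : IsPotential R u) (h : Sol u (fun x => z * y x + g x) y y₁)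
    (hg : IntervalIntegrable (fun x => ‖g x‖ ^ 2) volume 0 Real.pi) (h0 : y 0 = 0) (h1 : y₁ 0 = 0)
    {s x : ℝ} (hs : 1 ≤ s) (hx : x ∈ Icc 0 Real.pi) :
    ‖y₁ x‖ ^ 2 + s ^ 2 * ‖y x‖ ^ 2 ≤
      energyConst R * Real.exp ((1 + ‖z - s ^ 2‖ / s) * Real.pi) *
        ∫ t in (0 : ℝ)..x, ‖g t‖ ^ 2 := by
  have hs0 := zero_lt_one.trans_le hs
  have hE := energy_deriv h s
  have hbd := fun x => energy_bound (y₁ x) (y x) (g x) z (u x) hs0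
  have hG := growth_hasACDeriv hu (1 + ‖z - s ^ 2‖ / s) s
  have := hE.gronwall_forced hG (fun x => by positivity) (fun x => by positivity) hg
    (Eventually.of_forall fun x _ => by
      have h1 := (abs_le.1 (hbd x)).2
      -- The forcing is split by `2|y₁||g| ≤ |y₁|² + |g|²`; the first part accounts for the summand
      -- `1` in the growth rate.
      have h2 := sq_nonneg (‖y₁ x‖ - ‖g x‖)
      have h3 : 0 ≤ s ^ 2 * ‖y x‖ ^ 2 := by positivity
      nlinarith) hx
  simp only [h0, h1, norm_zero, ne_eq, OfNat.ofNat_ne_zero, not_false_eq_true, zero_pow, mul_zero,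
    add_zero, zero_add] at this
  refine this.trans ?_
  rw [energyConst, ← Real.exp_add]
  have h4 : 0 ≤ ∫ t in (0 : ℝ)..x, ‖g t‖ ^ 2 :=
    intervalIntegral.integral_nonneg hx.1 fun t _ => by positivity
  gcongr
  have := growth_sub_le hu (1 + ‖z - s ^ 2‖ / s) hs zero_mem_Icc_pi hx hx.1
  have h5 : (1 + ‖z - s ^ 2‖ / s) * (x - 0) ≤ (1 + ‖z - s ^ 2‖ / s) * Real.pi := by
    gcongr
    linarith [hx.2]
  linarith

/-- A solution of the homogeneous equation with zero data at a point vanishes. -/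
theorem eq_zero (hu : IsPotential R u) (h : Sol u (fun x => z * y x) y y₁) {a : ℝ}
    (ha : a ∈ Icc 0 Real.pi) (h0 : y a = 0) (h1 : y₁ a = 0) {x : ℝ} (hx : x ∈ Icc 0 Real.pi) :
    y x = 0 ∧ y₁ x = 0 := by
  have := h.energy_le hu le_rfl ha hx
  simp only [h0, h1, norm_zero] at this
  norm_num at this
  constructor <;> rw [← norm_eq_zero] <;> nlinarith [norm_nonneg (y x), norm_nonneg (y₁ x)]

theorem unique (hu : IsPotential R u) (h : Sol u (fun x => z * y x) y y₁)
    (h' : Sol u (fun x => z * w x) w w₁) {a : ℝ} (ha : a ∈ Icc 0 Real.pi) (h0 : y a = w a)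
    (h1 : y₁ a = w₁ a) {x : ℝ} (hx : x ∈ Icc 0 Real.pi) : y x = w x ∧ y₁ x = w₁ x := by
  have := eq_zero (z := z) hu ((h.sub h').congr_rhs fun x _ => by ring) ha (sub_eq_zero.2 h0)
    (sub_eq_zero.2 h1) hx
  exact ⟨sub_eq_zero.1 this.1, sub_eq_zero.1 this.2⟩

end Sol

/-- For `z = ρ²` and the scale `s = |ρ|` the growth rate of the energy is therefore `2|Im ρ|`,
exactly as for the free equation. -/
theorem norm_sq_sub_norm_sq_div (ρ : ℂ) (hρ : ρ ≠ 0) :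
    ‖ρ ^ 2 - (‖ρ‖ : ℂ) ^ 2‖ / ‖ρ‖ = 2 * |ρ.im| := by
  have : ρ ^ 2 - (‖ρ‖ : ℂ) ^ 2 = ρ * (ρ - conj ρ) := by
    rw [mul_sub, Complex.mul_conj, Complex.normSq_eq_norm_sq]; push_cast; ring
  rw [this, norm_mul, Complex.sub_conj, mul_div_cancel_left₀ _ (norm_ne_zero_iff.2 hρ)]
  simp


/-! ### Existence of solutions of the Cauchy problem -/

section Volterra

variable {E : Type*} [NormedAddCommGroup E] [NormedSpace ℝ E]
  {M : ℝ → E →L[ℝ] E}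

theorem intervalIntegrable_apply (hM : IntervalIntegrable M volume 0 Real.pi) {v : ℝ → E}
    (hv : Continuous v) : IntervalIntegrable (fun t => M t (v t)) volume 0 Real.pi := by
  obtain ⟨C, hC⟩ := (isCompact_Icc (a := (0 : ℝ)) (b := Real.pi)).exists_bound_of_continuousOn
    hv.continuousOn
  rw [intervalIntegrable_iff_muPi] at *
  refine (hM.norm.mul_const C).mono'
    (ContinuousLinearMap.aestronglyMeasurable_comp₂ (ContinuousLinearMap.id ℝ (E →L[ℝ] E)) hM.1
      hv.aestronglyMeasurable) ?_
  filter_upwards [ae_restrict_mem measurableSet_Icc] with t ht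
  exact (M t).le_opNorm_of_le (hC t ht)

/-- The Volterra operator `v ↦ v₀ + ∫₀ˣ M v` on `C[0, π]`. -/
noncomputable def volterraMap (hM : IntervalIntegrable M volume 0 Real.pi) (v₀ : E)
    (v : C(Icc 0 Real.pi, E)) : C(Icc 0 Real.pi, E) where
  toFun x := v₀ + ∫ t in (0 : ℝ)..x, M t (IccExtend Real.pi_pos.le v t)
  continuous_toFun := by
    have h := intervalIntegrable_apply hM (v := IccExtend Real.pi_pos.le v) v.continuous.Icc_extend'
    have := intervalIntegral.continuousOn_primitive_interval' h (by simp : (0 : ℝ) ∈ uIcc 0 Real.pi)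
    rw [uIcc_zero_pi, continuousOn_iff_continuous_domRestrict] at this
    exact continuous_const.add this

/-- The induction integrates `Φⁿ ‖M‖` to `Φⁿ⁺¹/(n+1)`, where `Φ` is the primitive of `‖M‖`. The
factorial makes some iterate a contraction, with no smallness assumed of the merely integrable
coefficients. -/
theorem volterraMap_iterate [CompleteSpace E] (hM : IntervalIntegrable M volume 0 Real.pi) (v₀ : E)
    (v w : C(Icc 0 Real.pi, E)) (n : ℕ) (x : Icc 0 Real.pi) :
    ‖((volterraMap hM v₀)^[n] v) x - ((volterraMap hM v₀)^[n] w) x‖ ≤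
      dist v w * ((∫ t in (0 : ℝ)..x, ‖M t‖) ^ n / n.factorial) := by
  induction n generalizing x with
  | zero => simpa [dist_eq_norm] using ContinuousMap.norm_coe_le_norm (v - w) x
  | succ n ih =>
    set a := (volterraMap hM v₀)^[n] v
    set b := (volterraMap hM v₀)^[n] w
    have hΦ : HasACDeriv (fun x => ∫ t in (0 : ℝ)..x, ‖M t‖) fun t => ‖M t‖ :=
      HasACDeriv.of_integral hM.norm (by simp)
    have hpow : HasACDeriv (fun x => (∫ t in (0 : ℝ)..x, ‖M t‖) ^ (n + 1))
        fun x => ((n + 1 : ℕ) * (∫ t in (0 : ℝ)..x, ‖M t‖) ^ n) * ‖M x‖ :=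
      hΦ.comp_contDiff (φ := fun r : ℝ => r ^ (n + 1))
        (φ' := fun r : ℝ => (n + 1 : ℕ) * r ^ n) (contDiff_id.pow _) (fun a v => by simp [mul_comm])
    have hpow' := hpow.const_mul (dist v w / (n + 1).factorial)
    have ha := intervalIntegrable_apply hM (v := IccExtend Real.pi_pos.le a)
      a.continuous.Icc_extend'
    have hb := intervalIntegrable_apply hM (v := IccExtend Real.pi_pos.le b)
      b.continuous.Icc_extend'
    have hx := x.2
    rw [Function.iterate_succ_apply', Function.iterate_succ_apply']
    change ‖(v₀ + ∫ t in (0 : ℝ)..x, M t (IccExtend Real.pi_pos.le a t)) -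
      (v₀ + ∫ t in (0 : ℝ)..x, M t (IccExtend Real.pi_pos.le b t))‖ ≤ _
    rw [add_sub_add_left_eq_sub, ← intervalIntegral.integral_sub
      (intervalIntegrable_sub ha zero_mem_Icc_pi hx) (intervalIntegrable_sub hb zero_mem_Icc_pi hx)]
    have key := hpow'.integral_eq_real zero_mem_Icc_pi hx
    simp only [intervalIntegral.integral_same, ne_eq, Nat.add_eq_zero_iff, one_ne_zero, and_false,
      not_false_eq_true, zero_pow, mul_zero, sub_zero] at key
    rw [show dist v w * ((∫ t in (0 : ℝ)..x, ‖M t‖) ^ (n + 1) / ((n + 1).factorial : ℝ)) =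
      dist v w / (n + 1).factorial * (∫ t in (0 : ℝ)..x, ‖M t‖) ^ (n + 1) by ring, ← key]
    refine intervalIntegral.norm_integral_le_of_norm_le hx.1 ?_
      (intervalIntegrable_sub hpow'.intervalIntegrable_real zero_mem_Icc_pi hx)
    refine Eventually.of_forall fun t ht => ?_
    have ht' : t ∈ Icc 0 Real.pi := ⟨ht.1.le, ht.2.trans hx.2⟩
    rw [← map_sub, IccExtend_of_mem _ _ ht', IccExtend_of_mem _ _ ht']
    refine ((M t).le_opNorm_of_le (ih ⟨t, ht'⟩)).trans (le_of_eq ?_)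
    rw [Nat.factorial_succ]
    push_cast
    field_simp

theorem exists_volterra [CompleteSpace E] (hM : IntervalIntegrable M volume 0 Real.pi) (v₀ : E) :
    ∃ v : ℝ → E, Continuous v ∧ ∀ x ∈ Icc 0 Real.pi, v x = v₀ + ∫ t in (0 : ℝ)..x, M t (v t) := by
  have hA : 0 ≤ ∫ t in (0 : ℝ)..Real.pi, ‖M t‖ :=
    intervalIntegral.integral_nonneg Real.pi_pos.le fun t _ => norm_nonneg _
  obtain ⟨n, hn⟩ := ((FloorSemiring.tendsto_pow_div_factorial_atTop
    (∫ t in (0 : ℝ)..Real.pi, ‖M t‖)).eventually (gt_mem_nhds zero_lt_one)).exists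
  have hK := div_nonneg (pow_nonneg hA n) (Nat.cast_nonneg (α := ℝ) n.factorial)
  have hc : ContractingWith
      (Real.toNNReal ((∫ t in (0 : ℝ)..Real.pi, ‖M t‖) ^ n / (n.factorial : ℝ)))
      (volterraMap hM v₀)^[n] := by
    refine ⟨Real.toNNReal_lt_one.2 hn, LipschitzWith.of_dist_le_mul fun v w => ?_⟩
    rw [Real.coe_toNNReal _ hK, ContinuousMap.dist_le (mul_nonneg hK dist_nonneg)]
    intro x
    rw [dist_eq_norm, mul_comm]
    refine (volterraMap_iterate hM v₀ v w n x).trans ?_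
    refine mul_le_mul_of_nonneg_left ?_ dist_nonneg
    gcongr
    · exact intervalIntegral.integral_nonneg x.2.1 fun t _ => norm_nonneg _
    · exact intervalIntegral.integral_mono_interval le_rfl x.2.1 x.2.2
        (Eventually.of_forall fun x => norm_nonneg _) hM.norm
  have hfix := hc.isFixedPt_fixedPoint_iterate
  set v := hc.fixedPoint (volterraMap hM v₀)^[n]
  refine ⟨IccExtend Real.pi_pos.le v, v.continuous.Icc_extend', fun x hx => ?_⟩
  rw [IccExtend_of_mem _ _ hx]
  nth_rewrite 1 [← hfix]
  rfl

end Volterra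

/-- The coefficient matrix of the first order system. -/
noncomputable def coeffMatrix (u : ℝ → ℝ) (z : ℂ) (t : ℝ) : ℂ × ℂ →L[ℝ] ℂ × ℂ :=
  (ContinuousLinearMap.snd ℝ ℂ ℂ).prod (-((z • ContinuousLinearMap.id ℝ ℂ).comp
      (ContinuousLinearMap.fst ℝ ℂ ℂ))) +
    (u t • (ContinuousLinearMap.fst ℝ ℂ ℂ).prod (-ContinuousLinearMap.snd ℝ ℂ ℂ) +
      u t ^ 2 • (0 : ℂ × ℂ →L[ℝ] ℂ).prod (-ContinuousLinearMap.fst ℝ ℂ ℂ))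

theorem exists_sol {R : ℝ} {u : ℝ → ℝ} (hu : IsPotential R u) (z a b : ℂ) :
    ∃ y y₁, Sol u (fun x => z * y x) y y₁ ∧ y 0 = a ∧ y₁ 0 = b := by
  have hM : IntervalIntegrable (coeffMatrix u z) volume 0 Real.pi := by
    have h1 := hu.intervalIntegrable
    have h2 := hu.intervalIntegrable_sq
    rw [intervalIntegrable_iff_muPi] at *
    exact (integrable_const _).add ((h1.smul_const _).add (h2.smul_const _))
  obtain ⟨v, hv, hveq⟩ := exists_volterra hM (a, b)
  have hi := intervalIntegrable_apply hM hv
  have h0 := hveq 0 zero_mem_Icc_pi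
  simp only [intervalIntegral.integral_same, add_zero] at h0
  have hac : HasACDeriv v fun t => coeffMatrix u z t (v t) :=
    HasACDeriv.of_integral hi fun x hx => by rw [h0, hveq x hx]
  refine ⟨fun x => (v x).1, fun x => (v x).2,
    ⟨(hac.clm (ContinuousLinearMap.fst ℝ ℂ ℂ)).congr_deriv' fun x => ?_,
      (hac.clm (ContinuousLinearMap.snd ℝ ℂ ℂ)).congr_deriv' fun x => ?_⟩, congrArg Prod.fst h0,
    congrArg Prod.snd h0⟩
  · simp [coeffMatrix]
  · simp [coeffMatrix]
    ring

/-- A solution with prescribed data at the right end point. -/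
theorem exists_sol_right {R : ℝ} {u : ℝ → ℝ} (hu : IsPotential R u) (z : ℂ) :
    ∃ y y₁, Sol u (fun x => z * y x) y y₁ ∧ y Real.pi = 0 ∧ y₁ Real.pi = 1 := by
  obtain ⟨a, a₁, ha, ha0, ha1⟩ := exists_sol hu z 0 1
  obtain ⟨b, b₁, hb, hb0, hb1⟩ := exists_sol hu z 1 0
  have hW := ((ha.lagrange hb).congr_deriv' (g := fun _ => 0) fun x => by ring).integral_eq
    zero_mem_Icc_pi pi_mem_Icc_pi
  simp only [intervalIntegral.integral_zero, ha0, ha1, hb0, hb1] at hW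
  -- The combination vanishes at `π`, and its quasi-derivative there is minus the Wronskian of the
  -- two basic solutions, which is constantly `-1`.
  refine ⟨_, _, ((ha.const_mul (b Real.pi)).sub (hb.const_mul (a Real.pi))).congr_rhs
    fun x _ => by ring, by ring, ?_⟩
  linear_combination hW


/-! ### The solutions normalized at the end points -/

/-- The solution normalized at the left end point. -/
structure IsOmega (u : ℝ → ℝ) (z : ℂ) (y y₁ : ℝ → ℂ) : Prop where
  sol : Sol u (fun x => z * y x) y y₁
  left : y 0 = 0
  left_quasi : y₁ 0 = 1

/-- The solution normalized at the right end point. -/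
structure IsPhi (u : ℝ → ℝ) (z : ℂ) (y y₁ : ℝ → ℂ) : Prop where
  sol : Sol u (fun x => z * y x) y y₁
  right : y Real.pi = 0
  right_quasi : y₁ Real.pi = 1

theorem IsPotential.exists_omega {R : ℝ} {u : ℝ → ℝ} (hu : IsPotential R u) :
    ∃ om om₁ : ℂ → ℝ → ℂ, ∀ z, IsOmega u z (om z) (om₁ z) := by
  choose y y₁ h using fun z => exists_sol hu z 0 1
  exact ⟨y, y₁, fun z => ⟨(h z).1, (h z).2.1, (h z).2.2⟩⟩

theorem IsPotential.exists_phi {R : ℝ} {u : ℝ → ℝ} (hu : IsPotential R u) :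
    ∃ ph ph₁ : ℂ → ℝ → ℂ, ∀ z, IsPhi u z (ph z) (ph₁ z) := by
  choose y y₁ h using fun z => exists_sol_right hu z
  exact ⟨y, y₁, fun z => ⟨(h z).1, (h z).2.1, (h z).2.2⟩⟩

/-- This is the energy estimate at the scale `|ρ|`. The starting point `a` is left free so that it
covers normalization at either end point. -/
theorem Sol.norm_le_of_data {R : ℝ} {u : ℝ → ℝ} {y y₁ : ℝ → ℂ} {ρ : ℂ} (hu : IsPotential R u)
    (h : Sol u (fun x => ρ ^ 2 * y x) y y₁) (hρ : 1 ≤ ‖ρ‖) {a b : ℝ} (ha : a ∈ Icc 0 Real.pi)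
    (hb : b ∈ Icc 0 Real.pi) (h0 : y a = 0) (h1 : y₁ a = 1) :
    ‖ρ‖ * ‖y b‖ ≤ energyConst R * Real.exp (|ρ.im| * |b - a|) ∧
      ‖y₁ b‖ ≤ energyConst R * Real.exp (|ρ.im| * |b - a|) := by
  have hK := one_le_energyConst R
  have hE := h.energy_le hu hρ ha hb
  rw [norm_sq_sub_norm_sq_div ρ (norm_pos_iff.1 (by linarith)), h0, h1] at hE
  simp only [norm_one, norm_zero] at hE
  have e : Real.exp (2 * |ρ.im| * |b - a|) = Real.exp (|ρ.im| * |b - a|) ^ 2 := by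
    rw [← Real.exp_nat_mul]; congr 1; push_cast; ring
  have hle : ‖y₁ b‖ ^ 2 + ‖ρ‖ ^ 2 * ‖y b‖ ^ 2 ≤
      (energyConst R * Real.exp (|ρ.im| * |b - a|)) ^ 2 := by
    refine (hE.trans_eq ?_).trans (mul_le_mul_of_nonneg_right (le_self_pow₀ hK two_ne_zero)
      (sq_nonneg (Real.exp (|ρ.im| * |b - a|)))) |>.trans_eq (mul_pow _ _ _).symm
    rw [e]
    ring
  constructor
  · refine abs_le_of_sq_le_sq' ?_ (by positivity) |>.2
    rw [mul_pow]
    nlinarith [sq_nonneg ‖y₁ b‖]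
  · refine abs_le_of_sq_le_sq' ?_ (by positivity) |>.2
    nlinarith [mul_nonneg (sq_nonneg ‖ρ‖) (sq_nonneg ‖y b‖)]

namespace IsOmega

variable {R : ℝ} {u : ℝ → ℝ} {z z' ρ : ℂ} {y y₁ w w₁ : ℝ → ℂ}

theorem norm_le (h : IsOmega u (ρ ^ 2) y y₁) (hu : IsPotential R u) (hρ : 1 ≤ ‖ρ‖) {x : ℝ}
    (hx : x ∈ Icc 0 Real.pi) : ‖ρ‖ * ‖y x‖ ≤ energyConst R * Real.exp (|ρ.im| * x) ∧
      ‖y₁ x‖ ≤ energyConst R * Real.exp (|ρ.im| * x) := by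
  have := h.sol.norm_le_of_data hu hρ zero_mem_Icc_pi hx h.left h.left_quasi
  rwa [sub_zero, abs_of_nonneg hx.1] at this

theorem unique (h : IsOmega u z y y₁) (h' : IsOmega u z w w₁) (hu : IsPotential R u) {x : ℝ}
    (hx : x ∈ Icc 0 Real.pi) : y x = w x ∧ y₁ x = w₁ x :=
  h.sol.unique hu h'.sol zero_mem_Icc_pi (h.left.trans h'.left.symm)
    (h.left_quasi.trans h'.left_quasi.symm) hx

theorem star (h : IsOmega u z y y₁) :
    IsOmega u (conj z) (fun x => conj (y x)) fun x => conj (y₁ x) :=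
  ⟨h.sol.star.congr_rhs fun x _ => by simp, by simp [h.left], by simp [h.left_quasi]⟩

theorem conj_eq (h : IsOmega u z y y₁) (hu : IsPotential R u) (hz : conj z = z) {x : ℝ}
    (hx : x ∈ Icc 0 Real.pi) : conj (y x) = y x ∧ conj (y₁ x) = y₁ x := by
  have := h.star
  rw [hz] at this
  exact this.unique h hu hx

theorem continuousOn (h : IsOmega u z y y₁) : ContinuousOn y (Icc 0 Real.pi) :=
  h.sol.deriv.continuousOn

theorem intervalIntegrable_norm_sq (h : IsOmega u z y y₁) :
    IntervalIntegrable (fun x => ‖y x‖ ^ 2) volume 0 Real.pi :=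
  (h.continuousOn.norm.pow 2).intervalIntegrable_of_Icc Real.pi_pos.le

/-- Quantitative dependence on the spectral parameter. -/
theorem energy_sub_le (h : IsOmega u z y y₁) (h' : IsOmega u z' w w₁) (hu : IsPotential R u)
    {s x : ℝ} (hs : 1 ≤ s) (hx : x ∈ Icc 0 Real.pi) :
    ‖y₁ x - w₁ x‖ ^ 2 + s ^ 2 * ‖y x - w x‖ ^ 2 ≤
      energyConst R * Real.exp ((1 + ‖z - s ^ 2‖ / s) * Real.pi) *
        (‖z - z'‖ ^ 2 * ∫ t in (0 : ℝ)..Real.pi, ‖w t‖ ^ 2) := by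
  have hi := h'.intervalIntegrable_norm_sq.const_mul (‖z - z'‖ ^ 2)
  have hS : Sol u (fun x => z * (y x - w x) + (z - z') * w x) (fun x => y x - w x)
      fun x => y₁ x - w₁ x := (h.sol.sub h'.sol).congr_rhs fun x _ => by ring
  have := hS.energy_forced hu (by simpa only [norm_mul, mul_pow] using hi)
    (by simp [h.left, h'.left]) (by simp [h.left_quasi, h'.left_quasi]) hs hx
  refine this.trans ?_
  have hK := one_le_energyConst R
  gcongr
  rw [← intervalIntegral.integral_const_mul]
  simp only [norm_mul, mul_pow]
  exact intervalIntegral.integral_mono_interval le_rfl hx.1 hx.2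
    (Eventually.of_forall fun x => by positivity) hi

theorem lagrange (h : IsOmega u z y y₁) (h' : IsOmega u z' w w₁) {x : ℝ}
    (hx : x ∈ Icc 0 Real.pi) :
    y x * w₁ x - y₁ x * w x = (z - z') * ∫ t in (0 : ℝ)..x, y t * w t := by
  have := ((h.sol.lagrange h'.sol).congr_deriv' (g := fun x => (z - z') * (y x * w x))
    fun x => by ring).integral_eq zero_mem_Icc_pi hx
  rw [intervalIntegral.integral_const_mul, h.left, h'.left] at this
  linear_combination -this

/-- If `y` vanished on `(0, b)`, then at almost every point there its derivative would be both `0`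
and `y₁`, so the Cauchy data would vanish, against uniqueness. -/
theorem exists_ne_zero (h : IsOmega u z y y₁) (hu : IsPotential R u) {b : ℝ} (hb : 0 < b)
    (hb' : b ≤ Real.pi) : ∃ x ∈ Ioo 0 b, y x ≠ 0 := by
  by_contra! hz
  have hae : ∀ᵐ x, x ∉ Ioo 0 b := by
    filter_upwards [h.sol.deriv.deriv] with x hx hx'
    have hx'' : x ∈ Ioo 0 Real.pi := ⟨hx'.1, hx'.2.trans_le hb'⟩
    have h1 := hx hx''
    have h2 : HasDerivAt y 0 x := by
      refine (hasDerivAt_const x (0 : ℂ)).congr_of_eventuallyEq ?_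
      filter_upwards [Ioo_mem_nhds hx'.1 hx'.2] with t ht using hz t ht
    have h3 := h1.unique h2
    rw [hz x hx', mul_zero, add_zero] at h3
    have := (h.sol.eq_zero hu (Ioo_subset_Icc_self hx'') (hz x hx') h3 zero_mem_Icc_pi).2
    rw [h.left_quasi] at this
    exact one_ne_zero this
  have : volume (Ioo 0 b) = 0 := by
    have := ae_iff.1 hae
    simp only [not_not] at this
    exact this
  rw [Real.volume_Ioo, sub_zero, ENNReal.ofReal_eq_zero] at this
  exact absurd this (not_le.2 hb)

theorem integral_norm_sq_pos (h : IsOmega u z y y₁) (hu : IsPotential R u) :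
    0 < ∫ t in (0 : ℝ)..Real.pi, ‖y t‖ ^ 2 := by
  obtain ⟨x, hx, hne⟩ := h.exists_ne_zero hu Real.pi_pos le_rfl
  exact intervalIntegral.integral_pos Real.pi_pos (h.continuousOn.norm.pow 2)
    (fun t _ => by positivity) ⟨x, Ioo_subset_Icc_self hx, by positivity⟩

/-- The eigenvalues are real. -/
theorem conj_eq_of_zero (h : IsOmega u z y y₁) (hu : IsPotential R u) (h0 : y Real.pi = 0) :
    conj z = z := by
  -- For the solution and its conjugate, Lagrange's identity reads `0 = (z - z̄) ∫ |y|²`.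
  have := h.lagrange h.star pi_mem_Icc_pi
  have hI : ∫ t in (0 : ℝ)..Real.pi, y t * conj (y t) =
      ((∫ t in (0 : ℝ)..Real.pi, ‖y t‖ ^ 2 : ℝ) : ℂ) := by
    rw [← intervalIntegral.integral_ofReal]
    congr 1; ext t
    rw [Complex.mul_conj, Complex.normSq_eq_norm_sq]
  simp only [h0, hI, zero_mul, map_zero, mul_zero, sub_zero] at this
  rcases mul_eq_zero.1 this.symm with h2 | h2
  · exact (sub_eq_zero.1 h2).symm
  · exact absurd (Complex.ofReal_eq_zero.1 h2) (h.integral_norm_sq_pos hu).ne'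

theorem integral_sq_eq (h : IsOmega u z y y₁) (hu : IsPotential R u) (hz : conj z = z) :
    ∫ t in (0 : ℝ)..Real.pi, y t * y t = ((∫ t in (0 : ℝ)..Real.pi, ‖y t‖ ^ 2 : ℝ) : ℂ) := by
  rw [← intervalIntegral.integral_ofReal]
  refine intervalIntegral.integral_congr fun t ht => ?_
  rw [uIcc_zero_pi] at ht
  have := (h.conj_eq hu hz ht).1
  calc y t * y t = y t * conj (y t) := by rw [this]
    _ = _ := by rw [Complex.mul_conj, Complex.normSq_eq_norm_sq]

end IsOmega

theorem IsPhi.norm_le {R : ℝ} {u : ℝ → ℝ} {ρ : ℂ} {y y₁ : ℝ → ℂ} (h : IsPhi u (ρ ^ 2) y y₁)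
    (hu : IsPotential R u) (hρ : 1 ≤ ‖ρ‖) {x : ℝ} (hx : x ∈ Icc 0 Real.pi) :
    ‖ρ‖ * ‖y x‖ ≤ energyConst R * Real.exp (|ρ.im| * (Real.pi - x)) ∧
      ‖y₁ x‖ ≤ energyConst R * Real.exp (|ρ.im| * (Real.pi - x)) := by
  have := h.sol.norm_le_of_data hu hρ pi_mem_Icc_pi hx h.right h.right_quasi
  rwa [abs_sub_comm, abs_of_nonneg (sub_nonneg.2 hx.2)] at this

theorem IsOmega.wronskian {u : ℝ → ℝ} {z : ℂ} {y y₁ p p₁ : ℝ → ℂ} (h : IsOmega u z y y₁)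
    (h' : IsPhi u z p p₁) {x : ℝ} (hx : x ∈ Icc 0 Real.pi) :
    y x * p₁ x - y₁ x * p x = y Real.pi := by
  have := ((h.sol.lagrange h'.sol).congr_deriv' (g := fun _ => 0) fun x => by ring).integral_eq
    hx pi_mem_Icc_pi
  rw [h'.right, h'.right_quasi] at this
  simp only [intervalIntegral.integral_zero] at this
  linear_combination this

section family

variable {R : ℝ} {u : ℝ → ℝ} {om om₁ : ℂ → ℝ → ℂ}

/-- The difference of two solutions solves a forced equation with forcing `(z - z₀) ω(z₀)` and zero
initial data. The forced energy estimate at the fixed scale `1` is uniform in `x`. -/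
theorem exists_lipschitz (hu : IsPotential R u) (h : ∀ z, IsOmega u z (om z) (om₁ z)) (z₀ : ℂ) :
    ∃ C, 0 ≤ C ∧ ∀ z, ‖z - z₀‖ ≤ 1 → ∀ x ∈ Icc 0 Real.pi,
      ‖om z x - om z₀ x‖ ≤ C * ‖z - z₀‖ ∧ ‖om₁ z x - om₁ z₀ x‖ ≤ C * ‖z - z₀‖ := by
  set I := ∫ t in (0 : ℝ)..Real.pi, ‖om z₀ t‖ ^ 2
  have hI : 0 ≤ I := ((h z₀).integral_norm_sq_pos hu).le
  have hK := one_le_energyConst R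
  set D := energyConst R * Real.exp ((2 + ‖z₀ - 1‖) * Real.pi) * I
  have hD : 0 ≤ D := by positivity
  refine ⟨Real.sqrt D, Real.sqrt_nonneg _, fun z hz x hx => ?_⟩
  have hE := (h z).energy_sub_le (h z₀) hu le_rfl hx
  have h2 : energyConst R * Real.exp ((1 + ‖z - (1 : ℝ) ^ 2‖ / 1) * Real.pi) *
      (‖z - z₀‖ ^ 2 * I) ≤ D * ‖z - z₀‖ ^ 2 := by
    rw [show D * ‖z - z₀‖ ^ 2 = energyConst R * Real.exp ((2 + ‖z₀ - 1‖) * Real.pi) *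
      (‖z - z₀‖ ^ 2 * I) by ring]
    have : ‖z - (1 : ℝ) ^ 2‖ ≤ ‖z - z₀‖ + ‖z₀ - 1‖ := by
      refine le_trans (le_of_eq ?_) (norm_add_le _ _)
      congr 1; push_cast; ring
    have h4 : (1 + ‖z - (1 : ℝ) ^ 2‖ / 1) * Real.pi ≤ (2 + ‖z₀ - 1‖) * Real.pi :=
      mul_le_mul_of_nonneg_right (by linarith) Real.pi_pos.le
    exact mul_le_mul_of_nonneg_right
      (mul_le_mul_of_nonneg_left (Real.exp_le_exp.2 h4) (by linarith)) (by positivity)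
  have h3 := hE.trans h2
  rw [one_pow, one_mul] at h3
  have e : (Real.sqrt D * ‖z - z₀‖) ^ 2 = D * ‖z - z₀‖ ^ 2 := by
    rw [mul_pow, Real.sq_sqrt hD]
  constructor
  · exact (abs_le_of_sq_le_sq' (by rw [e]; nlinarith [sq_nonneg ‖om₁ z x - om₁ z₀ x‖])
      (by positivity)).2
  · exact (abs_le_of_sq_le_sq' (by rw [e]; nlinarith [sq_nonneg ‖om z x - om z₀ x‖])
      (by positivity)).2

theorem continuous_om (hu : IsPotential R u) (h : ∀ z, IsOmega u z (om z) (om₁ z)) {x : ℝ}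
    (hx : x ∈ Icc 0 Real.pi) : Continuous (fun z => om z x) ∧ Continuous fun z => om₁ z x := by
  have key : ∀ F : ℂ → ℂ, (∀ z₀, ∃ C, 0 ≤ C ∧ ∀ z, ‖z - z₀‖ ≤ 1 → ‖F z - F z₀‖ ≤ C * ‖z - z₀‖) →
      Continuous F := by
    intro F hF
    refine continuous_iff_continuousAt.2 fun z₀ => ?_
    obtain ⟨C, -, hC⟩ := hF z₀
    rw [ContinuousAt, tendsto_iff_norm_sub_tendsto_zero]
    refine squeeze_zero' (Eventually.of_forall fun z => norm_nonneg _) ?_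
      (show Tendsto (fun z => C * ‖z - z₀‖) (𝓝 z₀) (𝓝 0) from ?_)
    · filter_upwards [Metric.closedBall_mem_nhds z₀ one_pos] with z hz
      exact hC z (by simpa [dist_eq_norm] using hz)
    · have : Continuous fun z => C * ‖z - z₀‖ := by fun_prop
      simpa using this.tendsto z₀
  constructor <;> refine key _ fun z₀ => ?_ <;> obtain ⟨C, hC, H⟩ := exists_lipschitz hu h z₀
  · exact ⟨C, hC, fun z hz => (H z hz x hx).1⟩
  · exact ⟨C, hC, fun z hz => (H z hz x hx).2⟩

theorem tendsto_integral_om_mul (hu : IsPotential R u) (h : ∀ z, IsOmega u z (om z) (om₁ z))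
    {p : ℝ → ℂ} (hp : ContinuousOn p (Icc 0 Real.pi)) (z₀ : ℂ) :
    Tendsto (fun z => ∫ t in (0 : ℝ)..Real.pi, om z t * p t) (𝓝 z₀)
      (𝓝 (∫ t in (0 : ℝ)..Real.pi, om z₀ t * p t)) := by
  obtain ⟨C, hC0, hC⟩ := exists_lipschitz hu h z₀
  obtain ⟨P, hP⟩ := isCompact_Icc.exists_bound_of_continuousOn hp
  have hP0 : 0 ≤ P := (norm_nonneg _).trans (hP 0 zero_mem_Icc_pi)
  rw [tendsto_iff_norm_sub_tendsto_zero]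
  refine squeeze_zero' (Eventually.of_forall fun z => norm_nonneg _) ?_
    (show Tendsto (fun z => C * ‖z - z₀‖ * P * Real.pi) (𝓝 z₀) (𝓝 0) from ?_)
  · filter_upwards [Metric.closedBall_mem_nhds z₀ one_pos] with z hz
    have hi : ∀ z, IntervalIntegrable (fun t => om z t * p t) volume 0 Real.pi := fun z =>
      ((h z).continuousOn.mul hp).intervalIntegrable_of_Icc Real.pi_pos.le
    rw [← intervalIntegral.integral_sub (hi z) (hi z₀)]
    have := intervalIntegral.norm_integral_le_of_norm_le_const (a := 0) (b := Real.pi)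
      (f := fun t => om z t * p t - om z₀ t * p t) (C := C * ‖z - z₀‖ * P) fun t ht => by
        rw [uIoc_of_le Real.pi_pos.le] at ht
        have ht' := Ioc_subset_Icc_self ht
        rw [← sub_mul, norm_mul]
        exact mul_le_mul (hC z (by simpa [dist_eq_norm] using hz) t ht').1 (hP t ht')
          (norm_nonneg _) (by positivity)
    simpa [abs_of_pos Real.pi_pos] using this
  · have : Continuous fun z => C * ‖z - z₀‖ * P * Real.pi := by fun_prop
    simpa using this.tendsto z₀

/-- Pairing with the solution that vanishes at `π` exhibits the difference quotient as an integral
continuous in `z`. Complex differentiability follows without differentiating the solution inside the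
interval. -/
theorem om_pi_sub (h : ∀ z, IsOmega u z (om z) (om₁ z)) {z z₀ : ℂ} {p p₁ : ℝ → ℂ}
    (hp : IsPhi u z₀ p p₁) :
    om z Real.pi - om z₀ Real.pi = (z - z₀) * ∫ t in (0 : ℝ)..Real.pi, om z t * p t := by
  have h1 := (((h z).sol.lagrange hp.sol).congr_deriv' (g := fun x => (z - z₀) * (om z x * p x))
    fun x => by ring).integral_eq zero_mem_Icc_pi pi_mem_Icc_pi
  have h2 := (h z₀).wronskian hp zero_mem_Icc_pi
  rw [intervalIntegral.integral_const_mul, (h z).left, (h z).left_quasi, hp.right,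
    hp.right_quasi] at h1
  rw [(h z₀).left, (h z₀).left_quasi] at h2
  linear_combination h2 - h1

theorem differentiable_om_pi (hu : IsPotential R u) (h : ∀ z, IsOmega u z (om z) (om₁ z)) :
    Differentiable ℂ fun z => om z Real.pi := by
  intro z₀
  obtain ⟨ph, ph₁, hp⟩ := hu.exists_phi
  have ht := tendsto_integral_om_mul hu h (hp z₀).sol.deriv.continuousOn z₀
  refine HasDerivAt.differentiableAt (f' := ∫ t in (0 : ℝ)..Real.pi, om z₀ t * ph z₀ t) ?_
  rw [hasDerivAt_iff_tendsto_slope]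
  refine (ht.mono_left nhdsWithin_le_nhds).congr' ?_
  filter_upwards [self_mem_nhdsWithin] with z hz
  have hz' : z - z₀ ≠ 0 := sub_ne_zero.2 hz
  rw [slope_def_field, om_pi_sub h (hp z₀)]
  field_simp

/-- The zeros of the characteristic function are simple. -/
theorem analyticOrderAt_om_pi (hu : IsPotential R u) (h : ∀ z, IsOmega u z (om z) (om₁ z))
    {z₀ : ℂ} (h0 : om z₀ Real.pi = 0) : analyticOrderAt (fun z => om z Real.pi) z₀ = 1 := by
  have hd := differentiable_om_pi hu h
  have han : AnalyticAt ℂ (fun z => om z Real.pi) z₀ := hd.analyticAt z₀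
  have hslope := (hd z₀).hasDerivAt.tendsto_slope
  have ht := (tendsto_integral_om_mul hu h (h z₀).continuousOn z₀).mono_left
    (nhdsWithin_le_nhds (s := {z₀}ᶜ))
  -- Lagrange's identity at `π` divided by `z - z₀`. At a real eigenvalue the solution is real, so
  -- the right-hand side is positive and the derivative cannot vanish.
  have heq : deriv (fun z => om z Real.pi) z₀ * om₁ z₀ Real.pi =
      ∫ t in (0 : ℝ)..Real.pi, om z₀ t * om z₀ t := by
    refine tendsto_nhds_unique ((hslope.mul_const _).congr' ?_) ht
    filter_upwards [self_mem_nhdsWithin] with z hz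
    have hz' : z - z₀ ≠ 0 := sub_ne_zero.2 hz
    have := (h z).lagrange (h z₀) pi_mem_Icc_pi
    rw [h0, mul_zero, sub_zero] at this
    rw [slope_def_field, h0, sub_zero, div_mul_eq_mul_div, this]
    field_simp
  rw [(h z₀).integral_sq_eq hu ((h z₀).conj_eq_of_zero hu h0)] at heq
  have hne : deriv (fun z => om z Real.pi) z₀ ≠ 0 := by
    intro h'
    rw [h', zero_mul] at heq
    exact absurd (Complex.ofReal_eq_zero.1 heq.symm) ((h z₀).integral_norm_sq_pos hu).ne'
  have := han.analyticOrderAt_sub_eq_one_of_deriv_ne_zero hne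
  simpa [h0] using this

end family


/-! ### Bounds for eigenfunctions and eigenvalues -/

section

variable {R : ℝ} {u : ℝ → ℝ} {g y y₁ : ℝ → ℂ}

theorem Sol.intervalIntegrable_norm_sq (h : Sol u g y y₁) :
    IntervalIntegrable (fun x => ‖y x‖ ^ 2) volume 0 Real.pi :=
  (h.deriv.continuousOn.norm.pow 2).intervalIntegrable_of_Icc Real.pi_pos.le

theorem Sol.intervalIntegrable_quasi_norm_sq (h : Sol u g y y₁) :
    IntervalIntegrable (fun x => ‖y₁ x‖ ^ 2) volume 0 Real.pi :=
  (h.deriv_quasi.continuousOn.norm.pow 2).intervalIntegrable_of_Icc Real.pi_pos.le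

theorem IsPotential.intervalIntegrable_sq_mul (hu : IsPotential R u) {f : ℝ → ℝ}
    (hf : ContinuousOn f (Icc 0 Real.pi)) :
    IntervalIntegrable (fun x => u x ^ 2 * f x) volume 0 Real.pi :=
  hu.intervalIntegrable_sq.mul_continuousOn (by rwa [uIcc_zero_pi])

theorem IsPotential.integral_sq_mul_le (hu : IsPotential R u) {f : ℝ → ℝ} {b M : ℝ}
    (hb : b ∈ Icc 0 Real.pi) (hf : ContinuousOn f (Icc 0 Real.pi)) (hM : ∀ x ∈ Icc 0 b, f x ≤ M)
    (hM0 : 0 ≤ M) : ∫ t in (0 : ℝ)..b, u t ^ 2 * f t ≤ R ^ 2 * M := by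
  have h1 := intervalIntegrable_sub (hu.intervalIntegrable_sq_mul hf) zero_mem_Icc_pi hb
  have h2 := (intervalIntegrable_sub hu.intervalIntegrable_sq zero_mem_Icc_pi hb).mul_const M
  refine (intervalIntegral.integral_mono_on hb.1 h1 h2 fun t ht =>
    mul_le_mul_of_nonneg_left (hM t ht) (sq_nonneg _)).trans ?_
  rw [intervalIntegral.integral_mul_const]
  exact mul_le_mul_of_nonneg_right (hu.integral_sq_sub_le zero_mem_Icc_pi hb hb.1) hM0

/-- A Gagliardo–Nirenberg inequality. -/
theorem Sol.norm_sq_le (hR : 0 < R) (hu : IsPotential R u) (h : Sol u g y y₁) (h0 : y 0 = 0)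
    {b η : ℝ} (hb : b ∈ Icc 0 Real.pi) (hη : 0 < η) {x : ℝ} (hx : x ∈ Icc 0 b) :
    ‖y x‖ ^ 2 ≤ 2 * η * (∫ t in (0 : ℝ)..b, ‖y₁ t‖ ^ 2) +
      (2 / η + 4 * R ^ 2) * ∫ t in (0 : ℝ)..b, ‖y t‖ ^ 2 := by
  have hsub : Icc 0 b ⊆ Icc 0 Real.pi := Icc_subset_Icc_right hb.2
  obtain ⟨c, hc, hmax⟩ := (isCompact_Icc (a := (0 : ℝ)) (b := b)).exists_isMaxOn
    ⟨0, le_rfl, hb.1⟩ (h.deriv.continuousOn.norm.mono hsub)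
  refine (pow_le_pow_left₀ (norm_nonneg _) (hmax hx) 2).trans ?_
  set M := ‖y c‖
  have hM : ∀ t ∈ Icc 0 b, ‖y t‖ ≤ M := fun t ht => hmax ht
  have hM0 : 0 ≤ M := norm_nonneg _
  have h_int := h.deriv.norm_sq.integral_eq_real zero_mem_Icc_pi (hsub hc)
  rw [h0, norm_zero, zero_pow two_ne_zero, sub_zero] at h_int
  have i0 := h.intervalIntegrable_norm_sq
  have i1 := h.intervalIntegrable_quasi_norm_sq
  have iu := hu.intervalIntegrable_sq
  have ibd : IntervalIntegrable (fun t => (η * ‖y₁ t‖ ^ 2 + (1 / η + 2 * R ^ 2) * ‖y t‖ ^ 2) +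
      M ^ 2 / (2 * R ^ 2) * u t ^ 2) volume 0 Real.pi :=
    ((i1.const_mul η).add (i0.const_mul (1 / η + 2 * R ^ 2))).add
      (iu.const_mul (M ^ 2 / (2 * R ^ 2)))
  have hpos : ∀ t, 0 ≤ (η * ‖y₁ t‖ ^ 2 + (1 / η + 2 * R ^ 2) * ‖y t‖ ^ 2) +
      M ^ 2 / (2 * R ^ 2) * u t ^ 2 := fun t => by positivity
  have h1 : M ^ 2 ≤ ∫ t in (0 : ℝ)..c, ((η * ‖y₁ t‖ ^ 2 + (1 / η + 2 * R ^ 2) * ‖y t‖ ^ 2) +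
      M ^ 2 / (2 * R ^ 2) * u t ^ 2) := by
    refine h_int.symm.le.trans ?_
    refine intervalIntegral.integral_mono_on hc.1
      (intervalIntegrable_sub h.deriv.norm_sq.intervalIntegrable_real zero_mem_Icc_pi (hsub hc))
      (intervalIntegrable_sub ibd zero_mem_Icc_pi (hsub hc)) fun t ht => ?_
    have htM := hM t ⟨ht.1, ht.2.trans hc.2⟩
    have e1 : (conj (y t) * (y₁ t + u t * y t)).re =
        (conj (y t) * y₁ t).re + u t * ‖y t‖ ^ 2 := by
      rw [Complex.sq_norm, Complex.normSq_apply]; simp; ring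
    have e2 : (conj (y t) * y₁ t).re ≤ ‖y t‖ * ‖y₁ t‖ := by
      have := Complex.re_le_norm (conj (y t) * y₁ t)
      rwa [norm_mul, RCLike.norm_conj] at this
    have e3 : 2 * (‖y t‖ * ‖y₁ t‖) ≤ η * ‖y₁ t‖ ^ 2 + 1 / η * ‖y t‖ ^ 2 := by
      have : 0 ≤ (η * ‖y₁ t‖ - ‖y t‖) ^ 2 / η := by positivity
      have e : (η * ‖y₁ t‖ - ‖y t‖) ^ 2 / η =
        η * ‖y₁ t‖ ^ 2 + 1 / η * ‖y t‖ ^ 2 - 2 * (‖y t‖ * ‖y₁ t‖) := by field_simp; ring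
      linarith
    -- The weight `M²/(2R²)` is chosen so that the integral of the `u²` term is at most `M²/2`, to
    -- be absorbed on the left.
    have e4 : 2 * (u t * ‖y t‖ ^ 2) ≤ 2 * R ^ 2 * ‖y t‖ ^ 2 + M ^ 2 / (2 * R ^ 2) * u t ^ 2 := by
      have h5 : 0 ≤ (2 * R ^ 2 * ‖y t‖ - M * |u t|) ^ 2 / (2 * R ^ 2) := by positivity
      have e : (2 * R ^ 2 * ‖y t‖ - M * |u t|) ^ 2 / (2 * R ^ 2) =
        2 * R ^ 2 * ‖y t‖ ^ 2 + M ^ 2 / (2 * R ^ 2) * |u t| ^ 2 - 2 * (|u t| * ‖y t‖ * M) := by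
        field_simp; ring
      have h6 : u t * ‖y t‖ ^ 2 ≤ |u t| * ‖y t‖ * M := by
        calc u t * ‖y t‖ ^ 2 ≤ |u t| * ‖y t‖ ^ 2 := by
              gcongr; exact le_abs_self _
          _ = |u t| * ‖y t‖ * ‖y t‖ := by ring
          _ ≤ _ := by gcongr
      rw [← sq_abs (u t)]
      linarith
    rw [e1]
    linarith
  have h2 := h1.trans (intervalIntegral.integral_mono_interval le_rfl hc.1 hc.2
    (Eventually.of_forall hpos) (intervalIntegrable_sub ibd zero_mem_Icc_pi hb))
  have j0 := intervalIntegrable_sub i0 zero_mem_Icc_pi hb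
  have j1 := intervalIntegrable_sub i1 zero_mem_Icc_pi hb
  have ju := intervalIntegrable_sub iu zero_mem_Icc_pi hb
  rw [intervalIntegral.integral_add ((j1.const_mul _).add (j0.const_mul _)) (ju.const_mul _),
    intervalIntegral.integral_add (j1.const_mul _) (j0.const_mul _),
    intervalIntegral.integral_const_mul, intervalIntegral.integral_const_mul,
    intervalIntegral.integral_const_mul] at h2
  have h3 : M ^ 2 / (2 * R ^ 2) * ∫ t in (0 : ℝ)..b, u t ^ 2 ≤ M ^ 2 / 2 := by
    calc _ ≤ M ^ 2 / (2 * R ^ 2) * R ^ 2 := by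
          gcongr; exact hu.integral_sq_sub_le zero_mem_Icc_pi hb hb.1
      _ = _ := by field_simp
  have e5 : (2 / η + 4 * R ^ 2) = 2 * (1 / η + 2 * R ^ 2) := by ring
  rw [e5]
  linarith

/-- The derivative of `Re(ȳ y₁)` for a real spectral parameter. -/
theorem Sol.form_deriv {lam : ℝ} (h : Sol u (fun x => (lam : ℂ) * y x) y y₁) :
    HasACDeriv (fun x => (conj (y x) * y₁ x).re)
      fun x => ‖y₁ x‖ ^ 2 - u x ^ 2 * ‖y x‖ ^ 2 - lam * ‖y x‖ ^ 2 := by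
  refine (h.star.mul_quasi h).re.congr_deriv' fun x => ?_
  simp only [Complex.sq_norm, Complex.normSq_apply]
  simp only [pow_two]
  simp
  ring

theorem Sol.integral_quasi_norm_sq (hu : IsPotential R u) {lam : ℝ}
    (h : Sol u (fun x => (lam : ℂ) * y x) y y₁) {b : ℝ} (hb : b ∈ Icc 0 Real.pi) (h0 : y 0 = 0) :
    ∫ t in (0 : ℝ)..b, ‖y₁ t‖ ^ 2 = (conj (y b) * y₁ b).re +
      (∫ t in (0 : ℝ)..b, u t ^ 2 * ‖y t‖ ^ 2) + lam * ∫ t in (0 : ℝ)..b, ‖y t‖ ^ 2 := by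
  have h_int := h.form_deriv.integral_eq_real zero_mem_Icc_pi hb
  have j0 := intervalIntegrable_sub h.intervalIntegrable_norm_sq zero_mem_Icc_pi hb
  have j1 := intervalIntegrable_sub h.intervalIntegrable_quasi_norm_sq zero_mem_Icc_pi hb
  have ju := intervalIntegrable_sub (hu.intervalIntegrable_sq_mul (f := fun t => ‖y t‖ ^ 2)
    (h.deriv.continuousOn.norm.pow 2)) zero_mem_Icc_pi hb
  rw [intervalIntegral.integral_sub (j1.sub ju) (j0.const_mul lam),
    intervalIntegral.integral_sub j1 ju, intervalIntegral.integral_const_mul, h0] at h_int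
  simp only [map_zero, zero_mul, Complex.zero_re, sub_zero] at h_int
  linarith

/-- The interpolation inequality bounds the maximum through `∫ |y₁|²`, and the form identity trades
that integral for `lam ∫ |y|² + ∫ u²|y|²`. -/
theorem Sol.norm_sq_le_of_dirichlet (hR : 0 < R) (hu : IsPotential R u) {lam : ℝ}
    (h : Sol u (fun x => (lam : ℂ) * y x) y y₁) {b : ℝ} (hb : b ∈ Icc 0 Real.pi) (h0 : y 0 = 0)
    (h1 : y b = 0) {x : ℝ} (hx : x ∈ Icc 0 b) :
    ‖y x‖ ^ 2 ≤ (lam / R ^ 2 + 24 * R ^ 2) * ∫ t in (0 : ℝ)..b, ‖y t‖ ^ 2 := by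
  have hsub : Icc 0 b ⊆ Icc 0 Real.pi := Icc_subset_Icc_right hb.2
  obtain ⟨c, hc, hmax⟩ := (isCompact_Icc (a := (0 : ℝ)) (b := b)).exists_isMaxOn
    ⟨0, le_rfl, hb.1⟩ (h.deriv.continuousOn.norm.mono hsub)
  refine (pow_le_pow_left₀ (norm_nonneg _) (hmax hx) 2).trans ?_
  -- With `η = 1/(4R²)` the contribution of `∫ u²|y|² ≤ R² max|y|²` is at most half of the squared
  -- maximum.
  have hM := h.norm_sq_le hR hu h0 hb (η := 1 / (4 * R ^ 2)) (by positivity) hc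
  have hu2 := hu.integral_sq_mul_le (f := fun t => ‖y t‖ ^ 2) (M := ‖y c‖ ^ 2) hb
    (h.deriv.continuousOn.norm.pow 2)
    (fun t ht => pow_le_pow_left₀ (norm_nonneg _) (hmax ht) 2) (by positivity)
  rw [h.integral_quasi_norm_sq hu hb h0, h1] at hM
  simp only [map_zero, zero_mul, Complex.zero_re, zero_add] at hM
  set I := ∫ t in (0 : ℝ)..b, ‖y t‖ ^ 2
  set U := ∫ t in (0 : ℝ)..b, u t ^ 2 * ‖y t‖ ^ 2
  have e : 2 * (1 / (4 * R ^ 2)) * (U + lam * I) + (2 / (1 / (4 * R ^ 2)) + 4 * R ^ 2) * I =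
      U / (2 * R ^ 2) + (lam / R ^ 2 + 24 * R ^ 2) * I / 2 := by
    field_simp; ring
  have e2 : U / (2 * R ^ 2) ≤ ‖y c‖ ^ 2 / 2 := by
    rw [div_le_iff₀ (by positivity)]
    linarith
  linarith

end

namespace IsOmega

variable {R : ℝ} {u : ℝ → ℝ} {y y₁ : ℝ → ℂ} {lam : ℝ}

/-- In this range the coefficient of the sup bound is nonpositive, so a zero at `b` would force `y =
0` on `[0, b]`. At `b = π` it bounds the spectrum from below; for general `b` it confines the Prüfer
angle. -/
theorem ne_zero_of_le (h : IsOmega u lam y y₁) (hR : 0 < R) (hu : IsPotential R u)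
    (hlam : lam ≤ -(24 * R ^ 4)) {b : ℝ} (hb : b ∈ Ioc 0 Real.pi) : y b ≠ 0 := by
  intro hb0
  obtain ⟨x, hx, hne⟩ := h.exists_ne_zero hu hb.1 hb.2
  have h1 := h.sol.norm_sq_le_of_dirichlet hR hu (Ioc_subset_Icc_self hb) h.left hb0
    (Ioo_subset_Icc_self hx)
  have h2 : 0 < ‖y x‖ ^ 2 := by positivity
  have h3 : lam / R ^ 2 + 24 * R ^ 2 ≤ 0 := by
    have : lam / R ^ 2 ≤ -(24 * R ^ 2) := by
      rw [div_le_iff₀ (by positivity)]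
      nlinarith
    linarith
  have h4 : 0 ≤ ∫ t in (0 : ℝ)..b, ‖y t‖ ^ 2 :=
    intervalIntegral.integral_nonneg hb.1.le fun t _ => by positivity
  nlinarith

end IsOmega

/-- A threshold for the square root of the spectral parameter. -/
noncomputable def rhoBound (R : ℝ) : ℝ :=
  1 + 2 * energyConst R * (R ^ 2 * energyConst R + energyConst R ^ 2)

theorem one_le_rhoBound (R : ℝ) : 1 ≤ rhoBound R := by
  have := one_le_energyConst R
  unfold rhoBound
  have : 0 ≤ 2 * energyConst R * (R ^ 2 * energyConst R + energyConst R ^ 2) := by positivity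
  linarith

namespace IsOmega

variable {R : ℝ} {u : ℝ → ℝ} {y y₁ : ℝ → ℂ} {σ : ℝ}

theorem energy_le_const (h : IsOmega u ((σ : ℂ) ^ 2) y y₁) (hu : IsPotential R u) (hσ : 1 ≤ σ)
    {x : ℝ} (hx : x ∈ Icc 0 Real.pi) : ‖y₁ x‖ ^ 2 + σ ^ 2 * ‖y x‖ ^ 2 ≤ energyConst R := by
  have := h.sol.energy_le hu hσ zero_mem_Icc_pi hx
  simpa [h.left, h.left_quasi] using this

theorem le_energy (h : IsOmega u ((σ : ℂ) ^ 2) y y₁) (hu : IsPotential R u) (hσ : 1 ≤ σ)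
    {x : ℝ} (hx : x ∈ Icc 0 Real.pi) :
    1 ≤ energyConst R * (‖y₁ x‖ ^ 2 + σ ^ 2 * ‖y x‖ ^ 2) := by
  have := h.sol.energy_le hu hσ hx zero_mem_Icc_pi
  simpa [h.left, h.left_quasi] using this

/-- A lower bound for the `L₂` norm at a large real parameter. -/
theorem le_integral_norm_sq (h : IsOmega u ((σ : ℂ) ^ 2) y y₁) (hu : IsPotential R u)
    (hσ : rhoBound R ≤ σ) :
    Real.pi / (4 * energyConst R) ≤ σ ^ 2 * ∫ t in (0 : ℝ)..Real.pi, ‖y t‖ ^ 2 := by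
  have hK := one_le_energyConst R
  set K := energyConst R
  have hσ1 : 1 ≤ σ := (one_le_rhoBound R).trans hσ
  have hσ0 : 0 < σ := by linarith
  have hs : Sol u (fun x => ((σ ^ 2 : ℝ) : ℂ) * y x) y y₁ := by simpa using h.sol
  have e1 := hs.integral_quasi_norm_sq hu pi_mem_Icc_pi h.left
  have hy : ∀ x ∈ Icc 0 Real.pi, ‖y x‖ ^ 2 ≤ K / σ ^ 2 := fun x hx => by
    rw [le_div_iff₀ (by positivity)]
    nlinarith [h.energy_le_const hu hσ1 hx, sq_nonneg ‖y₁ x‖]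
  have hU := hu.integral_sq_mul_le (f := fun t => ‖y t‖ ^ 2) (M := K / σ ^ 2) pi_mem_Icc_pi
    (h.continuousOn.norm.pow 2) hy
    (by positivity)
  have hB : (conj (y Real.pi) * y₁ Real.pi).re ≤ K / σ := by
    refine (Complex.re_le_norm _).trans ?_
    rw [norm_mul, RCLike.norm_conj, le_div_iff₀ hσ0]
    have := Sol.re_conj_mul_le (y₁ Real.pi) (y Real.pi) hσ0
    have h2 := h.energy_le_const hu hσ1 pi_mem_Icc_pi
    rw [le_div_iff₀ hσ0] at this
    nlinarith
  have i0 := h.sol.intervalIntegrable_norm_sq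
  have i1 := h.sol.intervalIntegrable_quasi_norm_sq
  -- Equipartition: the energy never falls below `1/K`, and by the form identity its two parts have
  -- equal integrals up to a boundary term and `∫ u²|y|²`.
  have hlow : Real.pi / K ≤ (∫ t in (0 : ℝ)..Real.pi, ‖y₁ t‖ ^ 2) +
      σ ^ 2 * ∫ t in (0 : ℝ)..Real.pi, ‖y t‖ ^ 2 := by
    rw [← intervalIntegral.integral_const_mul, ← intervalIntegral.integral_add i1
      (i0.const_mul _)]
    have : ∫ _ in (0 : ℝ)..Real.pi, 1 / K = Real.pi / K := by simp [div_eq_mul_inv]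
    rw [← this]
    refine intervalIntegral.integral_mono_on Real.pi_pos.le intervalIntegrable_const
      (i1.add (i0.const_mul _)) fun t ht => ?_
    rw [div_le_iff₀ (by positivity)]
    linarith [h.le_energy hu hσ1 ht]
  -- The threshold `rhoBound` is made for this: the two errors use up at most half of `π/K`.
  have hsm : R ^ 2 * (K / σ ^ 2) + K / σ ≤ Real.pi / (2 * K) := by
    have h1 : R ^ 2 * (K / σ ^ 2) + K / σ ≤ (R ^ 2 * K + K ^ 2) / σ := by
      rw [add_div, mul_div_assoc]
      gcongr
      · nlinarith
      · nlinarith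
    refine h1.trans ?_
    rw [div_le_div_iff₀ hσ0 (by positivity)]
    have h2 : 2 * K * (R ^ 2 * K + K ^ 2) ≤ σ := by
      have := hσ
      simp only [rhoBound] at this
      linarith
    nlinarith [Real.pi_gt_three]
  have e3 : Real.pi / K = 2 * (Real.pi / (2 * K)) := by field_simp
  have e4 : Real.pi / (4 * K) = (Real.pi / (2 * K)) / 2 := by field_simp; ring
  rw [e4]
  linarith

end IsOmega

/-- The constant in the uniform bound for normalized eigenfunctions. -/
noncomputable def supConst (R : ℝ) : ℝ :=
  4 * energyConst R ^ 2 + (rhoBound R ^ 2 / R ^ 2 + 24 * R ^ 2)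

/-- Eigenvalues up to `rhoBound R ^ 2` are covered by the interpolation bound. Above it the maximum
and the `L₂` norm are both of order `1/σ` by the energy estimates. -/
theorem IsOmega.norm_sq_le_supConst {R : ℝ} {u : ℝ → ℝ} {y y₁ : ℝ → ℂ} {lam : ℝ}
    (h : IsOmega u lam y y₁) (hR : 0 < R) (hu : IsPotential R u) (h0 : y Real.pi = 0) {x : ℝ}
    (hx : x ∈ Icc 0 Real.pi) : ‖y x‖ ^ 2 ≤ supConst R * ∫ t in (0 : ℝ)..Real.pi, ‖y t‖ ^ 2 := by
  have hK := one_le_energyConst R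
  have hI := h.integral_norm_sq_pos hu
  set I := ∫ t in (0 : ℝ)..Real.pi, ‖y t‖ ^ 2 with hIdef
  rcases le_total lam (rhoBound R ^ 2) with hl | hl
  · refine (h.sol.norm_sq_le_of_dirichlet hR hu pi_mem_Icc_pi h.left h0 hx).trans ?_
    have h1 : lam / R ^ 2 ≤ rhoBound R ^ 2 / R ^ 2 := by gcongr
    rw [supConst]
    have : 0 ≤ 4 * energyConst R ^ 2 := by positivity
    exact mul_le_mul_of_nonneg_right (by linarith) hI.le
  · have hr := one_le_rhoBound R
    have hlam : 0 ≤ lam := (sq_nonneg _).trans hl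
    set σ := Real.sqrt lam
    have hσ2 : σ ^ 2 = lam := Real.sq_sqrt hlam
    have hσ : rhoBound R ≤ σ := Real.le_sqrt_of_sq_le hl
    have h' : IsOmega u ((σ : ℂ) ^ 2) y y₁ := by
      rw [← Complex.ofReal_pow, hσ2]; exact h
    have e1 := h'.energy_le_const hu (hr.trans hσ) hx
    have e2 := h'.le_integral_norm_sq hu hσ
    rw [div_le_iff₀ (by positivity)] at e2
    have e3 : σ ^ 2 * ‖y x‖ ^ 2 ≤ σ ^ 2 * (4 * energyConst R ^ 2 * I) := by
      have : 1 ≤ σ ^ 2 * I * (4 * energyConst R) := by linarith [Real.pi_gt_three]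
      nlinarith [sq_nonneg ‖y₁ x‖]
    have hσ0 : 0 < σ ^ 2 := by
      have : 0 < σ := by linarith
      positivity
    refine (le_of_mul_le_mul_left e3 hσ0).trans ?_
    rw [supConst]
    have : 0 ≤ rhoBound R ^ 2 / R ^ 2 + 24 * R ^ 2 := by positivity
    exact mul_le_mul_of_nonneg_right (by linarith) hI.le


/-! ### Lower bounds for the characteristic function -/

/-- The logarithm of the distortion constants for complex spectral parameters. -/
noncomputable def expConst (R : ℝ) : ℝ := Real.pi + 4 * R ^ 2

section

variable {R : ℝ} {u : ℝ → ℝ} {y y₁ : ℝ → ℂ} {ρ : ℂ}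

/-- For `u = 0` this quantity `D` and the energy `E` satisfy `D' = τE` and `E' = 4τD` with `τ = Im
ρ`, the hyperbolic system behind the growth `exp(2τx)`. Since `D ≤ |ρ||y||y₁|`, a lower bound for
`D(π)` becomes one for `|y(π)|`. -/
theorem Sol.rotation_deriv (h : Sol u (fun x => ρ ^ 2 * y x) y y₁) :
    HasACDeriv (fun x => -(conj ρ * y₁ x * conj (y x)).im) fun x =>
      ρ.im * (‖y₁ x‖ ^ 2 + ‖ρ‖ ^ 2 * ‖y x‖ ^ 2 - u x ^ 2 * ‖y x‖ ^ 2) := by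
  refine (((HasACDeriv.const (conj ρ)).mul h.deriv_quasi).mul h.deriv.cconj).im.neg.congr_deriv'
    fun x => ?_
  simp only [Complex.sq_norm, Complex.normSq_apply]
  simp only [pow_two]
  simp
  ring

theorem Sol.energy_deriv_rotation (h : Sol u (fun x => ρ ^ 2 * y x) y y₁) :
    HasACDeriv (fun x => ‖y₁ x‖ ^ 2 + ‖ρ‖ ^ 2 * ‖y x‖ ^ 2) fun x =>
      2 * u x * (‖ρ‖ ^ 2 * ‖y x‖ ^ 2 - ‖y₁ x‖ ^ 2) - 2 * u x ^ 2 * (conj (y₁ x) * y x).re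
        + 4 * ρ.im * -(conj ρ * y₁ x * conj (y x)).im := by
  refine (Sol.energy_deriv (g := fun _ => 0) (by simpa using h) ‖ρ‖).congr_deriv' fun x => ?_
  have e : ρ ^ 2 - (‖ρ‖ : ℂ) ^ 2 = ρ * (2 * ρ.im * Complex.I) := by
    have := Complex.sub_conj ρ
    have h2 : (‖ρ‖ : ℂ) ^ 2 = ρ * conj ρ := by
      rw [Complex.mul_conj, Complex.normSq_eq_norm_sq]; push_cast; ring
    rw [h2, pow_two, ← mul_sub, this]
    push_cast
    ring
  rw [e]
  simp only [mul_zero, Complex.zero_re, sub_zero]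
  simp only [pow_two]
  simp
  ring

theorem abs_rotation_le (ρ a b : ℂ) :
    2 * |(conj ρ * a * conj b).im| ≤ ‖a‖ ^ 2 + ‖ρ‖ ^ 2 * ‖b‖ ^ 2 := by
  have := Complex.abs_im_le_norm (conj ρ * a * conj b)
  rw [norm_mul, norm_mul, RCLike.norm_conj, RCLike.norm_conj] at this
  nlinarith [sq_nonneg (‖a‖ - ‖ρ‖ * ‖b‖)]

/-- Growth of the solution and of its rotation number in the upper half plane. -/
theorem IsOmega.growth_bound (h : IsOmega u (ρ ^ 2) y y₁) (hu : IsPotential R u)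
    (hρ : 4 * Real.exp (expConst R) ≤ ‖ρ‖) (hτ : 0 < ρ.im) :
    Real.exp (2 * ρ.im * Real.pi - 2 * expConst R) ≤
        2 * (‖y₁ Real.pi‖ ^ 2 + ‖ρ‖ ^ 2 * ‖y Real.pi‖ ^ 2) ∧
      ((1 - Real.exp (-(2 * ρ.im * Real.pi))) / (4 * energyConst R) -
          Real.exp (expConst R) / ‖ρ‖) * (‖y₁ Real.pi‖ ^ 2 + ‖ρ‖ ^ 2 * ‖y Real.pi‖ ^ 2) ≤
        ‖ρ‖ * ‖y Real.pi‖ * ‖y₁ Real.pi‖ := by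
  have hK := one_le_energyConst R
  have hA1 : 1 ≤ Real.exp (expConst R) := Real.one_le_exp (by unfold expConst; positivity)
  have hρ1 : 1 ≤ ‖ρ‖ := by linarith
  have hρ0 : 0 < ‖ρ‖ := by linarith
  have hτρ : ρ.im ≤ ‖ρ‖ := (le_abs_self _).trans (Complex.abs_im_le_norm ρ)
  set s := ‖ρ‖
  set τ := ρ.im
  set E : ℝ → ℝ := fun x => ‖y₁ x‖ ^ 2 + s ^ 2 * ‖y x‖ ^ 2 with hEdef
  set D : ℝ → ℝ := fun x => -(conj ρ * y₁ x * conj (y x)).im with hDdef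
  have hE := h.sol.energy_deriv_rotation
  have hD := h.sol.rotation_deriv
  have hEpos : ∀ x, 0 ≤ E x := fun x => by positivity
  have hDE : ∀ x, |2 * D x| ≤ E x := fun x => by
    have := abs_rotation_le ρ (y₁ x) (y x)
    simp only [hDdef, hEdef, mul_neg, abs_neg, abs_mul, abs_two]
    exact this
  have hyE : ∀ x, τ * (u x ^ 2 * ‖y x‖ ^ 2) ≤ u x ^ 2 / s * E x := fun x => by
    have h1 : s ^ 2 * ‖y x‖ ^ 2 ≤ E x := by simp only [hEdef]; linarith [sq_nonneg ‖y₁ x‖]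
    calc τ * (u x ^ 2 * ‖y x‖ ^ 2) ≤ s * (u x ^ 2 * ‖y x‖ ^ 2) := by gcongr
      _ = u x ^ 2 / s * (s ^ 2 * ‖y x‖ ^ 2) := by field_simp
      _ ≤ _ := by gcongr
  have hE' : ∀ x, 4 * τ * D x - (2 * |u x| + u x ^ 2 / s) * E x ≤
      2 * u x * (s ^ 2 * ‖y x‖ ^ 2 - ‖y₁ x‖ ^ 2) - 2 * u x ^ 2 * (conj (y₁ x) * y x).re
        + 4 * τ * D x := fun x => by
    have := (abs_le.1 (Sol.energy_bound (y₁ x) (y x) 0 ((s : ℂ) ^ 2) (u x) hρ0)).1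
    simp only [sub_self, norm_zero, zero_div, zero_add, mul_zero, Complex.zero_re, sub_zero,
      add_zero] at this
    linarith
  have hG := growth_hasACDeriv hu 0 s
  have hU : HasACDeriv (fun x => ∫ t in (0 : ℝ)..x, u t ^ 2) fun t => u t ^ 2 :=
    HasACDeriv.of_integral hu.intervalIntegrable_sq (by simp)
  have hA := hG.add (hU.const_mul 2)
  set A : ℝ → ℝ := fun x => growth u 0 s x + 2 * ∫ t in (0 : ℝ)..x, u t ^ 2 with hAdef
  have hA0 : A 0 = 0 := by simp [hAdef, growth]
  have hAmono : MonotoneOn A (Icc 0 Real.pi) :=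
    hA.monotoneOn (Eventually.of_forall fun x _ => by positivity)
  have hApi : ∀ x ∈ Icc 0 Real.pi, A x ≤ expConst R := fun x hx => by
    have h1 := growth_sub_le hu 0 hρ1 zero_mem_Icc_pi hx hx.1
    have h2 := hu.integral_sq_sub_le zero_mem_Icc_pi hx hx.1
    have h3 : growth u 0 s 0 = 0 := by simp [growth]
    simp only [hAdef, expConst]
    linarith
  -- The weight `κ` vanishes at `0`, stays below `1/4`, and grows just fast enough that `κ'E` pays
  -- for all losses which `u` causes in `D'` and in `κE'`. Hence `D + κE` increases.
  set κ : ℝ → ℝ := fun x => 1 / s * (Real.exp (A x) - 1) with hκdef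
  have hκ := (hA.exp.sub (HasACDeriv.const 1)).const_mul (1 / s)
  have hκ0 : κ 0 = 0 := by simp [hκdef, hA0]
  have hκnn : ∀ x ∈ Icc 0 Real.pi, 0 ≤ κ x := fun x hx => by
    have : 0 ≤ A x := by
      have := hAmono zero_mem_Icc_pi hx hx.1
      rwa [hA0] at this
    have h2 := Real.one_le_exp this
    simp only [hκdef]
    exact mul_nonneg (by positivity) (by linarith)
  have hκle : ∀ x ∈ Icc 0 Real.pi, κ x ≤ Real.exp (expConst R) / s := fun x hx => by
    have := Real.exp_le_exp.2 (hApi x hx)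
    simp only [hκdef]
    rw [one_div, inv_mul_eq_div]
    gcongr
    linarith
  have hκ4 : ∀ x ∈ Icc 0 Real.pi, κ x ≤ 1 / 4 := fun x hx => by
    refine (hκle x hx).trans ?_
    rw [div_le_iff₀ hρ0]
    linarith
  have hX := hD.add (hκ.mul hE)
  have hX' : ∀ x ∈ Icc 0 Real.pi, τ / 2 * E x ≤ τ * (E x - u x ^ 2 * ‖y x‖ ^ 2) +
      (1 / s * (Real.exp (A x) * (0 + (2 * |u x| + u x ^ 2 / s) + 2 * u x ^ 2) - 0) * E x +
        κ x * (2 * u x * (s ^ 2 * ‖y x‖ ^ 2 - ‖y₁ x‖ ^ 2) - 2 * u x ^ 2 * (conj (y₁ x) * y x).re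
          + 4 * τ * D x)) := by
    intro x hx
    set a := 2 * |u x| + u x ^ 2 / s
    have ha : 0 ≤ a := by positivity
    have e1 := mul_le_mul_of_nonneg_left (hE' x) (hκnn x hx)
    have e2 := (abs_le.1 (hDE x)).1
    have e3 := hyE x
    have e4 : 1 ≤ Real.exp (A x) := Real.one_le_exp (by
      have := hAmono zero_mem_Icc_pi hx hx.1
      rwa [hA0] at this)
    have e5 : κ x * (4 * τ * D x) ≥ -(2 * κ x * τ * E x) := by
      have := mul_le_mul_of_nonneg_left e2 (mul_nonneg (mul_nonneg zero_le_two (hκnn x hx)) hτ.le)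
      linarith
    have e6 : 2 * κ x * τ * E x ≤ τ / 2 * E x := by
      have := mul_le_mul_of_nonneg_right (hκ4 x hx) (mul_nonneg hτ.le (hEpos x))
      linarith
    have e7 : u x ^ 2 / s * E x + κ x * (a * E x) ≤
        1 / s * (Real.exp (A x) * (0 + a + 2 * u x ^ 2) - 0) * E x := by
      have e8 : u x ^ 2 + (Real.exp (A x) - 1) * a ≤ Real.exp (A x) * (a + 2 * u x ^ 2) := by
        nlinarith [sq_nonneg (u x)]
      have := mul_le_mul_of_nonneg_left e8 (mul_nonneg (one_div_nonneg.2 hρ0.le) (hEpos x))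
      simp only [hκdef]
      calc _ = 1 / s * E x * (u x ^ 2 + (Real.exp (A x) - 1) * a) := by ring
        _ ≤ _ := this
        _ = _ := by ring
    linarith
  have hX0 : D 0 + κ 0 * E 0 = 0 := by simp [hκ0, hDdef, h.left]
  have hXnn : ∀ x ∈ Icc 0 Real.pi, 0 ≤ D x + κ x * E x := fun x hx => by
    have := hX.monotoneOn (Eventually.of_forall fun t ht =>
      (mul_nonneg (half_pos hτ).le (hEpos t)).trans (hX' t (Ioo_subset_Icc_self ht)))
      zero_mem_Icc_pi hx hx.1
    exact hX0.ge.trans this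
  constructor
  · have hQ := hE.add (hD.const_mul 2)
    have hB := ((((HasACDeriv.of_contDiff contDiff_id hasDerivAt_id).const_mul (2 * τ)).sub
      ((hG.add (hU.const_mul (2 / s))).const_mul 2)))
    have key := hQ.le_gronwall hB (Eventually.of_forall fun x hx => ?_) zero_mem_Icc_pi
      pi_mem_Icc_pi Real.pi_pos.le
    · have h1 := growth_sub_le hu 0 hρ1 zero_mem_Icc_pi pi_mem_Icc_pi Real.pi_pos.le
      have h2 := hu.integral_sq_sub_le zero_mem_Icc_pi pi_mem_Icc_pi Real.pi_pos.le
      have h3 : 2 / s * ∫ t in (0 : ℝ)..Real.pi, u t ^ 2 ≤ 2 * R ^ 2 := by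
        have : 2 / s ≤ 2 := div_le_self zero_le_two hρ1
        have h4 : 0 ≤ ∫ t in (0 : ℝ)..Real.pi, u t ^ 2 :=
          intervalIntegral.integral_nonneg Real.pi_pos.le fun t _ => sq_nonneg _
        nlinarith
      have h5 := (abs_le.1 (hDE Real.pi)).2
      refine le_trans (le_trans ?_ key) (show E Real.pi + 2 * D Real.pi ≤ 2 * E Real.pi by linarith)
      simp only [id, h.left, h.left_quasi, norm_one, norm_zero, map_zero, mul_zero,
        Complex.zero_im, intervalIntegral.integral_same, add_zero, one_pow, zero_pow two_ne_zero,
        neg_zero, one_mul, zero_sub]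
      refine Real.exp_le_exp.2 ?_
      simp only [expConst]
      linarith
    · have hx' := Ioo_subset_Icc_self hx
      have e1 := hE' x
      have e2 := hyE x
      have e3 := hXnn x hx'
      have e4 : E x ≤ 2 * (E x + 2 * D x) := by
        have := mul_le_mul_of_nonneg_right (hκ4 x hx') (hEpos x)
        linarith
      have e5 := mul_le_mul_of_nonneg_left e4
        (by positivity : 0 ≤ (2 * |u x| + u x ^ 2 / s) + 2 / s * u x ^ 2)
      simp only [mul_one]
      have e6 : 2 / s * u x ^ 2 * E x = 2 * (u x ^ 2 / s * E x) := by ring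
      change (2 * τ - 2 * (0 + (2 * |u x| + u x ^ 2 / s) + 2 / s * u x ^ 2)) *
        (E x + 2 * D x) ≤ _ + 2 * (τ * (E x - u x ^ 2 * ‖y x‖ ^ 2))
      linarith
  · have hexp : HasACDeriv (fun x => Real.exp (2 * τ * x - 2 * τ * Real.pi))
        fun x => Real.exp (2 * τ * x - 2 * τ * Real.pi) * (2 * τ) := by
      have := (((HasACDeriv.of_contDiff contDiff_id hasDerivAt_id).const_mul (2 * τ)).sub
        (HasACDeriv.const (2 * τ * Real.pi))).exp
      simpa using this
    -- The energy at `x` is at least `exp(-2τ(π - x)) E(π) / K`. Integrating the gain `τE/2` of `D +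
    -- κE` therefore yields a definite share of `E(π)`.
    have hmono := (hX.sub (hexp.const_mul (E Real.pi / (4 * energyConst R)))).monotoneOn
      (Eventually.of_forall fun x hx => by
        have hx' := Ioo_subset_Icc_self hx
        have e1 := hX' x hx'
        have e2 := h.sol.energy_le hu hρ1 hx' pi_mem_Icc_pi
        rw [norm_sq_sub_norm_sq_div ρ (norm_pos_iff.1 hρ0), abs_of_pos hτ,
          abs_of_nonneg (sub_nonneg.2 hx.2.le)] at e2
        have e3 : E Real.pi / (4 * energyConst R) *
            (Real.exp (2 * τ * x - 2 * τ * Real.pi) * (2 * τ)) ≤ τ / 2 * E x := by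
          have e4 := mul_le_mul_of_nonneg_right e2
            (Real.exp_pos (2 * τ * x - 2 * τ * Real.pi)).le
          have e5 : energyConst R * Real.exp (2 * τ * (Real.pi - x)) * E x *
              Real.exp (2 * τ * x - 2 * τ * Real.pi) = energyConst R * E x := by
            rw [mul_right_comm, mul_assoc (energyConst R), ← Real.exp_add]
            ring_nf
            simp
          have e6 : E Real.pi * Real.exp (2 * τ * x - 2 * τ * Real.pi) ≤ energyConst R * E x :=
            e4.trans_eq e5
          rw [div_mul_eq_mul_div, div_le_iff₀ (by positivity)]
          nlinarith
        linarith) zero_mem_Icc_pi pi_mem_Icc_pi Real.pi_pos.le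
    change D 0 + κ 0 * E 0 - _ ≤ D Real.pi + κ Real.pi * E Real.pi - _ at hmono
    rw [hX0, sub_self, Real.exp_zero, mul_zero, zero_sub (2 * τ * Real.pi)] at hmono
    have e1 := mul_le_mul_of_nonneg_right (hκle Real.pi pi_mem_Icc_pi) (hEpos Real.pi)
    have e2 : D Real.pi ≤ s * ‖y Real.pi‖ * ‖y₁ Real.pi‖ := by
      have := Complex.abs_im_le_norm (conj ρ * y₁ Real.pi * conj (y Real.pi))
      rw [norm_mul, norm_mul, RCLike.norm_conj, RCLike.norm_conj] at this
      have h2 := neg_le_abs (conj ρ * y₁ Real.pi * conj (y Real.pi)).im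
      simp only [hDdef]
      nlinarith
    refine le_trans ?_ e2
    change ((1 - Real.exp (-(2 * τ * Real.pi))) / (4 * energyConst R) -
      Real.exp (expConst R) / s) * E Real.pi ≤ D Real.pi
    calc _ = E Real.pi / (4 * energyConst R) - E Real.pi / (4 * energyConst R) *
          Real.exp (-(2 * τ * Real.pi)) - Real.exp (expConst R) / s * E Real.pi := by ring
      _ ≤ _ := by linarith

/-- A lower bound away from the real axis. -/
theorem IsOmega.le_norm_of_im (h : IsOmega u (ρ ^ 2) y y₁) (hu : IsPotential R u) {d : ℝ}
    (hd : 0 < d) (hρ : 4 * Real.exp (expConst R) ≤ ‖ρ‖) (hρd : Real.exp (expConst R) / ‖ρ‖ ≤ d)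
    (hτ : 0 < ρ.im)
    (hτd : 2 * d ≤ (1 - Real.exp (-(2 * ρ.im * Real.pi))) / (4 * energyConst R)) :
    d / 2 * Real.exp (-expConst R) * Real.exp (ρ.im * Real.pi) ≤ ‖ρ‖ * ‖y Real.pi‖ := by
  obtain ⟨h1, h2⟩ := h.growth_bound hu hρ hτ
  set E := ‖y₁ Real.pi‖ ^ 2 + ‖ρ‖ ^ 2 * ‖y Real.pi‖ ^ 2
  have hE : 0 < E := by
    have := Real.exp_pos (2 * ρ.im * Real.pi - 2 * expConst R)
    linarith
  -- As `|y₁(π)| ≤ √E`, this forces `|ρ y(π)| ≥ d√E`, and `E` has the full exponential growth.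
  have h3 : d * E ≤ ‖ρ‖ * ‖y Real.pi‖ * ‖y₁ Real.pi‖ :=
    le_trans (mul_le_mul_of_nonneg_right (by linarith) hE.le) h2
  have h4 : (d * E) ^ 2 ≤ (‖ρ‖ * ‖y Real.pi‖) ^ 2 * E := by
    refine (pow_le_pow_left₀ (by positivity) h3 2).trans ?_
    rw [mul_pow]
    gcongr
    have : 0 ≤ ‖ρ‖ ^ 2 * ‖y Real.pi‖ ^ 2 := by positivity
    simp only [E]
    linarith
  have h5 : d ^ 2 * E ≤ (‖ρ‖ * ‖y Real.pi‖) ^ 2 := by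
    refine le_of_mul_le_mul_right ?_ hE
    linarith
  refine (abs_le_of_sq_le_sq' (h5.trans' ?_) (by positivity)).2
  have e : (d / 2 * Real.exp (-expConst R) * Real.exp (ρ.im * Real.pi)) ^ 2 =
      d ^ 2 / 4 * Real.exp (2 * ρ.im * Real.pi - 2 * expConst R) := by
    rw [mul_assoc, mul_pow, ← Real.exp_add, ← Real.exp_nat_mul]
    congr 1
    · ring
    · congr 1; push_cast; ring
  rw [e]
  nlinarith [sq_nonneg d]

end

/-- A lower bound near the real axis, from the bound at the real point. -/
theorem IsOmega.le_norm_near_real {R : ℝ} {u : ℝ → ℝ} {y y₁ w w₁ : ℝ → ℂ} {σ τ : ℝ}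
    (hu : IsPotential R u) (hσ : 1 ≤ σ) (hτ : |τ| ≤ 1)
    (h : IsOmega u ((σ + τ * Complex.I : ℂ) ^ 2) y y₁) (h' : IsOmega u ((σ : ℂ) ^ 2) w w₁) :
    σ * ‖w Real.pi‖ - 3 * energyConst R * Real.exp (4 * Real.pi) * |τ| ≤ σ * ‖y Real.pi‖ := by
  have hK := one_le_energyConst R
  have hσ0 : 0 < σ := by linarith
  have hz : ‖(σ + τ * Complex.I : ℂ) ^ 2 - (σ : ℂ) ^ 2‖ ≤ 3 * σ * |τ| := by
    have e : (σ + τ * Complex.I : ℂ) ^ 2 - (σ : ℂ) ^ 2 = τ * Complex.I * (2 * σ + τ * Complex.I) := by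
      ring
    rw [e, norm_mul, norm_mul, Complex.norm_I, mul_one, Complex.norm_real, Real.norm_eq_abs]
    have : ‖(2 * σ + τ * Complex.I : ℂ)‖ ≤ 2 * σ + |τ| := by
      refine (norm_add_le _ _).trans ?_
      simp [abs_of_pos hσ0]
    nlinarith [abs_nonneg τ]
  have hE := h.energy_sub_le h' hu hσ pi_mem_Icc_pi
  have hI : ∫ t in (0 : ℝ)..Real.pi, ‖w t‖ ^ 2 ≤ Real.pi * energyConst R / σ ^ 2 := by
    have : ∫ _ in (0 : ℝ)..Real.pi, energyConst R / σ ^ 2 = Real.pi * energyConst R / σ ^ 2 := by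
      simp [mul_div_assoc]
    rw [← this]
    refine intervalIntegral.integral_mono_on Real.pi_pos.le h'.intervalIntegrable_norm_sq
      intervalIntegrable_const fun t ht => ?_
    rw [le_div_iff₀ (by positivity)]
    nlinarith [h'.energy_le_const hu hσ ht, sq_nonneg ‖w₁ t‖]
  have hexp : Real.exp ((1 + ‖(σ + τ * Complex.I : ℂ) ^ 2 - (σ : ℂ) ^ 2‖ / σ) * Real.pi) ≤
      Real.exp (4 * Real.pi) := by
    refine Real.exp_le_exp.2 (mul_le_mul_of_nonneg_right ?_ Real.pi_pos.le)
    have : ‖(σ + τ * Complex.I : ℂ) ^ 2 - (σ : ℂ) ^ 2‖ / σ ≤ 3 := by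
      rw [div_le_iff₀ hσ0]
      nlinarith
    linarith
  have hI0 : 0 ≤ ∫ t in (0 : ℝ)..Real.pi, ‖w t‖ ^ 2 := (h'.integral_norm_sq_pos hu).le
  have hpi : Real.pi ≤ Real.exp (4 * Real.pi) := by
    have := Real.add_one_le_exp (4 * Real.pi)
    linarith [Real.pi_pos]
  have h2 : σ ^ 2 * ‖y Real.pi - w Real.pi‖ ^ 2 ≤
      (3 * energyConst R * Real.exp (4 * Real.pi) * |τ|) ^ 2 := by
    calc σ ^ 2 * ‖y Real.pi - w Real.pi‖ ^ 2
        ≤ _ := (le_add_of_nonneg_left (sq_nonneg _)).trans hE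
      _ ≤ energyConst R * Real.exp (4 * Real.pi) *
          ((3 * σ * |τ|) ^ 2 * (Real.pi * energyConst R / σ ^ 2)) := by gcongr
      _ = energyConst R ^ 2 * Real.exp (4 * Real.pi) * 9 * |τ| ^ 2 * Real.pi := by
          field_simp; ring
      _ ≤ energyConst R ^ 2 * Real.exp (4 * Real.pi) * 9 * |τ| ^ 2 * Real.exp (4 * Real.pi) := by
          gcongr
      _ = _ := by ring
  rw [← mul_pow] at h2
  have h3 := (abs_le_of_sq_le_sq' h2 (by positivity)).2
  have h4 : ‖w Real.pi‖ ≤ ‖y Real.pi‖ + ‖y Real.pi - w Real.pi‖ := by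
    have := norm_sub_le (y Real.pi) (y Real.pi - w Real.pi)
    simpa using this
  nlinarith

/-- A uniform lower bound for the characteristic function on a vertical line that keeps away from
the spectrum. -/
theorem exists_nonresonance (R : ℝ) {δ : ℝ} (hδ : 0 < δ) : ∃ σ₀ c : ℝ, 1 ≤ σ₀ ∧ 0 < c ∧
    ∀ u, IsPotential R u → ∀ om om₁ : ℂ → ℝ → ℂ, (∀ z, IsOmega u z (om z) (om₁ z)) →
    ∀ σ : ℝ, σ₀ ≤ σ → δ ≤ σ * ‖om ((σ : ℂ) ^ 2) Real.pi‖ → ∀ τ : ℝ,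
      c * Real.exp (|τ| * Real.pi) ≤
        ‖(σ + τ * Complex.I : ℂ)‖ * ‖om ((σ + τ * Complex.I : ℂ) ^ 2) Real.pi‖ := by
  have hK := one_le_energyConst R
  set L := 3 * energyConst R * Real.exp (4 * Real.pi) with hL
  have hL0 : 0 < L := by positivity
  -- Up to the height `τ₁` moving off the real axis costs at most `δ/2`. Beyond it the estimate in
  -- the half plane applies with the fixed constant `d`, and conjugation covers negative `τ`.
  set τ₁ := min 1 (δ / (2 * L))
  have hτ₁ : 0 < τ₁ := lt_min one_pos (by positivity)
  have hexp1 : Real.exp (-(2 * τ₁ * Real.pi)) < 1 := by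
    rw [Real.exp_lt_one_iff]
    have := Real.pi_pos
    have : 0 < 2 * τ₁ * Real.pi := by positivity
    linarith
  set d := (1 - Real.exp (-(2 * τ₁ * Real.pi))) / (8 * energyConst R)
  have hd : 0 < d := div_pos (by linarith) (by positivity)
  have hA1 : 1 ≤ Real.exp (expConst R) := Real.one_le_exp (by unfold expConst; positivity)
  refine ⟨4 * Real.exp (expConst R) + Real.exp (expConst R) / d,
    min (δ / 2 * Real.exp (-Real.pi)) (d / 2 * Real.exp (-expConst R)), ?_,
    lt_min (by positivity) (by positivity), ?_⟩
  · have : 0 ≤ Real.exp (expConst R) / d := by positivity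
    linarith
  intro u hu om om₁ hom σ hσ hreal τ
  have hq : 0 ≤ Real.exp (expConst R) / d := by positivity
  have hσ1 : 1 ≤ σ := by linarith
  have hσρ : σ ≤ ‖(σ + τ * Complex.I : ℂ)‖ := by
    have := Complex.abs_re_le_norm (σ + τ * Complex.I : ℂ)
    simp only [Complex.add_re, Complex.ofReal_re, Complex.mul_re, Complex.I_re, mul_zero,
      Complex.ofReal_im, Complex.I_im, mul_one, sub_self, add_zero] at this
    exact (le_abs_self σ).trans this
  rcases le_total |τ| τ₁ with hτ | hτ
  · have h1 := IsOmega.le_norm_near_real hu hσ1 (hτ.trans (min_le_left _ _)) (hom _) (hom _)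
    have h2 : L * |τ| ≤ δ / 2 := by
      have := mul_le_mul_of_nonneg_left (hτ.trans (min_le_right _ _)) hL0.le
      refine this.trans_eq ?_
      field_simp
    have h3 : Real.exp (|τ| * Real.pi) ≤ Real.exp Real.pi := by
      refine Real.exp_le_exp.2 ?_
      have := hτ.trans (min_le_left _ _)
      nlinarith [Real.pi_pos]
    calc _ ≤ δ / 2 * Real.exp (-Real.pi) * Real.exp Real.pi := by
          gcongr
          exact min_le_left _ _
      _ = δ / 2 := by rw [mul_assoc, ← Real.exp_add]; simp
      _ ≤ σ * ‖om ((σ + τ * Complex.I : ℂ) ^ 2) Real.pi‖ := by linarith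
      _ ≤ _ := by gcongr
  · have main : ∀ (ρ : ℂ) (y y₁ : ℝ → ℂ), IsOmega u (ρ ^ 2) y y₁ → σ ≤ ‖ρ‖ → τ₁ ≤ ρ.im →
        d / 2 * Real.exp (-expConst R) * Real.exp (ρ.im * Real.pi) ≤ ‖ρ‖ * ‖y Real.pi‖ := by
      intro ρ y y₁ h hσρ him
      refine h.le_norm_of_im hu hd (by linarith) ?_ (hτ₁.trans_le him) ?_
      · rw [div_le_iff₀ (by linarith), ← div_le_iff₀' hd]
        linarith
      · have : Real.exp (-(2 * ρ.im * Real.pi)) ≤ Real.exp (-(2 * τ₁ * Real.pi)) := by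
          refine Real.exp_le_exp.2 ?_
          nlinarith [Real.pi_pos]
        calc 2 * d = (1 - Real.exp (-(2 * τ₁ * Real.pi))) / (4 * energyConst R) := by
              simp only [d]; field_simp; ring
          _ ≤ _ := by gcongr
    refine (mul_le_mul_of_nonneg_right (min_le_right _ _) (Real.exp_pos _).le).trans ?_
    rcases le_total 0 τ with h0 | h0
    · rw [abs_of_nonneg h0] at hτ ⊢
      have := main _ _ _ (hom ((σ + τ * Complex.I : ℂ) ^ 2)) hσρ (by simpa using hτ)
      simpa using this
    · rw [abs_of_nonpos h0] at hτ ⊢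
      have hc := (hom ((σ + τ * Complex.I : ℂ) ^ 2)).star
      rw [map_pow] at hc
      have := main _ _ _ hc (by rwa [RCLike.norm_conj]) (by simpa using hτ)
      rw [RCLike.norm_conj, RCLike.norm_conj] at this
      simpa using this


/-! ### Pointwise bounds for the resolvent -/

/-- The exponential average of `‖g‖` around `t`. -/
noncomputable def expAverage (g : ℝ → ℂ) (τ t : ℝ) : ℝ :=
  ∫ s in (0 : ℝ)..Real.pi, ‖g s‖ * Real.exp (-(|τ| * |t - s|))

theorem expAverage_nonneg (g : ℝ → ℂ) (τ t : ℝ) : 0 ≤ expAverage g τ t :=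
  intervalIntegral.integral_nonneg Real.pi_pos.le fun s _ => by positivity

section

variable {R : ℝ} {u : ℝ → ℝ} {g H H₁ y y₁ p p₁ : ℝ → ℂ} {z ρ : ℂ}

/-- Lagrange's identity against `y` on `[0, t]` and against `p` on `[t, π]` gives two linear
equations for `H t` and `H₁ t`, whose determinant is the constant Wronskian `y π`. -/
theorem Sol.green (h : Sol u (fun x => z * H x + g x) H H₁) (h0 : H 0 = 0) (hpi : H Real.pi = 0)
    (hy : IsOmega u z y y₁) (hp : IsPhi u z p p₁) {t : ℝ} (ht : t ∈ Icc 0 Real.pi) :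
    H t * y Real.pi = -(y t * ∫ s in t..Real.pi, g s * p s) - p t * ∫ s in (0 : ℝ)..t, g s * y s ∧
      H₁ t * y Real.pi =
        -(y₁ t * ∫ s in t..Real.pi, g s * p s) - p₁ t * ∫ s in (0 : ℝ)..t, g s * y s := by
  have h1 := ((h.lagrange hy.sol).congr_deriv' (g := fun x => g x * y x)
    fun x => by ring).integral_eq zero_mem_Icc_pi ht
  have h2 := ((h.lagrange hp.sol).congr_deriv' (g := fun x => g x * p x)
    fun x => by ring).integral_eq ht pi_mem_Icc_pi
  have hW := hy.wronskian hp ht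
  rw [h0, hy.left] at h1
  rw [hpi, hp.right] at h2
  rw [h1, h2, ← hW]
  constructor <;> ring

/-- The growth bound `w` is a pure exponential on one side of `t`, so recentring it at `t` leaves
the factor `exp(-|τ||t - s|)`. This produces the off-diagonal decay of Green's function. -/
theorem integral_norm_mul_le {τ : ℝ} (hg : ContinuousOn g (Icc 0 Real.pi)) {f : ℝ → ℂ}
    (hf : ContinuousOn f (Icc 0 Real.pi)) {w : ℝ → ℝ} {a b t A : ℝ} (ha : a ∈ Icc 0 Real.pi)
    (hb : b ∈ Icc 0 Real.pi) (hab : a ≤ b) (hA : 0 ≤ A) (hw : ∀ s ∈ Icc a b, A * ‖f s‖ ≤ w s)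
    (hwt : ∀ s ∈ Icc a b, w s = w t * Real.exp (-(|τ| * |t - s|))) :
    A * ‖∫ s in a..b, g s * f s‖ ≤
      w t * ∫ s in a..b, ‖g s‖ * Real.exp (-(|τ| * |t - s|)) := by
  have hsub : Icc a b ⊆ Icc 0 Real.pi := Icc_subset_Icc ha.1 hb.2
  have hc : ContinuousOn (fun s => ‖g s‖ * Real.exp (-(|τ| * |t - s|))) (Icc a b) :=
    (hg.norm.mono hsub).mul (Continuous.continuousOn (by fun_prop))
  calc A * ‖∫ s in a..b, g s * f s‖ ≤ A * ∫ s in a..b, ‖g s * f s‖ := by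
        gcongr
        exact intervalIntegral.norm_integral_le_integral_norm hab
    _ = ∫ s in a..b, A * ‖g s * f s‖ := (intervalIntegral.integral_const_mul _ _).symm
    _ ≤ ∫ s in a..b, w t * (‖g s‖ * Real.exp (-(|τ| * |t - s|))) := by
        refine intervalIntegral.integral_mono_on hab ?_ ?_ fun s hs => ?_
        · exact (((hg.mul hf).norm.mono hsub).const_smul A).intervalIntegrable_of_Icc hab
        · exact (hc.const_smul (w t)).intervalIntegrable_of_Icc hab
        · rw [norm_mul]
          have := mul_le_mul_of_nonneg_left (hw s hs) (norm_nonneg (g s))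
          rw [hwt s hs] at this
          linarith
    _ = _ := intervalIntegral.integral_const_mul _ _

/-- Pointwise bounds for the solution of the Dirichlet problem off the spectrum. -/
theorem Sol.resolvent_bound (hu : IsPotential R u) (h : Sol u (fun x => ρ ^ 2 * H x + g x) H H₁)
    (hg : ContinuousOn g (Icc 0 Real.pi)) (h0 : H 0 = 0) (hpi : H Real.pi = 0)
    (hy : IsOmega u (ρ ^ 2) y y₁) (hρ : 1 ≤ ‖ρ‖) {c : ℝ} (hc : 0 < c)
    (hW : c * Real.exp (|ρ.im| * Real.pi) ≤ ‖ρ‖ * ‖y Real.pi‖) {t : ℝ} (ht : t ∈ Icc 0 Real.pi) :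
    ‖ρ‖ * ‖H t‖ ≤ energyConst R ^ 2 / c * expAverage g ρ.im t ∧
      ‖H₁ t‖ ≤ energyConst R ^ 2 / c * expAverage g ρ.im t := by
  obtain ⟨ph, ph₁, hph⟩ := hu.exists_phi
  have hp := hph (ρ ^ 2)
  set p := ph (ρ ^ 2)
  set p₁ := ph₁ (ρ ^ 2)
  have hK := one_le_energyConst R
  set K := energyConst R
  set τ := ρ.im
  have hρ0 : 0 < ‖ρ‖ := by linarith
  obtain ⟨g1, g2⟩ := h.green h0 hpi hy hp ht
  have hyb := fun s (hs : s ∈ Icc 0 Real.pi) => hy.norm_le hu hρ hs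
  have hpb := fun s (hs : s ∈ Icc 0 Real.pi) => hp.norm_le hu hρ hs
  have b1 := integral_norm_mul_le (τ := τ) (t := t) (A := ‖ρ‖) hg hp.sol.deriv.continuousOn
    (w := fun s => K * Real.exp (|τ| * (Real.pi - s))) ht pi_mem_Icc_pi ht.2 hρ0.le
    (fun s hs => (hpb s ⟨ht.1.trans hs.1, hs.2⟩).1) (fun s hs => by
      rw [mul_assoc, ← Real.exp_add, abs_of_nonpos (sub_nonpos.2 hs.1)]; ring_nf)
  have b2 := integral_norm_mul_le (τ := τ) (t := t) (A := ‖ρ‖) hg hy.sol.deriv.continuousOn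
    (w := fun s => K * Real.exp (|τ| * s)) zero_mem_Icc_pi ht ht.1 hρ0.le
    (fun s hs => (hyb s ⟨hs.1, hs.2.trans ht.2⟩).1) (fun s hs => by
      rw [mul_assoc, ← Real.exp_add, abs_of_nonneg (sub_nonneg.2 hs.2)]; ring_nf)
  set I1 := ∫ s in t..Real.pi, ‖g s‖ * Real.exp (-(|τ| * |t - s|))
  set I2 := ∫ s in (0 : ℝ)..t, ‖g s‖ * Real.exp (-(|τ| * |t - s|))
  have hI : I2 + I1 = expAverage g τ t := by
    have hi : IntervalIntegrable (fun s => ‖g s‖ * Real.exp (-(|τ| * |t - s|))) volume 0 Real.pi :=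
      (hg.norm.mul (Continuous.continuousOn (by fun_prop))).intervalIntegrable_of_Icc
        Real.pi_pos.le
    exact intervalIntegral.integral_add_adjacent_intervals
      (intervalIntegrable_sub hi zero_mem_Icc_pi ht) (intervalIntegrable_sub hi ht pi_mem_Icc_pi)
  set J1 := ∫ s in t..Real.pi, g s * p s
  set J2 := ∫ s in (0 : ℝ)..t, g s * y s
  have hI1 : 0 ≤ I1 := intervalIntegral.integral_nonneg ht.2 fun s _ => by positivity
  have hI2 : 0 ≤ I2 := intervalIntegral.integral_nonneg ht.1 fun s _ => by positivity
  -- The growths of the left and right solutions multiply to `exp(|τ|π)`, which the lower bound for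
  -- the characteristic function cancels exactly.
  have e0 : Real.exp (|τ| * t) * Real.exp (|τ| * (Real.pi - t)) = Real.exp (|τ| * Real.pi) := by
    rw [← Real.exp_add]; ring_nf
  have key : ∀ (A : ℝ) (X a b : ℂ), 0 ≤ A → X * y Real.pi = -(a * J1) - b * J2 →
      A * ‖a‖ ≤ K * Real.exp (|τ| * t) → A * ‖b‖ ≤ K * Real.exp (|τ| * (Real.pi - t)) →
      A * ‖X‖ ≤ K ^ 2 / c * expAverage g τ t := by
    intro A X a b hA hX ha hb
    have e1 : A * ‖X‖ * (‖ρ‖ * ‖y Real.pi‖) ≤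
        K ^ 2 * Real.exp (|τ| * Real.pi) * expAverage g τ t := by
      calc A * ‖X‖ * (‖ρ‖ * ‖y Real.pi‖) = A * ‖ρ‖ * ‖X * y Real.pi‖ := by rw [norm_mul]; ring
        _ ≤ A * ‖ρ‖ * (‖a‖ * ‖J1‖ + ‖b‖ * ‖J2‖) := by
            rw [hX]
            gcongr
            refine (norm_sub_le _ _).trans ?_
            rw [norm_neg, norm_mul, norm_mul]
        _ = (A * ‖a‖) * (‖ρ‖ * ‖J1‖) + (A * ‖b‖) * (‖ρ‖ * ‖J2‖) := by ring
        _ ≤ (K * Real.exp (|τ| * t)) * (K * Real.exp (|τ| * (Real.pi - t)) * I1) +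
            (K * Real.exp (|τ| * (Real.pi - t))) * (K * Real.exp (|τ| * t) * I2) := by
            gcongr
        _ = K ^ 2 * (Real.exp (|τ| * t) * Real.exp (|τ| * (Real.pi - t))) * (I2 + I1) := by ring
        _ = _ := by rw [e0, hI]
    have e2 : A * ‖X‖ * (c * Real.exp (|τ| * Real.pi)) ≤
        K ^ 2 * Real.exp (|τ| * Real.pi) * expAverage g τ t :=
      (mul_le_mul_of_nonneg_left hW (by positivity)).trans e1
    rw [div_mul_eq_mul_div, le_div_iff₀ hc]
    refine le_of_mul_le_mul_right ?_ (Real.exp_pos (|τ| * Real.pi))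
    linarith
  refine ⟨key ‖ρ‖ _ _ _ hρ0.le g1 (hyb t ht).1 (hpb t ht).1, ?_⟩
  have := key 1 _ _ _ zero_le_one g2 (by rw [one_mul]; exact (hyb t ht).2)
    (by rw [one_mul]; exact (hpb t ht).2)
  rwa [one_mul] at this

end


/-! ### The Prüfer angle -/

theorem norm_sq_prufer {a b : ℂ} (ha : conj a = a) (hb : conj b = b) (s : ℝ) :
    ‖a + Complex.I * s * b‖ ^ 2 = ‖a‖ ^ 2 + s ^ 2 * ‖b‖ ^ 2 := by
  rw [Complex.conj_eq_iff_im] at ha hb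
  simp only [Complex.sq_norm, Complex.normSq_apply]
  simp [ha, hb]
  ring

/-- The derivative of `y₁ + i s y`. -/
noncomputable def pruferDeriv (u : ℝ → ℝ) (s : ℝ) (z : ℂ) (y y₁ : ℝ → ℂ) (x : ℝ) : ℂ :=
  -(u x * y₁ x + u x ^ 2 * y x + z * y x) + Complex.I * s * (y₁ x + u x * y x)

section

variable {R : ℝ} {u : ℝ → ℝ} {y y₁ : ℝ → ℂ} {s lam : ℝ}

theorem IsOmega.prufer_hasACDeriv (h : IsOmega u lam y y₁) (s : ℝ) :
    HasACDeriv (fun x => y₁ x + Complex.I * s * y x) (pruferDeriv u s lam y y₁) :=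
  h.sol.deriv_quasi.add (h.sol.deriv.const_mul (Complex.I * s))

theorem IsOmega.prufer_ne_zero (h : IsOmega u lam y y₁) (hu : IsPotential R u) (hs : s ≠ 0) {x : ℝ}
    (hx : x ∈ Icc 0 Real.pi) : y₁ x + Complex.I * s * y x ≠ 0 := by
  intro h0
  obtain ⟨c1, c2⟩ := h.conj_eq hu (Complex.conj_ofReal lam) hx
  have := norm_sq_prufer c2 c1 s
  rw [h0, norm_zero, zero_pow two_ne_zero] at this
  have h1 : ‖y₁ x‖ ^ 2 = 0 := by nlinarith [sq_nonneg ‖y₁ x‖, mul_nonneg (sq_nonneg s) (sq_nonneg ‖y x‖)]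
  have h2 : s ^ 2 * ‖y x‖ ^ 2 = 0 := by linarith
  have h3 : y₁ x = 0 := by simpa using h1
  have h4 : y x = 0 := by simpa [hs] using h2
  have := (h.sol.eq_zero hu hx h4 h3 zero_mem_Icc_pi).2
  rw [h.left_quasi] at this
  exact one_ne_zero this

theorem IsOmega.prufer_intervalIntegrable (h : IsOmega u lam y y₁) (hu : IsPotential R u)
    (hs : s ≠ 0) :
    IntervalIntegrable (fun x => pruferDeriv u s lam y y₁ x / (y₁ x + Complex.I * s * y x))
      volume 0 Real.pi := by
  have hP := h.prufer_hasACDeriv s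
  refine hP.intervalIntegrable.mul_continuousOn ?_
  rw [uIcc_zero_pi]
  exact hP.continuousOn.inv₀ fun x hx => h.prufer_ne_zero hu hs hx

/-- Integrating the logarithmic derivative gives a continuous argument without choosing branches. It
is legitimate because `y₁ + isy` has no zero when the spectral parameter is real. -/
theorem IsOmega.prufer_eq_exp (h : IsOmega u lam y y₁) (hu : IsPotential R u) (hs : s ≠ 0) {x : ℝ}
    (hx : x ∈ Icc 0 Real.pi) : y₁ x + Complex.I * s * y x =
      Complex.exp (∫ t in (0 : ℝ)..x, pruferDeriv u s lam y y₁ t / (y₁ t + Complex.I * s * y t)) := by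
  have hP := h.prufer_hasACDeriv s
  have hi := h.prufer_intervalIntegrable hu hs
  have hF : HasACDeriv (fun x => ∫ t in (0 : ℝ)..x, pruferDeriv u s lam y y₁ t /
      (y₁ t + Complex.I * s * y t)) _ := HasACDeriv.of_integral hi (by simp)
  have hc := ((hP.mul hF.neg.cexp).congr_deriv (g := fun _ => 0)
    (Eventually.of_forall fun x hx => by
      have := h.prufer_ne_zero hu hs (Ioo_subset_Icc_self hx)
      field_simp
      ring)).integral_eq zero_mem_Icc_pi hx
  simp only [intervalIntegral.integral_zero, intervalIntegral.integral_same, neg_zero,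
    Complex.exp_zero, h.left, h.left_quasi, mul_zero, add_zero, mul_one] at hc
  rw [Complex.exp_neg] at hc
  have hne := Complex.exp_ne_zero (∫ t in (0 : ℝ)..x, pruferDeriv u s lam y y₁ t /
      (y₁ t + Complex.I * s * y t))
  field_simp at hc
  linear_combination -hc

theorem norm_pruferDeriv_le {a b : ℂ} (ha : conj a = a) (hb : conj b = b) (v : ℝ) (hs : 1 ≤ s) :
    ‖-(v * a + v ^ 2 * b + lam * b) + Complex.I * s * (a + v * b)‖ ≤
      (|lam| + s + (2 * |v| + v ^ 2 / 1)) * ‖a + Complex.I * s * b‖ := by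
  have hn := norm_sq_prufer ha hb s
  set P := ‖a + Complex.I * s * b‖
  have hP : 0 ≤ P := norm_nonneg _
  have h1 : ‖a‖ ≤ P := (abs_le_of_sq_le_sq' (by nlinarith [mul_nonneg (sq_nonneg s) (sq_nonneg ‖b‖)]) hP).2
  have h2 : s * ‖b‖ ≤ P :=
    (abs_le_of_sq_le_sq' (by rw [mul_pow]; nlinarith [sq_nonneg ‖a‖]) hP).2
  have h3 : ‖b‖ ≤ P := by nlinarith [norm_nonneg b]
  have e1 : ‖-(v * a + v ^ 2 * b + lam * b) + Complex.I * s * (a + v * b)‖ ≤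
      (|v| * ‖a‖ + v ^ 2 * ‖b‖ + |lam| * ‖b‖) + s * (‖a‖ + |v| * ‖b‖) := by
    refine (norm_add_le _ _).trans (add_le_add ?_ ?_)
    · rw [norm_neg]
      refine (norm_add_le _ _).trans (add_le_add ((norm_add_le _ _).trans (le_of_eq ?_))
        (le_of_eq ?_)) <;> simp
    · rw [norm_mul, norm_mul, Complex.norm_I, one_mul, Complex.norm_real, Real.norm_eq_abs,
        abs_of_nonneg (by linarith)]
      gcongr
      refine (norm_add_le _ _).trans (le_of_eq ?_)
      simp
  refine e1.trans ?_
  have f1 := mul_le_mul_of_nonneg_left h1 (abs_nonneg v)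
  have f2 := mul_le_mul_of_nonneg_left h3 (sq_nonneg v)
  have f3 := mul_le_mul_of_nonneg_left h3 (abs_nonneg lam)
  have f4 := mul_le_mul_of_nonneg_left h1 (zero_le_one.trans hs)
  have f5 := mul_le_mul_of_nonneg_left h2 (abs_nonneg v)
  rw [div_one]
  linarith

end

/-- The Prüfer angle at the right end point, for the scale `s`. -/
noncomputable def pruferAngle (u : ℝ → ℝ) (om om₁ : ℂ → ℝ → ℂ) (s lam : ℝ) : ℝ :=
  (∫ t in (0 : ℝ)..Real.pi, pruferDeriv u s lam (om lam) (om₁ lam) t /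
    (om₁ lam t + Complex.I * s * om lam t)).im

section

variable {R : ℝ} {u : ℝ → ℝ} {om om₁ : ℂ → ℝ → ℂ} {s : ℝ}

theorem prufer_polar (hu : IsPotential R u) (hom : ∀ z, IsOmega u z (om z) (om₁ z)) (hs : s ≠ 0)
    (lam : ℝ) : om₁ lam Real.pi + Complex.I * s * om lam Real.pi =
      ‖om₁ lam Real.pi + Complex.I * s * om lam Real.pi‖ *
        Complex.exp (pruferAngle u om om₁ s lam * Complex.I) := by
  have := (hom lam).prufer_eq_exp hu hs pi_mem_Icc_pi
  rw [this, Complex.norm_exp, Complex.ofReal_exp, ← Complex.exp_add]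
  congr 1
  exact (Complex.re_add_im _).symm

theorem sin_pruferAngle (hu : IsPotential R u) (hom : ∀ z, IsOmega u z (om z) (om₁ z))
    (hs : s ≠ 0) (lam : ℝ) : s * (om lam Real.pi).re =
      ‖om₁ lam Real.pi + Complex.I * s * om lam Real.pi‖ *
        Real.sin (pruferAngle u om om₁ s lam) := by
  have h := congrArg Complex.im (prufer_polar hu hom hs lam)
  obtain ⟨c1, c2⟩ := (hom lam).conj_eq hu (Complex.conj_ofReal lam) pi_mem_Icc_pi
  rw [Complex.conj_eq_iff_im] at c1 c2
  rw [Complex.im_ofReal_mul, Complex.exp_ofReal_mul_I_im] at h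
  rw [← h]
  simp [c2]

theorem om_pi_eq_zero_iff (hu : IsPotential R u) (hom : ∀ z, IsOmega u z (om z) (om₁ z))
    (hs : s ≠ 0) (lam : ℝ) :
    om lam Real.pi = 0 ↔ ∃ k : ℤ, k * Real.pi = pruferAngle u om om₁ s lam := by
  have h := sin_pruferAngle hu hom hs lam
  have hne := norm_ne_zero_iff.2 ((hom lam).prufer_ne_zero hu hs pi_mem_Icc_pi)
  have hc := ((hom lam).conj_eq hu (Complex.conj_ofReal lam) pi_mem_Icc_pi).1
  rw [Complex.conj_eq_iff_re] at hc
  rw [← Real.sin_eq_zero_iff]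
  constructor
  · intro h0
    have h' : s * (om lam Real.pi).re = 0 := by rw [h0]; simp
    rw [h'] at h
    exact (mul_eq_zero.1 h.symm).resolve_left hne
  · intro h0
    rw [h0, mul_zero] at h
    rw [← hc, (mul_eq_zero.1 h).resolve_left hs, Complex.ofReal_zero]

theorem continuous_pruferAngle (hu : IsPotential R u) (hom : ∀ z, IsOmega u z (om z) (om₁ z))
    (hs : 1 ≤ s) : Continuous (pruferAngle u om om₁ s) := by
  have hs0 : s ≠ 0 := by linarith
  refine continuous_iff_continuousAt.2 fun l₀ => ?_
  refine Complex.continuous_im.continuousAt.comp ?_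
  refine intervalIntegral.continuousAt_of_dominated_interval
    (bound := fun t => |l₀| + 1 + s + (2 * |u t| + u t ^ 2 / 1)) ?_ ?_ ?_ ?_
  · refine Eventually.of_forall fun l => ?_
    exact ((hom l).prufer_intervalIntegrable hu hs0).aestronglyMeasurable_restrict_uIoc
  · filter_upwards [Metric.closedBall_mem_nhds l₀ one_pos] with l hl
    refine Eventually.of_forall fun t ht => ?_
    rw [uIoc_of_le Real.pi_pos.le] at ht
    have ht' := Ioc_subset_Icc_self ht
    obtain ⟨c1, c2⟩ := (hom l).conj_eq hu (Complex.conj_ofReal l) ht'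
    rw [norm_div, div_le_iff₀ (norm_pos_iff.2 ((hom l).prufer_ne_zero hu hs0 ht'))]
    refine (norm_pruferDeriv_le c2 c1 (u t) hs).trans ?_
    have : |l| ≤ |l₀| + 1 := by
      have h1 : |l - l₀| ≤ 1 := by simpa [Real.dist_eq] using hl
      have h2 := abs_sub_abs_le_abs_sub l l₀
      linarith
    gcongr
  · exact growth_integrable hu (|l₀| + 1 + s) 1
  · refine Eventually.of_forall fun t ht => ?_
    rw [uIoc_of_le Real.pi_pos.le] at ht
    have ht' := Ioc_subset_Icc_self ht
    obtain ⟨k1, k2⟩ := continuous_om hu hom ht'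
    have j1 : Continuous fun l : ℝ => om l t := k1.comp Complex.continuous_ofReal
    have j2 : Continuous fun l : ℝ => om₁ l t := k2.comp Complex.continuous_ofReal
    refine ContinuousAt.div ?_ ?_ ((hom l₀).prufer_ne_zero hu hs0 ht')
    · unfold pruferDeriv
      fun_prop
    · fun_prop

/-- The imaginary part of `P(l)` times the conjugate of `P(l₀)`, where `P = y₁ + isy` at `π`, is `s`
times the Lagrange bracket of the two solutions. The derivative of the angle in `l` can then be read
off without differentiating solutions. -/
theorem sin_pruferAngle_sub (hu : IsPotential R u) (hom : ∀ z, IsOmega u z (om z) (om₁ z))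
    (hs : s ≠ 0) (l l₀ : ℝ) :
    ‖om₁ l Real.pi + Complex.I * s * om l Real.pi‖ *
        ‖om₁ l₀ Real.pi + Complex.I * s * om l₀ Real.pi‖ *
        Real.sin (pruferAngle u om om₁ s l - pruferAngle u om om₁ s l₀) =
      s * (l - l₀) * (∫ t in (0 : ℝ)..Real.pi, om l t * om l₀ t).re := by
  have h1 := prufer_polar hu hom hs l
  have h2 := congrArg conj (prufer_polar hu hom hs l₀)
  obtain ⟨c1, c2⟩ := (hom l).conj_eq hu (Complex.conj_ofReal l) pi_mem_Icc_pi
  obtain ⟨d1, d2⟩ := (hom l₀).conj_eq hu (Complex.conj_ofReal l₀) pi_mem_Icc_pi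
  set P := ‖om₁ l Real.pi + Complex.I * s * om l Real.pi‖
  set P₀ := ‖om₁ l₀ Real.pi + Complex.I * s * om l₀ Real.pi‖
  rw [map_mul, ← Complex.exp_conj, Complex.conj_ofReal, map_mul, Complex.conj_ofReal,
    Complex.conj_I] at h2
  have h3 := congrArg Complex.im (congrArg₂ (· * ·) h1 h2)
  have e : (P : ℂ) * Complex.exp (pruferAngle u om om₁ s l * Complex.I) *
      (P₀ * Complex.exp (pruferAngle u om om₁ s l₀ * -Complex.I)) =
      ((P * P₀ : ℝ) : ℂ) * Complex.exp
        (((pruferAngle u om om₁ s l - pruferAngle u om om₁ s l₀ : ℝ) : ℂ) * Complex.I) := by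
    rw [mul_mul_mul_comm, ← Complex.exp_add]
    push_cast
    ring_nf
  simp only [e, Complex.im_ofReal_mul, Complex.exp_ofReal_mul_I_im] at h3
  rw [← h3]
  have hL := congrArg Complex.re ((hom l).lagrange (hom l₀) pi_mem_Icc_pi)
  rw [← Complex.ofReal_sub, Complex.re_ofReal_mul] at hL
  rw [mul_assoc s, ← hL]
  rw [Complex.conj_eq_iff_im] at c1 c2 d1 d2
  simp [c1, c2, d1, d2]
  ring

theorem hasDerivAt_pruferAngle (hu : IsPotential R u) (hom : ∀ z, IsOmega u z (om z) (om₁ z))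
    (hs : 1 ≤ s) (l₀ : ℝ) : HasDerivAt (pruferAngle u om om₁ s)
      (s * (∫ t in (0 : ℝ)..Real.pi, ‖om l₀ t‖ ^ 2) /
        (‖om₁ l₀ Real.pi‖ ^ 2 + s ^ 2 * ‖om l₀ Real.pi‖ ^ 2)) l₀ := by
  have hs0 : s ≠ 0 := by linarith
  set Θ := pruferAngle u om om₁ s
  have hcont := continuous_pruferAngle hu hom hs
  obtain ⟨d1, d2⟩ := (hom l₀).conj_eq hu (Complex.conj_ofReal l₀) pi_mem_Icc_pi
  set P : ℝ → ℝ := fun l => ‖om₁ l Real.pi + Complex.I * s * om l Real.pi‖ with hPdef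
  have hP : ∀ l, P l ≠ 0 := fun l =>
    norm_ne_zero_iff.2 ((hom l).prufer_ne_zero hu hs0 pi_mem_Icc_pi)
  have hPc : Continuous P := by
    obtain ⟨k1, k2⟩ := continuous_om hu hom pi_mem_Icc_pi
    have j1 : Continuous fun l : ℝ => om l Real.pi := k1.comp Complex.continuous_ofReal
    have j2 : Continuous fun l : ℝ => om₁ l Real.pi := k2.comp Complex.continuous_ofReal
    simp only [hPdef]
    fun_prop
  have hsin : HasDerivAt (fun l => Real.sin (Θ l - Θ l₀))
      (s * (∫ t in (0 : ℝ)..Real.pi, ‖om l₀ t‖ ^ 2) / (P l₀ * P l₀)) l₀ := by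
    rw [hasDerivAt_iff_tendsto_slope]
    have hI : Tendsto (fun l : ℝ => (∫ t in (0 : ℝ)..Real.pi, om l t * om l₀ t).re) (𝓝 l₀)
        (𝓝 (∫ t in (0 : ℝ)..Real.pi, ‖om l₀ t‖ ^ 2)) := by
      have h1 := (tendsto_integral_om_mul hu hom (hom l₀).continuousOn (l₀ : ℂ)).comp
        (Complex.continuous_ofReal.tendsto l₀)
      have h2 := (Complex.continuous_re.tendsto _).comp h1
      rw [(hom l₀).integral_sq_eq hu (Complex.conj_ofReal l₀), Complex.ofReal_re] at h2
      exact h2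
    have ht : Tendsto (fun l : ℝ => s * (∫ t in (0 : ℝ)..Real.pi, om l t * om l₀ t).re /
        (P l * P l₀)) (𝓝 l₀) (𝓝 (s * (∫ t in (0 : ℝ)..Real.pi, ‖om l₀ t‖ ^ 2) /
          (P l₀ * P l₀))) :=
      (hI.const_mul s).div ((hPc.tendsto l₀).mul_const _) (mul_ne_zero (hP _) (hP _))
    refine (ht.mono_left nhdsWithin_le_nhds).congr' ?_
    filter_upwards [self_mem_nhdsWithin] with l hl
    have hl' : l - l₀ ≠ 0 := sub_ne_zero.2 hl
    have := sin_pruferAngle_sub hu hom hs0 l l₀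
    change P l * P l₀ * Real.sin (Θ l - Θ l₀) = _ at this
    rw [slope_def_field, sub_self, Real.sin_zero, sub_zero, eq_div_iff hl',
      div_mul_eq_mul_div, div_eq_iff (mul_ne_zero (hP _) (hP _))]
    linarith
  -- By continuity the angle difference stays within `π/2` near `l₀`, where `arcsin` undoes the
  -- sine.
  have harc := (Real.hasDerivAt_arcsin (x := Real.sin (Θ l₀ - Θ l₀)) (by simp)
    (by simp)).comp l₀ hsin
  have h2 := harc.add_const (Θ l₀)
  have hval : P l₀ * P l₀ = ‖om₁ l₀ Real.pi‖ ^ 2 + s ^ 2 * ‖om l₀ Real.pi‖ ^ 2 := by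
    rw [← norm_sq_prufer d2 d1 s, pow_two]
  rw [hval] at h2
  simp only [sub_self, Real.sin_zero, ne_eq, OfNat.ofNat_ne_zero, not_false_eq_true, zero_pow,
    sub_zero, Real.sqrt_one, div_one, one_mul] at h2
  refine h2.congr_of_eventuallyEq ?_
  have hnear : ∀ᶠ l in 𝓝 l₀, |Θ l - Θ l₀| < Real.pi / 2 := by
    have : Tendsto (fun l => |Θ l - Θ l₀|) (𝓝 l₀) (𝓝 0) := by
      have := ((hcont.sub continuous_const).abs).tendsto l₀ (f := fun l => |Θ l - Θ l₀|)
      simpa using this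
    exact this.eventually (gt_mem_nhds (by positivity))
  filter_upwards [hnear] with l hl
  rw [abs_lt] at hl
  simp only [Function.comp_apply]
  rw [Real.arcsin_sin hl.1.le hl.2.le]
  ring

theorem strictMono_pruferAngle (hu : IsPotential R u) (hom : ∀ z, IsOmega u z (om z) (om₁ z))
    (hs : 1 ≤ s) : StrictMono (pruferAngle u om om₁ s) := by
  refine strictMono_of_deriv_pos fun l => ?_
  rw [(hasDerivAt_pruferAngle hu hom hs l).deriv]
  obtain ⟨d1, d2⟩ := (hom l).conj_eq hu (Complex.conj_ofReal l) pi_mem_Icc_pi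
  rw [← norm_sq_prufer d2 d1 s]
  have h1 := (hom l).integral_norm_sq_pos hu
  have h2 := norm_pos_iff.2 ((hom l).prufer_ne_zero hu (by linarith : s ≠ 0) pi_mem_Icc_pi)
  have : 0 < s := by linarith
  positivity

/-- At the parameter `s²` the logarithmic derivative of `P = y₁ + isy` differs from `is` by `-(u P̄
+ u² y)/P`. Its modulus is at most `|u| + u²/s`, since `|P̄| = |P|` and `s|y| ≤ |P|`. -/
theorem abs_pruferAngle_sub_le (hu : IsPotential R u) (hom : ∀ z, IsOmega u z (om z) (om₁ z))
    (hs : 1 ≤ s) :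
    |pruferAngle u om om₁ s (s ^ 2) - s * Real.pi| ≤ Real.pi + 2 * R ^ 2 := by
  have hs0 : s ≠ 0 := by linarith
  have hi := (hom ((s ^ 2 : ℝ) : ℂ)).prufer_intervalIntegrable hu hs0
  set f := fun t => pruferDeriv u s ((s ^ 2 : ℝ) : ℂ) (om ((s ^ 2 : ℝ) : ℂ))
    (om₁ ((s ^ 2 : ℝ) : ℂ)) t / (om₁ ((s ^ 2 : ℝ) : ℂ) t + Complex.I * s * om ((s ^ 2 : ℝ) : ℂ) t)
  have e1 : pruferAngle u om om₁ s (s ^ 2) - s * Real.pi =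
      (∫ t in (0 : ℝ)..Real.pi, (f t - Complex.I * s)).im := by
    rw [intervalIntegral.integral_sub hi intervalIntegrable_const]
    simp [pruferAngle, f, mul_comm]
  rw [e1]
  refine (Complex.abs_im_le_norm _).trans ?_
  have hw := hu.integral_weight_le hs zero_mem_Icc_pi pi_mem_Icc_pi Real.pi_pos.le
  refine le_trans ?_ hw
  refine intervalIntegral.norm_integral_le_of_norm_le Real.pi_pos.le
    (Eventually.of_forall fun t ht => ?_) (by simpa using growth_integrable hu 0 s)
  have ht' := Ioc_subset_Icc_self ht
  obtain ⟨c1, c2⟩ := (hom ((s ^ 2 : ℝ) : ℂ)).conj_eq hu (Complex.conj_ofReal _) ht'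
  have hne := (hom ((s ^ 2 : ℝ) : ℂ)).prufer_ne_zero hu hs0 ht'
  simp only [f, pruferDeriv]
  set a := om₁ ((s ^ 2 : ℝ) : ℂ) t
  set b := om ((s ^ 2 : ℝ) : ℂ) t
  rw [div_sub' hne, norm_div, div_le_iff₀ (norm_pos_iff.2 hne)]
  have hn := norm_sq_prufer c2 c1 s
  have hn' := norm_sq_prufer c2 c1 (-s)
  set P := ‖a + Complex.I * s * b‖
  have hP : 0 ≤ P := norm_nonneg _
  have hPm : ‖a + Complex.I * (-s : ℝ) * b‖ = P := by
    rw [neg_sq, ← hn] at hn'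
    exact (pow_left_inj₀ (norm_nonneg _) hP two_ne_zero).1 hn'
  have hsp : 0 < s := by linarith
  have hb : ‖b‖ ≤ P / s := by
    rw [le_div_iff₀ hsp, mul_comm]
    exact (abs_le_of_sq_le_sq' (by rw [mul_pow]; nlinarith [sq_nonneg ‖a‖]) hP).2
  have e2 : -(u t * a + u t ^ 2 * b + ((s ^ 2 : ℝ) : ℂ) * b) + Complex.I * s * (a + u t * b) -
      (a + Complex.I * s * b) * (Complex.I * s) =
      -(u t * (a + Complex.I * (-s : ℝ) * b)) - u t ^ 2 * b := by
    push_cast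
    linear_combination (-(s : ℂ) ^ 2 * b) * Complex.I_sq
  rw [e2]
  refine (norm_sub_le _ _).trans ?_
  rw [norm_neg, norm_mul, norm_mul, hPm, norm_pow, Complex.norm_real, Real.norm_eq_abs, sq_abs]
  calc |u t| * P + u t ^ 2 * ‖b‖ ≤ |u t| * P + u t ^ 2 * (P / s) := by gcongr
    _ ≤ |u t| * P + u t ^ 2 * (P / s) + |u t| * P := le_add_of_nonneg_right (by positivity)
    _ = _ := by ring

/-- So far below, the solution has no zero in `(0, π]`. An angle that starts at `0` can then never
pass `π` or `-π`, by the intermediate value theorem. -/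
theorem abs_pruferAngle_lt (hR : 0 < R) (hu : IsPotential R u)
    (hom : ∀ z, IsOmega u z (om z) (om₁ z)) (hs : 1 ≤ s) {l : ℝ} (hl : l ≤ -(24 * R ^ 4)) :
    |pruferAngle u om om₁ s l| < Real.pi := by
  have hs0 : s ≠ 0 := by linarith
  have hi := (hom l).prufer_intervalIntegrable hu hs0
  set F : ℝ → ℝ := fun x => (∫ t in (0 : ℝ)..x, pruferDeriv u s l (om l) (om₁ l) t /
    (om₁ l t + Complex.I * s * om l t)).im with hF
  have hFc : ContinuousOn F (Icc 0 Real.pi) := by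
    have := intervalIntegral.continuousOn_primitive_interval' hi
      (by simp : (0 : ℝ) ∈ uIcc 0 Real.pi)
    rw [uIcc_zero_pi] at this
    exact Complex.continuous_im.comp_continuousOn this
  have hF0 : F 0 = 0 := by simp [hF]
  have hne : ∀ x ∈ Ioc 0 Real.pi, Real.sin (F x) ≠ 0 := by
    intro x hx h0
    have hx' := Ioc_subset_Icc_self hx
    have h1 := congrArg Complex.im ((hom l).prufer_eq_exp hu hs0 hx')
    obtain ⟨c1, c2⟩ := (hom l).conj_eq hu (Complex.conj_ofReal l) hx'
    rw [Complex.exp_im] at h1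
    change _ = _ * Real.sin (F x) at h1
    rw [h0, mul_zero] at h1
    have h3 := c1
    rw [Complex.conj_eq_iff_im] at c1 c2
    rw [Complex.conj_eq_iff_re] at h3
    simp [c2, hs0] at h1
    refine (hom l).ne_zero_of_le hR hu hl hx ?_
    rw [← h3, h1, Complex.ofReal_zero]
  change |F Real.pi| < Real.pi
  by_contra hcon
  rw [not_lt] at hcon
  have hpos := Real.pi_pos
  rcases le_abs.1 hcon with h1 | h1
  · obtain ⟨x, hx, hxe⟩ := intermediate_value_Icc Real.pi_pos.le hFc
      (show Real.pi ∈ Icc (F 0) (F Real.pi) from ⟨by rw [hF0]; exact hpos.le, h1⟩)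
    rcases hx.1.eq_or_lt with rfl | hx0
    · rw [hF0] at hxe; linarith
    · exact hne x ⟨hx0, hx.2⟩ (by rw [hxe, Real.sin_pi])
  · obtain ⟨x, hx, hxe⟩ := intermediate_value_Icc' Real.pi_pos.le hFc
      (show -Real.pi ∈ Icc (F Real.pi) (F 0) from ⟨by linarith, by rw [hF0]; linarith⟩)
    rcases hx.1.eq_or_lt with rfl | hx0
    · rw [hF0] at hxe; linarith
    · exact hne x ⟨hx0, hx.2⟩ (by rw [hxe, Real.sin_neg, Real.sin_pi, neg_zero])

end


/-! ### Counting eigenvalues and finding gaps between them -/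

section

variable {R : ℝ} {u : ℝ → ℝ} {om om₁ : ℂ → ℝ → ℂ} {σ : ℝ}

/-- Eigenvalues are the points where the increasing angle meets `πℤ`. At the scale `σ` the angle is
`σπ + O(1)` at `σ²` and lies in `(-π, π)` at `-24R⁴`, so counting multiples of `π` counts
eigenvalues. -/
theorem abs_ncard_zeros_sub_le (hR : 0 < R) (hu : IsPotential R u)
    (hom : ∀ z, IsOmega u z (om z) (om₁ z)) (hσ : 1 ≤ σ) :
    {l : ℝ | om l Real.pi = 0 ∧ l < σ ^ 2}.Finite ∧
      |({l : ℝ | om l Real.pi = 0 ∧ l < σ ^ 2}.ncard : ℝ) - σ| ≤ 2 + R ^ 2 := by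
  have hσ0 : σ ≠ 0 := by linarith
  set Θ := pruferAngle u om om₁ σ with hΘ
  set Z := {l : ℝ | om l Real.pi = 0 ∧ l < σ ^ 2} with hZ
  have hmono : StrictMono Θ := strictMono_pruferAngle hu hom hσ
  have hcont : Continuous Θ := continuous_pruferAngle hu hom hσ
  have hiff := om_pi_eq_zero_iff hu hom hσ0
  set L := -(24 * R ^ 4) with hL
  have hLneg : L < 0 := by rw [hL]; have : 0 < R ^ 4 := by positivity
                           linarith
  have hLlt : L < σ ^ 2 := by nlinarith
  have ha : |Θ L| < Real.pi := abs_pruferAngle_lt hR hu hom hσ le_rfl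
  have hb : |Θ (σ ^ 2) - σ * Real.pi| ≤ Real.pi + 2 * R ^ 2 := abs_pruferAngle_sub_le hu hom hσ
  rw [abs_lt] at ha
  rw [abs_le] at hb
  have hpi := Real.pi_pos
  have hpi3 := Real.pi_gt_three
  set f : ℝ → ℤ := fun l => ⌊Θ l / Real.pi⌋ with hf
  have hfk : ∀ l : ℝ, om l Real.pi = 0 → (f l : ℝ) * Real.pi = Θ l := by
    intro l hl
    obtain ⟨k, hk⟩ := (hiff l).1 hl
    have : f l = k := by
      rw [hf]; simp only
      rw [hΘ, ← hk, mul_div_assoc, div_self hpi.ne', mul_one, Int.floor_intCast]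
    rw [this, hk]
  have hinj : InjOn f Z := by
    intro l hl l' hl' h
    apply hmono.injective
    rw [← hfk l hl.1, ← hfk l' hl'.1, h]
  set b := Θ (σ ^ 2) / Real.pi with hbdef
  have hbm : b * Real.pi = Θ (σ ^ 2) := by rw [hbdef]; field_simp
  -- Only `|Θ L| < π` is known, so the multiple `0` cannot be excluded here nor guaranteed below;
  -- the two ranges start at `0` and `1`.
  have hup : f '' Z ⊆ ↑(Finset.Ico (0 : ℤ) ⌈b⌉) := by
    rintro _ ⟨l, hl, rfl⟩
    have hk := hfk l hl.1
    have h1 : L < l := by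
      by_contra hcon
      exact (hom l).ne_zero_of_le hR hu (not_lt.1 hcon) ⟨hpi, le_rfl⟩ hl.1
    have h2 := hmono h1
    have h3 := hmono hl.2
    rw [Finset.coe_Ico]
    constructor
    · have : (-1 : ℝ) < f l := by
        by_contra hcon
        have := mul_le_mul_of_nonneg_right (not_lt.1 hcon) hpi.le
        linarith
      have : (-1 : ℤ) < f l := by exact_mod_cast this
      omega
    · rw [Int.lt_ceil]
      refine lt_of_mul_lt_mul_right ?_ hpi.le
      rw [hk, hbm]; exact h3
  have hlow : ↑(Finset.Ico (1 : ℤ) ⌈b⌉) ⊆ f '' Z := by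
    intro k hk
    rw [Finset.coe_Ico, mem_Ico, Int.lt_ceil] at hk
    have h1 : (1 : ℝ) ≤ k := by exact_mod_cast hk.1
    have h2 : Θ L < k * Real.pi := by nlinarith
    have h3 : k * Real.pi < Θ (σ ^ 2) := by rw [← hbm]; exact mul_lt_mul_of_pos_right hk.2 hpi
    obtain ⟨l, hl, hlk⟩ := intermediate_value_Ioo hLlt.le hcont.continuousOn ⟨h2, h3⟩
    have h0 : om l Real.pi = 0 := (hiff l).2 ⟨k, hlk.symm⟩
    refine ⟨l, ⟨h0, hl.2⟩, ?_⟩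
    have := hfk l h0
    rw [hlk] at this
    exact_mod_cast mul_right_cancel₀ hpi.ne' this
  have hfin : (f '' Z).Finite := (Finset.finite_toSet _).subset hup
  have hZfin : Z.Finite := hfin.of_finite_image hinj
  refine ⟨hZfin, ?_⟩
  have hcard : (f '' Z).ncard = Z.ncard := hinj.ncard_image
  have c1 := ncard_le_ncard hup (Finset.finite_toSet _)
  have c2 := ncard_le_ncard hlow hfin
  rw [ncard_coe_finset, Int.card_Ico, hcard] at c1 c2
  have d1 : b < σ + 1 + R ^ 2 := by
    rw [hbdef, div_lt_iff₀ hpi]; nlinarith [sq_nonneg R, sq_pos_of_pos hR]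
  have d2 : σ - 1 - R ^ 2 < b := by
    rw [hbdef, lt_div_iff₀ hpi]; nlinarith [sq_nonneg R, sq_pos_of_pos hR]
  have c1' : (Z.ncard : ℤ) ≤ max (⌈b⌉ - 0) 0 := by
    rw [← Int.toNat_eq_max]; exact_mod_cast c1
  have c2' : ⌈b⌉ - 1 ≤ (Z.ncard : ℤ) := (Int.self_le_toNat _).trans (by exact_mod_cast c2)
  have c1'' : (Z.ncard : ℝ) ≤ max (⌈b⌉ : ℝ) 0 := by
    have : ((Z.ncard : ℤ) : ℝ) ≤ ((max (⌈b⌉ - 0) 0 : ℤ) : ℝ) := by exact_mod_cast c1'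
    simpa using this
  have c2'' : (⌈b⌉ : ℝ) - 1 ≤ (Z.ncard : ℝ) := by exact_mod_cast c2'
  have hc1 := Int.ceil_lt_add_one b
  have hc2 := Int.le_ceil b
  rw [abs_le]
  constructor
  · linarith
  · have : max (⌈b⌉ : ℝ) 0 ≤ σ + 2 + R ^ 2 := max_le (by linarith) (by positivity)
    linarith

end

/-- The lower bound for the characteristic function at suitable points between consecutive
asymptotic eigenvalues. -/
noncomputable def gapConst (R : ℝ) : ℝ :=
  Real.sin (Real.pi / (32 * energyConst R ^ 2)) / (4 * energyConst R)

theorem gapConst_pos (R : ℝ) : 0 < gapConst R := by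
  have hK := one_le_energyConst R
  refine div_pos (Real.sin_pos_of_pos_of_lt_pi (by positivity) ?_) (by positivity)
  refine div_lt_self Real.pi_pos ?_
  nlinarith

/-- With the scale fixed at `m`, the angle gains at least `2κ` as the parameter runs from `(m +
1/4)²` to `(m + 3/4)²`, so its sine cannot stay small. The amplitude multiplying the sine is bounded
below by the energy. -/
theorem exists_gap {R : ℝ} {u : ℝ → ℝ} {om om₁ : ℂ → ℝ → ℂ} (hu : IsPotential R u)
    (hom : ∀ z, IsOmega u z (om z) (om₁ z)) {m : ℝ} (hm : rhoBound R ≤ m) :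
    ∃ σ ∈ Icc (m + 1 / 4) (m + 3 / 4), gapConst R ≤ σ * ‖om ((σ : ℂ) ^ 2) Real.pi‖ := by
  have hm1 : 1 ≤ m := (one_le_rhoBound R).trans hm
  have hm0 : m ≠ 0 := by linarith
  set K := energyConst R with hKdef
  have hK : 1 ≤ K := one_le_energyConst R
  set Θ := pruferAngle u om om₁ m with hΘ
  set κ := Real.pi / (32 * K ^ 2) with hκ
  have hpi := Real.pi_pos
  have hκ0 : 0 < κ := by positivity
  have hcont : Continuous Θ := continuous_pruferAngle hu hom hm1
  have hsq : ∀ l ∈ Icc ((m + 1 / 4) ^ 2) ((m + 3 / 4) ^ 2), ∃ σ ∈ Icc (m + 1 / 4) (m + 3 / 4),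
      l = σ ^ 2 := by
    intro l hl
    have hl0 : 0 ≤ l := le_trans (by positivity) hl.1
    refine ⟨Real.sqrt l, ⟨Real.le_sqrt_of_sq_le hl.1, ?_⟩, (Real.sq_sqrt hl0).symm⟩
    exact Real.sqrt_le_iff.2 ⟨by linarith, hl.2⟩
  have hab : (m + 1 / 4) ^ 2 ≤ (m + 3 / 4) ^ 2 := by nlinarith
  have hder : ∀ l ∈ Icc ((m + 1 / 4) ^ 2) ((m + 3 / 4) ^ 2),
      m * Real.pi / (4 * K ^ 2 * (m + 3 / 4) ^ 2) ≤ deriv Θ l := by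
    intro l hl
    obtain ⟨σ, hσ, rfl⟩ := hsq l hl
    have hσm : m ≤ σ := by linarith [hσ.1]
    have hσ1 : 1 ≤ σ := hm1.trans hσm
    rw [hΘ, (hasDerivAt_pruferAngle hu hom hm1 (σ ^ 2)).deriv]
    have hw := hom ((σ : ℂ) ^ 2)
    have hcast : ((σ ^ 2 : ℝ) : ℂ) = (σ : ℂ) ^ 2 := by push_cast; rfl
    rw [hcast]
    have h1 := hw.energy_le_const hu hσ1 pi_mem_Icc_pi
    have h2 := hw.le_energy hu hσ1 pi_mem_Icc_pi
    have h3 := hw.le_integral_norm_sq hu (hm.trans hσm)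
    set I := ∫ t in (0 : ℝ)..Real.pi, ‖om ((σ : ℂ) ^ 2) t‖ ^ 2
    set A := ‖om₁ ((σ : ℂ) ^ 2) Real.pi‖ ^ 2
    set B := ‖om ((σ : ℂ) ^ 2) Real.pi‖ ^ 2
    have hA : 0 ≤ A := sq_nonneg _
    have hB : 0 ≤ B := sq_nonneg _
    have hms : m ^ 2 ≤ σ ^ 2 := by nlinarith
    have hEm : A + m ^ 2 * B ≤ K := by nlinarith [mul_le_mul_of_nonneg_right hms hB]
    have hEpos : 0 < A + m ^ 2 * B := by
      rcases hA.eq_or_lt with h | h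
      · rcases hB.eq_or_lt with h' | h'
        · rw [← h, ← h'] at h2; norm_num at h2
        · positivity
      · positivity
    rw [div_le_div_iff₀ (by positivity) hEpos]
    have h4 : Real.pi ≤ 4 * K * ((m + 3 / 4) ^ 2 * I) := by
      rw [div_le_iff₀ (by positivity)] at h3
      have hI : 0 ≤ I := intervalIntegral.integral_nonneg hpi.le fun _ _ => sq_nonneg _
      have : σ ^ 2 ≤ (m + 3 / 4) ^ 2 := by nlinarith [hσ.2]
      have := mul_le_mul_of_nonneg_right this hI
      nlinarith
    calc m * Real.pi * (A + m ^ 2 * B) ≤ m * (4 * K * ((m + 3 / 4) ^ 2 * I)) * K := by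
          have hI : 0 ≤ I := intervalIntegral.integral_nonneg hpi.le fun _ _ => sq_nonneg _
          gcongr
      _ = _ := by ring
  have hinc : 2 * κ ≤ Θ ((m + 3 / 4) ^ 2) - Θ ((m + 1 / 4) ^ 2) := by
    have := Convex.mul_sub_le_image_sub_of_le_deriv
      (convex_Icc ((m + 1 / 4) ^ 2) ((m + 3 / 4) ^ 2)) hcont.continuousOn
      (fun l _ => (hasDerivAt_pruferAngle hu hom hm1 l).differentiableAt.differentiableWithinAt)
      (fun l hl => hder l (interior_subset hl)) _ (left_mem_Icc.2 hab) _ (right_mem_Icc.2 hab) hab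
    refine le_trans ?_ this
    rw [hκ, div_mul_eq_mul_div, mul_div_assoc', div_le_div_iff₀ (by positivity) (by positivity)]
    have : (m + 3 / 4) ^ 2 ≤ 4 * m * ((m + 3 / 4) ^ 2 - (m + 1 / 4) ^ 2) := by nlinarith
    have h5 : 0 ≤ 8 * Real.pi * K ^ 2 := by positivity
    nlinarith [mul_le_mul_of_nonneg_left this h5]
  have hexists : ∃ l ∈ Icc ((m + 1 / 4) ^ 2) ((m + 3 / 4) ^ 2),
      Real.sin κ / 2 ≤ |Real.sin (Θ l)| := by
    by_contra! hcon
    have h1 := hcon _ (left_mem_Icc.2 hab)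
    obtain ⟨l, hl, hlA⟩ := intermediate_value_Icc hab hcont.continuousOn
      (show Θ ((m + 1 / 4) ^ 2) + κ ∈ Icc _ _ from ⟨by linarith, by linarith⟩)
    have h2 := hcon l hl
    rw [hlA] at h2
    -- The addition formula: two sines at distance `κ` cannot both be smaller than `sin κ / 2`.
    have h3 : Real.sin κ = Real.sin (Θ ((m + 1 / 4) ^ 2) + κ) * Real.cos (Θ ((m + 1 / 4) ^ 2)) -
        Real.cos (Θ ((m + 1 / 4) ^ 2) + κ) * Real.sin (Θ ((m + 1 / 4) ^ 2)) := by
      rw [← Real.sin_sub]; congr 1; ring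
    have h4 := (le_abs_self _).trans (abs_sub (Real.sin (Θ ((m + 1 / 4) ^ 2) + κ) *
      Real.cos (Θ ((m + 1 / 4) ^ 2))) (Real.cos (Θ ((m + 1 / 4) ^ 2) + κ) *
      Real.sin (Θ ((m + 1 / 4) ^ 2))))
    rw [← h3, abs_mul, abs_mul] at h4
    have h5 := mul_le_mul_of_nonneg_left (Real.abs_cos_le_one (Θ ((m + 1 / 4) ^ 2)))
      (abs_nonneg (Real.sin (Θ ((m + 1 / 4) ^ 2) + κ)))
    have h6 := mul_le_mul_of_nonneg_right (Real.abs_cos_le_one (Θ ((m + 1 / 4) ^ 2) + κ))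
      (abs_nonneg (Real.sin (Θ ((m + 1 / 4) ^ 2))))
    linarith
  obtain ⟨l, hl, hsin⟩ := hexists
  obtain ⟨σ, hσ, rfl⟩ := hsq l hl
  refine ⟨σ, hσ, ?_⟩
  have hσm : m ≤ σ := by linarith [hσ.1]
  have hσ1 : 1 ≤ σ := hm1.trans hσm
  have hcast : ((σ ^ 2 : ℝ) : ℂ) = (σ : ℂ) ^ 2 := by push_cast; rfl
  have h1 := sin_pruferAngle hu hom hm0 (σ ^ 2)
  obtain ⟨c1, c2⟩ := (hom ((σ ^ 2 : ℝ) : ℂ)).conj_eq hu (Complex.conj_ofReal _) pi_mem_Icc_pi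
  have hn := norm_sq_prufer c2 c1 m
  have h2 := (hom ((σ : ℂ) ^ 2)).le_energy hu hσ1 pi_mem_Icc_pi
  rw [hcast] at h1 hn c1
  rw [Complex.conj_eq_iff_re] at c1
  have hre : ‖om ((σ : ℂ) ^ 2) Real.pi‖ = |(om ((σ : ℂ) ^ 2) Real.pi).re| := by
    rw [← c1, Complex.norm_real, Real.norm_eq_abs, Complex.ofReal_re]
  set P := ‖om₁ ((σ : ℂ) ^ 2) Real.pi + Complex.I * m * om ((σ : ℂ) ^ 2) Real.pi‖
  have hP0 : 0 ≤ P := norm_nonneg _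
  have hPK : 1 / (2 * K) ≤ P := by
    refine (abs_le_of_sq_le_sq' ?_ hP0).2
    rw [hn, div_pow, one_pow, div_le_iff₀ (by positivity)]
    set A := ‖om₁ ((σ : ℂ) ^ 2) Real.pi‖ ^ 2
    set B := ‖om ((σ : ℂ) ^ 2) Real.pi‖ ^ 2
    have hA : 0 ≤ A := sq_nonneg _
    have hB : 0 ≤ B := sq_nonneg _
    have : σ ^ 2 ≤ 4 * m ^ 2 := by nlinarith [hσ.2]
    have h3 := mul_le_mul_of_nonneg_right this hB
    have h4 : 0 ≤ A + m ^ 2 * B := by positivity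
    have h5 : A + σ ^ 2 * B ≤ 4 * (A + m ^ 2 * B) := by linarith
    have h6 := mul_le_mul_of_nonneg_left h5 (by linarith : (0 : ℝ) ≤ K)
    nlinarith [mul_le_mul_of_nonneg_right hK (mul_nonneg (by linarith : (0 : ℝ) ≤ K) h4)]
  have habs : m * ‖om ((σ : ℂ) ^ 2) Real.pi‖ = P * |Real.sin (Θ (σ ^ 2))| := by
    have h3 := congrArg abs h1
    rwa [abs_mul, abs_of_nonneg (by linarith : (0 : ℝ) ≤ m), ← hre, abs_mul,
      abs_of_nonneg hP0] at h3
  have hsk : 0 ≤ Real.sin κ := by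
    refine Real.sin_nonneg_of_nonneg_of_le_pi hκ0.le (div_le_self hpi.le (by nlinarith))
  calc gapConst R = 1 / (2 * K) * (Real.sin κ / 2) := by rw [gapConst, ← hKdef, ← hκ]; field_simp; norm_num
    _ ≤ P * |Real.sin (Θ (σ ^ 2))| := by gcongr
    _ = m * ‖om ((σ : ℂ) ^ 2) Real.pi‖ := habs.symm
    _ ≤ _ := by gcongr


/-! ### Green's operator as a compact operator -/

section

variable {X E : Type*} [TopologicalSpace X] [CompactSpace X] [NormedAddCommGroup E]
  [InnerProductSpace ℂ E]

/-- The operator taking `g` to the function `t ↦ ⟪κ t, g⟫`. -/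
noncomputable def pairing (κ : C(X, E)) : E →L[ℂ] BoundedContinuousFunction X ℂ :=
  LinearMap.mkContinuous
    { toFun := fun g => BoundedContinuousFunction.mkOfCompact
        ⟨fun t => inner ℂ (κ t) g, κ.continuous.inner continuous_const⟩
      map_add' := fun a b => by ext t; simp
      map_smul' := fun c a => by ext t; simp }
    ‖κ‖ fun g => by
      refine (BoundedContinuousFunction.norm_le (by positivity)).2 fun t => ?_
      exact (norm_inner_le_norm _ _).trans (by gcongr; exact κ.norm_coe_le_norm t)

theorem pairing_apply (κ : C(X, E)) (g : E) (t : X) : pairing κ g t = inner ℂ (κ t) g := rfl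

/-- By Arzelà–Ascoli: for `g` in the unit ball the images inherit the bound and the modulus of
continuity of `κ`. -/
theorem isCompactOperator_pairing (κ : C(X, E)) : IsCompactOperator (pairing κ) := by
  rw [← ContinuousLinearMap.coe_coe,
    isCompactOperator_iff_isCompact_closure_image_closedBall _ one_pos]
  refine BoundedContinuousFunction.arzela_ascoli (Metric.closedBall 0 ‖κ‖)
    (isCompact_closedBall _ _) _ ?_ ?_
  · rintro _ t ⟨g, hg, rfl⟩
    rw [mem_closedBall_zero_iff] at hg ⊢
    rw [ContinuousLinearMap.coe_coe, pairing_apply]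
    refine (norm_inner_le_norm _ _).trans ?_
    calc ‖κ t‖ * ‖g‖ ≤ ‖κ‖ * 1 := by gcongr; exact κ.norm_coe_le_norm t
      _ = ‖κ‖ := mul_one _
  · intro t₀
    rw [Metric.equicontinuousAt_iff_right]
    intro ε hε
    filter_upwards [Metric.continuousAt_iff'.1 κ.continuous.continuousAt ε hε] with t ht
    rintro ⟨_, g, hg, rfl⟩
    rw [mem_closedBall_zero_iff] at hg
    simp only [ContinuousLinearMap.coe_coe, pairing_apply]
    rw [dist_eq_norm] at ht ⊢
    rw [← inner_sub_left]
    refine (norm_inner_le_norm _ _).trans_lt ?_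
    calc ‖κ t₀ - κ t‖ * ‖g‖ ≤ ‖κ t₀ - κ t‖ * 1 := by gcongr
      _ < ε := by rw [mul_one, norm_sub_rev]; exact ht

end

/-- Continuous functions on `[0, π]` as elements of `L₂`. -/
noncomputable def continuousToL2 :
    BoundedContinuousFunction (Icc (0 : ℝ) Real.pi) ℂ →L[ℂ] Lp ℂ 2 muPi :=
  (BoundedContinuousFunction.toLp 2 muPi ℂ).comp <|
    LinearMap.mkContinuous (σ := RingHom.id ℂ)
      { toFun := fun f => f.compContinuous ⟨projIcc 0 Real.pi Real.pi_pos.le, continuous_projIcc⟩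
        map_add' := fun a b => by ext t; simp
        map_smul' := fun c a => by ext t; simp }
      1 fun f => by
        rw [one_mul]
        exact (BoundedContinuousFunction.norm_le (norm_nonneg _)).2 fun t => f.norm_coe_le_norm _

theorem coeFn_continuousToL2 (f : BoundedContinuousFunction (Icc (0 : ℝ) Real.pi) ℂ) :
    continuousToL2 f =ᵐ[muPi] fun t => f (projIcc 0 Real.pi Real.pi_pos.le t) :=
  BoundedContinuousFunction.coeFn_toLp (E := ℂ) 2 muPi ℂ
    (f.compContinuous ⟨projIcc 0 Real.pi Real.pi_pos.le, continuous_projIcc⟩)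

theorem ae_muPi_mem : ∀ᵐ t ∂muPi, t ∈ Icc 0 Real.pi := ae_restrict_mem measurableSet_Icc

section

variable {R : ℝ} {u : ℝ → ℝ} {g y y₁ p p₁ : ℝ → ℂ} {z : ℂ}

/-- Variation of constants. The Wronskian turns the terms from differentiating the two integrals
into `g` in the quasi-derivative, while in the derivative of the solution itself they cancel. -/
theorem sol_of_green (hy : IsOmega u z y y₁) (hp : IsPhi u z p p₁) (hW : y Real.pi ≠ 0)
    (hg : IntervalIntegrable g volume 0 Real.pi) :
    Sol u (fun t => z * (-(y Real.pi)⁻¹ * (y t * (∫ s in t..Real.pi, g s * p s) +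
          p t * ∫ s in (0 : ℝ)..t, g s * y s)) + g t)
      (fun t => -(y Real.pi)⁻¹ * (y t * (∫ s in t..Real.pi, g s * p s) +
          p t * ∫ s in (0 : ℝ)..t, g s * y s))
      fun t => -(y Real.pi)⁻¹ * (y₁ t * (∫ s in t..Real.pi, g s * p s) +
          p₁ t * ∫ s in (0 : ℝ)..t, g s * y s) := by
  have hgy : IntervalIntegrable (fun s => g s * y s) volume 0 Real.pi :=
    hg.mul_continuousOn (by rw [uIcc_zero_pi]; exact hy.continuousOn)
  have hgp : IntervalIntegrable (fun s => g s * p s) volume 0 Real.pi :=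
    hg.mul_continuousOn (by rw [uIcc_zero_pi]; exact hp.sol.deriv.continuousOn)
  have hB : HasACDeriv (fun t => ∫ s in (0 : ℝ)..t, g s * y s) fun s => g s * y s :=
    HasACDeriv.of_integral hgy (by simp)
  have hA : HasACDeriv (fun t => ∫ s in t..Real.pi, g s * p s) fun s => -(g s * p s) := by
    refine HasACDeriv.of_integral hgp.neg fun x hx => ?_
    rw [intervalIntegral.integral_neg, ← sub_eq_add_neg, eq_sub_iff_add_eq, add_comm]
    exact intervalIntegral.integral_add_adjacent_intervals
      (intervalIntegrable_sub hgp zero_mem_Icc_pi hx) (intervalIntegrable_sub hgp hx pi_mem_Icc_pi)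
  constructor
  · refine (((hy.sol.deriv.mul hA).add (hp.sol.deriv.mul hB)).const_mul (-(y Real.pi)⁻¹)).congr_deriv'
      fun t => ?_
    ring
  · refine (((hy.sol.deriv_quasi.mul hA).add (hp.sol.deriv_quasi.mul hB)).const_mul
      (-(y Real.pi)⁻¹)).congr_deriv ?_
    refine Eventually.of_forall fun t ht => ?_
    have hw := hy.wronskian hp (Ioo_subset_Icc_self ht)
    have hg' : g t = (y Real.pi)⁻¹ * (y t * p₁ t - y₁ t * p t) * g t := by
      rw [hw, inv_mul_cancel₀ hW, one_mul]
    linear_combination hg'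

theorem continuousOn_restrict {f : ℝ → ℂ} (hf : ContinuousOn f (Icc 0 Real.pi)) :
    Continuous fun t : Icc (0 : ℝ) Real.pi => f t := continuousOn_iff_continuous_domRestrict.1 hf

/-- The kernel `y(min) p(max)` is continuous, so the operator factors through `C[0, π]` and is
compact. Each value comes with its absolutely continuous representative `H`, to which the
differential equation applies. -/
theorem exists_green_operator (hy : IsOmega u z y y₁) (hp : IsPhi u z p p₁)
    (hW : y Real.pi ≠ 0) :
    ∃ T : Lp ℂ 2 muPi →L[ℂ] Lp ℂ 2 muPi, IsCompactOperator T ∧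
      ∀ g : Lp ℂ 2 muPi, ∃ H H₁ : ℝ → ℂ, Sol u (fun t => z * H t + g t) H H₁ ∧ H 0 = 0 ∧
        H Real.pi = 0 ∧ T g =ᵐ[muPi] H := by
  set k : C(Icc (0 : ℝ) Real.pi × Icc (0 : ℝ) Real.pi, ℂ) :=
    -- The kernel is conjugated because the inner product is conjugate linear in its first argument.
    ⟨fun q => conj (-(y Real.pi)⁻¹ * (y (min q.1 q.2 : Icc (0 : ℝ) Real.pi) *
      p (max q.1 q.2 : Icc (0 : ℝ) Real.pi))), by
      have h1 := (continuousOn_restrict hy.continuousOn).comp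
        (continuous_fst.min continuous_snd : Continuous fun q : Icc (0 : ℝ) Real.pi ×
          Icc (0 : ℝ) Real.pi => min q.1 q.2)
      have h2 := (continuousOn_restrict hp.sol.deriv.continuousOn).comp
        (continuous_fst.max continuous_snd : Continuous fun q : Icc (0 : ℝ) Real.pi ×
          Icc (0 : ℝ) Real.pi => max q.1 q.2)
      exact Complex.continuous_conj.comp (continuous_const.mul (h1.mul h2))⟩ with hk
  set κ : C(Icc (0 : ℝ) Real.pi, Lp ℂ 2 muPi) :=
    ⟨fun t => continuousToL2 (BoundedContinuousFunction.mkOfCompact (k.curry t)), by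
      refine continuousToL2.continuous.comp ?_
      exact (ContinuousMap.isometryEquivBoundedOfCompact _ ℂ).continuous.comp k.curry.continuous⟩
    with hκ
  refine ⟨continuousToL2.comp (pairing κ), ?_, fun g => ?_⟩
  · exact (isCompactOperator_pairing κ).clm_comp continuousToL2
  have hg2 : MemLp g 2 muPi := Lp.memLp g
  have hg : IntervalIntegrable g volume 0 Real.pi :=
    intervalIntegrable_iff_muPi.2 (hg2.integrable (by norm_num))
  refine ⟨_, _, sol_of_green hy hp hW hg, ?_, ?_, ?_⟩
  · simp [hy.left]
  · simp [hp.right]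
  · have hgy : IntervalIntegrable (fun s => g s * y s) volume 0 Real.pi :=
      hg.mul_continuousOn (by rw [uIcc_zero_pi]; exact hy.continuousOn)
    have hgp : IntervalIntegrable (fun s => g s * p s) volume 0 Real.pi :=
      hg.mul_continuousOn (by rw [uIcc_zero_pi]; exact hp.sol.deriv.continuousOn)
    filter_upwards [coeFn_continuousToL2 (pairing κ g), ae_muPi_mem] with t ht htI
    rw [ContinuousLinearMap.comp_apply, ht, pairing_apply, L2.inner_def]
    have h1 : ∫ s, inner ℂ (κ (projIcc 0 Real.pi Real.pi_pos.le t) s) (g s) ∂muPi =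
        ∫ s in (0 : ℝ)..Real.pi, -(y Real.pi)⁻¹ * (y (min t s) * p (max t s)) * g s := by
      rw [intervalIntegral_eq_muPi]
      refine integral_congr_ae ?_
      filter_upwards [coeFn_continuousToL2 (BoundedContinuousFunction.mkOfCompact
        (k.curry (projIcc 0 Real.pi Real.pi_pos.le t))), ae_muPi_mem] with s hs hsI
      rw [hκ]
      simp only [ContinuousMap.coe_mk]
      rw [hs, projIcc_of_mem _ htI, projIcc_of_mem _ hsI]
      simp only [BoundedContinuousFunction.mkOfCompact_apply, ContinuousMap.curry_apply, hk,
        ContinuousMap.coe_mk, RCLike.inner_apply, Complex.conj_conj]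
      rw [mul_comm]
      rcases le_total t s with h | h
      · have h' : (⟨t, htI⟩ : Icc (0 : ℝ) Real.pi) ≤ ⟨s, hsI⟩ := h
        rw [min_eq_left h, max_eq_right h, min_eq_left h', max_eq_right h']
      · have h' : (⟨s, hsI⟩ : Icc (0 : ℝ) Real.pi) ≤ ⟨t, htI⟩ := h
        rw [min_eq_right h, max_eq_left h, min_eq_right h', max_eq_left h']
    rw [h1]
    have h2 : ∫ s in (0 : ℝ)..t, -(y Real.pi)⁻¹ * (y (min t s) * p (max t s)) * g s =
        -(y Real.pi)⁻¹ * p t * ∫ s in (0 : ℝ)..t, g s * y s := by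
      rw [← intervalIntegral.integral_const_mul]
      refine intervalIntegral.integral_congr fun s hs => ?_
      rw [uIcc_of_le htI.1] at hs
      rw [min_eq_right hs.2, max_eq_left hs.2]
      ring
    have h3 : ∫ s in t..Real.pi, -(y Real.pi)⁻¹ * (y (min t s) * p (max t s)) * g s =
        -(y Real.pi)⁻¹ * y t * ∫ s in t..Real.pi, g s * p s := by
      rw [← intervalIntegral.integral_const_mul]
      refine intervalIntegral.integral_congr fun s hs => ?_
      rw [uIcc_of_le htI.2] at hs
      rw [min_eq_left hs.1, max_eq_right hs.1]
      ring
    have i2 : IntervalIntegrable (fun s => -(y Real.pi)⁻¹ * (y (min t s) * p (max t s)) * g s)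
        volume 0 t := by
      refine ((intervalIntegrable_sub hgy zero_mem_Icc_pi htI).const_mul
        (-(y Real.pi)⁻¹ * p t)).congr fun s hs => ?_
      rw [uIoc_of_le htI.1] at hs
      rw [min_eq_right hs.2, max_eq_left hs.2]
      ring
    have i3 : IntervalIntegrable (fun s => -(y Real.pi)⁻¹ * (y (min t s) * p (max t s)) * g s)
        volume t Real.pi := by
      refine ((intervalIntegrable_sub hgp htI pi_mem_Icc_pi).const_mul
        (-(y Real.pi)⁻¹ * y t)).congr fun s hs => ?_
      rw [uIoc_of_le htI.2] at hs
      rw [min_eq_left hs.1.le, max_eq_right hs.1.le]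
      ring
    rw [← intervalIntegral.integral_add_adjacent_intervals i2 i3, h2, h3]
    ring

end


/-! ### Orthonormal eigensystems and their completeness -/

/-- All Dirichlet eigenvalues `lam i`, each listed once, with real normalized eigenfunctions `e i`
and their quasi-derivatives `e₁ i`. -/
structure EigenSystem (u : ℝ → ℝ) (lam : ℕ → ℝ) (e e₁ : ℕ → ℝ → ℂ) : Prop where
  sol : ∀ i, Sol u (fun x => (lam i : ℂ) * e i x) (e i) (e₁ i)
  left : ∀ i, e i 0 = 0
  right : ∀ i, e i Real.pi = 0
  real : ∀ i, ∀ x ∈ Icc 0 Real.pi, conj (e i x) = e i x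
  injective : Function.Injective lam
  normalized : ∀ i, ∫ x in (0 : ℝ)..Real.pi, ‖e i x‖ ^ 2 = 1
  exhaustive : ∀ (l : ℝ) (y y₁ : ℝ → ℂ), IsOmega u l y y₁ → y Real.pi = 0 → ∃ i, lam i = l

theorem memLp_of_continuousOn {f : ℝ → ℂ} (hf : ContinuousOn f (Icc 0 Real.pi)) :
    MemLp f 2 muPi := by
  obtain ⟨C, hC⟩ := isCompact_Icc.exists_bound_of_continuousOn hf
  refine MemLp.of_bound (hf.aestronglyMeasurable measurableSet_Icc) C ?_
  filter_upwards [ae_muPi_mem] with x hx using hC x hx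

theorem eqOn_of_ae_eq {f g : ℝ → ℂ} (hf : ContinuousOn f (Icc 0 Real.pi))
    (hg : ContinuousOn g (Icc 0 Real.pi)) (h : f =ᵐ[muPi] g) : EqOn f g (Icc 0 Real.pi) :=
  Measure.eqOn_Icc_of_ae_eq volume Real.pi_pos.ne h hf hg

theorem ae_of_ae_muPi {p : ℝ → Prop} (h : ∀ᵐ x ∂muPi, p x) : ∀ᵐ x, x ∈ Ioo 0 Real.pi → p x := by
  filter_upwards [(ae_restrict_iff' measurableSet_Icc).1 h] with x hx hxI
  exact hx (Ioo_subset_Icc_self hxI)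

theorem ae_muPi_of_ae {p : ℝ → Prop} (h : ∀ᵐ x, x ∈ Ioo 0 Real.pi → p x) : ∀ᵐ x ∂muPi, p x := by
  rw [muPi, restrict_Ioo_eq_restrict_Icc.symm, ae_restrict_iff' measurableSet_Ioo]
  exact h

section

variable {R : ℝ} {u : ℝ → ℝ} {g g' y y₁ : ℝ → ℂ} {z : ℂ}

theorem Sol.congr_rhs_ae (h : Sol u g y y₁) (hg : g =ᵐ[muPi] g') : Sol u g' y y₁ := by
  refine ⟨h.deriv, h.deriv_quasi.congr_deriv ?_⟩
  filter_upwards [ae_of_ae_muPi hg] with x hx hxI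
  rw [hx hxI]

theorem HasACDeriv.ae_eq_zero {F f : ℝ → ℂ} (h : HasACDeriv F f)
    (hF : ∀ x ∈ Icc 0 Real.pi, F x = 0) : ∀ᵐ x ∂muPi, f x = 0 := by
  refine ae_muPi_of_ae ?_
  filter_upwards [h.deriv] with x hx hxI
  refine (hx hxI).unique ((hasDerivAt_const x (0 : ℂ)).congr_of_eventuallyEq ?_)
  filter_upwards [Ioo_mem_nhds hxI.1 hxI.2] with t ht using hF t (Ioo_subset_Icc_self ht)

/-- This is the injectivity of Green's operator: a vanishing solution has vanishing
quasi-derivative, hence vanishing right-hand side. -/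
theorem Sol.rhs_ae_eq_zero (h : Sol u g y y₁) (hy : ∀ x ∈ Icc 0 Real.pi, y x = 0) :
    g =ᵐ[muPi] 0 := by
  have h1 : y₁ =ᵐ[muPi] fun _ => 0 := by
    filter_upwards [h.deriv.ae_eq_zero hy, ae_muPi_mem] with x hx hxI
    rwa [hy x hxI, mul_zero, add_zero] at hx
  have h2 := eqOn_of_ae_eq h.deriv_quasi.continuousOn continuousOn_const h1
  filter_upwards [h.deriv_quasi.ae_eq_zero h2, ae_muPi_mem] with x hx hxI
  rw [hy x hxI, h2 hxI] at hx
  simpa using hx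

theorem Sol.eq_mul_omega (hu : IsPotential R u) (h : Sol u (fun x => z * y x) y y₁) (h0 : y 0 = 0)
    {w w₁ : ℝ → ℂ} (hw : IsOmega u z w w₁) {x : ℝ} (hx : x ∈ Icc 0 Real.pi) :
    y x = y₁ 0 * w x ∧ y₁ x = y₁ 0 * w₁ x := by
  have h' : Sol u (fun x => z * (y₁ 0 * w x)) (fun x => y₁ 0 * w x) fun x => y₁ 0 * w₁ x :=
    (hw.sol.const_mul (y₁ 0)).congr_rhs fun x _ => by ring
  exact h.unique hu h' zero_mem_Icc_pi (by simp [h0, hw.left]) (by simp [hw.left_quasi]) hx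

end

section

variable {R : ℝ} {u : ℝ → ℝ} {lam : ℝ}

/-- Lagrange's identity for two Dirichlet solutions has no boundary terms, and `lam` is real. -/
theorem isSymmetric_of_green {T : Lp ℂ 2 muPi →L[ℂ] Lp ℂ 2 muPi}
    (hT : ∀ g : Lp ℂ 2 muPi, ∃ H H₁ : ℝ → ℂ, Sol u (fun t => (lam : ℂ) * H t + g t) H H₁ ∧
      H 0 = 0 ∧ H Real.pi = 0 ∧ T g =ᵐ[muPi] H) : T.IsSymmetric := by
  intro f g
  obtain ⟨F, F₁, hF, hF0, hFp, hFT⟩ := hT f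
  obtain ⟨G, G₁, hG, hG0, hGp, hGT⟩ := hT g
  have h := (hF.star.lagrange hG).integral_eq zero_mem_Icc_pi pi_mem_Icc_pi
  rw [hF0, hFp, hG0, hGp] at h
  simp only [map_zero, zero_mul, mul_zero, sub_self] at h
  rw [intervalIntegral_eq_muPi] at h
  rw [ContinuousLinearMap.coe_coe, L2.inner_def, L2.inner_def, ← sub_eq_zero, ← integral_sub
    (L2.integrable_inner _ _) (L2.integrable_inner _ _), ← neg_eq_zero, ← integral_neg, ← h]
  refine integral_congr_ae ?_
  filter_upwards [hFT, hGT] with x h1 h2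
  simp only [RCLike.inner_apply, h1, h2, map_add, map_mul, Complex.conj_ofReal]
  ring

end

namespace EigenSystem

variable {R : ℝ} {u : ℝ → ℝ} {lam : ℕ → ℝ} {e e₁ : ℕ → ℝ → ℂ}

theorem continuousOn (h : EigenSystem u lam e e₁) (i : ℕ) : ContinuousOn (e i) (Icc 0 Real.pi) :=
  (h.sol i).deriv.continuousOn

theorem integral_mul (h : EigenSystem u lam e e₁) (i j : ℕ) :
    ∫ x in (0 : ℝ)..Real.pi, e i x * e j x = if i = j then 1 else 0 := by
  split_ifs with hij
  · subst hij
    have : ∫ x in (0 : ℝ)..Real.pi, e i x * e i x =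
        ∫ x in (0 : ℝ)..Real.pi, ((‖e i x‖ ^ 2 : ℝ) : ℂ) := by
      refine intervalIntegral.integral_congr fun x hx => ?_
      rw [uIcc_zero_pi] at hx
      push_cast
      rw [← Complex.conj_mul', h.real i x hx]
    rw [this, intervalIntegral.integral_ofReal, h.normalized i, Complex.ofReal_one]
  · have h1 := ((h.sol i).lagrange (h.sol j)).integral_eq zero_mem_Icc_pi pi_mem_Icc_pi
    rw [h.left, h.left, h.right, h.right] at h1
    have h2 : ((lam i : ℂ) - lam j) * ∫ x in (0 : ℝ)..Real.pi, e i x * e j x = 0 := by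
      rw [← intervalIntegral.integral_const_mul]
      simp only [zero_mul, mul_zero, sub_self] at h1
      rw [← h1]
      refine intervalIntegral.integral_congr fun x _ => ?_
      ring
    refine (mul_eq_zero.1 h2).resolve_left ?_
    rw [sub_eq_zero]
    exact fun h3 => hij (h.injective (Complex.ofReal_injective h3))

theorem memLp (h : EigenSystem u lam e e₁) (i : ℕ) : MemLp (e i) 2 muPi :=
  memLp_of_continuousOn (h.continuousOn i)

/-- The eigenfunctions as elements of `L₂`. -/
noncomputable def vec (h : EigenSystem u lam e e₁) (i : ℕ) : Lp ℂ 2 muPi := (h.memLp i).toLp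

theorem coeFn_vec (h : EigenSystem u lam e e₁) (i : ℕ) : h.vec i =ᵐ[muPi] e i :=
  (h.memLp i).coeFn_toLp

theorem inner_vec (h : EigenSystem u lam e e₁) (i : ℕ) (f : Lp ℂ 2 muPi) :
    inner ℂ (h.vec i) f = ∫ x in (0 : ℝ)..Real.pi, f x * e i x := by
  rw [L2.inner_def, intervalIntegral_eq_muPi]
  refine integral_congr_ae ?_
  filter_upwards [h.coeFn_vec i, ae_muPi_mem] with x hx hxI
  rw [hx, RCLike.inner_apply, h.real i x hxI]

theorem orthonormal (h : EigenSystem u lam e e₁) : Orthonormal ℂ h.vec := by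
  rw [orthonormal_iff_ite]
  intro i j
  rw [h.inner_vec, intervalIntegral_eq_muPi]
  have : ∫ x, h.vec j x * e i x ∂muPi = ∫ x, e i x * e j x ∂muPi := by
    refine integral_congr_ae ?_
    filter_upwards [h.coeFn_vec j] with x hx
    rw [hx, mul_comm]
  rw [this, ← intervalIntegral_eq_muPi, h.integral_mul]

theorem quasi_zero_ne_zero (h : EigenSystem u lam e e₁) (hu : IsPotential R u) (i : ℕ) :
    e₁ i 0 ≠ 0 := by
  intro h0
  have h1 := h.normalized i
  have : ∫ x in (0 : ℝ)..Real.pi, ‖e i x‖ ^ 2 = ∫ x in (0 : ℝ)..Real.pi, (0 : ℝ) := by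
    refine intervalIntegral.integral_congr fun x hx => ?_
    rw [uIcc_zero_pi] at hx
    simp [((h.sol i).eq_zero hu zero_mem_Icc_pi (h.left i) h0 hx).1]
  rw [this] at h1
  simp at h1

/-- Here `T` inverts the operator shifted by `l`, so an eigenvector with `μ ≠ 0` solves the
homogeneous equation at `l + μ⁻¹`. Unless it vanishes, that number is a real Dirichlet eigenvalue,
and the vector is a multiple of some `e i`. For `μ = 0` the injectivity of `T` applies. -/
theorem eigenspace_le (h : EigenSystem u lam e e₁) (hu : IsPotential R u) {l : ℝ}
    {T : Lp ℂ 2 muPi →L[ℂ] Lp ℂ 2 muPi}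
    (hT : ∀ g : Lp ℂ 2 muPi, ∃ H H₁ : ℝ → ℂ, Sol u (fun t => (l : ℂ) * H t + g t) H H₁ ∧
      H 0 = 0 ∧ H Real.pi = 0 ∧ T g =ᵐ[muPi] H) (μ : ℂ) :
    Module.End.eigenspace (T : Module.End ℂ (Lp ℂ 2 muPi)) μ ≤
      Submodule.span ℂ (Set.range h.vec) := by
  intro v hv
  have hv' : T v = μ • v := Module.End.mem_eigenspace_iff.1 hv
  obtain ⟨H, H₁, hH, h0, hpi, hTH⟩ := hT v
  have hz : (∀ x ∈ Icc 0 Real.pi, H x = 0) → v ∈ Submodule.span ℂ (Set.range h.vec) := by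
    intro hz
    have h1 := hH.rhs_ae_eq_zero hz
    have : v = 0 := by
      rw [Lp.eq_zero_iff_ae_eq_zero]
      filter_upwards [h1, ae_muPi_mem] with x hx hxI
      rw [hz x hxI] at hx
      simpa using hx
    rw [this]
    exact zero_mem _
  have hsm : H =ᵐ[muPi] fun x => μ * v x := by
    rw [hv'] at hTH
    filter_upwards [hTH, Lp.coeFn_smul μ v] with x h1 h2
    rw [← h1, h2]; rfl
  rcases eq_or_ne μ 0 with rfl | hμ
  · refine hz (eqOn_of_ae_eq hH.deriv.continuousOn continuousOn_const ?_)
    filter_upwards [hsm] with x hx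
    rw [hx, zero_mul]
  · have hHz : Sol u (fun x => ((l : ℂ) + μ⁻¹) * H x) H H₁ := by
      refine hH.congr_rhs_ae ?_
      filter_upwards [hsm] with x hx
      have : v x = μ⁻¹ * H x := by rw [hx, inv_mul_cancel_left₀ hμ]
      rw [this, add_mul]
    obtain ⟨om, om₁, hom⟩ := hu.exists_omega
    set z := (l : ℂ) + μ⁻¹ with hzdef
    have hform := fun x hx => (hHz.eq_mul_omega hu h0 (hom z) (x := x) hx).1
    rcases eq_or_ne (H₁ 0) 0 with h10 | h10
    · exact hz fun x hx => by rw [hform x hx, h10, zero_mul]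
    · have homz : om z Real.pi = 0 := by
        have := hform _ pi_mem_Icc_pi
        rw [hpi] at this
        exact (mul_eq_zero.1 this.symm).resolve_left h10
      have hzr := (hom z).conj_eq_of_zero hu homz
      rw [Complex.conj_eq_iff_re] at hzr
      obtain ⟨i, hi⟩ := h.exhaustive z.re _ _ (by rw [hzr]; exact hom z) homz
      have hsi := h.sol i
      rw [hi, hzr] at hsi
      have hei := fun x hx => (hsi.eq_mul_omega hu (h.left i) (hom z) (x := x) hx).1
      have hne := h.quasi_zero_ne_zero hu i
      have : v = (μ⁻¹ * H₁ 0 * (e₁ i 0)⁻¹) • h.vec i := by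
        refine Lp.ext ?_
        filter_upwards [hsm, h.coeFn_vec i, ae_muPi_mem,
          Lp.coeFn_smul (μ⁻¹ * H₁ 0 * (e₁ i 0)⁻¹) (h.vec i)] with x h1 h2 hxI h3
        rw [h3, Pi.smul_apply, h2, hei x hxI, smul_eq_mul]
        rw [hform x hxI] at h1
        field_simp
        linear_combination -h1
      rw [this]
      exact Submodule.smul_mem _ _ (Submodule.subset_span ⟨i, rfl⟩)

/-- The spectral theorem for compact symmetric operators, applied to Green's operator at `-24R⁴`, a
point where the characteristic function does not vanish. -/
theorem span_orthogonal_eq_bot (h : EigenSystem u lam e e₁) (hR : 0 < R) (hu : IsPotential R u) :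
    (Submodule.span ℂ (Set.range h.vec))ᗮ = ⊥ := by
  obtain ⟨om, om₁, hom⟩ := hu.exists_omega
  obtain ⟨ph, ph₁, hph⟩ := hu.exists_phi
  obtain ⟨T, hTc, hT⟩ := exists_green_operator (hom ((-(24 * R ^ 4) : ℝ) : ℂ)) (hph _)
    ((hom _).ne_zero_of_le hR hu le_rfl ⟨Real.pi_pos, le_rfl⟩)
  have hsym := isSymmetric_of_green hT
  rw [eq_bot_iff, ← ContinuousLinearMap.orthogonalComplement_iSup_eigenspaces_eq_bot hTc hsym]
  exact Submodule.orthogonal_le (iSup_le fun μ => h.eigenspace_le hu hT μ)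

/-- The eigenfunctions form an orthonormal basis of `L₂`. -/
noncomputable def basis (h : EigenSystem u lam e e₁) (hR : 0 < R) (hu : IsPotential R u) :
    HilbertBasis ℕ ℂ (Lp ℂ 2 muPi) :=
  HilbertBasis.mkOfOrthogonalEqBot h.orthonormal (h.span_orthogonal_eq_bot hR hu)

theorem coe_basis (h : EigenSystem u lam e e₁) (hR : 0 < R) (hu : IsPotential R u) :
    ⇑(h.basis hR hu) = h.vec := HilbertBasis.coe_mkOfOrthogonalEqBot _ _

end EigenSystem


/-! ### The free operator and the sine system -/

theorem sol_free_sin (c ρ : ℂ) : Sol (fun _ => 0) (fun x => ρ ^ 2 * (c * Complex.sin (ρ * x)))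
    (fun x => c * Complex.sin (ρ * x)) fun x => c * (ρ * Complex.cos (ρ * x)) := by
  have hl : ∀ x : ℝ, HasDerivAt (fun x : ℝ => ρ * (x : ℂ)) ρ x := fun x => by
    simpa using (Complex.ofRealCLM.hasDerivAt (x := x)).const_mul ρ
  have hcl : ContDiff ℝ 1 fun x : ℝ => ρ * (x : ℂ) :=
    contDiff_const.mul Complex.ofRealCLM.contDiff
  constructor
  · refine HasACDeriv.congr_deriv' (HasACDeriv.of_contDiff
      (f := fun x => c * (Complex.cos (ρ * x) * ρ)) ?_ fun x => ?_) fun x => ?_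
    · exact contDiff_const.mul ((Complex.contDiff_sin.restrict_scalars ℝ).comp hcl)
    · exact (((Complex.hasDerivAt_sin (ρ * x)).comp x (hl x))).const_mul c
    · push_cast; ring
  · refine HasACDeriv.congr_deriv' (HasACDeriv.of_contDiff
      (f := fun x => c * (ρ * (-Complex.sin (ρ * x) * ρ))) ?_ fun x => ?_) fun x => ?_
    · exact contDiff_const.mul (contDiff_const.mul
        ((Complex.contDiff_cos.restrict_scalars ℝ).comp hcl))
    · exact (((Complex.hasDerivAt_cos (ρ * x)).comp x (hl x)).const_mul ρ).const_mul c
    · simp; ring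

theorem IsOmega.free_eq {ρ : ℂ} {y y₁ : ℝ → ℂ} (h : IsOmega (fun _ => 0) (ρ ^ 2) y y₁)
    (hρ : ρ ≠ 0) {x : ℝ} (hx : x ∈ Icc 0 Real.pi) : y x = ρ⁻¹ * Complex.sin (ρ * x) :=
  (h.sol.unique IsPotential.zero (sol_free_sin ρ⁻¹ ρ) zero_mem_Icc_pi (by simp [h.left])
    (by simp [h.left_quasi, hρ]) hx).1

theorem sol_free_id : Sol (fun _ => 0) (fun x => 0 * (x : ℂ)) (fun x => (x : ℂ)) fun _ => 1 := by
  constructor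
  · refine HasACDeriv.congr_deriv' (HasACDeriv.of_contDiff (f := fun _ => (1 : ℂ))
      Complex.ofRealCLM.contDiff fun x => ?_) fun x => ?_
    · exact Complex.ofRealCLM.hasDerivAt (x := x)
    · simp
  · exact (HasACDeriv.const 1).congr_deriv' fun x => by simp

/-- A complex square root of `l` treats all signs at once; only `l = 0`, where the solution is `x`,
needs its own argument. Indices start at `0`, hence the eigenvalue `(k + 1)²`. -/
theorem IsOmega.free_exists_nat {l : ℝ} {y y₁ : ℝ → ℂ} (h : IsOmega (fun _ => 0) l y y₁)
    (h0 : y Real.pi = 0) : ∃ k : ℕ, ((k : ℝ) + 1) ^ 2 = l := by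
  obtain ⟨ρ, hρ⟩ := IsAlgClosed.exists_pow_nat_eq (l : ℂ) two_pos
  rw [← hρ] at h
  have hpi : (Real.pi : ℂ) ≠ 0 := Complex.ofReal_ne_zero.2 Real.pi_ne_zero
  rcases eq_or_ne ρ 0 with rfl | hρ0
  · exfalso
    have hs := h.sol
    simp only [ne_eq, OfNat.ofNat_ne_zero, not_false_eq_true, zero_pow] at hs
    have := (hs.unique IsPotential.zero sol_free_id zero_mem_Icc_pi (by simp [h.left])
      (by simp [h.left_quasi]) pi_mem_Icc_pi).1
    rw [h0] at this
    exact hpi this.symm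
  · have h1 := h.free_eq hρ0 pi_mem_Icc_pi
    rw [h0] at h1
    have h2 := (mul_eq_zero.1 h1.symm).resolve_left (inv_ne_zero hρ0)
    obtain ⟨k, hk⟩ := Complex.sin_eq_zero_iff.1 h2
    have hk' : ρ = k := mul_right_cancel₀ hpi hk
    have hk0 : k ≠ 0 := by rintro rfl; simp at hk'; exact hρ0 hk'
    refine ⟨k.natAbs - 1, ?_⟩
    have h3 : 1 ≤ k.natAbs := Int.natAbs_pos.2 hk0
    rw [Nat.cast_sub h3, Nat.cast_one, sub_add_cancel, Nat.cast_natAbs, Int.cast_abs, sq_abs]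
    rw [hk'] at hρ
    exact_mod_cast hρ

/-- The normalized sine functions `√(2/π) sin (k + 1) x`. -/
noncomputable def sine (k : ℕ) (x : ℝ) : ℂ :=
  (Real.sqrt (2 / Real.pi) : ℂ) * Complex.sin (((k : ℂ) + 1) * x)

/-- The derivatives of the normalized sine functions. -/
noncomputable def sineDeriv (k : ℕ) (x : ℝ) : ℂ :=
  (Real.sqrt (2 / Real.pi) : ℂ) * (((k : ℂ) + 1) * Complex.cos (((k : ℂ) + 1) * x))

theorem sine_eq_ofReal (k : ℕ) (x : ℝ) :
    sine k x = ((Real.sqrt (2 / Real.pi) * Real.sin ((k + 1) * x) : ℝ) : ℂ) := by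
  simp [sine]

theorem sineDeriv_eq_ofReal (k : ℕ) (x : ℝ) : sineDeriv k x =
    ((Real.sqrt (2 / Real.pi) * ((k + 1) * Real.cos ((k + 1) * x)) : ℝ) : ℂ) := by
  simp [sineDeriv]

theorem integral_norm_sine_sq (k : ℕ) : ∫ x in (0 : ℝ)..Real.pi, ‖sine k x‖ ^ 2 = 1 := by
  have h1 : ∀ x : ℝ, ‖sine k x‖ ^ 2 = 2 / Real.pi * Real.sin (((k : ℝ) + 1) * x) ^ 2 := fun x => by
    rw [sine_eq_ofReal, Complex.norm_real, Real.norm_eq_abs, sq_abs, mul_pow,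
      Real.sq_sqrt (by positivity)]
  simp_rw [h1]
  have hk : ((k : ℝ) + 1) ≠ 0 := by positivity
  rw [intervalIntegral.integral_const_mul,
    intervalIntegral.integral_comp_mul_left (fun x => Real.sin x ^ 2) hk, integral_sin_sq]
  have h2 : Real.sin (((k : ℝ) + 1) * Real.pi) = 0 := by
    have := Real.sin_nat_mul_pi (k + 1)
    push_cast at this
    exact this
  rw [h2]
  have := Real.pi_ne_zero
  simp
  field_simp

theorem sineSystem :
    EigenSystem (fun _ => 0) (fun k => ((k : ℝ) + 1) ^ 2) sine sineDeriv where
  sol k := by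
    have := sol_free_sin (Real.sqrt (2 / Real.pi) : ℂ) ((k : ℂ) + 1)
    push_cast
    exact this
  left k := by simp [sine]
  right k := by
    have := Complex.sin_nat_mul_pi (k + 1)
    push_cast at this
    simp [sine, this]
  real k x _ := by rw [sine_eq_ofReal, Complex.conj_ofReal]
  injective a b hab := by
    have h1 : (a : ℝ) + 1 = b + 1 := (sq_eq_sq₀ (by positivity) (by positivity)).1 hab
    exact_mod_cast add_right_cancel h1
  normalized := integral_norm_sine_sq
  exhaustive l y y₁ h h0 := h.free_exists_nat h0

theorem norm_sine_le (k : ℕ) (x : ℝ) : ‖sine k x‖ ≤ 1 := by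
  rw [sine_eq_ofReal, Complex.norm_real, Real.norm_eq_abs, abs_mul,
    abs_of_nonneg (Real.sqrt_nonneg _)]
  have h1 : Real.sqrt (2 / Real.pi) ≤ 1 := by
    rw [Real.sqrt_le_one, div_le_one Real.pi_pos]
    linarith [Real.pi_gt_three]
  exact mul_le_one₀ h1 (abs_nonneg _) (Real.abs_sin_le_one _)

/-- The free characteristic function is `sin(ρπ)/ρ`, which is not small anywhere in the window from
which `exists_gap` picks `σ`. One line can therefore serve both operators. -/
theorem IsOmega.free_gap {m : ℕ} {σ : ℝ} {y y₁ : ℝ → ℂ} (h : IsOmega (fun _ => 0) ((σ : ℂ) ^ 2) y y₁)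
    (hσ : σ ∈ Icc ((m : ℝ) + 1 / 4) (m + 3 / 4)) : 1 / 2 ≤ σ * ‖y Real.pi‖ := by
  have hσ0 : 0 < σ := lt_of_lt_of_le (by positivity) hσ.1
  rw [h.free_eq (Complex.ofReal_ne_zero.2 hσ0.ne') pi_mem_Icc_pi, norm_mul, norm_inv,
    Complex.norm_real, Real.norm_of_nonneg hσ0.le, mul_inv_cancel_left₀ hσ0.ne',
    ← Complex.ofReal_mul, ← Complex.ofReal_sin, Complex.norm_real, Real.norm_eq_abs]
  have h1 : Real.sin (σ * Real.pi) = (-1) ^ m * Real.sin ((σ - m) * Real.pi) := by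
    rw [← Real.sin_add_nat_mul_pi]; congr 1; ring
  rw [h1, abs_mul, abs_pow, abs_neg, abs_one, one_pow, one_mul]
  refine le_trans ?_ (le_abs_self _)
  have hpi := Real.pi_pos
  rw [← Real.cos_pi_div_two_sub]
  have h2 : |Real.pi / 2 - (σ - m) * Real.pi| ≤ Real.pi / 3 := by
    rw [abs_le]
    constructor <;> nlinarith [hσ.1, hσ.2]
  rw [← Real.cos_abs, ← Real.cos_pi_div_three]
  exact Real.cos_le_cos_of_nonneg_of_le_pi (abs_nonneg _) (by linarith) h2


/-! ### The contour integral on a vertical line -/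

/-- A point of the vertical line `Re ρ = σ`. -/
noncomputable def rho (σ τ : ℝ) : ℂ := σ + τ * Complex.I

theorem rho_re (σ τ : ℝ) : (rho σ τ).re = σ := by simp [rho]

theorem rho_im (σ τ : ℝ) : (rho σ τ).im = τ := by simp [rho]

theorem hasDerivAt_rho (σ τ : ℝ) : HasDerivAt (rho σ) Complex.I τ := by
  have := ((Complex.ofRealCLM.hasDerivAt (x := τ)).mul_const Complex.I).const_add (σ : ℂ)
  simp only [Complex.ofRealCLM_apply, Complex.ofReal_one, one_mul] at this
  exact this

theorem continuous_rho (σ : ℝ) : Continuous (rho σ) :=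
  continuous_iff_continuousAt.2 fun τ => (hasDerivAt_rho σ τ).continuousAt

theorem rho_sq_re (σ τ : ℝ) : (rho σ τ ^ 2).re = σ ^ 2 - τ ^ 2 := by
  rw [sq, Complex.mul_re, rho_re, rho_im]; ring

theorem rho_sq_im (σ τ : ℝ) : (rho σ τ ^ 2).im = 2 * σ * τ := by
  rw [sq, Complex.mul_im, rho_re, rho_im]; ring

theorem rho_neg (σ τ : ℝ) : rho σ (-τ) = conj (rho σ τ) := by
  apply Complex.ext <;> simp [rho]

section

variable {σ a : ℝ}

theorem hasDerivAt_sub_rho_sq (σ a τ : ℝ) :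
    HasDerivAt (fun τ => (a : ℂ) - rho σ τ ^ 2) (-(2 * rho σ τ * Complex.I)) τ := by
  have := ((hasDerivAt_rho σ τ).pow 2).const_sub (a : ℂ)
  simpa using this

theorem sub_rho_sq_ne_zero (hσ : 0 < σ) (ha : a ≠ σ ^ 2) (τ : ℝ) : (a : ℂ) - rho σ τ ^ 2 ≠ 0 := by
  intro h
  have him := congrArg Complex.im h
  have hre := congrArg Complex.re h
  rw [Complex.sub_im, rho_sq_im, Complex.ofReal_im, Complex.zero_im] at him
  rw [Complex.sub_re, rho_sq_re, Complex.ofReal_re, Complex.zero_re] at hre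
  have hτ : τ = 0 := by
    have : σ * τ = 0 := by linarith
    exact (mul_eq_zero.1 this).resolve_left hσ.ne'
  rw [hτ] at hre
  exact ha (by linarith)

/-- The integrand of the contour integral on the vertical line. -/
noncomputable def contourKernel (σ a τ : ℝ) : ℂ :=
  2 * rho σ τ * Complex.I / ((a : ℂ) - rho σ τ ^ 2)

theorem continuous_contourKernel (hσ : 0 < σ) (ha : a ≠ σ ^ 2) :
    Continuous (contourKernel σ a) := by
  have := continuous_rho σ
  exact Continuous.div (by fun_prop) (by fun_prop) (sub_rho_sq_ne_zero hσ ha)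

/-- The primitive is `-log(a - ρ²)`, in the principal branch because `Re(a - ρ²) > 0`. Its end
values are conjugate, so only the argument survives. -/
theorem integral_contourKernel_of_gt (hσ : 0 < σ) (ha : σ ^ 2 < a) (T : ℝ) :
    ∫ τ in (-T)..T, contourKernel σ a τ =
      -(2 * ((Complex.arg ((a : ℂ) - rho σ T ^ 2) : ℝ) : ℂ) * Complex.I) := by
  have hre : ∀ τ, 0 < ((a : ℂ) - rho σ τ ^ 2).re := fun τ => by
    rw [Complex.sub_re, rho_sq_re, Complex.ofReal_re]; nlinarith [sq_nonneg τ]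
  have hd : ∀ τ, HasDerivAt (fun τ => -Complex.log ((a : ℂ) - rho σ τ ^ 2))
      (contourKernel σ a τ) τ := fun τ => by
    have := ((hasDerivAt_sub_rho_sq σ a τ).clog_real (Or.inl (hre τ))).neg
    refine this.congr_deriv ?_
    rw [contourKernel]; ring
  rw [intervalIntegral.integral_eq_sub_of_hasDerivAt (fun τ _ => hd τ)
    ((continuous_contourKernel hσ ha.ne').intervalIntegrable _ _)]
  have hc : (a : ℂ) - rho σ (-T) ^ 2 = conj ((a : ℂ) - rho σ T ^ 2) := by
    rw [rho_neg]; simp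
  rw [hc, Complex.log_conj _ ?_]
  · apply Complex.ext
    · simp
    · simp [Complex.log_im]; ring
  · rw [ne_eq, Complex.arg_eq_pi_iff]
    intro h
    linarith [hre T, h.1]

/-- Now `log(ρ² - a)` is the right primitive: the curve `ρ² - a` meets the real axis only at `τ =
0`, at a positive number, so it avoids the branch cut. -/
theorem integral_contourKernel_of_lt (hσ : 0 < σ) (ha : a < σ ^ 2) {T : ℝ} (hT : 0 < T) :
    ∫ τ in (-T)..T, contourKernel σ a τ =
      -(2 * ((Complex.arg (rho σ T ^ 2 - (a : ℂ)) : ℝ) : ℂ) * Complex.I) := by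
  have hsl : ∀ τ, rho σ τ ^ 2 - (a : ℂ) ∈ Complex.slitPlane := fun τ => by
    rw [Complex.mem_slitPlane_iff, Complex.sub_re, Complex.sub_im, rho_sq_re, rho_sq_im,
      Complex.ofReal_re, Complex.ofReal_im]
    rcases eq_or_ne τ 0 with rfl | h
    · left; linarith
    · right
      rw [sub_zero]
      positivity
  have hd : ∀ τ, HasDerivAt (fun τ => -Complex.log (rho σ τ ^ 2 - (a : ℂ)))
      (contourKernel σ a τ) τ := fun τ => by
    have h1 := (hasDerivAt_sub_rho_sq σ a τ).neg
    simp only [Pi.neg_def, neg_sub, neg_neg] at h1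
    refine (h1.clog_real (hsl τ)).neg.congr_deriv ?_
    rw [contourKernel, ← neg_sub (a : ℂ), div_neg, neg_neg]
  rw [intervalIntegral.integral_eq_sub_of_hasDerivAt (fun τ _ => hd τ)
    ((continuous_contourKernel hσ ha.ne).intervalIntegrable _ _)]
  have hc : rho σ (-T) ^ 2 - (a : ℂ) = conj (rho σ T ^ 2 - (a : ℂ)) := by
    rw [rho_neg]; simp
  rw [hc, Complex.log_conj _ ?_]
  · apply Complex.ext
    · simp
    · simp [Complex.log_im]; ring
  · rw [ne_eq, Complex.arg_eq_pi_iff]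
    rintro ⟨_, h⟩
    rw [Complex.sub_im, rho_sq_im, Complex.ofReal_im] at h
    have : 0 < 2 * σ * T := by positivity
    linarith

theorem tendsto_scaled_rho_sq (σ a : ℝ) :
    Tendsto (fun T : ℝ => (((T ^ 2)⁻¹ : ℝ) : ℂ) * (rho σ T ^ 2 - (a : ℂ))) atTop (𝓝 (-1)) := by
  have h1 : Tendsto (fun T : ℝ => (T ^ 2)⁻¹) atTop (𝓝 0) :=
    tendsto_inv_atTop_zero.comp (tendsto_pow_atTop two_ne_zero)
  have h2 : Tendsto (fun T : ℝ => T⁻¹) atTop (𝓝 0) := tendsto_inv_atTop_zero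
  have hre : Tendsto (fun T : ℝ => (σ ^ 2 - a) * (T ^ 2)⁻¹ - 1) atTop (𝓝 ((σ ^ 2 - a) * 0 - 1)) :=
    (h1.const_mul _).sub tendsto_const_nhds
  have him : Tendsto (fun T : ℝ => 2 * σ * T⁻¹) atTop (𝓝 (2 * σ * 0)) := h2.const_mul _
  have h3 : Tendsto (fun T : ℝ => (((σ ^ 2 - a) * (T ^ 2)⁻¹ - 1 : ℝ) : ℂ) +
      ((2 * σ * T⁻¹ : ℝ) : ℂ) * Complex.I) atTop
      (𝓝 ((((σ ^ 2 - a) * 0 - 1 : ℝ) : ℂ) + ((2 * σ * 0 : ℝ) : ℂ) * Complex.I)) :=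
    (Complex.continuous_ofReal.continuousAt.tendsto.comp hre).add
      ((Complex.continuous_ofReal.continuousAt.tendsto.comp him).mul_const _)
  have h4 : ((((σ ^ 2 - a) * 0 - 1 : ℝ) : ℂ) + ((2 * σ * 0 : ℝ) : ℂ) * Complex.I) = -1 := by simp
  rw [h4] at h3
  refine h3.congr' ?_
  filter_upwards [eventually_gt_atTop 0] with T hT
  have hT' : (T : ℂ) ≠ 0 := Complex.ofReal_ne_zero.2 hT.ne'
  rw [rho]
  push_cast
  field_simp
  linear_combination (-(T : ℂ) ^ 2) * Complex.I_sq

theorem tendsto_integral_contourKernel_of_gt (hσ : 0 < σ) (ha : σ ^ 2 < a) :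
    Tendsto (fun T : ℝ => ∫ τ in (-T)..T, contourKernel σ a τ) atTop (𝓝 0) := by
  have h1 : Tendsto (fun T : ℝ => Complex.arg ((a : ℂ) - rho σ T ^ 2)) atTop (𝓝 0) := by
    have h2 := (tendsto_scaled_rho_sq σ a).neg
    rw [neg_neg] at h2
    have h3 := (Complex.continuousAt_arg Complex.one_mem_slitPlane).tendsto.comp h2
    rw [Complex.arg_one] at h3
    refine h3.congr' ?_
    filter_upwards [eventually_gt_atTop 0] with T hT
    rw [Function.comp_apply, ← mul_neg, neg_sub, Complex.arg_real_mul _ (by positivity)]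
  have h2 := ((Complex.continuous_ofReal.tendsto _).comp h1).const_mul 2 |>.mul_const Complex.I
    |>.neg
  simp only [Complex.ofReal_zero, mul_zero, zero_mul, neg_zero] at h2
  exact h2.congr fun T => (integral_contourKernel_of_gt hσ ha T).symm

theorem tendsto_integral_contourKernel_of_lt (hσ : 0 < σ) (ha : a < σ ^ 2) :
    Tendsto (fun T : ℝ => ∫ τ in (-T)..T, contourKernel σ a τ) atTop
      (𝓝 (-(2 * Real.pi * Complex.I))) := by
  have h1 : Tendsto (fun T : ℝ => Complex.arg (rho σ T ^ 2 - (a : ℂ))) atTop (𝓝 Real.pi) := by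
    -- The argument jumps at `-1`. The imaginary part `2σT` is positive, so the limit is `π`, and
    -- this is what produces the residue.
    have h2 : Tendsto (fun T : ℝ => (((T ^ 2)⁻¹ : ℝ) : ℂ) * (rho σ T ^ 2 - (a : ℂ))) atTop
        (𝓝[{z : ℂ | 0 ≤ z.im}] (-1)) := by
      refine tendsto_nhdsWithin_iff.2 ⟨tendsto_scaled_rho_sq σ a, ?_⟩
      filter_upwards [eventually_gt_atTop 0] with T hT
      rw [Complex.im_ofReal_mul, Complex.sub_im, rho_sq_im, Complex.ofReal_im]
      rw [sub_zero]
      positivity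
    have h3 := (Complex.tendsto_arg_nhdsWithin_im_nonneg_of_re_neg_of_im_zero (z := -1)
      (by simp) (by simp)).comp h2
    refine h3.congr' ?_
    filter_upwards [eventually_gt_atTop 0] with T hT
    rw [Function.comp_apply, Complex.arg_real_mul _ (by positivity)]
  have h2 := ((Complex.continuous_ofReal.tendsto _).comp h1).const_mul 2 |>.mul_const Complex.I
    |>.neg
  refine h2.congr' ?_
  filter_upwards [eventually_gt_atTop 0] with T hT
  exact (integral_contourKernel_of_lt hσ ha hT).symm

end


/-! ### Integral inequalities for exponential averages -/

section

variable {α : Type*} [MeasurableSpace α] {μ : Measure α} {f g : α → ENNReal}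

theorem lintegral_mul_le_sqrt (hf : AEMeasurable f μ) (hg : AEMeasurable g μ) :
    ∫⁻ a, f a * g a ∂μ ≤ ((∫⁻ a, f a ^ 2 ∂μ) * ∫⁻ a, g a ^ 2 ∂μ) ^ (1 / 2 : ℝ) := by
  have h := ENNReal.lintegral_mul_le_Lp_mul_Lq μ
    (show (2 : ℝ).HolderConjugate 2 from ⟨by norm_num, by norm_num, by norm_num⟩) hf hg
  rw [ENNReal.mul_rpow_of_nonneg _ _ (by norm_num : (0 : ℝ) ≤ 1 / 2)]
  simpa only [ENNReal.rpow_two, Pi.mul_apply] using h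

theorem lintegral_mul_sq_le (hf : AEMeasurable f μ) (hg : AEMeasurable g μ) :
    (∫⁻ a, f a * g a ∂μ) ^ 2 ≤ (∫⁻ a, f a ^ 2 ∂μ) * ∫⁻ a, g a ^ 2 ∂μ := by
  have h := ENNReal.rpow_le_rpow (lintegral_mul_le_sqrt hf hg) zero_le_two
  rwa [← ENNReal.rpow_mul, one_div_mul_cancel two_ne_zero, ENNReal.rpow_one,
    ENNReal.rpow_two] at h

/-- The Cauchy–Schwarz inequality with a weight. -/
theorem lintegral_mul_sq_le_weighted {w : α → ℝ} (hf : AEMeasurable f μ) (hg : AEMeasurable g μ)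
    (hw : AEMeasurable w μ) (hw0 : ∀ᵐ a ∂μ, 0 < w a) :
    (∫⁻ a, f a * g a ∂μ) ^ 2 ≤ (∫⁻ a, f a ^ 2 * g a * ENNReal.ofReal (w a) ∂μ) *
      ∫⁻ a, g a * ENNReal.ofReal (w a)⁻¹ ∂μ := by
  have hs : ∀ x : ENNReal, (x ^ (1 / 2 : ℝ)) ^ 2 = x := fun x => by
    rw [← ENNReal.rpow_two, ← ENNReal.rpow_mul, one_div_mul_cancel two_ne_zero, ENNReal.rpow_one]
  have h1 : ∫⁻ a, f a * g a ∂μ = ∫⁻ a, f a * (g a * ENNReal.ofReal (w a)) ^ (1 / 2 : ℝ) *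
      (g a * ENNReal.ofReal (w a)⁻¹) ^ (1 / 2 : ℝ) ∂μ := by
    refine lintegral_congr_ae ?_
    filter_upwards [hw0] with a ha
    rw [mul_assoc, ← ENNReal.mul_rpow_of_nonneg _ _ (by norm_num : (0 : ℝ) ≤ 1 / 2)]
    have : g a * ENNReal.ofReal (w a) * (g a * ENNReal.ofReal (w a)⁻¹) = g a ^ 2 := by
      rw [mul_mul_mul_comm, ← ENNReal.ofReal_mul ha.le, mul_inv_cancel₀ ha.ne',
        ENNReal.ofReal_one, mul_one, sq]
    rw [this, ← ENNReal.rpow_two, ← ENNReal.rpow_mul, mul_one_div_cancel two_ne_zero,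
      ENNReal.rpow_one]
  have m1 : AEMeasurable (fun a => f a * (g a * ENNReal.ofReal (w a)) ^ (1 / 2 : ℝ)) μ :=
    hf.mul ((hg.mul hw.ennreal_ofReal).pow_const _)
  have m2 : AEMeasurable (fun a => (g a * ENNReal.ofReal (w a)⁻¹) ^ (1 / 2 : ℝ)) μ :=
    (hg.mul hw.inv.ennreal_ofReal).pow_const _
  rw [h1]
  refine (lintegral_mul_sq_le m1 m2).trans (le_of_eq ?_)
  simp_rw [mul_pow, hs, mul_assoc]

end

theorem lintegral_gamma_half {b : ℝ} (hb : 0 < b) :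
    ∫⁻ x : ℝ, ENNReal.ofReal (|x| ^ (-(1 / 2) : ℝ) * Real.exp (-(b * |x|))) =
      ENNReal.ofReal (2 * Real.sqrt Real.pi * b ^ (-(1 / 2) : ℝ)) := by
  have h1 : ∫ x : ℝ, |x| ^ (-(1 / 2) : ℝ) * Real.exp (-(b * |x|)) =
      2 * Real.sqrt Real.pi * b ^ (-(1 / 2) : ℝ) := by
    rw [integral_comp_abs (f := fun x => x ^ (-(1 / 2) : ℝ) * Real.exp (-(b * x)))]
    have h2 := Real.integral_rpow_mul_exp_neg_mul_Ioi (a := 1 / 2) (by norm_num) hb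
    have h3 : (1 / 2 : ℝ) - 1 = -(1 / 2) := by norm_num
    rw [h3] at h2
    rw [h2, Real.Gamma_one_half_eq, one_div b, Real.inv_rpow hb.le, Real.rpow_neg hb.le]
    ring
  have h0 : 2 * Real.sqrt Real.pi * b ^ (-(1 / 2) : ℝ) ≠ 0 := by
    have := Real.pi_pos
    positivity
  -- A nonzero value of the Bochner integral certifies integrability.
  have hi : Integrable fun x : ℝ => |x| ^ (-(1 / 2) : ℝ) * Real.exp (-(b * |x|)) := by
    by_contra hcon
    rw [integral_undef hcon] at h1
    exact h0 h1.symm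
  rw [← ofReal_integral_eq_lintegral_ofReal hi (Eventually.of_forall fun x => by positivity), h1]

/-- The exponential kernel `exp (-c |τ| |r|)` in extended nonnegative reals. -/
noncomputable def expKernel (c τ r : ℝ) : ENNReal := ENNReal.ofReal (Real.exp (-(c * |τ| * |r|)))

@[fun_prop]
theorem measurable_expKernel {β : Type*} [MeasurableSpace β] {a b : β → ℝ} (c : ℝ)
    (ha : Measurable a) (hb : Measurable b) : Measurable fun q => expKernel c (a q) (b q) := by
  unfold expKernel
  fun_prop

/-- At half the rate both decays can be measured from `x` instead of from `t`. The double integral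
over `t` and `s` then splits into a product of two transforms at `x`. -/
theorem expKernel_mul_le (τ t s x : ℝ) :
    expKernel 1 τ (t - x) * expKernel 1 τ (t - s) ≤
      expKernel (1 / 2) τ (x - t) * expKernel (1 / 2) τ (x - s) := by
  unfold expKernel
  rw [← ENNReal.ofReal_mul (Real.exp_pos _).le, ← ENNReal.ofReal_mul (Real.exp_pos _).le,
    ← Real.exp_add, ← Real.exp_add]
  refine ENNReal.ofReal_le_ofReal (Real.exp_le_exp.2 ?_)
  have h1 : |x - s| ≤ |t - x| + |t - s| := by
    have := abs_sub_le x t s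
    rwa [abs_sub_comm x t] at this
  rw [abs_sub_comm x t]
  have h2 : |t - x| + |x - s| ≤ 2 * (|t - x| + |t - s|) := by
    linarith [abs_nonneg (t - s)]
  nlinarith [mul_le_mul_of_nonneg_left h2 (abs_nonneg τ)]

theorem expKernel_le_one {c : ℝ} (hc : 0 ≤ c) (τ r : ℝ) : expKernel c τ r ≤ 1 := by
  unfold expKernel
  rw [ENNReal.ofReal_le_one, Real.exp_le_one_iff]
  have : 0 ≤ c * |τ| * |r| := by positivity
  linarith

/-- The exponential average of `f` in extended nonnegative reals. -/
noncomputable def expLaplace (μ : Measure ℝ) (f : ℝ → ENNReal) (c τ t : ℝ) : ENNReal :=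
  ∫⁻ s, f s * expKernel c τ (t - s) ∂μ

section

variable {μ : Measure ℝ} [SFinite μ]

@[fun_prop]
theorem measurable_expLaplace {β : Type*} [MeasurableSpace β] {a b : β → ℝ} {f : ℝ → ENNReal}
    (hf : Measurable f) (c : ℝ) (ha : Measurable a) (hb : Measurable b) :
    Measurable fun q => expLaplace μ f c (a q) (b q) := by
  refine Measurable.lintegral_prod_right' (f := fun q : β × ℝ =>
    f q.2 * expKernel c (a q.1) (b q.1 - q.2)) ?_
  fun_prop

/-- Boundedness of the Laplace transform on `L₂`. -/
theorem lintegral_expLaplace_sq_le (hμ : μ ≤ volume) {v : ℝ → ENNReal} (hv : Measurable v)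
    {c : ℝ} (hc : 0 < c) (x : ℝ) :
    ∫⁻ τ, expLaplace μ v c τ x ^ 2 ≤ ENNReal.ofReal (4 * Real.pi / c) * ∫⁻ t, v t ^ 2 ∂μ := by
  have hpi := Real.pi_pos
  set A : ℝ := 2 * Real.sqrt Real.pi * c ^ (-(1 / 2) : ℝ) with hA
  have hA0 : 0 ≤ A := by positivity
  have hx0 : ∀ᵐ t ∂μ, t ≠ x := by
    refine (Measure.absolutelyContinuous_of_le hμ).ae_le ?_
    exact (Set.finite_singleton x).countable.ae_notMem volume
  have hx : ∀ᵐ t ∂μ, 0 < |x - t| ^ (1 / 2 : ℝ) := by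
    filter_upwards [hx0] with t ht
    exact Real.rpow_pos_of_pos (abs_pos.2 (sub_ne_zero.2 ht.symm)) _
  have hτ0 : ∀ᵐ τ : ℝ, τ ≠ 0 := (Set.finite_singleton (0 : ℝ)).countable.ae_notMem volume
  have hmk : ∀ τ : ℝ, Measurable fun t => expKernel c τ (x - t) := fun τ => by fun_prop
  have hmw : Measurable fun t : ℝ => |x - t| ^ (1 / 2 : ℝ) := by fun_prop
  have hgam : ∀ r : ℝ, r ≠ 0 → ∫⁻ s, ENNReal.ofReal (|s| ^ (-(1 / 2) : ℝ)) * expKernel c s r =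
      ENNReal.ofReal (A * |r| ^ (-(1 / 2) : ℝ)) := by
    intro r hr
    have hr' : 0 < |r| := abs_pos.2 hr
    rw [hA, mul_assoc, ← Real.mul_rpow hc.le hr'.le, ← lintegral_gamma_half (mul_pos hc hr')]
    refine lintegral_congr fun s => ?_
    rw [expKernel, ← ENNReal.ofReal_mul (by positivity)]
    congr 4
    ring
  have hgam' : ∀ τ : ℝ, τ ≠ 0 → ∫⁻ t, expKernel c τ (x - t) *
      ENNReal.ofReal (|x - t| ^ (1 / 2 : ℝ))⁻¹ ∂μ ≤ ENNReal.ofReal (A * |τ| ^ (-(1 / 2) : ℝ)) := by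
    intro τ hτ
    rw [← hgam τ hτ, ← lintegral_sub_left_eq_self (μ := volume)
      (fun s => ENNReal.ofReal (|s| ^ (-(1 / 2) : ℝ)) * expKernel c s τ) x]
    refine (lintegral_mono' hμ le_rfl).trans (le_of_eq (lintegral_congr fun t => ?_))
    rw [mul_comm, Real.rpow_neg (abs_nonneg _)]
    congr 1
    unfold expKernel
    congr 3
    ring
  -- A Schur test with weight `|x - t|^(1/2)`. Integrating in `t` gives `A|τ|^(-1/2)`, integrating
  -- that in `τ` gives `A²|x - t|^(-1/2)`, and the weight cancels the last power.
  calc ∫⁻ τ, expLaplace μ v c τ x ^ 2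
      ≤ ∫⁻ τ, (∫⁻ t, v t ^ 2 * expKernel c τ (x - t) * ENNReal.ofReal (|x - t| ^ (1 / 2 : ℝ)) ∂μ) *
          ENNReal.ofReal (A * |τ| ^ (-(1 / 2) : ℝ)) := by
        refine lintegral_mono_ae ?_
        filter_upwards [hτ0] with τ hτ
        refine (lintegral_mul_sq_le_weighted hv.aemeasurable (hmk τ).aemeasurable
          hmw.aemeasurable hx).trans ?_
        gcongr
        exact hgam' τ hτ
    _ = ∫⁻ τ, ∫⁻ t, v t ^ 2 * expKernel c τ (x - t) * ENNReal.ofReal (|x - t| ^ (1 / 2 : ℝ)) *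
          ENNReal.ofReal (A * |τ| ^ (-(1 / 2) : ℝ)) ∂μ := by
        refine lintegral_congr fun τ => ?_
        rw [lintegral_mul_const _ (by fun_prop)]
    _ = ∫⁻ t, ∫⁻ τ, v t ^ 2 * expKernel c τ (x - t) * ENNReal.ofReal (|x - t| ^ (1 / 2 : ℝ)) *
          ENNReal.ofReal (A * |τ| ^ (-(1 / 2) : ℝ)) ∂volume ∂μ := by
        refine lintegral_lintegral_swap (Measurable.aemeasurable ?_)
        simp only [Function.uncurry_def]
        fun_prop
    _ = ∫⁻ t, ENNReal.ofReal (4 * Real.pi / c) * v t ^ 2 ∂μ := by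
        refine lintegral_congr_ae ?_
        filter_upwards [hx0] with t ht
        have ht' : x - t ≠ 0 := sub_ne_zero.2 ht.symm
        have h1 : ∀ τ, v t ^ 2 * expKernel c τ (x - t) * ENNReal.ofReal (|x - t| ^ (1 / 2 : ℝ)) *
            ENNReal.ofReal (A * |τ| ^ (-(1 / 2) : ℝ)) =
            (v t ^ 2 * ENNReal.ofReal (|x - t| ^ (1 / 2 : ℝ) * A)) *
              (ENNReal.ofReal (|τ| ^ (-(1 / 2) : ℝ)) * expKernel c τ (x - t)) := fun τ => by
          rw [ENNReal.ofReal_mul hA0, ENNReal.ofReal_mul (p := |x - t| ^ (1 / 2 : ℝ)) (by positivity)]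
          ring
        simp_rw [h1]
        rw [lintegral_const_mul _ (by fun_prop), hgam _ ht', mul_assoc,
          ← ENNReal.ofReal_mul (by positivity), mul_comm]
        congr 2
        have h2 : |x - t| ^ (1 / 2 : ℝ) * |x - t| ^ (-(1 / 2) : ℝ) = 1 := by
          rw [← Real.rpow_add (abs_pos.2 ht')]; simp
        have h3 : c ^ (-(1 / 2) : ℝ) * c ^ (-(1 / 2) : ℝ) = c⁻¹ := by
          rw [← Real.rpow_add hc, ← Real.rpow_neg_one]; norm_num
        have h4 : A * A = 4 * Real.pi / c := by
          rw [hA]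
          calc _ = 4 * (Real.sqrt Real.pi * Real.sqrt Real.pi) *
                (c ^ (-(1 / 2) : ℝ) * c ^ (-(1 / 2) : ℝ)) := by ring
            _ = _ := by rw [Real.mul_self_sqrt hpi.le, h3]; ring
        calc _ = A * A * (|x - t| ^ (1 / 2 : ℝ) * |x - t| ^ (-(1 / 2) : ℝ)) := by ring
          _ = _ := by rw [h2, h4, mul_one]
    _ = _ := lintegral_const_mul _ (by fun_prop)

variable {U f g : ℝ → ENNReal}

theorem lintegral_kernel_product_le (hμ : μ ≤ volume) (hU : Measurable U) (hf : Measurable f)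
    (x : ℝ) :
    ∫⁻ τ, ∫⁻ t, U t * expLaplace μ f 1 τ t * expKernel 1 τ (t - x) ∂μ ≤
      ENNReal.ofReal (8 * Real.pi) *
        ((∫⁻ t, U t ^ 2 ∂μ) * ∫⁻ t, f t ^ 2 ∂μ) ^ (1 / 2 : ℝ) := by
  calc _ ≤ ∫⁻ τ, expLaplace μ U (1 / 2) τ x * expLaplace μ f (1 / 2) τ x := by
        refine lintegral_mono fun τ => ?_
        unfold expLaplace
        rw [← lintegral_mul_const _ (by fun_prop)]
        refine lintegral_mono fun t => ?_
        rw [mul_right_comm, ← lintegral_const_mul _ (by fun_prop),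
          ← lintegral_const_mul _ (by fun_prop)]
        refine lintegral_mono fun s => ?_
        calc _ = U t * f s * (expKernel 1 τ (t - x) * expKernel 1 τ (t - s)) := by ring
          _ ≤ U t * f s * (expKernel (1 / 2) τ (x - t) * expKernel (1 / 2) τ (x - s)) := by
              gcongr U t * f s * ?_
              exact expKernel_mul_le τ t s x
          _ = _ := by ring
    _ ≤ _ := lintegral_mul_le_sqrt (Measurable.aemeasurable (by fun_prop))
        (Measurable.aemeasurable (by fun_prop))
    _ ≤ ((ENNReal.ofReal (4 * Real.pi / (1 / 2)) * ∫⁻ t, U t ^ 2 ∂μ) *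
          (ENNReal.ofReal (4 * Real.pi / (1 / 2)) * ∫⁻ t, f t ^ 2 ∂μ)) ^ (1 / 2 : ℝ) :=
        ENNReal.rpow_le_rpow (mul_le_mul' (lintegral_expLaplace_sq_le hμ hU (by norm_num) x)
          (lintegral_expLaplace_sq_le hμ hf (by norm_num) x)) (by norm_num)
    _ = _ := by
        rw [mul_mul_mul_comm, ENNReal.mul_rpow_of_nonneg _ _ (by norm_num : (0 : ℝ) ≤ 1 / 2),
          ← sq, ← ENNReal.rpow_two, ← ENNReal.rpow_mul, mul_one_div_cancel two_ne_zero,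
          ENNReal.rpow_one]
        congr 2
        ring

/-- Unfolding the average of `g` makes its point `x` a parameter, and the bound at fixed `x` is
uniform. Only the `L₁` norm of `g` remains, which is what duality needs for an estimate in `C`. -/
theorem lintegral_kernel_triple_le (hμ : μ ≤ volume) (hU : Measurable U) (hf : Measurable f)
    (hg : Measurable g) :
    ∫⁻ τ, ∫⁻ t, U t * expLaplace μ f 1 τ t * expLaplace μ g 1 τ t ∂μ ≤
      ENNReal.ofReal (8 * Real.pi) *
        ((∫⁻ t, U t ^ 2 ∂μ) * ∫⁻ t, f t ^ 2 ∂μ) ^ (1 / 2 : ℝ) * ∫⁻ x, g x ∂μ := by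
  calc _ = ∫⁻ τ, ∫⁻ t, ∫⁻ x, U t * expLaplace μ f 1 τ t *
        (g x * expKernel 1 τ (t - x)) ∂μ ∂μ := by
        refine lintegral_congr fun τ => lintegral_congr fun t => ?_
        rw [lintegral_const_mul _ (by fun_prop)]
        rfl
    _ = ∫⁻ τ, ∫⁻ x, ∫⁻ t, U t * expLaplace μ f 1 τ t *
        (g x * expKernel 1 τ (t - x)) ∂μ ∂μ := by
        refine lintegral_congr fun τ => lintegral_lintegral_swap (Measurable.aemeasurable ?_)
        simp only [Function.uncurry_def]
        fun_prop
    _ = ∫⁻ x, ∫⁻ τ, ∫⁻ t, U t * expLaplace μ f 1 τ t *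
        (g x * expKernel 1 τ (t - x)) ∂μ ∂volume ∂μ := by
        refine lintegral_lintegral_swap (Measurable.aemeasurable ?_)
        refine Measurable.lintegral_prod_right' (f := fun q : (ℝ × ℝ) × ℝ => U q.2 *
          expLaplace μ f 1 q.1.1 q.2 * (g q.1.2 * expKernel 1 q.1.1 (q.2 - q.1.2))) ?_
        fun_prop
    _ ≤ ∫⁻ x, g x * (ENNReal.ofReal (8 * Real.pi) *
        ((∫⁻ t, U t ^ 2 ∂μ) * ∫⁻ t, f t ^ 2 ∂μ) ^ (1 / 2 : ℝ)) ∂μ := by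
        refine lintegral_mono fun x => ?_
        refine le_trans (le_of_eq ?_) (mul_le_mul_right
          (lintegral_kernel_product_le hμ hU hf x) (g x))
        rw [← lintegral_const_mul]
        · refine lintegral_congr fun τ => ?_
          rw [← lintegral_const_mul _ (by fun_prop)]
          exact lintegral_congr fun t => by ring
        · refine Measurable.lintegral_prod_right' (f := fun q : ℝ × ℝ => U q.2 *
            expLaplace μ f 1 q.1 q.2 * expKernel 1 q.1 (q.2 - x)) ?_
          fun_prop
    _ = _ := by rw [lintegral_mul_const _ hg, mul_comm]

/-- This serves the term with `u²`, which is merely integrable. The average of `g` is replaced by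
its `L₁` norm, and the integral over `τ` converges by pairing the extra factor `q` with the `L₂`
bound of the transform of `f`. -/
theorem lintegral_kernel_decay_le (hμ : μ ≤ volume) (hU : Measurable U) (hf : Measurable f)
    {q : ℝ → ENNReal} (hq : Measurable q) :
    ∫⁻ τ, q τ * ∫⁻ t, U t * expLaplace μ f 1 τ t * expLaplace μ g 1 τ t ∂μ ≤
      ((∫⁻ τ, q τ ^ 2) * (ENNReal.ofReal (4 * Real.pi) * ∫⁻ t, f t ^ 2 ∂μ)) ^ (1 / 2 : ℝ) *
        (∫⁻ t, U t ∂μ) * ∫⁻ x, g x ∂μ := by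
  calc _ ≤ ∫⁻ τ, ∫⁻ t, U t * (∫⁻ x, g x ∂μ) * (q τ * expLaplace μ f 1 τ t) ∂μ := by
        refine lintegral_mono fun τ => ?_
        have hgG : ∀ t, expLaplace μ g 1 τ t ≤ ∫⁻ x, g x ∂μ := fun t =>
          lintegral_mono fun x => mul_le_of_le_one_right' (expKernel_le_one zero_le_one _ _)
        calc _ ≤ q τ * ∫⁻ t, U t * expLaplace μ f 1 τ t * (∫⁻ x, g x ∂μ) ∂μ :=
              mul_le_mul_right (lintegral_mono fun t => mul_le_mul_right (hgG t) _) _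
          _ = _ := by
              rw [← lintegral_const_mul _ (by fun_prop)]
              exact lintegral_congr fun t => by ring
    _ = ∫⁻ t, ∫⁻ τ, U t * (∫⁻ x, g x ∂μ) * (q τ * expLaplace μ f 1 τ t) ∂volume ∂μ := by
        refine lintegral_lintegral_swap (Measurable.aemeasurable ?_)
        simp only [Function.uncurry_def]
        fun_prop
    _ ≤ ∫⁻ t, U t * ((∫⁻ x, g x ∂μ) * ((∫⁻ τ, q τ ^ 2) *
        (ENNReal.ofReal (4 * Real.pi) * ∫⁻ t, f t ^ 2 ∂μ)) ^ (1 / 2 : ℝ)) ∂μ := by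
        refine lintegral_mono fun t => ?_
        rw [lintegral_const_mul _ (by fun_prop), mul_assoc]
        refine mul_le_mul_right (mul_le_mul_right ?_ _) _
        refine (lintegral_mul_le_sqrt hq.aemeasurable
          (Measurable.aemeasurable (by fun_prop))).trans ?_
        have := lintegral_expLaplace_sq_le hμ hf zero_lt_one t
        rw [div_one] at this
        exact ENNReal.rpow_le_rpow (mul_le_mul_right this _) (by norm_num)
    _ = _ := by rw [lintegral_mul_const _ hU]; ring

end


/-! ### Differences of spectral projections as contour integrals -/

/-- A lower bound for the characteristic function on the vertical line `Re ρ = σ`. -/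
def Nonresonant (u : ℝ → ℝ) (σ c : ℝ) : Prop :=
  ∃ om om₁ : ℂ → ℝ → ℂ, (∀ z, IsOmega u z (om z) (om₁ z)) ∧
    ∀ τ, c * Real.exp (|τ| * Real.pi) ≤ ‖rho σ τ‖ * ‖om (rho σ τ ^ 2) Real.pi‖

/-- The second resolvent identity in weak form. The quasi-derivatives `H₁` and `F₁` belong to
different potentials, so differentiating `H F₁ - H₁ F` leaves terms in `u` and `u²` but none in
`u'`. -/
theorem Sol.cross {u : ℝ → ℝ} {z : ℂ} {f g F F₁ H H₁ : ℝ → ℂ}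
    (hH : Sol u (fun x => z * H x + g x) H H₁)
    (hF : Sol (fun _ => 0) (fun x => z * F x + f x) F F₁) (hH0 : H 0 = 0) (hHp : H Real.pi = 0)
    (hF0 : F 0 = 0) (hFp : F Real.pi = 0) (hf : ContinuousOn f (Icc 0 Real.pi))
    (hg : ContinuousOn g (Icc 0 Real.pi)) :
    ∫ x in (0 : ℝ)..Real.pi, (H x * f x - F x * g x) =
      ∫ x in (0 : ℝ)..Real.pi, u x * (H x * F₁ x + H₁ x * F x + u x * (H x * F x)) := by
  have hd := (hH.deriv.mul hF.deriv_quasi).sub (hH.deriv_quasi.mul hF.deriv)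
  have h1 := hd.integral_eq zero_mem_Icc_pi pi_mem_Icc_pi
  have hi := hd.intervalIntegrable
  simp only [hH0, hHp, hF0, hFp, zero_mul, mul_zero, sub_self] at h1
  have h2 : IntervalIntegrable (fun x => H x * f x - F x * g x) volume 0 Real.pi := by
    refine ContinuousOn.intervalIntegrable ?_
    rw [uIcc_zero_pi]
    exact (hH.deriv.continuousOn.mul hf).sub (hF.deriv.continuousOn.mul hg)
  have h3 := intervalIntegral.integral_add hi h2
  rw [h1, zero_add] at h3
  rw [← h3]
  refine intervalIntegral.integral_congr fun x _ => ?_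
  push_cast
  ring

theorem intervalIntegrable_sum {ι : Type*} (s : Finset ι) {f : ι → ℝ → ℂ} {a b : ℝ}
    (h : ∀ i ∈ s, IntervalIntegrable (f i) volume a b) :
    IntervalIntegrable (fun x => ∑ i ∈ s, f i x) volume a b :=
  (IntervalIntegrable.sum s h).congr fun x _ => by simp

/-- The finite combination `∑ b n e n`. -/
def combo (e : ℕ → ℝ → ℂ) (B : Finset ℕ) (b : ℕ → ℂ) (x : ℝ) : ℂ := ∑ n ∈ B, b n * e n x

theorem integral_combo_mul_combo {e s : ℕ → ℝ → ℂ} (he : ∀ n, ContinuousOn (e n) (Icc 0 Real.pi))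
    (hs : ∀ n, ContinuousOn (s n) (Icc 0 Real.pi)) (A B : Finset ℕ) (a b : ℕ → ℂ) :
    ∫ x in (0 : ℝ)..Real.pi, combo e B b x * combo s A a x =
      ∑ n ∈ B, ∑ k ∈ A, b n * a k * ∫ x in (0 : ℝ)..Real.pi, e n x * s k x := by
  have hi : ∀ n k, IntervalIntegrable (fun x => e n x * s k x) volume 0 Real.pi := fun n k => by
    refine ContinuousOn.intervalIntegrable ?_
    rw [uIcc_zero_pi]
    exact (he n).mul (hs k)
  simp_rw [combo, Finset.sum_mul_sum]
  rw [intervalIntegral.integral_finsetSum]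
  · refine Finset.sum_congr rfl fun n _ => ?_
    rw [intervalIntegral.integral_finsetSum]
    · refine Finset.sum_congr rfl fun k _ => ?_
      rw [← intervalIntegral.integral_const_mul]
      exact intervalIntegral.integral_congr fun x _ => by ring
    · intro k _
      refine ((hi n k).const_mul (b n * a k)).congr fun x _ => by ring
  · intro n _
    refine intervalIntegrable_sum _ fun k _ => ?_
    exact ((hi n k).const_mul (b n * a k)).congr fun x _ => by ring

theorem continuousOn_combo {e : ℕ → ℝ → ℂ} (he : ∀ n, ContinuousOn (e n) (Icc 0 Real.pi))
    (B : Finset ℕ) (b : ℕ → ℂ) : ContinuousOn (combo e B b) (Icc 0 Real.pi) :=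
  continuousOn_finsetSum _ fun n _ => continuousOn_const.mul (he n)

namespace EigenSystem

variable {R σ c : ℝ} {u : ℝ → ℝ} {lam : ℕ → ℝ} {e e₁ : ℕ → ℝ → ℂ}

theorem lam_ne (h : EigenSystem u lam e e₁) (hu : IsPotential R u) (hc : 0 < c)
    (hW : Nonresonant u σ c) (n : ℕ) : lam n ≠ σ ^ 2 := by
  intro hn
  obtain ⟨om, om₁, hom, hb⟩ := hW
  have hs := h.sol n
  have hz : ((lam n : ℝ) : ℂ) = rho σ 0 ^ 2 := by rw [hn]; simp [rho]
  rw [hz] at hs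
  have h1 := (hs.eq_mul_omega hu (h.left n) (hom _) pi_mem_Icc_pi).1
  rw [h.right n] at h1
  have h2 := (mul_eq_zero.1 h1.symm).resolve_left (h.quasi_zero_ne_zero hu n)
  have h3 := hb 0
  rw [h2, norm_zero, mul_zero] at h3
  have : 0 < c * Real.exp (|0| * Real.pi) := by positivity
  linarith

/-- The coefficients of the resolvent applied to `∑ b n e n`. -/
noncomputable def resolvCoeff (lam : ℕ → ℝ) (σ τ : ℝ) (b : ℕ → ℂ) (n : ℕ) : ℂ :=
  b n / (lam n - rho σ τ ^ 2)

theorem sol_resolvent (h : EigenSystem u lam e e₁) (hσ : 0 < σ) (hlam : ∀ n, lam n ≠ σ ^ 2)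
    (B : Finset ℕ) (b : ℕ → ℂ) (τ : ℝ) :
    Sol u (fun x => rho σ τ ^ 2 * combo e B (resolvCoeff lam σ τ b) x + combo e B b x)
      (combo e B (resolvCoeff lam σ τ b)) (combo e₁ B (resolvCoeff lam σ τ b)) := by
  refine (Sol.sum B fun n _ => (h.sol n).const_mul (resolvCoeff lam σ τ b n)).congr_rhs
    fun x _ => ?_
  rw [combo, combo, Finset.mul_sum, ← Finset.sum_add_distrib]
  refine Finset.sum_congr rfl fun n _ => ?_
  have := sub_rho_sq_ne_zero hσ (hlam n) τ
  rw [resolvCoeff]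
  field_simp
  ring

theorem combo_left (h : EigenSystem u lam e e₁) (B : Finset ℕ) (b : ℕ → ℂ) :
    combo e B b 0 = 0 := Finset.sum_eq_zero fun n _ => by rw [h.left, mul_zero]

theorem combo_right (h : EigenSystem u lam e e₁) (B : Finset ℕ) (b : ℕ → ℂ) :
    combo e B b Real.pi = 0 := Finset.sum_eq_zero fun n _ => by rw [h.right, mul_zero]

theorem resolvent_bound (h : EigenSystem u lam e e₁) (hu : IsPotential R u) (hσ : 1 ≤ σ)
    (hc : 0 < c) (hW : Nonresonant u σ c) (B : Finset ℕ) (b : ℕ → ℂ) (τ : ℝ) {t : ℝ}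
    (ht : t ∈ Icc 0 Real.pi) :
    ‖rho σ τ‖ * ‖combo e B (resolvCoeff lam σ τ b) t‖ ≤
        energyConst R ^ 2 / c * expAverage (combo e B b) τ t ∧
      ‖combo e₁ B (resolvCoeff lam σ τ b) t‖ ≤
        energyConst R ^ 2 / c * expAverage (combo e B b) τ t := by
  have hlam := h.lam_ne hu hc hW
  obtain ⟨om, om₁, hom, hb⟩ := hW
  have hρ : 1 ≤ ‖rho σ τ‖ := by
    have := Complex.re_le_norm (rho σ τ)
    rw [rho_re] at this
    linarith
  have := Sol.resolvent_bound hu (h.sol_resolvent (by linarith) hlam B b τ)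
    (continuousOn_combo h.continuousOn B b) (h.combo_left _ _) (h.combo_right _ _)
    (hom (rho σ τ ^ 2)) hρ hc (by rw [rho_im]; exact hb τ) ht
  rwa [rho_im] at this

/-- The pairing of the difference of two spectral projections of `∑ a k s k` with `∑ b n e n`. -/
noncomputable def projectionPairing (e : ℕ → ℝ → ℂ) (lam : ℕ → ℝ) (σ : ℝ) (A B : Finset ℕ)
    (a b : ℕ → ℂ) : ℂ :=
  ∑ n ∈ B, ∑ k ∈ A, b n * a k * (∫ x in (0 : ℝ)..Real.pi, e n x * sine k x) *
    ((if lam n < σ ^ 2 then 1 else 0) - if ((k : ℝ) + 1) ^ 2 < σ ^ 2 then 1 else 0)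

/-- The integrand of the contour integral representing `projectionPairing`. -/
noncomputable def contourIntegrand (u : ℝ → ℝ) (e e₁ : ℕ → ℝ → ℂ) (lam : ℕ → ℝ) (σ : ℝ)
    (A B : Finset ℕ) (a b : ℕ → ℂ) (τ x : ℝ) : ℂ :=
  2 * rho σ τ * Complex.I * (u x *
    (combo e B (resolvCoeff lam σ τ b) x *
        combo sineDeriv A (resolvCoeff (fun k => ((k : ℝ) + 1) ^ 2) σ τ a) x +
      combo e₁ B (resolvCoeff lam σ τ b) x *
        combo sine A (resolvCoeff (fun k => ((k : ℝ) + 1) ^ 2) σ τ a) x +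
      u x * (combo e B (resolvCoeff lam σ τ b) x *
        combo sine A (resolvCoeff (fun k => ((k : ℝ) + 1) ^ 2) σ τ a) x)))

theorem tendsto_contourKernel_ite (hσ : 0 < σ) {a : ℝ} (ha : a ≠ σ ^ 2) :
    Tendsto (fun T : ℝ => ∫ τ in (-T)..T, contourKernel σ a τ) atTop
      (𝓝 (-(2 * Real.pi * Complex.I) * if a < σ ^ 2 then 1 else 0)) := by
  split_ifs with h
  · rw [mul_one]
    exact tendsto_integral_contourKernel_of_lt hσ h
  · rw [mul_zero]
    exact tendsto_integral_contourKernel_of_gt hσ (lt_of_le_of_ne (not_lt.1 h) ha.symm)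

/-- On eigenfunctions the resolvent is division by `λ - ρ²`, so the left side is the pairing of the
resolvent difference times `2ρi`. The cross identity rewrites that pairing as an integral against
`u`. -/
theorem sum_contourKernel_eq (h : EigenSystem u lam e e₁) (hσ : 0 < σ)
    (hlam : ∀ n, lam n ≠ σ ^ 2) (hlam0 : ∀ k : ℕ, ((k : ℝ) + 1) ^ 2 ≠ σ ^ 2) (A B : Finset ℕ)
    (a b : ℕ → ℂ) (τ : ℝ) :
    ∑ n ∈ B, ∑ k ∈ A, b n * a k * (∫ x in (0 : ℝ)..Real.pi, e n x * sine k x) *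
        (contourKernel σ (lam n) τ - contourKernel σ (((k : ℝ) + 1) ^ 2) τ) =
      ∫ x in (0 : ℝ)..Real.pi, contourIntegrand u e e₁ lam σ A B a b τ x := by
  have hH := h.sol_resolvent hσ hlam B b τ
  have hF := sineSystem.sol_resolvent hσ hlam0 A a τ
  have hcr := hH.cross hF (h.combo_left _ _) (h.combo_right _ _) (sineSystem.combo_left _ _)
    (sineSystem.combo_right _ _) (continuousOn_combo sineSystem.continuousOn A a)
    (continuousOn_combo h.continuousOn B b)
  unfold contourIntegrand
  rw [intervalIntegral.integral_const_mul, ← hcr]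
  have h_int : ∀ b' a', IntervalIntegrable (fun x => combo e B b' x * combo sine A a' x) volume 0
      Real.pi := fun b' a' => by
    refine ContinuousOn.intervalIntegrable ?_
    rw [uIcc_zero_pi]
    exact (continuousOn_combo h.continuousOn B b').mul
      (continuousOn_combo sineSystem.continuousOn A a')
  simp_rw [mul_comm (combo sine A _ _) (combo e B _ _)]
  rw [intervalIntegral.integral_sub (h_int _ _) (h_int _ _),
    integral_combo_mul_combo h.continuousOn sineSystem.continuousOn,
    integral_combo_mul_combo h.continuousOn sineSystem.continuousOn, ← Finset.sum_sub_distrib,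
    Finset.mul_sum]
  refine Finset.sum_congr rfl fun n _ => ?_
  rw [← Finset.sum_sub_distrib, Finset.mul_sum]
  refine Finset.sum_congr rfl fun k _ => ?_
  unfold contourKernel resolvCoeff
  ring

/-- A single kernel decays only like `1/τ`, so the limit is taken over symmetric intervals. Finite
sums make the passage to the limit termwise. -/
theorem tendsto_contourIntegral (h : EigenSystem u lam e e₁) (hσ : 0 < σ)
    (hlam : ∀ n, lam n ≠ σ ^ 2) (hlam0 : ∀ k : ℕ, ((k : ℝ) + 1) ^ 2 ≠ σ ^ 2) (A B : Finset ℕ)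
    (a b : ℕ → ℂ) :
    Tendsto (fun T : ℝ => ∫ τ in (-T)..T, ∫ x in (0 : ℝ)..Real.pi,
        contourIntegrand u e e₁ lam σ A B a b τ x) atTop
      (𝓝 (-(2 * Real.pi * Complex.I) * projectionPairing e lam σ A B a b)) := by
  have hk : ∀ n T, IntervalIntegrable (contourKernel σ (lam n)) volume (-T) T := fun n T =>
    (continuous_contourKernel hσ (hlam n)).intervalIntegrable _ _
  have hk0 : ∀ (k : ℕ) (T : ℝ), IntervalIntegrable (contourKernel σ (((k : ℝ) + 1) ^ 2)) volume
      (-T) T := fun k T => (continuous_contourKernel hσ (hlam0 k)).intervalIntegrable _ _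
  simp_rw [← h.sum_contourKernel_eq hσ hlam hlam0]
  have h1 : ∀ T : ℝ, ∫ τ in (-T)..T, ∑ n ∈ B, ∑ k ∈ A, b n * a k *
      (∫ x in (0 : ℝ)..Real.pi, e n x * sine k x) *
        (contourKernel σ (lam n) τ - contourKernel σ (((k : ℝ) + 1) ^ 2) τ) =
      ∑ n ∈ B, ∑ k ∈ A, b n * a k * (∫ x in (0 : ℝ)..Real.pi, e n x * sine k x) *
        ((∫ τ in (-T)..T, contourKernel σ (lam n) τ) -
          ∫ τ in (-T)..T, contourKernel σ (((k : ℝ) + 1) ^ 2) τ) := fun T => by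
    rw [intervalIntegral.integral_finsetSum fun n _ => intervalIntegrable_sum _ fun k _ =>
      ((hk n T).sub (hk0 k T)).const_mul _]
    refine Finset.sum_congr rfl fun n _ => ?_
    rw [intervalIntegral.integral_finsetSum fun k _ => ((hk n T).sub (hk0 k T)).const_mul _]
    refine Finset.sum_congr rfl fun k _ => ?_
    rw [intervalIntegral.integral_const_mul, intervalIntegral.integral_sub (hk n T) (hk0 k T)]
  simp_rw [h1]
  unfold projectionPairing
  rw [Finset.mul_sum]
  refine tendsto_finsetSum _ fun n _ => ?_
  rw [Finset.mul_sum]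
  refine tendsto_finsetSum _ fun k _ => ?_
  have := ((tendsto_contourKernel_ite hσ (hlam n)).sub
    (tendsto_contourKernel_ite hσ (hlam0 k))).const_mul
      (b n * a k * (∫ x in (0 : ℝ)..Real.pi, e n x * sine k x))
  convert this using 2
  ring

end EigenSystem


/-! ### The uniform bound for the contour integral -/

theorem muPi_le_volume : muPi ≤ volume := Measure.restrict_le_self

theorem ofReal_expAverage {g : ℝ → ℂ} (hg : ContinuousOn g (Icc 0 Real.pi)) {G : ℝ → ENNReal}
    (hG : G =ᵐ[muPi] fun t => ‖g t‖ₑ) (τ t : ℝ) :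
    ENNReal.ofReal (expAverage g τ t) = expLaplace muPi G 1 τ t := by
  have hc : ContinuousOn (fun s => ‖g s‖ * Real.exp (-(|τ| * |t - s|))) (Icc 0 Real.pi) :=
    hg.norm.mul (Continuous.continuousOn (by fun_prop))
  have hi : Integrable (fun s => ‖g s‖ * Real.exp (-(|τ| * |t - s|))) muPi :=
    hc.integrableOn_Icc
  rw [expAverage, intervalIntegral_eq_muPi, ofReal_integral_eq_lintegral_ofReal hi
    (Eventually.of_forall fun s => by positivity), expLaplace]
  refine lintegral_congr_ae ?_
  filter_upwards [hG] with s hs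
  rw [hs, ENNReal.ofReal_mul (norm_nonneg _), ofReal_norm, expKernel, one_mul]

theorem lintegral_decay_sq :
    ∫⁻ τ : ℝ, ENNReal.ofReal (Real.sqrt (1 + τ ^ 2))⁻¹ ^ 2 = ENNReal.ofReal Real.pi := by
  rw [← integral_univ_inv_one_add_sq, ofReal_integral_eq_lintegral_ofReal integrable_inv_one_add_sq
    (Eventually.of_forall fun τ => by positivity)]
  refine lintegral_congr fun τ => ?_
  rw [← ENNReal.ofReal_pow (by positivity), inv_pow, Real.sq_sqrt (by positivity)]

theorem le_norm_rho {σ : ℝ} (hσ : 1 ≤ σ) (τ : ℝ) : Real.sqrt (1 + τ ^ 2) ≤ ‖rho σ τ‖ := by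
  rw [Complex.norm_def, Complex.normSq_apply, rho_re, rho_im]
  exact Real.sqrt_le_sqrt (by nlinarith)

namespace EigenSystem

variable {R σ c : ℝ} {u : ℝ → ℝ} {lam : ℕ → ℝ} {e e₁ : ℕ → ℝ → ℂ}

/-- The factor `|ρ|` from `dλ = 2ρ dρ` is absorbed by a solution entering without quasi-derivative.
In the `u²` term both factors are such, and a spare `1/|ρ| ≤ (1 + τ²)^(-1/2)` remains for
convergence in `τ`. -/
theorem norm_contourIntegrand_le (h : EigenSystem u lam e e₁) (hR : 0 ≤ R) (hu : IsPotential R u)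
    (hσ : 1 ≤ σ) (hc : 0 < c) (hW : Nonresonant u σ c) (hW0 : Nonresonant (fun _ => 0) σ c)
    (A B : Finset ℕ) (a b : ℕ → ℂ) (τ : ℝ) {t : ℝ} (ht : t ∈ Icc 0 Real.pi) :
    ‖contourIntegrand u e e₁ lam σ A B a b τ t‖ ≤
      4 * (energyConst R ^ 2 / c) ^ 2 * (|u t| * expAverage (combo sine A a) τ t *
        expAverage (combo e B b) τ t) +
      2 * (energyConst R ^ 2 / c) ^ 2 * ((Real.sqrt (1 + τ ^ 2))⁻¹ * (u t ^ 2 *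
        expAverage (combo sine A a) τ t * expAverage (combo e B b) τ t)) := by
  obtain ⟨h1, h2⟩ := h.resolvent_bound hu hσ hc hW B b τ ht
  obtain ⟨h3, h4⟩ := sineSystem.resolvent_bound (IsPotential.zero.mono le_rfl hR) hσ hc hW0 A a τ ht
  have hE := expAverage_nonneg (combo sine A a) τ t
  have hG := expAverage_nonneg (combo e B b) τ t
  unfold contourIntegrand
  set C := energyConst R ^ 2 / c
  have hC : 0 ≤ C := by positivity
  set E := expAverage (combo sine A a) τ t
  set G := expAverage (combo e B b) τ t
  set H := combo e B (resolvCoeff lam σ τ b) t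
  set H₁ := combo e₁ B (resolvCoeff lam σ τ b) t
  set F := combo sine A (resolvCoeff (fun k => ((k : ℝ) + 1) ^ 2) σ τ a) t
  set F₁ := combo sineDeriv A (resolvCoeff (fun k => ((k : ℝ) + 1) ^ 2) σ τ a) t
  have hs := le_norm_rho hσ τ
  set r := ‖rho σ τ‖
  have hs0 : 0 < Real.sqrt (1 + τ ^ 2) := by positivity
  have hr : 0 < r := hs0.trans_le hs
  rw [norm_mul, norm_mul, norm_mul, Complex.norm_I, Complex.norm_ofNat, norm_mul,
    Complex.norm_real, Real.norm_eq_abs, mul_one]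
  have h5 : ‖H * F₁ + H₁ * F + u t * (H * F)‖ ≤ ‖H‖ * ‖F₁‖ + ‖H₁‖ * ‖F‖ + |u t| * (‖H‖ * ‖F‖) := by
    refine (norm_add_le _ _).trans (add_le_add ((norm_add_le _ _).trans ?_) ?_)
    · rw [norm_mul, norm_mul]
    · rw [norm_mul, norm_mul, Complex.norm_real, Real.norm_eq_abs]
  have h6 : r * (‖H‖ * ‖F₁‖) ≤ C * G * (C * E) := by
    rw [← mul_assoc]; exact mul_le_mul h1 h4 (norm_nonneg _) (by positivity)
  have h7 : r * (‖H₁‖ * ‖F‖) ≤ C * G * (C * E) := by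
    rw [mul_left_comm]; exact mul_le_mul h2 h3 (by positivity) (by positivity)
  have h8 : r * (‖H‖ * ‖F‖) ≤ (Real.sqrt (1 + τ ^ 2))⁻¹ * (C * G * (C * E)) := by
    have : r * (r * (‖H‖ * ‖F‖)) ≤ C * G * (C * E) := by
      calc r * (r * (‖H‖ * ‖F‖)) = (r * ‖H‖) * (r * ‖F‖) := by ring
        _ ≤ _ := mul_le_mul h1 h3 (by positivity) (by positivity)
    rw [inv_mul_eq_div, le_div_iff₀ hs0]
    calc r * (‖H‖ * ‖F‖) * Real.sqrt (1 + τ ^ 2) ≤ r * (‖H‖ * ‖F‖) * r := by gcongr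
      _ ≤ _ := by linarith
  calc 2 * r * (|u t| * ‖H * F₁ + H₁ * F + u t * (H * F)‖)
      ≤ 2 * r * (|u t| * (‖H‖ * ‖F₁‖ + ‖H₁‖ * ‖F‖ + |u t| * (‖H‖ * ‖F‖))) := by gcongr
    _ = 2 * |u t| * (r * (‖H‖ * ‖F₁‖) + r * (‖H₁‖ * ‖F‖)) + 2 * |u t| ^ 2 * (r * (‖H‖ * ‖F‖)) := by
        ring
    _ ≤ 2 * |u t| * (C * G * (C * E) + C * G * (C * E)) +
        2 * |u t| ^ 2 * ((Real.sqrt (1 + τ ^ 2))⁻¹ * (C * G * (C * E))) := by gcongr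
    _ = _ := by rw [sq_abs]; ring

/-- The two kernel inequalities applied to the pointwise bound. The term with `u` contributes `32R =
4 · 8R`, the term with `u²` contributes `4R² = 2 · 2R²`. -/
theorem lintegral_contourIntegrand_le (h : EigenSystem u lam e e₁) (hR : 0 ≤ R)
    (hu : IsPotential R u) (hσ : 1 ≤ σ) (hc : 0 < c) (hW : Nonresonant u σ c)
    (hW0 : Nonresonant (fun _ => 0) σ c) (A B : Finset ℕ) (a b : ℕ → ℂ) :
    ∫⁻ τ, ∫⁻ t, ‖contourIntegrand u e e₁ lam σ A B a b τ t‖ₑ ∂muPi ≤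
      ENNReal.ofReal ((energyConst R ^ 2 / c) ^ 2 * Real.pi * (32 * R + 4 * R ^ 2) *
        Real.sqrt (∫ x in (0 : ℝ)..Real.pi, ‖combo sine A a x‖ ^ 2) *
          ∫ x in (0 : ℝ)..Real.pi, ‖combo e B b x‖) := by
  have hpi := Real.pi_pos
  have hfc := continuousOn_combo sineSystem.continuousOn A a
  have hgc := continuousOn_combo h.continuousOn B b
  set f := combo sine A a
  set g := combo e B b
  have mu : AEMeasurable (fun t => ‖u t‖ₑ) muPi := hu.memLp.1.enorm
  have mf : AEMeasurable (fun t => ‖f t‖ₑ) muPi :=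
    (hfc.aestronglyMeasurable measurableSet_Icc).enorm
  have mg : AEMeasurable (fun t => ‖g t‖ₑ) muPi :=
    (hgc.aestronglyMeasurable measurableSet_Icc).enorm
  -- Measurable representatives are chosen because the kernel inequalities interchange integrals of
  -- genuinely measurable functions.
  obtain ⟨U, hU, hUe⟩ := mu
  obtain ⟨F, hF, hFe⟩ := mf
  obtain ⟨G, hG, hGe⟩ := mg
  set C := energyConst R ^ 2 / c
  set q : ℝ → ENNReal := fun τ => ENNReal.ofReal (Real.sqrt (1 + τ ^ 2))⁻¹ with hq
  have hqm : Measurable q := by fun_prop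
  have hpt : ∀ τ, ∫⁻ t, ‖contourIntegrand u e e₁ lam σ A B a b τ t‖ₑ ∂muPi ≤
      ENNReal.ofReal (4 * C ^ 2) * (∫⁻ t, U t * expLaplace muPi F 1 τ t *
        expLaplace muPi G 1 τ t ∂muPi) +
      ENNReal.ofReal (2 * C ^ 2) * (q τ * ∫⁻ t, U t ^ 2 * expLaplace muPi F 1 τ t *
        expLaplace muPi G 1 τ t ∂muPi) := by
    intro τ
    rw [← lintegral_const_mul _ (by fun_prop), ← lintegral_const_mul _ (by fun_prop),
      ← lintegral_const_mul _ (by fun_prop), ← lintegral_add_left (by fun_prop)]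
    refine lintegral_mono_ae ?_
    filter_upwards [ae_muPi_mem, hUe] with t ht hUt
    have h1 := h.norm_contourIntegrand_le hR hu hσ hc hW hW0 A B a b τ ht
    have hE := expAverage_nonneg f τ t
    have hE' := expAverage_nonneg g τ t
    rw [← ofReal_expAverage hfc hFe.symm, ← ofReal_expAverage hgc hGe.symm, ← hUt,
      ← ofReal_norm, ← ofReal_norm, Real.norm_eq_abs, hq,
      ← ENNReal.ofReal_pow (abs_nonneg _), sq_abs]
    simp only
    rw [← ENNReal.ofReal_mul (by positivity), ← ENNReal.ofReal_mul (by positivity),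
      ← ENNReal.ofReal_mul (by positivity), ← ENNReal.ofReal_mul (by positivity),
      ← ENNReal.ofReal_mul (by positivity), ← ENNReal.ofReal_mul (by positivity),
      ← ENNReal.ofReal_mul (by positivity), ← ENNReal.ofReal_add (by positivity) (by positivity)]
    exact ENNReal.ofReal_le_ofReal h1
  have hI1 := lintegral_kernel_triple_le muPi_le_volume hU hF hG
  have hI2 := lintegral_kernel_decay_le (g := G) muPi_le_volume (hU.pow_const 2) hF hqm
  rw [hq, lintegral_decay_sq] at hI2
  have hU2 : ∫⁻ t, U t ^ 2 ∂muPi ≤ ENNReal.ofReal (R ^ 2) := by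
    refine le_trans (le_of_eq ?_) (ENNReal.ofReal_le_ofReal hu.integral_sq_le)
    rw [intervalIntegral_eq_muPi, ofReal_integral_eq_lintegral_ofReal hu.memLp.integrable_sq
      (Eventually.of_forall fun t => sq_nonneg _)]
    refine lintegral_congr_ae ?_
    filter_upwards [hUe] with t ht
    rw [← ht, ← ofReal_norm, Real.norm_eq_abs, ← ENNReal.ofReal_pow (abs_nonneg _), sq_abs]
  have hN0 : 0 ≤ ∫ x in (0 : ℝ)..Real.pi, ‖f x‖ ^ 2 :=
    intervalIntegral.integral_nonneg hpi.le fun _ _ => sq_nonneg _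
  have hF2 : ∫⁻ t, F t ^ 2 ∂muPi = ENNReal.ofReal (∫ x in (0 : ℝ)..Real.pi, ‖f x‖ ^ 2) := by
    have hi : Integrable (fun x => ‖f x‖ ^ 2) muPi := (hfc.norm.pow 2).integrableOn_Icc
    rw [intervalIntegral_eq_muPi, ofReal_integral_eq_lintegral_ofReal hi (Eventually.of_forall fun t => sq_nonneg _)]
    refine lintegral_congr_ae ?_
    filter_upwards [hFe] with t ht
    rw [← ht, ← ofReal_norm, ← ENNReal.ofReal_pow (norm_nonneg _)]
  have hG1 : ∫⁻ t, G t ∂muPi = ENNReal.ofReal (∫ x in (0 : ℝ)..Real.pi, ‖g x‖) := by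
    rw [intervalIntegral_eq_muPi, ofReal_integral_eq_lintegral_ofReal
      (hgc.norm.integrableOn_Icc) (Eventually.of_forall fun t => norm_nonneg _)]
    refine lintegral_congr_ae ?_
    filter_upwards [hGe] with t ht
    rw [← ht, ← ofReal_norm]
  have hM0 : 0 ≤ ∫ x in (0 : ℝ)..Real.pi, ‖g x‖ :=
    intervalIntegral.integral_nonneg hpi.le fun _ _ => norm_nonneg _
  rw [hF2, hG1] at hI1 hI2
  set N := ∫ x in (0 : ℝ)..Real.pi, ‖f x‖ ^ 2
  set M := ∫ x in (0 : ℝ)..Real.pi, ‖g x‖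
  have hhalf : ∀ x : ℝ, 0 ≤ x → ENNReal.ofReal x ^ (1 / 2 : ℝ) = ENNReal.ofReal (Real.sqrt x) :=
    fun x hx => by rw [ENNReal.ofReal_rpow_of_nonneg hx (by norm_num), Real.sqrt_eq_rpow]
  have hI1' : ∫⁻ τ, ∫⁻ t, U t * expLaplace muPi F 1 τ t * expLaplace muPi G 1 τ t ∂muPi ≤
      ENNReal.ofReal (8 * Real.pi * (R * Real.sqrt N) * M) := by
    refine hI1.trans ?_
    have : ((∫⁻ t, U t ^ 2 ∂muPi) * ENNReal.ofReal N) ^ (1 / 2 : ℝ) ≤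
        ENNReal.ofReal (R * Real.sqrt N) := by
      calc _ ≤ (ENNReal.ofReal (R ^ 2) * ENNReal.ofReal N) ^ (1 / 2 : ℝ) :=
            ENNReal.rpow_le_rpow (mul_le_mul_left hU2 _) (by norm_num)
        _ = _ := by
            rw [← ENNReal.ofReal_mul (by positivity), hhalf _ (by positivity),
              Real.sqrt_mul (by positivity), Real.sqrt_sq hR]
    rw [ENNReal.ofReal_mul (by positivity : 0 ≤ 8 * Real.pi * (R * Real.sqrt N)),
      ENNReal.ofReal_mul (by positivity : 0 ≤ 8 * Real.pi)]
    exact mul_le_mul_left (mul_le_mul_right this _) _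
  have hI2' : ∫⁻ τ, q τ * ∫⁻ t, U t ^ 2 * expLaplace muPi F 1 τ t *
      expLaplace muPi G 1 τ t ∂muPi ≤
      ENNReal.ofReal (2 * Real.pi * Real.sqrt N * R ^ 2 * M) := by
    refine hI2.trans ?_
    have : (ENNReal.ofReal Real.pi * (ENNReal.ofReal (4 * Real.pi) * ENNReal.ofReal N)) ^
        (1 / 2 : ℝ) = ENNReal.ofReal (2 * Real.pi * Real.sqrt N) := by
      rw [← ENNReal.ofReal_mul (by positivity), ← ENNReal.ofReal_mul (by positivity),
        hhalf _ (by positivity)]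
      congr 1
      rw [show Real.pi * (4 * Real.pi * N) = (2 * Real.pi) ^ 2 * N by ring,
        Real.sqrt_mul (by positivity), Real.sqrt_sq (by positivity)]
    rw [this, ENNReal.ofReal_mul (by positivity : 0 ≤ 2 * Real.pi * Real.sqrt N * R ^ 2),
      ENNReal.ofReal_mul (by positivity : 0 ≤ 2 * Real.pi * Real.sqrt N)]
    exact mul_le_mul_left (mul_le_mul_right hU2 _) _
  have hmeas : Measurable fun τ => ∫⁻ t, U t * expLaplace muPi F 1 τ t *
      expLaplace muPi G 1 τ t ∂muPi := by
    refine Measurable.lintegral_prod_right' (f := fun p : ℝ × ℝ => U p.2 *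
      expLaplace muPi F 1 p.1 p.2 * expLaplace muPi G 1 p.1 p.2) ?_
    fun_prop
  have hmeas2 : Measurable fun τ => ∫⁻ t, U t ^ 2 * expLaplace muPi F 1 τ t *
      expLaplace muPi G 1 τ t ∂muPi := by
    refine Measurable.lintegral_prod_right' (f := fun p : ℝ × ℝ => U p.2 ^ 2 *
      expLaplace muPi F 1 p.1 p.2 * expLaplace muPi G 1 p.1 p.2) ?_
    fun_prop
  refine (lintegral_mono hpt).trans ?_
  rw [lintegral_add_left (hmeas.const_mul _), lintegral_const_mul _ hmeas,
    lintegral_const_mul _ (by fun_prop : Measurable fun τ => q τ * ∫⁻ t, U t ^ 2 *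
      expLaplace muPi F 1 τ t * expLaplace muPi G 1 τ t ∂muPi)]
  refine (add_le_add (mul_le_mul_right hI1' _) (mul_le_mul_right hI2' _)).trans (le_of_eq ?_)
  rw [← ENNReal.ofReal_mul (by positivity), ← ENNReal.ofReal_mul (by positivity),
    ← ENNReal.ofReal_add (by positivity) (by positivity)]
  congr 1
  ring

/-- The constant in the uniform bound for differences of spectral projections. -/
noncomputable def diffConst (R c : ℝ) : ℝ := (energyConst R ^ 2 / c) ^ 2 * (16 * R + 2 * R ^ 2)

/-- The absolute integral over the whole line dominates every truncated contour integral, hence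
their limit; the residue factor `2π` is divided out. -/
theorem norm_projectionPairing_le (h : EigenSystem u lam e e₁) (hR : 0 ≤ R)
    (hu : IsPotential R u) (hσ : 1 ≤ σ) (hc : 0 < c) (hW : Nonresonant u σ c)
    (hW0 : Nonresonant (fun _ => 0) σ c) (A B : Finset ℕ) (a b : ℕ → ℂ) :
    ‖projectionPairing e lam σ A B a b‖ ≤ diffConst R c *
        Real.sqrt (∫ x in (0 : ℝ)..Real.pi, ‖combo sine A a x‖ ^ 2) *
          ∫ x in (0 : ℝ)..Real.pi, ‖combo e B b x‖ := by
  have hpi := Real.pi_pos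
  have hM0 : 0 ≤ ∫ x in (0 : ℝ)..Real.pi, ‖combo e B b x‖ :=
    intervalIntegral.integral_nonneg hpi.le fun _ _ => norm_nonneg _
  have hlim := (h.tendsto_contourIntegral (by linarith) (h.lam_ne hu hc hW)
    (sineSystem.lam_ne IsPotential.zero hc hW0) A B a b).norm
  have hle := h.lintegral_contourIntegrand_le hR hu hσ hc hW hW0 A B a b
  set K := (energyConst R ^ 2 / c) ^ 2 * Real.pi * (32 * R + 4 * R ^ 2) *
        Real.sqrt (∫ x in (0 : ℝ)..Real.pi, ‖combo sine A a x‖ ^ 2) *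
          ∫ x in (0 : ℝ)..Real.pi, ‖combo e B b x‖ with hK
  have hK0 : 0 ≤ K := by positivity
  have hb : ∀ᶠ T : ℝ in atTop, ‖∫ τ in (-T)..T, ∫ x in (0 : ℝ)..Real.pi,
      contourIntegrand u e e₁ lam σ A B a b τ x‖ ≤ K := by
    filter_upwards [eventually_ge_atTop 0] with T hT
    rw [← ENNReal.ofReal_le_ofReal_iff hK0, ofReal_norm,
      intervalIntegral.integral_of_le (by linarith)]
    refine (enorm_integral_le_lintegral_enorm _).trans ((setLIntegral_le_lintegral _ _).trans
      (le_trans (lintegral_mono fun τ => ?_) hle))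
    rw [intervalIntegral_eq_muPi]
    exact enorm_integral_le_lintegral_enorm _
  have h1 := le_of_tendsto hlim hb
  rw [norm_mul, norm_neg, norm_mul, norm_mul, Complex.norm_I, Complex.norm_real,
    Complex.norm_ofNat, Real.norm_of_nonneg hpi.le, mul_one] at h1
  refine le_of_mul_le_mul_left (h1.trans (le_of_eq ?_)) (by positivity : 0 < 2 * Real.pi)
  rw [hK, diffConst]
  ring

end EigenSystem


/-! ### From finite combinations to a bound from `L₂` to `C` -/

theorem norm_sq_Lp (F : Lp ℂ 2 muPi) : ‖F‖ ^ 2 = ∫ x in (0 : ℝ)..Real.pi, ‖F x‖ ^ 2 := by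
  have h := inner_self_eq_norm_sq (𝕜 := ℂ) F
  rw [← h, L2.inner_def, intervalIntegral_eq_muPi, ← integral_re (L2.integrable_inner F F)]
  refine integral_congr_ae (Eventually.of_forall fun x => ?_)
  simp only [inner_self_eq_norm_sq]

theorem norm_Lp_eq_sqrt (F : Lp ℂ 2 muPi) :
    ‖F‖ = Real.sqrt (∫ x in (0 : ℝ)..Real.pi, ‖F x‖ ^ 2) := by
  rw [← norm_sq_Lp, Real.sqrt_sq (norm_nonneg _)]

theorem norm_toLp_eq_sqrt {f : ℝ → ℂ} (hf : MemLp f 2 muPi) :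
    ‖hf.toLp f‖ = Real.sqrt (∫ x in (0 : ℝ)..Real.pi, ‖f x‖ ^ 2) := by
  rw [norm_Lp_eq_sqrt, intervalIntegral_eq_muPi, intervalIntegral_eq_muPi]
  congr 1
  refine integral_congr_ae ?_
  filter_upwards [hf.coeFn_toLp] with x hx
  rw [hx]

theorem integral_norm_mul_norm_le {f g : ℝ → ℂ} (hf : MemLp f 2 muPi) (hg : MemLp g 2 muPi) :
    ∫ x, ‖f x‖ * ‖g x‖ ∂muPi ≤
      Real.sqrt (∫ x, ‖f x‖ ^ 2 ∂muPi) * Real.sqrt (∫ x, ‖g x‖ ^ 2 ∂muPi) := by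
  have h2 : ENNReal.ofReal 2 = 2 := by simp
  have h := integral_mul_le_Lp_mul_Lq_of_nonneg (μ := muPi) (f := fun x => ‖f x‖)
    (g := fun x => ‖g x‖) (show (2 : ℝ).HolderConjugate 2 from
      ⟨by norm_num, by norm_num, by norm_num⟩)
    (Eventually.of_forall fun x => norm_nonneg _) (Eventually.of_forall fun x => norm_nonneg _)
    (by rw [h2]; exact hf.norm) (by rw [h2]; exact hg.norm)
  simpa only [Real.rpow_two, Real.sqrt_eq_rpow] using h

theorem integral_norm_Lp_le (F : Lp ℂ 2 muPi) :
    ∫ x in (0 : ℝ)..Real.pi, ‖F x‖ ≤ Real.sqrt Real.pi * ‖F‖ := by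
  have h := integral_norm_mul_norm_le (memLp_const (1 : ℂ) : MemLp (fun _ => (1 : ℂ)) 2 muPi)
    (Lp.memLp F)
  rw [intervalIntegral_eq_muPi, norm_Lp_eq_sqrt F, intervalIntegral_eq_muPi]
  simpa [Real.pi_pos.le] using h

namespace EigenSystem

variable {R σ c : ℝ} {u : ℝ → ℝ} {lam : ℕ → ℝ} {e e₁ : ℕ → ℝ → ℂ}

theorem coeFn_sum_vec (h : EigenSystem u lam e e₁) (B : Finset ℕ) (b : ℕ → ℂ) :
    ⇑(∑ n ∈ B, b n • h.vec n) =ᵐ[muPi] combo e B b := by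
  classical
  induction B using Finset.induction_on with
  | empty =>
    filter_upwards [Lp.coeFn_zero ℂ 2 muPi] with x hx
    rw [Finset.sum_empty, hx]
    simp [combo]
  | insert n B hn ih =>
    rw [Finset.sum_insert hn]
    filter_upwards [ih, Lp.coeFn_add (b n • h.vec n) (∑ n ∈ B, b n • h.vec n),
      Lp.coeFn_smul (b n) (h.vec n), h.coeFn_vec n] with x h1 h2 h3 h4
    rw [h2, Pi.add_apply, h1, h3, Pi.smul_apply, h4, combo, combo, Finset.sum_insert hn,
      smul_eq_mul]

theorem norm_sum_vec (h : EigenSystem u lam e e₁) (B : Finset ℕ) (b : ℕ → ℂ) :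
    ‖∑ n ∈ B, b n • h.vec n‖ = Real.sqrt (∫ x in (0 : ℝ)..Real.pi, ‖combo e B b x‖ ^ 2) := by
  rw [norm_Lp_eq_sqrt, intervalIntegral_eq_muPi, intervalIntegral_eq_muPi]
  congr 1
  refine integral_congr_ae ?_
  filter_upwards [h.coeFn_sum_vec B b] with x hx
  rw [hx]

theorem conj_combo (h : EigenSystem u lam e e₁) (B : Finset ℕ) (b : ℕ → ℂ) {x : ℝ}
    (hx : x ∈ Icc 0 Real.pi) : conj (combo e B b x) = combo e B (fun n => conj (b n)) x := by
  simp only [combo, map_sum, map_mul, h.real _ x hx]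

theorem integral_norm_sum_vec (h : EigenSystem u lam e e₁) (B : Finset ℕ) (b : ℕ → ℂ) :
    ∫ x in (0 : ℝ)..Real.pi, ‖(∑ n ∈ B, b n • h.vec n : Lp ℂ 2 muPi) x‖ =
      ∫ x in (0 : ℝ)..Real.pi, ‖combo e B (fun n => conj (b n)) x‖ := by
  rw [intervalIntegral_eq_muPi, intervalIntegral_eq_muPi]
  refine integral_congr_ae ?_
  filter_upwards [h.coeFn_sum_vec B b, ae_muPi_mem] with x hx hxI
  rw [hx, ← h.conj_combo B b hxI, Complex.norm_conj]

/-- The spectral projection onto the eigenfunctions with indices in `N`. -/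
noncomputable def proj (h : EigenSystem u lam e e₁) (N : Finset ℕ) (F : Lp ℂ 2 muPi) :
    Lp ℂ 2 muPi := ∑ n ∈ N, (inner ℂ (h.vec n) F : ℂ) • h.vec n

theorem continuous_proj (h : EigenSystem u lam e e₁) (N : Finset ℕ) : Continuous (h.proj N) := by
  unfold proj
  fun_prop

theorem proj_sum (h : EigenSystem u lam e e₁) (N A : Finset ℕ) (a : ℕ → ℂ)
    (v : ℕ → Lp ℂ 2 muPi) : h.proj N (∑ k ∈ A, a k • v k) = ∑ k ∈ A, a k • h.proj N (v k) := by
  simp only [proj, inner_sum, inner_smul_right, Finset.sum_smul, Finset.smul_sum, smul_smul]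
  exact Finset.sum_comm

theorem inner_vec_proj (h : EigenSystem u lam e e₁) (N : Finset ℕ) (n : ℕ) (F : Lp ℂ 2 muPi) :
    inner ℂ (h.vec n) (h.proj N F) = if n ∈ N then inner ℂ (h.vec n) F else 0 := by
  classical
  simp only [proj, inner_sum, inner_smul_right, orthonormal_iff_ite.1 h.orthonormal]
  simp

theorem proj_vec (h : EigenSystem u lam e e₁) (N : Finset ℕ) (k : ℕ) :
    h.proj N (h.vec k) = if k ∈ N then h.vec k else 0 := by
  classical
  simp only [proj, orthonormal_iff_ite.1 h.orthonormal, ite_smul, one_smul, zero_smul]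
  simp

theorem inner_vec_sine (h : EigenSystem u lam e e₁) (n k : ℕ) :
    inner ℂ (h.vec n) (sineSystem.vec k) = ∫ x in (0 : ℝ)..Real.pi, e n x * sine k x := by
  rw [h.inner_vec, intervalIntegral_eq_muPi, intervalIntegral_eq_muPi]
  refine integral_congr_ae ?_
  filter_upwards [sineSystem.coeFn_vec k] with x hx
  rw [hx, mul_comm]

theorem inner_sum_proj_sub (h : EigenSystem u lam e e₁) {N N₀ : Finset ℕ}
    (hN : ∀ n, n ∈ N ↔ lam n < σ ^ 2) (hN₀ : ∀ k : ℕ, k ∈ N₀ ↔ ((k : ℝ) + 1) ^ 2 < σ ^ 2)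
    (A B : Finset ℕ) (a b : ℕ → ℂ) :
    inner ℂ (∑ n ∈ B, b n • h.vec n) (h.proj N (∑ k ∈ A, a k • sineSystem.vec k) -
        sineSystem.proj N₀ (∑ k ∈ A, a k • sineSystem.vec k)) =
      projectionPairing e lam σ A B a fun n => conj (b n) := by
  classical
  rw [h.proj_sum, sineSystem.proj_sum, ← Finset.sum_sub_distrib, sum_inner, projectionPairing]
  refine Finset.sum_congr rfl fun n _ => ?_
  rw [inner_sum]
  refine Finset.sum_congr rfl fun k _ => ?_
  rw [← smul_sub, inner_smul_left, inner_smul_right, inner_sub_right, h.inner_vec_proj,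
    sineSystem.proj_vec, ← h.inner_vec_sine]
  simp only [hN, hN₀]
  split_ifs <;> simp [mul_assoc]

/-- Both arguments are approximated by finite sums of their own eigenfunctions, by completeness of
the two systems. The approximation of `G` is in `L₂`, which also controls `L₁` norms at the cost of
`√π`. -/
theorem norm_inner_proj_sub_le (h : EigenSystem u lam e e₁) (hR : 0 < R) (hu : IsPotential R u)
    (hσ : 1 ≤ σ) (hc : 0 < c) (hW : Nonresonant u σ c) (hW0 : Nonresonant (fun _ => 0) σ c)
    {N N₀ : Finset ℕ} (hN : ∀ n, n ∈ N ↔ lam n < σ ^ 2)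
    (hN₀ : ∀ k : ℕ, k ∈ N₀ ↔ ((k : ℝ) + 1) ^ 2 < σ ^ 2) (F G : Lp ℂ 2 muPi) :
    ‖inner ℂ G (h.proj N F - sineSystem.proj N₀ F)‖ ≤
      diffConst R c * ‖F‖ * ∫ x in (0 : ℝ)..Real.pi, ‖G x‖ := by
  have hC : 0 ≤ diffConst R c := by unfold diffConst; positivity
  have hR0 : 0 ≤ R := hR.le
  have hfin : ∀ (A B : Finset ℕ) (a b : ℕ → ℂ),
      ‖inner ℂ (∑ n ∈ B, b n • h.vec n) (h.proj N (∑ k ∈ A, a k • sineSystem.vec k) -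
        sineSystem.proj N₀ (∑ k ∈ A, a k • sineSystem.vec k))‖ ≤
      diffConst R c * ‖∑ k ∈ A, a k • sineSystem.vec k‖ *
        ((∫ x in (0 : ℝ)..Real.pi, ‖G x‖) +
          Real.sqrt Real.pi * ‖(∑ n ∈ B, b n • h.vec n) - G‖) := by
    intro A B a b
    have h1 := h.norm_projectionPairing_le hR0 hu hσ hc hW hW0 A B a fun n => conj (b n)
    rw [h.inner_sum_proj_sub hN hN₀, sineSystem.norm_sum_vec]
    refine h1.trans ?_
    gcongr
    rw [← h.integral_norm_sum_vec]
    set S := ∑ n ∈ B, b n • h.vec n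
    have hi : ∀ H : Lp ℂ 2 muPi, Integrable (fun x => ‖H x‖) muPi := fun H =>
      ((Lp.memLp H).integrable (by norm_num)).norm
    refine le_trans ?_ (add_le_add le_rfl (integral_norm_Lp_le (S - G)))
    rw [intervalIntegral_eq_muPi, intervalIntegral_eq_muPi, intervalIntegral_eq_muPi,
      ← integral_add (hi _) (hi _)]
    refine integral_mono_ae (hi _) ((hi _).add (hi _)) ?_
    filter_upwards [Lp.coeFn_sub S G] with x hx
    rw [hx, Pi.sub_apply]
    have := norm_add_le (G x) (S x - G x)
    rwa [add_sub_cancel] at this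
  have tF : Tendsto (fun A : Finset ℕ => ∑ k ∈ A, (inner ℂ (sineSystem.vec k) F : ℂ) •
      sineSystem.vec k) atTop (𝓝 F) := by
    have hs := (sineSystem.basis hR (IsPotential.zero.mono le_rfl hR0)).hasSum_repr F
    simp only [HilbertBasis.repr_apply_apply, coe_basis] at hs
    exact hs
  have tG : Tendsto (fun B : Finset ℕ => ∑ n ∈ B, (inner ℂ (h.vec n) G : ℂ) •
      h.vec n) atTop (𝓝 G) := by
    have hs := (h.basis hR hu).hasSum_repr G
    simp only [HilbertBasis.repr_apply_apply, coe_basis] at hs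
    exact hs
  have step : ∀ B : Finset ℕ, ‖inner ℂ (∑ n ∈ B, (inner ℂ (h.vec n) G : ℂ) • h.vec n)
      (h.proj N F - sineSystem.proj N₀ F)‖ ≤ diffConst R c * ‖F‖ *
        ((∫ x in (0 : ℝ)..Real.pi, ‖G x‖) +
          Real.sqrt Real.pi * ‖(∑ n ∈ B, (inner ℂ (h.vec n) G : ℂ) • h.vec n) - G‖) := by
    intro B
    have hcont : Continuous fun F' => ‖inner ℂ (∑ n ∈ B, (inner ℂ (h.vec n) G : ℂ) • h.vec n)
        (h.proj N F' - sineSystem.proj N₀ F')‖ := by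
      have := h.continuous_proj N
      have := sineSystem.continuous_proj N₀
      fun_prop
    have t1 := (hcont.tendsto F).comp tF
    have t2 := (tF.norm.const_mul (diffConst R c)).mul_const ((∫ x in (0 : ℝ)..Real.pi, ‖G x‖) +
      Real.sqrt Real.pi * ‖(∑ n ∈ B, (inner ℂ (h.vec n) G : ℂ) • h.vec n) - G‖)
    exact le_of_tendsto_of_tendsto t1 t2 (Eventually.of_forall fun A => hfin A B
      (fun k => inner ℂ (sineSystem.vec k) F) fun n => inner ℂ (h.vec n) G)
  have h1 := (tG.inner (𝕜 := ℂ) (tendsto_const_nhds (x := h.proj N F - sineSystem.proj N₀ F))).norm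
  have h2 : Tendsto (fun B : Finset ℕ => diffConst R c * ‖F‖ *
      ((∫ x in (0 : ℝ)..Real.pi, ‖G x‖) +
        Real.sqrt Real.pi * ‖(∑ n ∈ B, (inner ℂ (h.vec n) G : ℂ) • h.vec n) - G‖)) atTop
      (𝓝 (diffConst R c * ‖F‖ * ((∫ x in (0 : ℝ)..Real.pi, ‖G x‖) +
        Real.sqrt Real.pi * ‖G - G‖))) :=
    ((((tG.sub tendsto_const_nhds).norm).const_mul _).const_add _).const_mul _
  rw [sub_self, norm_zero, mul_zero, add_zero] at h2
  exact le_of_tendsto_of_tendsto h1 h2 (Eventually.of_forall step)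

/-- The spectral projections of the perturbed and of the free operator differ by a bounded
operator from `L₂` to `C`. -/
theorem norm_combo_sub_le (h : EigenSystem u lam e e₁) (hR : 0 < R) (hu : IsPotential R u)
    (hσ : 1 ≤ σ) (hc : 0 < c) (hW : Nonresonant u σ c) (hW0 : Nonresonant (fun _ => 0) σ c)
    {N N₀ : Finset ℕ} (hN : ∀ n, n ∈ N ↔ lam n < σ ^ 2)
    (hN₀ : ∀ k : ℕ, k ∈ N₀ ↔ ((k : ℝ) + 1) ^ 2 < σ ^ 2) (F : Lp ℂ 2 muPi)
    {x : ℝ} (hx : x ∈ Icc 0 Real.pi) :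
    ‖combo e N (fun n => inner ℂ (h.vec n) F) x -
      combo sine N₀ (fun k => inner ℂ (sineSystem.vec k) F) x‖ ≤ diffConst R c * ‖F‖ := by
  have hR0 : 0 ≤ R := hR.le
  set φ : ℝ → ℂ := fun x => combo e N (fun n => inner ℂ (h.vec n) F) x -
      combo sine N₀ (fun k => inner ℂ (sineSystem.vec k) F) x with hφ
  have hC : 0 ≤ diffConst R c := by unfold diffConst; positivity
  have hcont : ContinuousOn φ (Icc 0 Real.pi) :=
    (continuousOn_combo h.continuousOn _ _).sub (continuousOn_combo sineSystem.continuousOn _ _)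
  set D := h.proj N F - sineSystem.proj N₀ F with hD
  have hDφ : D =ᵐ[muPi] φ := by
    filter_upwards [Lp.coeFn_sub (h.proj N F) (sineSystem.proj N₀ F),
      h.coeFn_sum_vec N (fun n => inner ℂ (h.vec n) F),
      sineSystem.coeFn_sum_vec N₀ (fun n => inner ℂ (sineSystem.vec n) F)] with x h1 h2 h3
    rw [hD, h1, Pi.sub_apply, proj, proj, h2, h3]
  set M := diffConst R c * ‖F‖ with hM
  have hM0 : 0 ≤ M := by positivity
  change ‖φ x‖ ≤ M
  rcases eq_or_ne (φ x) 0 with h0 | h0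
  · rw [h0, norm_zero]; exact hM0
  -- Testing with the indicator of an arbitrary set times this fixed direction bounds all averages
  -- of `Re(d̄ φ)` by `M`, hence the function itself almost everywhere.
  set d : ℂ := φ x / ‖φ x‖ with hd
  have hn : (‖φ x‖ : ℂ) ≠ 0 := Complex.ofReal_ne_zero.2 (norm_ne_zero_iff.2 h0)
  have hd1 : ‖d‖ = 1 := by
    rw [hd, norm_div, Complex.norm_real, norm_norm, div_self (norm_ne_zero_iff.2 h0)]
  have hDi : Integrable (fun t => (inner ℂ d (D t) : ℂ)) muPi :=
    ((Lp.memLp D).integrable (by norm_num)).const_inner d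
  have hae : (fun t => (inner ℂ d (D t) : ℂ).re) ≤ᵐ[muPi] fun _ => M := by
    refine ae_le_of_forall_setIntegral_le hDi.re (integrable_const _) fun s hs hμs => ?_
    have h1 := h.norm_inner_proj_sub_le hR hu hσ hc hW hW0 hN hN₀ F
      (indicatorConstLp 2 hs hμs.ne d)
    rw [← hD, L2.inner_indicatorConstLp_eq_setIntegral_inner] at h1
    have h2 : ∫ t in s, (inner ℂ d (D t) : ℂ).re ∂muPi = (∫ t in s, inner ℂ d (D t) ∂muPi).re :=
      integral_re hDi.integrableOn
    have h3 : ∫ t in (0 : ℝ)..Real.pi, ‖(indicatorConstLp 2 hs hμs.ne d : Lp ℂ 2 muPi) t‖ =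
        muPi.real s := by
      rw [intervalIntegral_eq_muPi, ← integral_indicator_one hs]
      refine integral_congr_ae ?_
      filter_upwards [indicatorConstLp_coeFn (p := 2) (hs := hs) (hμs := hμs.ne) (c := d)] with t ht
      rw [ht]
      by_cases hts : t ∈ s <;> simp [hts, hd1]
    rw [h2]
    refine (Complex.re_le_norm _).trans (h1.trans (le_of_eq ?_))
    rw [h3, setIntegral_const, smul_eq_mul, mul_comm]
  -- The inequality is written as an equality with a maximum so that agreement almost everywhere of
  -- continuous functions extends to every point.
  have hev : EqOn (fun t => max ((inner ℂ d (φ t) : ℂ).re) M) (fun _ => M) (Icc 0 Real.pi) := by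
    refine Measure.eqOn_Icc_of_ae_eq volume Real.pi_pos.ne ?_ ?_ continuousOn_const
    · filter_upwards [hae, hDφ] with t h1 h2
      rw [← h2]
      exact max_eq_right h1
    · refine ContinuousOn.sup ?_ continuousOn_const
      exact Complex.continuous_re.comp_continuousOn (continuousOn_const.inner hcont)
  have hfin := hev hx
  simp only [max_eq_right_iff] at hfin
  have h4 : (inner ℂ d (φ x) : ℂ).re = ‖φ x‖ := by
    rw [RCLike.inner_apply, hd, map_div₀, Complex.conj_ofReal, mul_div_assoc', Complex.mul_conj',
      sq, mul_div_assoc, div_self hn, mul_one, Complex.ofReal_re]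
  linarith

end EigenSystem


/-! ### Expansion of smooth functions -/

theorem norm_integral_mul_le {f g : ℝ → ℂ} (hf : MemLp f 2 muPi) (hg : MemLp g 2 muPi) :
    ‖∫ x in (0 : ℝ)..Real.pi, f x * g x‖ ≤
      Real.sqrt (∫ x in (0 : ℝ)..Real.pi, ‖f x‖ ^ 2) *
        Real.sqrt (∫ x in (0 : ℝ)..Real.pi, ‖g x‖ ^ 2) := by
  simp only [intervalIntegral_eq_muPi]
  refine (norm_integral_le_integral_norm _).trans ?_
  simp only [norm_mul]
  exact integral_norm_mul_norm_le hf hg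

theorem IsPotential.memLp_ofReal {R : ℝ} {u : ℝ → ℝ} (hu : IsPotential R u) :
    MemLp (fun x => (u x : ℂ)) 2 muPi := hu.memLp.ofReal

theorem IsPotential.norm_integral_mul_mul_le {R M : ℝ} {u : ℝ → ℝ} (hu : IsPotential R u)
    (hR : 0 ≤ R) {f g : ℝ → ℂ} (hf : ContinuousOn f (Icc 0 Real.pi))
    (hg : ContinuousOn g (Icc 0 Real.pi)) (hM : ∀ x ∈ Icc 0 Real.pi, ‖g x‖ ≤ M) :
    ‖∫ x in (0 : ℝ)..Real.pi, u x * g x * f x‖ ≤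
      R * M * Real.sqrt (∫ x in (0 : ℝ)..Real.pi, ‖f x‖ ^ 2) := by
  have hM0 : 0 ≤ M := (norm_nonneg _).trans (hM 0 zero_mem_Icc_pi)
  have hug : MemLp (fun x => (u x : ℂ) * g x) 2 muPi := by
    refine MemLp.of_le_mul (c := M) hu.memLp_ofReal
      (hu.memLp_ofReal.aestronglyMeasurable.mul (hg.aestronglyMeasurable measurableSet_Icc)) ?_
    filter_upwards [ae_muPi_mem] with x hx
    rw [norm_mul, mul_comm]
    exact mul_le_mul_of_nonneg_right (hM x hx) (norm_nonneg _)
  refine (norm_integral_mul_le hug (memLp_of_continuousOn hf)).trans ?_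
  gcongr
  refine Real.sqrt_le_iff.2 ⟨by positivity, ?_⟩
  have h1 : ∀ x, ‖(u x : ℂ) * g x‖ ^ 2 = u x ^ 2 * ‖g x‖ ^ 2 := fun x => by
    rw [norm_mul, mul_pow, Complex.norm_real, Real.norm_eq_abs, sq_abs]
  simp only [h1]
  rw [mul_pow]
  exact hu.integral_sq_mul_le pi_mem_Icc_pi (hg.norm.pow 2)
    (fun x hx => pow_le_pow_left₀ (norm_nonneg _) (hM x hx) 2) (by positivity)

theorem IsPotential.norm_integral_sq_mul_le {R M : ℝ} {u : ℝ → ℝ} (hu : IsPotential R u)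
    {g : ℝ → ℂ} (hg : ContinuousOn g (Icc 0 Real.pi)) (hM : ∀ x ∈ Icc 0 Real.pi, ‖g x‖ ≤ M) :
    ‖∫ x in (0 : ℝ)..Real.pi, u x ^ 2 * g x‖ ≤ R ^ 2 * M := by
  have hM0 : 0 ≤ M := (norm_nonneg _).trans (hM 0 zero_mem_Icc_pi)
  refine (intervalIntegral.norm_integral_le_integral_norm Real.pi_pos.le).trans ?_
  have h1 : ∀ x, ‖(u x : ℂ) ^ 2 * g x‖ = u x ^ 2 * ‖g x‖ := fun x => by
    rw [norm_mul, norm_pow, Complex.norm_real, Real.norm_eq_abs, sq_abs]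
  simp only [h1]
  exact hu.integral_sq_mul_le pi_mem_Icc_pi hg.norm hM hM0

section

variable {R : ℝ} {u : ℝ → ℝ} {G H H₁ γ g g₁ : ℝ → ℂ}

/-- The operator is moved from `H` to the smooth function `g`: `γ` is `-g''`, and the distribution
`u'` splits into terms containing only `u` and `u²`. -/
theorem Sol.integral_rhs_mul (hu : IsPotential R u) (h : Sol u G H H₁) (h0 : H 0 = 0)
    (hpi : H Real.pi = 0) (hg : Sol (fun _ => 0) γ g g₁) (hg0 : g 0 = 0) (hgpi : g Real.pi = 0)
    (hγ : ContinuousOn γ (Icc 0 Real.pi)) :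
    ∫ x in (0 : ℝ)..Real.pi, G x * g x = (∫ x in (0 : ℝ)..Real.pi, γ x * H x) -
      (∫ x in (0 : ℝ)..Real.pi, u x * g₁ x * H x) - (∫ x in (0 : ℝ)..Real.pi, u x * g x * H₁ x) -
      ∫ x in (0 : ℝ)..Real.pi, u x ^ 2 * (g x * H x) := by
  have hd := ((h.deriv_quasi.mul hg.deriv).sub (h.deriv.mul hg.deriv_quasi))
  have hi := hd.integral_eq zero_mem_Icc_pi pi_mem_Icc_pi
  have i1 : IntervalIntegrable (fun x => γ x * H x) volume 0 Real.pi :=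
    (hγ.mul h.deriv.continuousOn).intervalIntegrable_of_Icc Real.pi_pos.le
  have i2 : IntervalIntegrable (fun x => u x * g₁ x * H x) volume 0 Real.pi :=
    (integrable_mul_of_continuousOn hu.intervalIntegrable
      (hg.deriv_quasi.continuousOn.mul h.deriv.continuousOn)).congr fun x _ => by
        simp only [Pi.mul_apply]; ring
  have i3 : IntervalIntegrable (fun x => u x * g x * H₁ x) volume 0 Real.pi :=
    (integrable_mul_of_continuousOn hu.intervalIntegrable
      (hg.deriv.continuousOn.mul h.deriv_quasi.continuousOn)).congr fun x _ => by
        simp only [Pi.mul_apply]; ring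
  have i4 : IntervalIntegrable (fun x => (u x : ℂ) ^ 2 * (g x * H x)) volume 0 Real.pi := by
    have := integrable_mul_of_continuousOn hu.intervalIntegrable_sq
      (hg.deriv.continuousOn.mul h.deriv.continuousOn)
    push_cast at this
    exact this
  rw [← intervalIntegral.integral_sub i1 i2, ← intervalIntegral.integral_sub (i1.sub i2) i3,
    ← intervalIntegral.integral_sub ((i1.sub i2).sub i3) i4, eq_comm, ← sub_eq_zero]
  rw [h0, hpi, hg0, hgpi] at hi
  simp only [zero_mul, mul_zero, sub_self] at hi
  have i5 : IntervalIntegrable (fun x => G x * g x) volume 0 Real.pi := by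
    refine ((((i1.sub i2).sub i3).sub i4).sub hd.intervalIntegrable).congr fun x _ => ?_
    push_cast
    ring
  rw [← intervalIntegral.integral_sub (((i1.sub i2).sub i3).sub i4) i5, ← hi]
  refine intervalIntegral.integral_congr fun x _ => ?_
  push_cast
  ring

theorem Sol.integral_quasi_norm_sq_of_dirichlet (hu : IsPotential R u) (h : Sol u G H H₁)
    (h0 : H 0 = 0) (hpi : H Real.pi = 0) (hG : ContinuousOn G (Icc 0 Real.pi)) :
    ∫ x in (0 : ℝ)..Real.pi, ‖H₁ x‖ ^ 2 = (∫ x in (0 : ℝ)..Real.pi, u x ^ 2 * ‖H x‖ ^ 2) +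
      (∫ x in (0 : ℝ)..Real.pi, G x * conj (H x)).re := by
  have hd : HasACDeriv (fun x => (conj (H x) * H₁ x).re)
      fun x => ‖H₁ x‖ ^ 2 - u x ^ 2 * ‖H x‖ ^ 2 - (G x * conj (H x)).re := by
    refine (h.star.mul_quasi h).re.congr_deriv' fun x => ?_
    simp only [Complex.sq_norm, Complex.normSq_apply]
    simp only [pow_two]
    simp
    ring
  have hi := hd.integral_eq_real zero_mem_Icc_pi pi_mem_Icc_pi
  have ju := hu.intervalIntegrable_sq_mul (f := fun t => ‖H t‖ ^ 2)
    (h.deriv.continuousOn.norm.pow 2)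
  have jG : IntervalIntegrable (fun x => G x * conj (H x)) volume 0 Real.pi :=
    (hG.mul h.star.deriv.continuousOn).intervalIntegrable_of_Icc Real.pi_pos.le
  have jG' : IntervalIntegrable (fun x => (G x * conj (H x)).re) volume 0 Real.pi := by
    rw [intervalIntegrable_iff_muPi] at *
    exact jG.re
  have e : (∫ x in (0 : ℝ)..Real.pi, G x * conj (H x)).re =
      ∫ x in (0 : ℝ)..Real.pi, (G x * conj (H x)).re := by
    rw [intervalIntegral_eq_muPi, intervalIntegral_eq_muPi]
    rw [intervalIntegrable_iff_muPi] at jG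
    exact (integral_re jG).symm
  rw [intervalIntegral.integral_sub (h.intervalIntegrable_quasi_norm_sq.sub ju) jG',
    intervalIntegral.integral_sub h.intervalIntegrable_quasi_norm_sq ju, h0, hpi] at hi
  simp only [map_zero, zero_mul, Complex.zero_re, sub_zero] at hi
  rw [e]
  linarith

end

/-- The quadratic inequality behind the decay of the expansion of a smooth function. -/
theorem sup_le_of_form {R σ S q I Q G₀ G₁ G₂ : ℝ} (hR : 0 < R) (hσ : 4 * R ^ 2 ≤ σ) (hS : 0 ≤ S)
    (hI : 0 ≤ I) (hG₀ : 0 ≤ G₀) (hG₁ : 0 ≤ G₁) (hG₂ : 0 ≤ G₂) (hIq : σ ^ 2 * I ≤ q)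
    (hQ : Q ≤ q + R ^ 2 * S ^ 2)
    (hSS : S ^ 2 ≤ 2 * (1 / σ) * Q + (2 / (1 / σ) + 4 * R ^ 2) * I)
    (hq : q ≤ G₂ * Real.sqrt I + R * G₁ * Real.sqrt I + R * G₀ * Real.sqrt Q +
      R ^ 2 * (G₀ * S)) :
    S ≤ 4 / Real.sqrt σ * ((G₂ + R * G₁) / σ + 4 * R * G₀) := by
  have hσ0 : 0 < σ := lt_of_lt_of_le (by positivity) hσ
  have hq0 : 0 ≤ q := le_trans (by positivity) hIq
  set s := Real.sqrt σ with hs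
  have hs0 : 0 < s := Real.sqrt_pos.2 hσ0
  have hs2 : s ^ 2 = σ := Real.sq_sqrt hσ0.le
  -- `S`, `√Q` and `√I` are all bounded by multiples of `p`, so `hq` becomes `p² ≤ const · p` and
  -- bounds `p`.
  set p := Real.sqrt q with hp
  have hp0 : 0 ≤ p := Real.sqrt_nonneg _
  have hp2 : p ^ 2 = q := Real.sq_sqrt hq0
  have e1 : σ * S ^ 2 ≤ 10 * q := by
    have h1 : σ * S ^ 2 ≤ 2 * Q + (2 * σ ^ 2 + 4 * R ^ 2 * σ) * I := by
      have := mul_le_mul_of_nonneg_left hSS hσ0.le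
      have e : σ * (2 * (1 / σ) * Q + (2 / (1 / σ) + 4 * R ^ 2) * I) =
        2 * Q + (2 * σ ^ 2 + 4 * R ^ 2 * σ) * I := by field_simp
      rwa [e] at this
    have h2 : (2 * σ ^ 2 + 4 * R ^ 2 * σ) * I ≤ 3 * q := by
      have : 4 * R ^ 2 * σ * I ≤ σ * σ * I := by gcongr
      nlinarith
    have h3 : R ^ 2 * S ^ 2 ≤ σ / 4 * S ^ 2 := by gcongr; linarith
    linarith
  have e2 : s * S ≤ 4 * p := by
    refine (sq_le_sq₀ (by positivity) (by positivity)).1 ?_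
    rw [mul_pow, mul_pow, hs2, hp2]
    linarith
  have e3 : Real.sqrt Q ≤ 2 * p := by
    refine Real.sqrt_le_iff.2 ⟨by positivity, ?_⟩
    rw [mul_pow, hp2]
    have : R ^ 2 * S ^ 2 ≤ σ / 4 * S ^ 2 := by gcongr; linarith
    linarith
  have e4 : Real.sqrt I ≤ p / σ := by
    refine Real.sqrt_le_iff.2 ⟨by positivity, ?_⟩
    rw [div_pow, hp2, le_div_iff₀ (by positivity)]
    linarith
  have e5 : R ≤ s / 2 := by
    refine (sq_le_sq₀ (by positivity) (by positivity)).1 ?_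
    rw [div_pow, hs2]
    linarith
  have e6 : R ^ 2 * (G₀ * S) ≤ 2 * R * G₀ * p := by
    calc R ^ 2 * (G₀ * S) = R * G₀ * (R * S) := by ring
      _ ≤ R * G₀ * (s / 2 * S) := by gcongr
      _ ≤ R * G₀ * (2 * p) := mul_le_mul_of_nonneg_left (by linarith) (by positivity)
      _ = _ := by ring
  have e7 : p ≤ (G₂ + R * G₁) / σ + 4 * R * G₀ := by
    rcases hp0.eq_or_lt with h0 | h0
    · rw [← h0]; positivity
    · refine le_of_mul_le_mul_right ?_ h0
      calc p * p = q := by rw [← sq, hp2]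
        _ ≤ G₂ * (p / σ) + R * G₁ * (p / σ) + R * G₀ * (2 * p) + 2 * R * G₀ * p :=
          hq.trans (by gcongr)
        _ = _ := by field_simp; ring
  calc S ≤ 4 * p / s := by rw [le_div_iff₀ hs0]; linarith
    _ = 4 / s * p := by ring
    _ ≤ _ := by gcongr

namespace EigenSystem

variable {R σ : ℝ} {u : ℝ → ℝ} {lam : ℕ → ℝ} {e e₁ : ℕ → ℝ → ℂ}

/-- Let `H` be a finite piece of the expansion of `g`. The number `q = Σ λₙ|bₙ|²` is both the
quadratic form of `H` and the pairing of the operator applied to `H` with `g`. Only eigenvalues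
above `σ²` occur, so `σ² ∫ |H|² ≤ q`, and `sup_le_of_form` closes the loop. -/
theorem norm_combo_le_of_free (h : EigenSystem u lam e e₁) (hR : 0 < R) (hu : IsPotential R u)
    (hσ : 4 * R ^ 2 ≤ σ) {γ g g₁ : ℝ → ℂ} (hg : Sol (fun _ => 0) γ g g₁) (hg0 : g 0 = 0)
    (hgpi : g Real.pi = 0) (hγ : ContinuousOn γ (Icc 0 Real.pi)) {G₀ G₁ G₂ : ℝ}
    (hG₀ : ∀ x ∈ Icc 0 Real.pi, ‖g x‖ ≤ G₀) (hG₁ : ∀ x ∈ Icc 0 Real.pi, ‖g₁ x‖ ≤ G₁)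
    (hG₂ : Real.sqrt (∫ x in (0 : ℝ)..Real.pi, ‖γ x‖ ^ 2) ≤ G₂) (B : Finset ℕ)
    (hB : ∀ n ∈ B, σ ^ 2 ≤ lam n) {x : ℝ} (hx : x ∈ Icc 0 Real.pi) :
    ‖combo e B (fun n => ∫ t in (0 : ℝ)..Real.pi, g t * e n t) x‖ ≤
      4 / Real.sqrt σ * ((G₂ + R * G₁) / σ + 4 * R * G₀) := by
  have hσ0 : 0 < σ := lt_of_lt_of_le (by positivity) hσ
  set b : ℕ → ℂ := fun n => ∫ t in (0 : ℝ)..Real.pi, g t * e n t with hb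
  set H := combo e B b with hH
  set H₁ := combo e₁ B b
  set G := combo e B fun n => lam n * b n with hGdef
  have hS : Sol u G H H₁ := (Sol.sum B fun n _ => (h.sol n).const_mul (b n)).congr_rhs
    fun x _ => Finset.sum_congr rfl fun n _ => by ring
  have hGc : ContinuousOn G (Icc 0 Real.pi) := continuousOn_combo h.continuousOn _ _
  have hH0 : H 0 = 0 := h.combo_left B b
  have hHpi : H Real.pi = 0 := h.combo_right B b
  have hgc := hg.deriv.continuousOn
  have hbconj : ∀ n, ∫ t in (0 : ℝ)..Real.pi, e n t * conj (g t) = conj (b n) := fun n => by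
    rw [hb]
    simp only
    rw [intervalIntegral_eq_muPi, intervalIntegral_eq_muPi, ← integral_conj]
    refine integral_congr_ae ?_
    filter_upwards [ae_muPi_mem] with t ht
    rw [map_mul, h.real n t ht, mul_comm]
  set q : ℝ := ∑ n ∈ B, lam n * ‖b n‖ ^ 2 with hq
  have hqG : ∫ x in (0 : ℝ)..Real.pi, G x * conj (g x) = q := by
    have h1 := integral_combo_mul_combo (s := fun _ x => conj (g x)) h.continuousOn
      (fun _ => hg.star.deriv.continuousOn) {0} B (fun _ => 1) fun n => lam n * b n
    simp only [Finset.sum_singleton, hbconj] at h1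
    have e1 : ∀ x, combo (fun _ x => conj (g x)) {0} (fun _ => 1) x = conj (g x) := fun x => by
      simp [combo]
    simp only [e1] at h1
    rw [hGdef, h1, hq]
    push_cast
    refine Finset.sum_congr rfl fun n _ => ?_
    rw [← Complex.mul_conj']
    ring
  have hpair : ∀ d : ℕ → ℂ, ∫ x in (0 : ℝ)..Real.pi, combo e B d x * conj (H x) =
      ∑ n ∈ B, d n * conj (b n) := fun d => by
    have h1 := integral_combo_mul_combo h.continuousOn h.continuousOn B B (fun n => conj (b n)) d
    simp only [h.integral_mul] at h1
    rw [intervalIntegral.integral_congr (g := fun x => combo e B d x *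
      combo e B (fun n => conj (b n)) x), h1]
    · refine Finset.sum_congr rfl fun n hn => ?_
      simp [hn]
    · intro x hx
      rw [uIcc_zero_pi] at hx
      simp only [hH, h.conj_combo B b hx]
  have hI : ∫ x in (0 : ℝ)..Real.pi, ‖H x‖ ^ 2 = ∑ n ∈ B, ‖b n‖ ^ 2 := by
    have h1 := hpair b
    rw [← Complex.ofReal_inj, ← intervalIntegral.integral_ofReal]
    push_cast
    simp only [← Complex.mul_conj']
    exact h1
  have hQ := hS.integral_quasi_norm_sq_of_dirichlet hu hH0 hHpi hGc
  have hqH : (∫ x in (0 : ℝ)..Real.pi, G x * conj (H x)).re = q := by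
    rw [hGdef, hpair]
    have : ∑ n ∈ B, (lam n * b n) * conj (b n) = (q : ℂ) := by
      rw [hq]
      push_cast
      refine Finset.sum_congr rfl fun n _ => ?_
      rw [← Complex.mul_conj']
      ring
    rw [this, Complex.ofReal_re]
  rw [hqH] at hQ
  obtain ⟨c, hc, hmax⟩ := (isCompact_Icc (a := (0 : ℝ)) (b := Real.pi)).exists_isMaxOn
    ⟨0, zero_mem_Icc_pi⟩ hS.deriv.continuousOn.norm
  refine (hmax hx).trans ?_
  set S := ‖H c‖ with hSdef
  have hSle : ∀ t ∈ Icc 0 Real.pi, ‖H t‖ ≤ S := fun t ht => hmax ht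
  have hS0 : 0 ≤ S := norm_nonneg _
  have hG₀0 : 0 ≤ G₀ := (norm_nonneg _).trans (hG₀ 0 zero_mem_Icc_pi)
  have hG₁0 : 0 ≤ G₁ := (norm_nonneg _).trans (hG₁ 0 zero_mem_Icc_pi)
  have hG₂0 : 0 ≤ G₂ := (Real.sqrt_nonneg _).trans hG₂
  have hI0 : 0 ≤ ∫ x in (0 : ℝ)..Real.pi, ‖H x‖ ^ 2 :=
    intervalIntegral.integral_nonneg Real.pi_pos.le fun t _ => by positivity
  refine sup_le_of_form (q := q) (Q := ∫ x in (0 : ℝ)..Real.pi, ‖H₁ x‖ ^ 2)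
    (I := ∫ x in (0 : ℝ)..Real.pi, ‖H x‖ ^ 2) hR hσ hS0 hI0 hG₀0 hG₁0 hG₂0 ?_ ?_ ?_ ?_
  · rw [hI, hq, Finset.mul_sum]
    exact Finset.sum_le_sum fun n hn => mul_le_mul_of_nonneg_right (hB n hn) (by positivity)
  · have := hu.integral_sq_mul_le (f := fun t => ‖H t‖ ^ 2) (M := S ^ 2) pi_mem_Icc_pi
      (hS.deriv.continuousOn.norm.pow 2)
      (fun t ht => pow_le_pow_left₀ (norm_nonneg _) (hSle t ht) 2) (by positivity)
    linarith
  · exact hS.norm_sq_le hR hu hH0 pi_mem_Icc_pi (by positivity) hc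
  · have hform := hS.integral_rhs_mul hu hH0 hHpi hg.star (by simp [hg0]) (by simp [hgpi])
      (Complex.continuous_conj.comp_continuousOn hγ)
    rw [hqG] at hform
    have hHc := hS.deriv.continuousOn
    have b1 := norm_integral_mul_le (memLp_of_continuousOn
      (Complex.continuous_conj.comp_continuousOn hγ)) (memLp_of_continuousOn hHc)
    simp only [Function.comp_apply, Complex.norm_conj] at b1
    have b2 := hu.norm_integral_mul_mul_le hR.le (M := G₁) hHc
      hg.star.deriv_quasi.continuousOn fun x hx => by rw [Complex.norm_conj]; exact hG₁ x hx
    have b3 := hu.norm_integral_mul_mul_le hR.le (M := G₀) hS.deriv_quasi.continuousOn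
      hg.star.deriv.continuousOn fun x hx => by rw [Complex.norm_conj]; exact hG₀ x hx
    have b4 := hu.norm_integral_sq_mul_le (M := G₀ * S) (hg.star.deriv.continuousOn.mul hHc)
      fun x hx => by
        rw [Pi.mul_apply, norm_mul, Complex.norm_conj]
        exact mul_le_mul (hG₀ x hx) (hSle x hx) (norm_nonneg _) hG₀0
    have b1' := b1.trans (mul_le_mul_of_nonneg_right hG₂ (Real.sqrt_nonneg _))
    calc q ≤ ‖(q : ℂ)‖ := by rw [Complex.norm_real]; exact le_abs_self _
      _ ≤ _ := by
        rw [hform]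
        refine (norm_sub_le _ _).trans (add_le_add ((norm_sub_le _ _).trans
          (add_le_add ((norm_sub_le _ _).trans (add_le_add b1' b2)) b3)) b4)

/-- Partial sums converge in `L₂`, hence almost everywhere along a subsequence. A bound for all
finite pieces outside `N` passes to the remainder almost everywhere, and by continuity everywhere.
-/
theorem norm_sub_combo_le (h : EigenSystem u lam e e₁) (hR : 0 < R) (hu : IsPotential R u)
    {g : ℝ → ℂ} (hg : ContinuousOn g (Icc 0 Real.pi)) {N : Finset ℕ} {M : ℝ}
    (hM : ∀ B : Finset ℕ, Disjoint N B → ∀ x ∈ Icc 0 Real.pi,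
      ‖combo e B (fun n => ∫ t in (0 : ℝ)..Real.pi, g t * e n t) x‖ ≤ M) {x : ℝ}
    (hx : x ∈ Icc 0 Real.pi) :
    ‖g x - combo e N (fun n => ∫ t in (0 : ℝ)..Real.pi, g t * e n t) x‖ ≤ M := by
  classical
  set b : ℕ → ℂ := fun n => ∫ t in (0 : ℝ)..Real.pi, g t * e n t with hb
  set F : Lp ℂ 2 muPi := (memLp_of_continuousOn hg).toLp with hF
  have hFg : F =ᵐ[muPi] g := (memLp_of_continuousOn hg).coeFn_toLp
  have hbF : ∀ n, inner ℂ (h.vec n) F = b n := fun n => by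
    rw [h.inner_vec, hb]
    simp only
    rw [intervalIntegral_eq_muPi, intervalIntegral_eq_muPi]
    refine integral_congr_ae ?_
    filter_upwards [hFg] with t ht
    rw [ht]
  have hs := (h.basis hR hu).hasSum_repr F
  simp only [HilbertBasis.repr_apply_apply, coe_basis, hbF] at hs
  have ht := (tendstoInMeasure_of_tendsto_Lp (hs.tendsto_sum_nat)).exists_seq_tendsto_ae
  obtain ⟨ns, hns, hae⟩ := ht
  have hcomb : ∀ᵐ x ∂muPi, ∀ i, (∑ n ∈ Finset.range (ns i), b n • h.vec n : Lp ℂ 2 muPi) x =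
      combo e (Finset.range (ns i)) b x := by
    rw [ae_all_iff]
    exact fun i => h.coeFn_sum_vec _ _
  have hle : ∀ᵐ x ∂muPi, ‖g x - combo e N b x‖ ≤ M := by
    filter_upwards [hae, hcomb, hFg, ae_muPi_mem] with x h1 h2 h3 hxI
    rw [← h3]
    simp only [h2] at h1
    refine le_of_tendsto (h1.sub_const (combo e N b x)).norm ?_
    obtain ⟨K, hK⟩ := N.bddAbove
    filter_upwards [hns.tendsto_atTop.eventually_gt_atTop K] with i hi
    have hsub : N ⊆ Finset.range (ns i) := fun n hn =>
      Finset.mem_range.2 ((hK (Finset.mem_coe.2 hn)).trans_lt hi)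
    have e1 : combo e (Finset.range (ns i)) b x - combo e N b x =
        combo e (Finset.range (ns i) \ N) b x := by
      rw [combo, combo, combo, ← Finset.sum_sdiff hsub, add_sub_cancel_right]
    rw [e1]
    exact hM _ Finset.disjoint_sdiff x hxI
  have hcont : ContinuousOn (fun x => ‖g x - combo e N b x‖) (Icc 0 Real.pi) :=
    (hg.sub (continuousOn_combo h.continuousOn _ _)).norm
  have hev : EqOn (fun t => max ‖g t - combo e N b t‖ M) (fun _ => M) (Icc 0 Real.pi) := by
    refine Measure.eqOn_Icc_of_ae_eq volume Real.pi_pos.ne ?_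
      (ContinuousOn.sup hcont continuousOn_const) continuousOn_const
    filter_upwards [hle] with t ht using max_eq_right ht
  exact max_eq_right_iff.1 (hev hx)

end EigenSystem


/-! ### Partial sums of the eigenfunction expansion -/

/-- `exists_gap` selects `σ` for `u`, and the free operator is nonresonant at every point of the
same window. -/
theorem exists_uniform_nonresonance (R : ℝ) (hR : 0 < R) : ∃ (M : ℕ) (c : ℝ), 0 < c ∧
    ∀ u, IsPotential R u → ∀ m : ℕ, M ≤ m → ∃ σ ∈ Icc ((m : ℝ) + 1 / 4) (m + 3 / 4),
      Nonresonant u σ c ∧ Nonresonant (fun _ => 0) σ c := by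
  have hδ : 0 < min (gapConst R) (1 / 2) := lt_min (gapConst_pos R) (by norm_num)
  obtain ⟨σ₀, c, hσ₀, hc, hnr⟩ := exists_nonresonance R hδ
  refine ⟨⌈max (rhoBound R) σ₀⌉₊, c, hc, fun u hu m hm => ?_⟩
  have hm' : max (rhoBound R) σ₀ ≤ m := (Nat.le_ceil _).trans (by exact_mod_cast hm)
  have h0 : IsPotential R fun _ => 0 := IsPotential.zero.mono le_rfl hR.le
  obtain ⟨om, om₁, hom⟩ := hu.exists_omega
  obtain ⟨om', om₁', hom'⟩ := h0.exists_omega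
  obtain ⟨σ, hσ, hgap⟩ := exists_gap hu hom ((le_max_left _ _).trans hm')
  have hσσ : σ₀ ≤ σ := ((le_max_right _ _).trans hm').trans (by linarith [hσ.1])
  exact ⟨σ, hσ, ⟨om, om₁, hom, hnr u hu om om₁ hom σ hσσ ((min_le_left _ _).trans hgap)⟩,
    ⟨om', om₁', hom', hnr _ h0 om' om₁' hom' σ hσσ
      ((min_le_right _ _).trans ((hom' _).free_gap hσ))⟩⟩

theorem norm_sum_range_sub_le {b : ℕ → ℂ} {T : ℝ} (hb : ∀ n, ‖b n‖ ≤ T) (m N : ℕ) :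
    ‖∑ n ∈ Finset.range m, b n - ∑ n ∈ Finset.range N, b n‖ ≤ |(m : ℝ) - N| * T := by
  wlog hmN : N ≤ m generalizing m N
  · rw [norm_sub_rev, abs_sub_comm]
    exact this N m (le_of_not_ge hmN)
  rw [← Finset.sum_Ico_eq_sub _ hmN]
  refine (norm_sum_le_of_le _ fun n _ => hb n).trans ?_
  rw [Finset.sum_const, Nat.card_Ico, nsmul_eq_mul, Nat.cast_sub hmN]
  have hT : 0 ≤ T := (norm_nonneg _).trans (hb 0)
  exact mul_le_mul_of_nonneg_right (le_abs_self _) hT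

theorem eq_Iio_ncard_of_isLowerSet {S : Set ℕ} (hS : S.Finite) (hl : IsLowerSet S) :
    S = Iio S.ncard := by
  classical
  have hex : ∃ n, n ∉ S := by
    by_contra! hall
    exact Set.infinite_univ (hS.subset fun n _ => hall n)
  have hE : S = Iio (Nat.find hex) := by
    ext n
    refine ⟨fun hn => ?_, fun hn => not_not.1 (Nat.find_min hex hn)⟩
    by_contra hle
    exact Nat.find_spec hex (hl (not_lt.1 hle) hn)
  have : S.ncard = Nat.find hex := by
    rw [congrArg Set.ncard hE, ← Finset.coe_Iio, Set.ncard_coe_finset, Nat.card_Iio]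
  rw [this]
  exact hE

namespace EigenSystem

variable {R σ c : ℝ} {u : ℝ → ℝ} {lam : ℕ → ℝ} {e e₁ : ℕ → ℝ → ℂ}

theorem om_pi_eq_zero (h : EigenSystem u lam e e₁) (hu : IsPotential R u) {y y₁ : ℝ → ℂ} {n : ℕ}
    (hy : IsOmega u (lam n) y y₁) : y Real.pi = 0 := by
  have h1 := ((h.sol n).eq_mul_omega hu (h.left n) hy pi_mem_Icc_pi).1
  rw [h.right n] at h1
  exact (mul_eq_zero.1 h1.symm).resolve_left (h.quasi_zero_ne_zero hu n)

theorem norm_le (h : EigenSystem u lam e e₁) (hR : 0 < R) (hu : IsPotential R u) (n : ℕ) {x : ℝ}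
    (hx : x ∈ Icc 0 Real.pi) : ‖e n x‖ ≤ Real.sqrt (supConst R) := by
  obtain ⟨om, om₁, hom⟩ := hu.exists_omega
  have hO := hom (lam n)
  have hE := fun x hx => ((h.sol n).eq_mul_omega hu (h.left n) hO (x := x) hx).1
  refine Real.le_sqrt_of_sq_le ?_
  have h1 := hO.norm_sq_le_supConst hR hu (h.om_pi_eq_zero hu hO) hx
  have h2 := h.normalized n
  have h3 : ∫ x in (0 : ℝ)..Real.pi, ‖e n x‖ ^ 2 =
      ‖e₁ n 0‖ ^ 2 * ∫ x in (0 : ℝ)..Real.pi, ‖om (lam n) x‖ ^ 2 := by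
    rw [← intervalIntegral.integral_const_mul]
    refine intervalIntegral.integral_congr fun x hx => ?_
    rw [uIcc_zero_pi] at hx
    simp only [hE x hx, norm_mul, mul_pow]
  calc ‖e n x‖ ^ 2 = ‖e₁ n 0‖ ^ 2 * ‖om (lam n) x‖ ^ 2 := by rw [hE x hx, norm_mul, mul_pow]
    _ ≤ ‖e₁ n 0‖ ^ 2 * (supConst R * ∫ t in (0 : ℝ)..Real.pi, ‖om (lam n) t‖ ^ 2) := by gcongr
    _ = supConst R := by rw [mul_left_comm, ← h3, h2, mul_one]

theorem norm_inner_vec_le (h : EigenSystem u lam e e₁) (n : ℕ) (F : Lp ℂ 2 muPi) :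
    ‖inner ℂ (h.vec n) F‖ ≤ ‖F‖ := by
  have := norm_inner_le_norm (𝕜 := ℂ) (h.vec n) F
  rwa [h.orthonormal.1 n, one_mul] at this

theorem neg_lt_lam (h : EigenSystem u lam e e₁) (hR : 0 < R) (hu : IsPotential R u) (n : ℕ) :
    -(24 * R ^ 4) < lam n := by
  obtain ⟨om, om₁, hom⟩ := hu.exists_omega
  by_contra! hle
  exact (hom (lam n)).ne_zero_of_le hR hu hle ⟨Real.pi_pos, le_rfl⟩ (h.om_pi_eq_zero hu (hom _))

/-- If the eigenvalues are ordered by modulus, those below `σ ^ 2` form an initial segment of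
length `σ + O(1)`. -/
theorem exists_lt_iff (h : EigenSystem u lam e e₁) (hR : 0 < R) (hu : IsPotential R u)
    (hmono : Monotone fun n => |lam n|) (hσ : 1 ≤ σ) (hσR : 24 * R ^ 4 ≤ σ ^ 2) :
    ∃ N : ℕ, (∀ n, n < N ↔ lam n < σ ^ 2) ∧ |(N : ℝ) - σ| ≤ 2 + R ^ 2 := by
  obtain ⟨om, om₁, hom⟩ := hu.exists_omega
  obtain ⟨hfin, hcard⟩ := abs_ncard_zeros_sub_le hR hu hom hσ
  have himg : lam '' {n | lam n < σ ^ 2} = {l : ℝ | om l Real.pi = 0 ∧ l < σ ^ 2} := by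
    ext l
    constructor
    · rintro ⟨n, hn, rfl⟩
      exact ⟨h.om_pi_eq_zero hu (hom _), hn⟩
    · rintro ⟨h0, hl⟩
      obtain ⟨n, rfl⟩ := h.exhaustive l _ _ (hom l) h0
      exact ⟨n, hl, rfl⟩
  rw [← himg] at hfin hcard
  rw [Set.ncard_image_of_injective _ h.injective] at hcard
  have hfin' := hfin.of_finite_image h.injective.injOn
  -- All eigenvalues exceed `-24R⁴ ≥ -σ²`, so one below `σ²` has modulus below `σ²`, and the
  -- ordering by modulus applies.
  have hlow : IsLowerSet {n | lam n < σ ^ 2} := by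
    intro a b hab ha
    have h1 : |lam b| ≤ |lam a| := hmono hab
    have h2 : |lam a| < σ ^ 2 := abs_lt.2 ⟨by linarith [h.neg_lt_lam hR hu a], ha⟩
    exact (le_abs_self _).trans_lt (h1.trans_lt h2)
  have hE := eq_Iio_ncard_of_isLowerSet hfin' hlow
  refine ⟨_, fun n => ?_, hcard⟩
  have : n ∈ {n | lam n < σ ^ 2} ↔ n ∈ Iio {n | lam n < σ ^ 2}.ncard := by rw [← hE]
  exact this.symm

theorem le_lam (h : EigenSystem u lam e e₁) (hR : 0 < R) (hu : IsPotential R u)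
    (hmono : Monotone fun n => |lam n|) (hσ : 1 ≤ σ) (hσR : 24 * R ^ 4 ≤ σ ^ 2) {n : ℕ}
    (hn : σ + (2 + R ^ 2) ≤ n) : σ ^ 2 ≤ lam n := by
  obtain ⟨N, hN, hc⟩ := h.exists_lt_iff hR hu hmono hσ hσR
  have : (N : ℝ) ≤ n := by linarith [(abs_le.1 hc).2]
  exact not_lt.1 fun hlt => (not_lt.2 (Nat.cast_le.1 this)) ((hN n).2 hlt)

theorem norm_combo_range_le (h : EigenSystem u lam e e₁) (hR : 0 < R) (hu : IsPotential R u)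
    (F : Lp ℂ 2 muPi) (m : ℕ) {x : ℝ} (hx : x ∈ Icc 0 Real.pi) :
    ‖combo e (Finset.range m) (fun n => inner ℂ (h.vec n) F) x‖ ≤
      m * (Real.sqrt (supConst R) * ‖F‖) := by
  refine (norm_sum_le_of_le _ fun n _ => ?_).trans_eq (by
    rw [Finset.sum_const, Finset.card_range, nsmul_eq_mul])
  rw [norm_mul, mul_comm]
  exact mul_le_mul (h.norm_le hR hu n hx) (h.norm_inner_vec_le n F) (norm_nonneg _)
    (Real.sqrt_nonneg _)

end EigenSystem

/-- The partial sums of the two expansions of an arbitrary function differ boundedly. -/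
theorem exists_norm_combo_sub_le (R : ℝ) (hR : 0 < R) : ∃ C : ℝ, 0 ≤ C ∧
    ∀ (u : ℝ → ℝ) (_ : IsPotential R u) (lam : ℕ → ℝ) (e e₁ : ℕ → ℝ → ℂ)
      (h : EigenSystem u lam e e₁), (Monotone fun n => |lam n|) →
      ∀ (F : Lp ℂ 2 muPi) (m : ℕ), ∀ x ∈ Icc 0 Real.pi,
        ‖combo e (Finset.range m) (fun n => inner ℂ (h.vec n) F) x -
          combo sine (Finset.range m) (fun k => inner ℂ (sineSystem.vec k) F) x‖ ≤ C * ‖F‖ := by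
  obtain ⟨M, c, hc, hnr⟩ := exists_uniform_nonresonance R hR
  set s := Real.sqrt (supConst R)
  have hs : 0 ≤ s := Real.sqrt_nonneg _
  -- From `M'` on a nonresonant line exists, and `σ ≥ 5R²` ensures `24R⁴ ≤ σ²`. The finitely many
  -- smaller `m` are handled by bounding every term.
  set M' : ℝ := M + 5 * R ^ 2 + 1 with hM'
  have hM'0 : 0 ≤ M' := by positivity
  have hD : 0 ≤ EigenSystem.diffConst R c := by have := hR.le; unfold EigenSystem.diffConst; positivity
  refine ⟨2 * M' * s + (EigenSystem.diffConst R c + (3 + R ^ 2) * s), by positivity,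
    fun u hu lam e e₁ h hmono F m x hx => ?_⟩
  rcases lt_or_ge (m : ℝ) M' with hm | hm
  · have h1 := h.norm_combo_range_le hR hu F m hx
    have h2 := sineSystem.norm_combo_range_le hR (IsPotential.zero.mono le_rfl hR.le) F m hx
    have h3 : (m : ℝ) * (s * ‖F‖) ≤ M' * (s * ‖F‖) := by gcongr
    have h4 : 0 ≤ (EigenSystem.diffConst R c + (3 + R ^ 2) * s) * ‖F‖ := by positivity
    refine (norm_sub_le _ _).trans ((add_le_add (h1.trans h3) (h2.trans h3)).trans ?_)
    linarith
  · have hMm : M ≤ m := by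
      have : (M : ℝ) ≤ m := by linarith [sq_nonneg R]
      exact_mod_cast this
    obtain ⟨σ, hσ, hW, hW0⟩ := hnr u hu m hMm
    have hσ1 : 1 ≤ σ := by
      have : (0 : ℝ) ≤ M := Nat.cast_nonneg M
      linarith [hσ.1, sq_nonneg R]
    have hσR : 24 * R ^ 4 ≤ σ ^ 2 := by
      have : (0 : ℝ) ≤ M := Nat.cast_nonneg M
      have h5 : 5 * R ^ 2 ≤ σ := by linarith [hσ.1]
      have := pow_le_pow_left₀ (by positivity) h5 2
      nlinarith [sq_nonneg (R ^ 2)]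
    obtain ⟨N, hN, hcard⟩ := h.exists_lt_iff hR hu hmono hσ1 hσR
    have hN₀ : ∀ k : ℕ, k ∈ Finset.range m ↔ ((k : ℝ) + 1) ^ 2 < σ ^ 2 := fun k => by
      rw [Finset.mem_range, sq_lt_sq₀ (by positivity) (by linarith)]
      constructor
      · intro hk
        have : (k : ℝ) + 1 ≤ m := by exact_mod_cast hk
        linarith [hσ.1]
      · intro hk
        have : (k : ℝ) < m := by linarith [hσ.2]
        exact_mod_cast this
    have h1 := h.norm_combo_sub_le hR hu hσ1 hc hW hW0 (N := Finset.range N)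
      (fun n => by rw [Finset.mem_range, hN]) hN₀ F hx
    have h2 := norm_sum_range_sub_le (b := fun n => inner ℂ (h.vec n) F * e n x)
      (T := s * ‖F‖) (fun n => by
        rw [norm_mul, mul_comm]
        exact mul_le_mul (h.norm_le hR hu n hx) (h.norm_inner_vec_le n F) (norm_nonneg _) hs) m N
    -- The contour isolates the `N` eigenvalues below `σ²` rather than the first `m`. The
    -- discrepancy is bounded since `|N - σ| ≤ 2 + R²` and `|σ - m| ≤ 3/4`.
    have h3 : |(m : ℝ) - N| ≤ 3 + R ^ 2 := by
      rw [abs_le] at *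
      constructor <;> linarith [hσ.1, hσ.2, hcard.1, hcard.2]
    have h4 := h2.trans (mul_le_mul_of_nonneg_right h3 (by positivity))
    have h5 := norm_add_le
      (combo e (Finset.range m) (fun n => inner ℂ (h.vec n) F) x -
        combo e (Finset.range N) (fun n => inner ℂ (h.vec n) F) x)
      (combo e (Finset.range N) (fun n => inner ℂ (h.vec n) F) x -
        combo sine (Finset.range m) (fun k => inner ℂ (sineSystem.vec k) F) x)
    rw [sub_add_sub_cancel] at h5
    refine h5.trans ((add_le_add h4 h1).trans ?_)
    have h6 : 0 ≤ 2 * M' * s * ‖F‖ := by positivity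
    linarith


/-! ### Equiconvergence -/

theorem norm_sineDeriv_le (k : ℕ) (x : ℝ) : ‖sineDeriv k x‖ ≤ k + 1 := by
  have hk : (0 : ℝ) ≤ (k : ℝ) + 1 := by positivity
  rw [sineDeriv_eq_ofReal, Complex.norm_real, Real.norm_eq_abs, abs_mul, abs_mul,
    abs_of_nonneg (Real.sqrt_nonneg _), abs_of_nonneg hk]
  have h1 : Real.sqrt (2 / Real.pi) ≤ 1 := by
    rw [Real.sqrt_le_one, div_le_one Real.pi_pos]
    linarith [Real.pi_gt_three]
  have h2 : ((k : ℝ) + 1) * |Real.cos ((k + 1) * x)| ≤ k + 1 :=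
    mul_le_of_le_one_right hk (Real.abs_cos_le_one _)
  calc _ ≤ 1 * ((k : ℝ) + 1) := mul_le_mul h1 h2 (by positivity) zero_le_one
    _ = _ := one_mul _

theorem norm_combo_le_sqrt {e : ℕ → ℝ → ℂ} {K : ℕ} {a : ℕ → ℂ} {x D : ℝ} (hD : 0 ≤ D)
    (he : ∀ k < K, ‖e k x‖ ≤ D) : ‖combo e (Finset.range K) a x‖ ≤
      D * (Real.sqrt K * Real.sqrt (∑ k ∈ Finset.range K, ‖a k‖ ^ 2)) := by
  rw [← Real.sqrt_mul (Nat.cast_nonneg K)]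
  have h1 : ∑ k ∈ Finset.range K, ‖a k‖ ≤
      Real.sqrt (K * ∑ k ∈ Finset.range K, ‖a k‖ ^ 2) := by
    refine Real.le_sqrt_of_sq_le ?_
    have := sq_sum_le_card_mul_sum_sq (s := Finset.range K) (f := fun k => ‖a k‖)
    rwa [Finset.card_range] at this
  refine le_trans ?_ (mul_le_mul_of_nonneg_left h1 hD)
  rw [Finset.mul_sum]
  refine norm_sum_le_of_le _ fun k hk => ?_
  rw [norm_mul, mul_comm]
  exact mul_le_mul_of_nonneg_right (he k (Finset.mem_range.1 hk)) (norm_nonneg _)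

namespace EigenSystem

variable {R : ℝ} {u : ℝ → ℝ} {lam : ℕ → ℝ} {e e₁ : ℕ → ℝ → ℂ}

theorem norm_sq_sum_vec (h : EigenSystem u lam e e₁) (B : Finset ℕ) (b : ℕ → ℂ) :
    ‖∑ n ∈ B, b n • h.vec n‖ ^ 2 = ∑ n ∈ B, ‖b n‖ ^ 2 := by
  rw [← Complex.ofReal_inj]
  push_cast
  refine (inner_self_eq_norm_sq_to_K (𝕜 := ℂ) (∑ n ∈ B, b n • h.vec n)).symm.trans ?_
  rw [h.orthonormal.inner_sum]
  exact Finset.sum_congr rfl fun n _ => Complex.conj_mul' _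

theorem inner_vec_of_ae_eq (h : EigenSystem u lam e e₁) (n : ℕ) (F : Lp ℂ 2 muPi) {g : ℝ → ℂ}
    (hg : F =ᵐ[muPi] g) : inner ℂ (h.vec n) F = ∫ t in (0 : ℝ)..Real.pi, g t * e n t := by
  rw [h.inner_vec, intervalIntegral_eq_muPi, intervalIntegral_eq_muPi]
  refine integral_congr_ae ?_
  filter_upwards [hg] with t ht
  rw [ht]

/-- The remainder of the expansion of a trigonometric polynomial of degree at most `√m`. -/
theorem norm_sine_combo_sub_le (h : EigenSystem u lam e e₁) (hR : 0 < R) (hu : IsPotential R u)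
    (hmono : Monotone fun n => |lam n|) {m K : ℕ} (hm : 4 + 10 * R ^ 2 ≤ m)
    (hK : (K : ℝ) ≤ Real.sqrt m) (a : ℕ → ℂ) {x : ℝ} (hx : x ∈ Icc 0 Real.pi) :
    ‖combo sine (Finset.range K) a x - combo e (Finset.range m)
        (fun n => ∫ t in (0 : ℝ)..Real.pi, combo sine (Finset.range K) a t * e n t) x‖ ≤
      (8 + 24 * R) * Real.sqrt (2 / Real.sqrt m) *
        Real.sqrt (∑ k ∈ Finset.range K, ‖a k‖ ^ 2) := by
  set L := Real.sqrt (∑ k ∈ Finset.range K, ‖a k‖ ^ 2) with hL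
  have hL0 : 0 ≤ L := Real.sqrt_nonneg _
  have hm0 : (0 : ℝ) < m := lt_of_lt_of_le (by positivity) hm
  -- With this choice every index `n ≥ m` has `lam n ≥ σ²`, with room for the error in the
  -- eigenvalue count, while `K² ≤ m = 2σ`.
  set σ : ℝ := m / 2 with hσ
  have hσ0 : 0 < σ := by positivity
  have hK0 : (0 : ℝ) ≤ K := Nat.cast_nonneg K
  set g := combo sine (Finset.range K) a
  set γ := combo sine (Finset.range K) fun k => (((k : ℝ) + 1) ^ 2 : ℝ) * a k with hγ
  have hS : Sol (fun _ => 0) γ g (combo sineDeriv (Finset.range K) a) :=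
    (Sol.sum _ fun k _ => (sineSystem.sol k).const_mul (a k)).congr_rhs
      fun x _ => Finset.sum_congr rfl fun n _ => by ring
  have hgc : ContinuousOn g (Icc 0 Real.pi) := continuousOn_combo sineSystem.continuousOn _ _
  have hγc : ContinuousOn γ (Icc 0 Real.pi) := continuousOn_combo sineSystem.continuousOn _ _
  have hG₂ : Real.sqrt (∫ x in (0 : ℝ)..Real.pi, ‖γ x‖ ^ 2) ≤ K ^ 2 * L := by
    rw [hγ, ← sineSystem.norm_sum_vec]
    refine (sq_le_sq₀ (norm_nonneg _) (by positivity)).1 ?_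
    rw [sineSystem.norm_sq_sum_vec, mul_pow, hL, Real.sq_sqrt (by positivity), Finset.mul_sum]
    refine Finset.sum_le_sum fun k hk => ?_
    have hk1 : (k : ℝ) + 1 ≤ K := by exact_mod_cast Finset.mem_range.1 hk
    rw [norm_mul, mul_pow, Complex.norm_real, Real.norm_of_nonneg (by positivity)]
    gcongr
  -- Bernstein-type bounds for a sine polynomial of degree `K`: passing from `L₂` to the supremum
  -- costs `√K`, and each derivative costs `K`.
  have key := fun B hB x (hx : x ∈ Icc 0 Real.pi) => h.norm_combo_le_of_free hR hu (σ := σ)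
    (by rw [hσ]; linarith) hS (sineSystem.combo_left _ _) (sineSystem.combo_right _ _) hγc
    (G₀ := 1 * (Real.sqrt K * L)) (G₁ := K * (Real.sqrt K * L))
    (fun x _ => norm_combo_le_sqrt zero_le_one fun k _ => norm_sine_le k x)
    (fun x _ => norm_combo_le_sqrt hK0 fun k hk => (norm_sineDeriv_le k x).trans
      (by exact_mod_cast hk)) hG₂ B hB hx
  refine (h.norm_sub_combo_le hR hu hgc (fun B hB x hx => key B (fun n hn => ?_) x hx) hx).trans ?_
  · have hn' : m ≤ n := by
      by_contra! hlt
      exact Finset.disjoint_left.1 hB (Finset.mem_range.2 hlt) hn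
    have hn'' : (m : ℝ) ≤ n := by exact_mod_cast hn'
    refine h.le_lam hR hu hmono (by rw [hσ]; nlinarith [sq_nonneg R]) ?_ (by
      rw [hσ]; nlinarith [sq_nonneg R])
    have h5 : 5 * R ^ 2 ≤ σ := by rw [hσ]; linarith
    have := pow_le_pow_left₀ (by positivity) h5 2
    nlinarith [sq_nonneg (R ^ 2)]
  · set r := Real.sqrt K with hr
    have hr0 : 0 ≤ r := Real.sqrt_nonneg _
    have hr2 : r ^ 2 = K := Real.sq_sqrt hK0
    have hK2 : (K : ℝ) ^ 2 ≤ 2 * σ := by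
      have := pow_le_pow_left₀ hK0 hK 2
      rw [Real.sq_sqrt hm0.le] at this
      rw [hσ]
      linarith
    have hKr : (K : ℝ) ^ 2 ≤ 2 * σ * r := by
      rcases Nat.eq_zero_or_pos K with h0 | h0
      · rw [h0]; simp only [Nat.cast_zero, ne_eq, OfNat.ofNat_ne_zero, not_false_eq_true, zero_pow]
        positivity
      · have : 1 ≤ r := by
          rw [hr, Real.one_le_sqrt]
          exact_mod_cast h0
        calc (K : ℝ) ^ 2 ≤ 2 * σ := hK2
          _ ≤ 2 * σ * r := le_mul_of_one_le_right (by positivity) this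
    have hKK : (K : ℝ) ≤ 2 * σ := by
      rcases Nat.eq_zero_or_pos K with h0 | h0
      · rw [h0]; simp only [Nat.cast_zero]; positivity
      · have : (1 : ℝ) ≤ K := by exact_mod_cast h0
        nlinarith
    have h1 : (K ^ 2 * L + R * (K * (r * L))) / σ + 4 * R * (1 * (r * L)) ≤
        (2 + 6 * R) * (r * L) := by
      have h2 : K ^ 2 * L + R * (K * (r * L)) ≤ σ * ((2 + 2 * R) * (r * L)) := by
        calc K ^ 2 * L + R * (K * (r * L)) ≤ 2 * σ * r * L + R * (2 * σ * (r * L)) := by gcongr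
          _ = _ := by ring
      have h3 : (K ^ 2 * L + R * (K * (r * L))) / σ ≤ (2 + 2 * R) * (r * L) := by
        rw [div_le_iff₀ hσ0]
        linarith
      linarith
    -- Since `K ≤ √m` and `σ = m/2`, the ratio `K/σ` is at most `2/√m`; this is the source of the
    -- rate `m^(-1/4)`.
    have h4 : r / Real.sqrt σ ≤ Real.sqrt (2 / Real.sqrt m) := by
      rw [hr, ← Real.sqrt_div hK0]
      refine Real.sqrt_le_sqrt ?_
      have hsm : 0 < Real.sqrt m := Real.sqrt_pos.2 hm0
      rw [div_le_div_iff₀ hσ0 hsm, hσ]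
      have : (m : ℝ) = Real.sqrt m * Real.sqrt m := (Real.mul_self_sqrt hm0.le).symm
      calc (K : ℝ) * Real.sqrt m ≤ Real.sqrt m * Real.sqrt m := by gcongr
        _ = 2 * (m / 2) := by rw [← this]; ring
    calc _ ≤ 4 / Real.sqrt σ * ((2 + 6 * R) * (r * L)) := by gcongr
      _ = (8 + 24 * R) * (r / Real.sqrt σ) * L := by ring
      _ ≤ _ := by gcongr

/-- Parseval's identity for the remainder of the sine series. -/
theorem norm_sub_proj_sq (h : EigenSystem u lam e e₁) (hR : 0 < R) (hu : IsPotential R u)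
    (N : Finset ℕ) (F : Lp ℂ 2 muPi) :
    ‖F - h.proj N F‖ ^ 2 = ∑' n : {n : ℕ // n ∉ N}, ‖inner ℂ (h.vec n) F‖ ^ 2 := by
  classical
  set D := F - h.proj N F
  have hs := (h.basis hR hu).hasSum_inner_mul_inner D D
  rw [coe_basis] at hs
  have e1 : ∀ n, inner ℂ D (h.vec n) * inner ℂ (h.vec n) D =
      ((({n | n ∉ N} : Set ℕ).indicator (fun n => ‖inner ℂ (h.vec n) F‖ ^ 2) n : ℝ) : ℂ) := by
    intro n
    rw [← inner_conj_symm D, Complex.conj_mul', inner_sub_right, h.inner_vec_proj]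
    by_cases hn : n ∈ N <;> simp [hn, Set.indicator]
  simp only [e1] at hs
  have hs' : HasSum (fun n => ({n | n ∉ N} : Set ℕ).indicator
      (fun n => ‖inner ℂ (h.vec n) F‖ ^ 2) n) (‖D‖ ^ 2) := by
    have := Complex.hasSum_re hs
    have e2 : (inner ℂ D D : ℂ).re = ‖D‖ ^ 2 := inner_self_eq_norm_sq (𝕜 := ℂ) D
    simpa only [Complex.ofReal_re, e2] using this
  rw [← hs'.tsum_eq, ← tsum_subtype]
  rfl

end EigenSystem


/-- Index `k` carries the frequency `k + 1`, so this range holds exactly the frequencies strictly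
below `√m`, the complement of the tail `n ≥ √m`. -/
theorem mem_range_ceil_sqrt_iff (m k : ℕ) :
    k ∈ Finset.range (⌈Real.sqrt m⌉₊ - 1) ↔ (k : ℝ) + 1 < Real.sqrt m := by
  rw [Finset.mem_range, Nat.lt_sub_iff_add_lt, Nat.lt_ceil]
  push_cast
  rfl

theorem combo_sub_eq {s : ℕ → ℝ → ℂ} {u : ℝ → ℝ} {lam : ℕ → ℝ} {s₁ : ℕ → ℝ → ℂ}
    (h : EigenSystem u lam s s₁) (N : Finset ℕ) (F G : Lp ℂ 2 muPi) (x : ℝ) :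
    combo s N (fun n => inner ℂ (h.vec n) F) x = combo s N (fun n => inner ℂ (h.vec n) G) x +
      combo s N (fun n => inner ℂ (h.vec n) (F - G)) x := by
  simp only [combo, ← Finset.sum_add_distrib, inner_sub_right]
  exact Finset.sum_congr rfl fun n _ => by ring

/-- Equiconvergence for an eigensystem ordered by modulus. -/
theorem exists_equiconvergence (R : ℝ) (hR : 0 < R) : ∃ (C : ℝ) (υ : ℕ → ℝ),
    Tendsto υ atTop (𝓝 0) ∧
    ∀ (u : ℝ → ℝ) (_ : IsPotential R u) (lam : ℕ → ℝ) (e e₁ : ℕ → ℝ → ℂ)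
      (h : EigenSystem u lam e e₁), (Monotone fun n => |lam n|) →
      ∀ (F : Lp ℂ 2 muPi) (m : ℕ), ∀ x ∈ Icc 0 Real.pi,
        ‖combo e (Finset.range m) (fun n => inner ℂ (h.vec n) F) x -
          combo sine (Finset.range m) (fun k => inner ℂ (sineSystem.vec k) F) x‖ ≤
        C * ‖F - sineSystem.proj (Finset.range (⌈Real.sqrt m⌉₊ - 1)) F‖ + ‖F‖ * υ m := by
  obtain ⟨C, hC, hb⟩ := exists_norm_combo_sub_le R hR
  -- For the finitely many small `m` the uniform bound `C‖F‖` itself is taken as the remainder,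
  -- which does not affect the limit.
  refine ⟨C, fun m => if (m : ℝ) < 4 + 10 * R ^ 2 then C else
    (8 + 24 * R) * Real.sqrt (2 / Real.sqrt m), ?_, fun u hu lam e e₁ h hmono F m x hx => ?_⟩
  · have h1 : Tendsto (fun m : ℕ => (8 + 24 * R) * Real.sqrt (2 / Real.sqrt m)) atTop
        (𝓝 ((8 + 24 * R) * Real.sqrt 0)) :=
      ((Real.continuous_sqrt.tendsto 0).comp (Tendsto.const_div_atTop
        (Real.tendsto_sqrt_atTop.comp tendsto_natCast_atTop_atTop) 2)).const_mul _
    rw [Real.sqrt_zero, mul_zero] at h1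
    refine h1.congr' ?_
    filter_upwards [tendsto_natCast_atTop_atTop.eventually_ge_atTop (4 + 10 * R ^ 2)] with m hm
    rw [if_neg (not_lt.2 hm)]
  · beta_reduce
    split_ifs with hm
    · have := hb u hu lam e e₁ h hmono F m x hx
      have h1 : 0 ≤ C * ‖F - sineSystem.proj (Finset.range (⌈Real.sqrt m⌉₊ - 1)) F‖ := by positivity
      linarith
    · rw [not_lt] at hm
      set K := ⌈Real.sqrt m⌉₊ - 1 with hK
      set P := sineSystem.proj (Finset.range K) F with hP
      set a : ℕ → ℂ := fun k => inner ℂ (sineSystem.vec k) F with ha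
      have hKs : (K : ℝ) ≤ Real.sqrt m := by
        rcases Nat.eq_zero_or_pos K with h0 | h0
        · rw [h0]; simp
        · have := (mem_range_ceil_sqrt_iff m (K - 1)).1 (Finset.mem_range.2 (Nat.sub_lt h0 one_pos))
          rw [Nat.cast_sub (Nat.one_le_of_lt h0)] at this
          push_cast at this
          linarith
      have hm1 : (1 : ℝ) ≤ m := by nlinarith [sq_nonneg R]
      have hKm : K ≤ m := by
        have : Real.sqrt m ≤ m := Real.sqrt_le_iff.2 ⟨by positivity, by nlinarith⟩
        exact_mod_cast hKs.trans this
      have hPa : P =ᵐ[muPi] combo sine (Finset.range K) a := sineSystem.coeFn_sum_vec _ _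
      have h1 := hb u hu lam e e₁ h hmono (F - P) m x hx
      have h2 := h.norm_sine_combo_sub_le hR hu hmono hm hKs a hx
      have h3 : Real.sqrt (∑ k ∈ Finset.range K, ‖a k‖ ^ 2) ≤ ‖F‖ :=
        Real.sqrt_le_iff.2 ⟨norm_nonneg _, sineSystem.orthonormal.sum_inner_products_le F⟩
      have h4 : combo sine (Finset.range m) (fun k => inner ℂ (sineSystem.vec k) P) x =
          combo sine (Finset.range K) a x := by
        classical
        simp only [combo, hP, sineSystem.inner_vec_proj, ite_mul, zero_mul]
        rw [Finset.sum_ite_mem, Finset.inter_eq_right.2 (Finset.range_subset_range.2 hKm)]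
      have h5 : combo e (Finset.range m) (fun n => inner ℂ (h.vec n) P) x =
          combo e (Finset.range m) (fun n => ∫ t in (0 : ℝ)..Real.pi,
            combo sine (Finset.range K) a t * e n t) x :=
        Finset.sum_congr rfl fun n _ => congrArg (· * e n x) (h.inner_vec_of_ae_eq n P hPa)
      rw [← h5, ← h4, norm_sub_rev] at h2
      -- Split `F = P + (F - P)`. The sine sums reproduce `P` because `K ≤ m`, and the uniform bound
      -- handles `F - P`.
      rw [combo_sub_eq h _ F P, combo_sub_eq sineSystem _ F P, add_sub_add_comm, add_comm]
      refine (norm_add_le _ _).trans (add_le_add h1 (h2.trans ?_))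
      rw [mul_comm]
      gcongr

/-! ### Root systems -/

theorem isPotential_of_memL2 {R : ℝ} {u : ℝ → ℝ} (hR : 0 < R) (hu : MemL2 fun x => (u x : ℂ))
    (hn : l2Norm (fun x => (u x : ℂ)) ≤ R) : IsPotential R u := by
  refine ⟨by simpa using hu.re, ?_⟩
  have h1 := (Real.sqrt_le_left hR.le).1 hn
  refine le_trans (le_of_eq ?_) h1
  refine intervalIntegral.integral_congr fun x _ => ?_
  simp only [Complex.norm_real, Real.norm_eq_abs, sq_abs]

theorem IsCauchySolution.exists_isOmega {R : ℝ} {u : ℝ → ℝ} (hu : IsPotential R u)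
    {ω : ℂ → ℝ → ℂ} (h : IsCauchySolution (fun x => (u x : ℂ)) ω) :
    ∃ ω₁ : ℂ → ℝ → ℂ, ∀ z, IsOmega u z (ω z) (ω₁ z) := by
  choose ω₁ hs h0 h1 using h
  refine ⟨ω₁, fun z => ⟨(hs z).sol hu ?_, h0 z, h1 z⟩⟩
  exact (continuousOn_const.mul (hs z).continuousOn).intervalIntegrable_of_Icc Real.pi_pos.le

/-- Since the eigenvalues are real and simple, a root system is a unimodular multiple of an
eigensystem ordered by modulus. -/
theorem IsRootSystem.exists_eigenSystem {R : ℝ} {u : ℝ → ℝ} (hu : IsPotential R u) {lam : ℕ → ℂ}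
    {y : ℕ → ℝ → ℂ} (h : IsRootSystem (fun x => (u x : ℂ)) lam y) :
    ∃ (l : ℕ → ℝ) (e e₁ : ℕ → ℝ → ℂ) (d : ℕ → ℂ), EigenSystem u l e e₁ ∧
      (Monotone fun n => |l n|) ∧
      ∀ n, ‖d n‖ = 1 ∧ ∀ x ∈ Icc 0 Real.pi, y (n + 1) x = d n * e n x := by
  obtain ⟨ω, j, hω, himg, hmono, hy⟩ := h
  obtain ⟨ω₁, hom⟩ := hω.exists_isOmega hu
  have han := fun z => (differentiable_om_pi hu hom).analyticAt z
  -- Simplicity of the zeros leaves only chains of length one, so `j` vanishes and no derivative in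
  -- the spectral parameter enters.
  have hmem : ∀ n : ℕ, ω (lam (n + 1)) Real.pi = 0 ∧ j (n + 1) = 0 := fun n => by
    have h1 : (lam (n + 1), j (n + 1)) ∈
        {p : ℂ × ℕ | (p.2 : ℕ∞) < analyticOrderAt (fun z => ω z Real.pi) p.1} := by
      rw [← himg]
      exact ⟨n + 1, by simp, rfl⟩
    simp only [mem_ofPred_eq] at h1
    have h2 : ω (lam (n + 1)) Real.pi = 0 := by
      by_contra hne
      rw [(han _).analyticOrderAt_eq_zero.2 hne] at h1
      exact not_lt_bot h1
    rw [analyticOrderAt_om_pi hu hom h2] at h1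
    exact ⟨h2, by exact_mod_cast Nat.lt_one_iff.1 (by exact_mod_cast h1)⟩
  have hreal : ∀ n : ℕ, ((lam (n + 1)).re : ℂ) = lam (n + 1) := fun n =>
    Complex.conj_eq_iff_re.1 ((hom _).conj_eq_of_zero hu (hmem n).1)
  set I : ℕ → ℝ := fun n => ∫ t in (0 : ℝ)..Real.pi, ‖ω (lam (n + 1)) t‖ ^ 2 with hI
  have hI0 : ∀ n, 0 < I n := fun n => (hom _).integral_norm_sq_pos hu
  set κ : ℕ → ℝ := fun n => (Real.sqrt (I n))⁻¹ with hκ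
  have hκ0 : ∀ n, 0 < κ n := fun n => inv_pos.2 (Real.sqrt_pos.2 (hI0 n))
  have hκI : ∀ n, κ n ^ 2 * I n = 1 := fun n => by
    rw [hκ]
    simp only
    rw [inv_pow, Real.sq_sqrt (hI0 n).le, inv_mul_cancel₀ (hI0 n).ne']
  have hconj := fun n x hx => (hom (lam (n + 1))).conj_eq hu
    ((hom _).conj_eq_of_zero hu (hmem n).1) (x := x) hx
  have hES : EigenSystem u (fun n => (lam (n + 1)).re) (fun n x => κ n * ω (lam (n + 1)) x)
      fun n x => κ n * ω₁ (lam (n + 1)) x := by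
    refine ⟨fun n => ?_, fun n => ?_, fun n => ?_, fun n x hx => ?_,
      fun a b hab => ?_, fun n => ?_, fun l w w₁ hw hw0 => ?_⟩
    · refine ((hom (lam (n + 1))).sol.const_mul (κ n : ℂ)).congr_rhs fun x _ => ?_
      rw [hreal]; ring
    · rw [(hom _).left, mul_zero]
    · rw [(hmem n).1, mul_zero]
    · rw [map_mul, Complex.conj_ofReal, (hconj n x hx).1]
    · have hab' : lam (a + 1) = lam (b + 1) := by
        rw [← hreal a, ← hreal b]
        exact congrArg _ hab
      have := hmono.injOn (x₁ := a + 1) (x₂ := b + 1) (by simp) (by simp)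
        (by simp only [hab', (hmem a).2, (hmem b).2])
      exact Nat.succ_injective this
    · simp only [norm_mul, mul_pow, Complex.norm_real, Real.norm_eq_abs, sq_abs]
      rw [intervalIntegral.integral_const_mul]
      exact hκI n
    · have h0 : ω l Real.pi = 0 := by rw [((hom l).unique hw hu pi_mem_Icc_pi).1, hw0]
      have h1 : ((l : ℂ), 0) ∈
          {p : ℂ × ℕ | (p.2 : ℕ∞) < analyticOrderAt (fun z => ω z Real.pi) p.1} := by
        simp only [mem_ofPred_eq]
        rw [analyticOrderAt_om_pi hu hom h0]
        simp
      rw [← himg] at h1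
      obtain ⟨n, hn, hne⟩ := h1
      obtain ⟨n, rfl⟩ : ∃ k, n = k + 1 := ⟨n - 1, (Nat.sub_add_cancel hn).symm⟩
      refine ⟨n, ?_⟩
      have : lam (n + 1) = l := congrArg Prod.fst hne
      rw [this, Complex.ofReal_re]
  have hyn := fun n : ℕ => hy (n + 1) (by simp)
  choose c hc using fun n => (hyn n).1
  have hform : ∀ n, ∀ x ∈ Icc 0 Real.pi,
      y (n + 1) x = c n * (κ n : ℂ)⁻¹ * (κ n * ω (lam (n + 1)) x) := fun n x hx => by
    have : (κ n : ℂ) ≠ 0 := Complex.ofReal_ne_zero.2 (hκ0 n).ne'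
    rw [hc n x hx, (hmem n).2, iteratedDeriv_zero]
    field_simp
  refine ⟨_, _, _, fun n => c n * (κ n : ℂ)⁻¹, hES, ?_, fun n => ⟨?_, hform n⟩⟩
  · intro a b hab
    have h1 : ∀ n, |(lam (n + 1)).re| = ‖lam (n + 1)‖ := fun n => by
      conv_rhs => rw [← hreal n, Complex.norm_real, Real.norm_eq_abs]
    simp only [h1]
    have h2 := hmono.monotoneOn (a := a + 1) (b := b + 1) (by simp) (by simp) (by simpa using hab)
    exact Prod.Lex.monotone_fst _ _ h2
  · have h1 := (hyn n).2
    rw [l2Norm, Real.sqrt_eq_one] at h1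
    have h2 : ∫ x in (0 : ℝ)..Real.pi, ‖y (n + 1) x‖ ^ 2 = ‖c n * (κ n : ℂ)⁻¹‖ ^ 2 := by
      have h3 := hES.normalized n
      rw [← mul_one (‖c n * (κ n : ℂ)⁻¹‖ ^ 2), ← h3, ← intervalIntegral.integral_const_mul]
      refine intervalIntegral.integral_congr fun x hx => ?_
      rw [uIcc_zero_pi] at hx
      simp only [hform n x hx]
      rw [norm_mul (c n * (κ n : ℂ)⁻¹), mul_pow]
    rw [h2] at h1
    exact (pow_eq_one_iff_of_nonneg (norm_nonneg _) two_ne_zero).1 h1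

theorem scalarProduct_eq_inner {f g : ℝ → ℂ} (hf : MemLp f 2 muPi) (hg : MemLp g 2 muPi) :
    scalarProduct f g = inner ℂ hg.toLp hf.toLp := by
  rw [L2.inner_def, scalarProduct, intervalIntegral_eq_muPi]
  refine integral_congr_ae ?_
  filter_upwards [hf.coeFn_toLp, hg.coeFn_toLp] with x h1 h2
  rw [h1, h2, RCLike.inner_apply]

/-- The biorthogonal system of an orthonormal basis is the basis itself. -/
theorem IsBiorthogonal.scalarProduct_mul {R : ℝ} {u : ℝ → ℝ} (hR : 0 < R) (hu : IsPotential R u)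
    {l : ℕ → ℝ} {e e₁ : ℕ → ℝ → ℂ} {d : ℕ → ℂ} {y w : ℕ → ℝ → ℂ} (hw : IsBiorthogonal y w)
    (h : EigenSystem u l e e₁)
    (hd : ∀ n, ‖d n‖ = 1 ∧ ∀ x ∈ Icc 0 Real.pi, y (n + 1) x = d n * e n x) {f : ℝ → ℂ}
    (hf : MemLp f 2 muPi) (n : ℕ) {x : ℝ} (hx : x ∈ Icc 0 Real.pi) :
    scalarProduct f (w (n + 1)) * y (n + 1) x = inner ℂ (h.vec n) hf.toLp * e n x := by
  have hW : MemLp (w (n + 1)) 2 muPi := hw.1 (n + 1) (by simp)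
  have hdd : ∀ k, d k * conj (d k) = 1 := fun k => by
    rw [Complex.mul_conj', (hd k).1]; simp
  have hy : ∀ k, scalarProduct (y (k + 1)) (w (n + 1)) = d k * inner ℂ hW.toLp (h.vec k) := by
    intro k
    rw [EigenSystem.vec, ← scalarProduct_eq_inner (h.memLp k) hW, scalarProduct, scalarProduct,
      ← intervalIntegral.integral_const_mul]
    refine intervalIntegral.integral_congr fun x hx => ?_
    rw [uIcc_zero_pi] at hx
    simp only [(hd k).2 x hx]
    ring
  have hin : ∀ k, inner ℂ (h.vec k) hW.toLp = if k = n then d n else 0 := fun k => by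
    have h1 := hw.2 (k + 1) (n + 1) (by simp) (by simp)
    rw [hy k] at h1
    simp only [add_left_inj] at h1
    have h2 : inner ℂ hW.toLp (h.vec k) = if k = n then conj (d k) else 0 := by
      calc inner ℂ hW.toLp (h.vec k) = conj (d k) * (d k * inner ℂ hW.toLp (h.vec k)) := by
            rw [← mul_assoc, mul_comm (conj (d k)), hdd, one_mul]
        _ = _ := by rw [h1]; split_ifs <;> simp
    rw [← inner_conj_symm, h2]
    split_ifs with hk
    · rw [Complex.conj_conj, hk]
    · simp
  -- By completeness the coefficients determine `w`. The unimodular factor then appears once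
  -- conjugated in `cₙ` and once in `yₙ`, and cancels.
  have hWe : hW.toLp = d n • h.vec n := by
    have hs := (h.basis hR hu).hasSum_repr hW.toLp
    simp only [HilbertBasis.repr_apply_apply, EigenSystem.coe_basis, hin] at hs
    refine hs.unique ?_
    convert hasSum_single n fun k hk => ?_ using 1
    · simp
    · simp [hk]
  rw [scalarProduct_eq_inner hf hW, hWe, inner_smul_left, (hd n).2 x hx]
  calc _ = d n * conj (d n) * (inner ℂ (h.vec n) hf.toLp * e n x) := by ring
    _ = _ := by rw [hdd, one_mul]

theorem sineCoeff_succ {f : ℝ → ℂ} (hf : MemLp f 2 muPi) (k : ℕ) :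
    sineCoeff f (k + 1) = inner ℂ (sineSystem.vec k) hf.toLp := by
  rw [sineSystem.inner_vec_of_ae_eq k _ hf.coeFn_toLp, sineCoeff, scalarProduct,
    ← intervalIntegral.integral_const_mul]
  refine intervalIntegral.integral_congr fun x _ => ?_
  simp only [Complex.conj_ofReal, sine_eq_ofReal]
  push_cast
  ring

theorem sum_Icc_one {f : ℕ → ℂ} (m : ℕ) :
    ∑ n ∈ Finset.Icc 1 m, f n = ∑ n ∈ Finset.range m, f (n + 1) := by
  rw [← Finset.Ico_succ_right_eq_Icc, Finset.sum_Ico_eq_sum_range]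
  simp [add_comm]

/-- Parseval's identity after shifting frequencies `n ≥ 1` to indices `n - 1`; it identifies the
tail in the statement with the norm of `F - P`. -/
theorem tsum_sineCoeff {f : ℝ → ℂ} (hf : MemLp f 2 muPi) (m : ℕ) :
    ∑' n : {n : ℕ // 1 ≤ n ∧ Real.sqrt m ≤ n}, ‖sineCoeff f n‖ ^ 2 =
      ‖hf.toLp - sineSystem.proj (Finset.range (⌈Real.sqrt m⌉₊ - 1)) hf.toLp‖ ^ 2 := by
  rw [sineSystem.norm_sub_proj_sq one_pos (IsPotential.zero.mono le_rfl zero_le_one)]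
  let E : {n : ℕ // n ∉ Finset.range (⌈Real.sqrt m⌉₊ - 1)} ≃
      {n : ℕ // 1 ≤ n ∧ Real.sqrt m ≤ n} :=
    { toFun := fun n => ⟨n + 1, by simp, by
        have := n.2
        rw [mem_range_ceil_sqrt_iff, not_lt] at this
        push_cast
        exact this⟩
      invFun := fun n => ⟨n - 1, by
        rw [mem_range_ceil_sqrt_iff, not_lt, Nat.cast_sub n.2.1]
        simpa using n.2.2⟩
      left_inv := fun n => by simp
      right_inv := fun n => Subtype.ext (Nat.sub_add_cancel n.2.1) }
  rw [← E.tsum_eq]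
  exact tsum_congr fun n => by rw [← sineCoeff_succ hf]; rfl

end SturmLiouville

theorem mainTheorem2 (R : ℝ) (hR : 0 < R) :
    ∃ (C : ℝ) (υ : ℕ → ℝ), Tendsto υ atTop (𝓝 0) ∧
      ∀ u : ℝ → ℝ,
        SturmLiouville.MemL2 (fun x => (u x : ℂ)) →
        SturmLiouville.l2Norm (fun x => (u x : ℂ)) ≤ R →
        ∀ (lam : ℕ → ℂ) (y w : ℕ → ℝ → ℂ),
          SturmLiouville.IsRootSystem (fun x => (u x : ℂ)) lam y →
          SturmLiouville.IsBiorthogonal y w →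
          ∀ f : ℝ → ℂ, SturmLiouville.MemL2 f →
            ∀ m : ℕ, ∀ x ∈ Icc (0 : ℝ) Real.pi,
              ‖(∑ n ∈ Finset.Icc 1 m, SturmLiouville.scalarProduct f (w n) * y n x) -
                  ∑ n ∈ Finset.Icc 1 m,
                    (Real.sqrt (2 / Real.pi) : ℂ) * SturmLiouville.sineCoeff f n *
                      (Real.sin (n * x) : ℂ)‖ ≤
                C * Real.sqrt (∑' n : {n : ℕ // 1 ≤ n ∧ Real.sqrt (m : ℝ) ≤ (n : ℝ)},
                    ‖SturmLiouville.sineCoeff f n‖ ^ 2) +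
                  SturmLiouville.l2Norm f * υ m := by
  obtain ⟨C, υ, hυ, hmain⟩ := SturmLiouville.exists_equiconvergence R hR
  refine ⟨C, υ, hυ, fun u hu hun lam y w hy hw f hf m x hx => ?_⟩
  have hp := SturmLiouville.isPotential_of_memL2 hR hu hun
  obtain ⟨l, e, e₁, d, hE, hmono, hd⟩ := hy.exists_eigenSystem hp
  have hfm : MemLp f 2 SturmLiouville.muPi := hf
  have h1 := hmain u hp l e e₁ hE hmono hfm.toLp m x hx
  rw [SturmLiouville.tsum_sineCoeff hfm, Real.sqrt_sq (norm_nonneg _), SturmLiouville.sum_Icc_one,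
    SturmLiouville.sum_Icc_one, SturmLiouville.l2Norm, ← SturmLiouville.norm_toLp_eq_sqrt hfm]
  convert h1 using 3
  · exact Finset.sum_congr rfl fun n _ => hw.scalarProduct_mul hR hp hE hd hfm n hx
  · refine Finset.sum_congr rfl fun n _ => ?_
    rw [SturmLiouville.sineCoeff_succ hfm, SturmLiouville.sine_eq_ofReal]
    push_cast
    ring
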